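/- **Setting.** We work in synthetic computability, that is, in intuitionistic higher-order logic with natural numbers and the following axioms: *Dependent Choice* (if $R$ is a total relation on a set $X$, then every $x_0\in X$ begins a sequence $f:\mathbb N\to X$ with $f(0)=x_0$ and $R(f(n),f(n+1))$ for all $n$); *Markov principle* (a binary sequence whose terms are not all zero contains a one); *Enumerability* (there are countably many countable subsets of $\mathbb N$); *Stable Subspace* (if $A\subseteq\mathbb N$ satisfies $\neg\neg(n\in A)\Rightarrow n\in A$ for all $n$, then every $S:A\to\Sigma$ is the restriction of some $T:\mathbb N\to\Sigma$). Precisely: let $\mathcal E$ be any elementary topos with a natural numbers object in whose internal language these axioms hold (Dependent Choice for every object $X$). Then the statements below hold in the internal language of $\mathcal E$, for all objects $X$, $M$, $P$ of $\mathcal E$. **Definitions.** $\Sigma\subseteq\Omega$ is the set of semidecidable truth values, i.e. those equivalent to $\exists n\in\mathbb N.\ n\in D$ for some decidable $D\subseteq\mathbb N$. The *intrinsic topology* of $X$ is $\Sigma^X$. A set $X$ is *overt* if $\exists x\in X.\ x\in S$ is semidecidable for every $S\in\Sigma^X$. A set $D$ is *countable* if there is a surjection $\mathbb N\to 1+D$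 (so an enumeration may skip). A *topology* on $X$ is a subset $\mathcal T\subseteq\Sigma^X$ containing $\emptyset$ and $X$ and closed under binary intersections and unions of sequences. It is *countably based* if there is a sequence $(B_n)_{n\in\mathbb N}$ in $\mathcal T$ such that every $U\in\mathcal T$ equals $\bigcup_{i\in I}B_i$ for some countable $I\subseteq\mathbb N$. It is *sober* if $x\mapsto\hat x$, $\hat x(U)=(x\in U)$, is a bijection from $X$ onto the set of maps $\mathcal T\to\Sigma$ preserving finite meets and countable joins. A sequence (or a subset) is *dense* for $\mathcal T$ if every inhabited $U\in\mathcal T$ contains one of its terms (elements); $\mathcal T$ is *separable* if it has a countable dense subset. A metric takes values in the non-negative Dedekind reals; the *metric topology* consists of the countable unions of open balls. A metric space is *complete* if every Cauchy sequence converges, and *separable* if it has a countable subset $D$ such that for all $x$ and all $k\in\mathbb N$ there is $y\in D$ with $d(x,y)<1/(k+1)$. An *$\omega$-cpo* is a poset in which every chain $c_0\le c_1\le\cdots$ has a supremum; $x$ is *compact* if $x\le\sup_n c_n$ implies $x\le c_m$ for some $m$, for every chain $c$. An $\omega$-cpo is *$\omega$-algebraic* if its compact elements form a countable set on which the order is decidable,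 and for every $x$ the set of compact elements below $x$ is countable and directed (in particular inhabited) with supremum $x$. Its *Scott topology* consists of the semidecidable subsets that are upward closed and inaccessible by suprema of chains. **Statement.** 1. If $\mathcal T$ is a countably based sober topology on $X$ and a sequence $a:\mathbb N\to X$ is dense for $\mathcal T$, then $a$ is dense for the intrinsic topology $\Sigma^X$. 2. If $X$ carries a separable, countably based, sober topology, then $X$ is overt. 3. If $M$ is a complete separable metric space, then its metric topology is a countably based, sober and separable topology, and $M$ is overt. 4. If $P$ is an $\omega$-algebraic $\omega$-cpo, then its Scott topology is a countably based, sober and separable topology, and $P$ is overt. -/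

import Mathlib

/-!
The internal language of an elementary topos with a natural numbers object, and, written in it,
the notions of synthetic topology and synthetic computability.

A term of type `X` in context `Γ` is a morphism `Γ ⟶ X`; a formula in context `Γ` is a term of type
`Ω`.  Extending the context by a variable of type `X` gives the context `X ⊗ Γ`.  The type formers
are the products and exponentials of the topos, and equality, membership and application have
their usual interpretation, so that `Valid φ` is truth in the Mitchell-Benabou language.
-/

universe v u

namespace SynthTopos

open CategoryTheory CategoryTheory.Limits MonoidalCategory CartesianMonoidalCategory

/-! ### Natural numbers object -/

/-- A natural numbers object: `1 → N → N` is initial among the diagrams `1 → A → A`. -/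
class NaturalNumbersObject (E : Type u) [Category.{v} E] [CartesianMonoidalCategory E] where
  N : E
  zero : 𝟙_ E ⟶ N
  succ : N ⟶ N
  iter {A : E} (a : 𝟙_ E ⟶ A) (f : A ⟶ A) : N ⟶ A
  zero_iter {A : E} (a : 𝟙_ E ⟶ A) (f : A ⟶ A) : zero ≫ iter a f = a
  succ_iter {A : E} (a : 𝟙_ E ⟶ A) (f : A ⟶ A) : succ ≫ iter a f = iter a f ≫ f
  iter_unique {A : E} (a : 𝟙_ E ⟶ A) (f : A ⟶ A) (h : N ⟶ A)
    (h_zero : zero ≫ h = a) (h_succ : succ ≫ h = h ≫ f) : h = iter a f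

/-! ### Weakening: a term in context `Γ` is silently used in every extension of `Γ` -/

section Weakening

variable {E : Type u} [Category.{v} E] [CartesianMonoidalCategory E]

/-- `Δ` is the context `Γ` extended by finitely many variables; `wk` is the projection. -/
class Extends (Δ Γ : E) where
  wk : Δ ⟶ Γ

instance extendsRefl (Γ : E) : Extends Γ Γ := ⟨𝟙 Γ⟩

instance extendsStep (X Δ Γ : E) [Extends Δ Γ] : Extends (X ⊗ Δ) Γ :=
  ⟨snd X Δ ≫ Extends.wk⟩

instance coeWeaken (Δ Γ X : E) [Extends Δ Γ] : CoeHTCT (Γ ⟶ X) (Δ ⟶ X) :=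
  ⟨fun t => Extends.wk ≫ t⟩

/-- Explicit weakening, where the elaborator cannot find the type by itself. -/
notation:max "↟" t:max => CategoryStruct.comp Extends.wk t

end Weakening

noncomputable section

variable {E : Type u} [Category.{v} E] [CartesianMonoidalCategory E] [MonoidalClosed E]
  [HasSubobjectClassifier E]

/-! ### Types -/

/-- The object of truth values. -/
abbrev Om (E : Type u) [Category.{v} E] [HasSubobjectClassifier E] : E :=
  HasSubobjectClassifier.Ω E

/-- The exponential `Y ^ X`. -/
abbrev Fn (X Y : E) : E := (ihom X).obj Y

/-- The power object of `X`. -/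
abbrev Pw (X : E) : E := Fn X (Om E)

/-! ### Logic

Every connective is obtained from equality, in the standard way. -/

section Logic

variable {Γ X Y : E}

/-- Truth. -/
def tt : Γ ⟶ Om E :=
  HasSubobjectClassifier.exists_classifier.some.χ₀ Γ ≫ HasSubobjectClassifier.truth E

/-- The formula is true (in every instance of its context). -/
def Valid (φ : Γ ⟶ Om E) : Prop := φ = tt

instance diag_mono (X : E) : Mono (lift (𝟙 X) (𝟙 X)) :=
  ⟨fun f g h => by simpa using h =≫ fst X X⟩

/-- Equality, as the characteristic map of the diagonal. -/
def eqI (x y : Γ ⟶ X) : Γ ⟶ Om E :=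
  lift x y ≫ HasSubobjectClassifier.χ (lift (𝟙 X) (𝟙 X))

infix:50 " =ᵢ " => eqI

/-- Conjunction: `(p, q) = (⊤, ⊤)`. -/
def andI (p q : Γ ⟶ Om E) : Γ ⟶ Om E := lift p q =ᵢ lift tt tt

infixr:35 " ∧ᵢ " => andI

/-- Implication: `p ∧ q = p`. -/
def impI (p q : Γ ⟶ Om E) : Γ ⟶ Om E := (p ∧ᵢ q) =ᵢ p

infixr:25 " →ᵢ " => impI

/-- Bi-implication, which on truth values is equality. -/
def iffI (p q : Γ ⟶ Om E) : Γ ⟶ Om E := p =ᵢ q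

infix:20 " ↔ᵢ " => iffI

/-- Set comprehension `{x : X | φ x}`; the new variable is the first projection. -/
def compr (X : E) (φ : (X ⊗ Γ ⟶ X) → (X ⊗ Γ ⟶ Om E)) : Γ ⟶ Pw X :=
  MonoidalClosed.curry (φ (fst X Γ))

/-- Universal quantification: `{x : X | φ x} = {x : X | ⊤}`. -/
def all (X : E) (φ : (X ⊗ Γ ⟶ X) → (X ⊗ Γ ⟶ Om E)) : Γ ⟶ Om E :=
  compr X φ =ᵢ compr X fun _ => tt

/-- Falsity: `∀ r, r`. -/
def ff : Γ ⟶ Om E := all (Om E) fun r => r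

/-- Negation. -/
def notI (p : Γ ⟶ Om E) : Γ ⟶ Om E := p →ᵢ ff

prefix:max "¬ᵢ " => notI

/-- Disjunction: `∀ r, (p → r) → (q → r) → r`. -/
def orI (p q : Γ ⟶ Om E) : Γ ⟶ Om E :=
  all (Om E) fun r => (p →ᵢ r) →ᵢ (q →ᵢ r) →ᵢ r

infixr:30 " ∨ᵢ " => orI

/-- Existential quantification: `∀ r, (∀ x, φ x → r) → r`. -/
def ex (X : E) (φ : (X ⊗ Γ ⟶ X) → (X ⊗ Γ ⟶ Om E)) : Γ ⟶ Om E :=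
  all (Om E) fun r => (all X fun _ => (X ◁ snd (Om E) Γ ≫ φ (fst X Γ)) →ᵢ r) →ᵢ r

/-- Function application. -/
def app (f : Γ ⟶ Fn X Y) (x : Γ ⟶ X) : Γ ⟶ Y := lift x f ≫ (ihom.ev X).app Y

/-- Membership. -/
def memI (x : Γ ⟶ X) (S : Γ ⟶ Pw X) : Γ ⟶ Om E := app S x

infix:50 " ∈ᵢ " => memI

/-- The empty subset. -/
def emptyI : Γ ⟶ Pw X := compr X fun _ => ff

/-- The whole of `X`, as a subset. -/
def univI : Γ ⟶ Pw X := compr X fun _ => tt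

/-- The singleton `{x}`. -/
def singI (x : Γ ⟶ X) : Γ ⟶ Pw X := compr X fun y => y =ᵢ x

/-- Binary intersection. -/
def interI (S T : Γ ⟶ Pw X) : Γ ⟶ Pw X := compr X fun x => x ∈ᵢ S ∧ᵢ x ∈ᵢ T

end Logic

/-! ### Arithmetic -/

section Arithmetic

variable [NaturalNumbersObject E] {Γ X : E}

/-- The natural numbers object. -/
abbrev Nn (E : Type u) [Category.{v} E] [CartesianMonoidalCategory E] [NaturalNumbersObject E] :
    E := NaturalNumbersObject.N

def zeroI : Γ ⟶ Nn E := toUnit Γ ≫ NaturalNumbersObject.zero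

def succI (n : Γ ⟶ Nn E) : Γ ⟶ Nn E := n ≫ NaturalNumbersObject.succ

/-- Addition `N × N → N`: `m + 0 = m` and `m + (n + 1) = (m + n) + 1`. -/
def addMor (E : Type u) [Category.{v} E] [CartesianMonoidalCategory E] [MonoidalClosed E]
    [NaturalNumbersObject E] : Nn E ⊗ Nn E ⟶ Nn E :=
  MonoidalClosed.uncurry (NaturalNumbersObject.iter
    (MonoidalClosed.curry (fst (Nn E) (𝟙_ E)))
    ((ihom (Nn E)).map NaturalNumbersObject.succ))

def addI (m n : Γ ⟶ Nn E) : Γ ⟶ Nn E := lift m n ≫ addMor E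

infixl:65 " +ᵢ " => addI

/-- Multiplication `N × N → N`: `m * 0 = 0` and `m * (n + 1) = m * n + m`. -/
def mulMor (E : Type u) [Category.{v} E] [CartesianMonoidalCategory E] [MonoidalClosed E]
    [NaturalNumbersObject E] : Nn E ⊗ Nn E ⟶ Nn E :=
  MonoidalClosed.uncurry (NaturalNumbersObject.iter
    (MonoidalClosed.curry (zeroI : Nn E ⊗ 𝟙_ E ⟶ Nn E))
    (MonoidalClosed.curry
      (addI ((ihom.ev (Nn E)).app (Nn E)) (fst (Nn E) (Fn (Nn E) (Nn E))))))

def mulI (m n : Γ ⟶ Nn E) : Γ ⟶ Nn E := lift m n ≫ mulMor E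

infixl:70 " *ᵢ " => mulI

/-- `m ≤ n`. -/
def leI (m n : Γ ⟶ Nn E) : Γ ⟶ Om E := ex (Nn E) fun k => m +ᵢ k =ᵢ n

/-- `m < n`. -/
def ltI (m n : Γ ⟶ Nn E) : Γ ⟶ Om E := leI (succI m) n

end Arithmetic

/-! ### Semidecidability, countability, overtness -/

section Semidecidable

variable [NaturalNumbersObject E] {Γ X : E}

/-- `D` is a decidable subset. -/
def IsDecidable (D : Γ ⟶ Pw X) : Γ ⟶ Om E := all X fun x => x ∈ᵢ D ∨ᵢ ¬ᵢ (x ∈ᵢ D)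

/-- `p` is a semidecidable truth value, i.e. an element of the Rosolini dominance `Σ`: it is
equivalent to `∃ n, n ∈ D` for a decidable subset `D` of the natural numbers. -/
def IsSd (p : Γ ⟶ Om E) : Γ ⟶ Om E :=
  ex (Pw (Nn E)) fun D => IsDecidable D ∧ᵢ (p ↔ᵢ ex (Nn E) fun n => n ∈ᵢ D)

/-- `S` is a semidecidable subset, i.e. `S ∈ Σ ^ X`. -/
def IsSdSet (S : Γ ⟶ Pw X) : Γ ⟶ Om E := all X fun x => IsSd (x ∈ᵢ S)

/-- The intrinsic topology `Σ ^ X`. -/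
def intrinsic (X : E) : Γ ⟶ Pw (Pw X) := compr (Pw X) fun S => IsSdSet S

/-- `T` is an overt subset of `X`: for every `S : X → Σ`, `∃ x ∈ T, x ∈ S` is semidecidable. -/
def IsOvert (T : Γ ⟶ Pw X) : Γ ⟶ Om E :=
  all (Pw X) fun S => IsSdSet S →ᵢ IsSd (ex X fun x => x ∈ᵢ T ∧ᵢ x ∈ᵢ S)

/-- The set `X` is overt. -/
def OvertSpace (X : E) : Γ ⟶ Om E := IsOvert (univI : Γ ⟶ Pw X)

/-- `e` enumerates `D`.  Maps `N → 1 + X` are presented as maps to the subsets of `X` which are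
empty (the enumeration skips) or singletons. -/
def Enumerates (e : Γ ⟶ Fn (Nn E) (Pw X)) (D : Γ ⟶ Pw X) : Γ ⟶ Om E :=
  (all (Nn E) fun n => app ↟e n =ᵢ emptyI ∨ᵢ ex X fun x => app ↟e n =ᵢ singI x) ∧ᵢ
  (all X fun x => x ∈ᵢ D ↔ᵢ ex (Nn E) fun n => x ∈ᵢ app ↟e n)

/-- `D` is a countable subset of `X`: there is a surjection `N → 1 + D`. -/
def IsCountable (D : Γ ⟶ Pw X) : Γ ⟶ Om E :=
  ex (Fn (Nn E) (Pw X)) fun e => Enumerates e D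

end Semidecidable

/-! ### The axioms of synthetic computability -/

section Axioms

variable [NaturalNumbersObject E] {Γ : E}

/-- Dependent Choice on `X`: for every total relation `R` on `X` and every `x₀` there is
`f : N → X` with `f 0 = x₀` and `R (f n) (f (n + 1))` for all `n`. -/
def DependentChoice (X : E) : Γ ⟶ Om E :=
  all (Pw (X ⊗ X)) fun R =>
    (all X fun x => ex X fun y => lift ↟x y ∈ᵢ ↟R) →ᵢ
    all X fun x₀ => ex (Fn (Nn E) X) fun f =>
      (app ↟f zeroI =ᵢ x₀) ∧ᵢ
      all (Nn E) fun n => lift (app ↟f n) (app ↟f (succI n)) ∈ᵢ ↟R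

/-- Markov principle: if not all terms of a binary sequence are zero, some term is one.  A binary
sequence is given as a decidable subset of the natural numbers. -/
def MarkovPrinciple : Γ ⟶ Om E :=
  all (Pw (Nn E)) fun D => IsDecidable D →ᵢ
    ¬ᵢ (all (Nn E) fun n => ¬ᵢ (n ∈ᵢ D)) →ᵢ ex (Nn E) fun n => n ∈ᵢ D

/-- Enumerability Axiom: there are countably many countable subsets of the natural numbers. -/
def EnumerabilityAxiom : Γ ⟶ Om E :=
  IsCountable (compr (Pw (Nn E)) fun S => IsCountable S)

/-- Stable Subspace Axiom: if `A ⊆ N` is stable under double negation, then every `S : A → Σ` is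
the restriction of some `T : N → Σ`. -/
def StableSubspaceAxiom : Γ ⟶ Om E :=
  all (Pw (Nn E)) fun A =>
    (all (Nn E) fun n => ¬ᵢ (¬ᵢ (n ∈ᵢ A)) →ᵢ n ∈ᵢ A) →ᵢ
    all (Pw (Nn E)) fun S => (all (Nn E) fun n => n ∈ᵢ A →ᵢ IsSd (n ∈ᵢ S)) →ᵢ
      ex (Pw (Nn E)) fun T => IsSdSet T ∧ᵢ
        all (Nn E) fun n => n ∈ᵢ A →ᵢ (n ∈ᵢ T ↔ᵢ n ∈ᵢ S)

variable (E) in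
/-- The axioms of synthetic computability hold in the topos `E`. -/
structure SyntheticComputability : Prop where
  dependentChoice : ∀ X : E, Valid (DependentChoice X : 𝟙_ E ⟶ Om E)
  markov : Valid (MarkovPrinciple : 𝟙_ E ⟶ Om E)
  enumerability : Valid (EnumerabilityAxiom : 𝟙_ E ⟶ Om E)
  stableSubspace : Valid (StableSubspaceAxiom : 𝟙_ E ⟶ Om E)

end Axioms

/-! ### Topological spaces -/

section Topology

variable [NaturalNumbersObject E] {Γ X : E}

/-- The union of a sequence of subsets. -/
def iUnionI (V : Γ ⟶ Fn (Nn E) (Pw X)) : Γ ⟶ Pw X :=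
  compr X fun x => ex (Nn E) fun n => x ∈ᵢ app ↟V n

/-- `T` is a (Malcev) topology on `X`: a sub-`σ`-frame of the intrinsic topology. -/
def IsTopology (T : Γ ⟶ Pw (Pw X)) : Γ ⟶ Om E :=
  (all (Pw X) fun U => U ∈ᵢ T →ᵢ IsSdSet U) ∧ᵢ
  univI ∈ᵢ T ∧ᵢ
  (all (Pw X) fun U => all (Pw X) fun V => ↟U ∈ᵢ ↟T →ᵢ V ∈ᵢ ↟T →ᵢ interI U V ∈ᵢ T) ∧ᵢ
  emptyI ∈ᵢ T ∧ᵢ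
  (all (Fn (Nn E) (Pw X)) fun V => (all (Nn E) fun n => app ↟V n ∈ᵢ ↟T) →ᵢ iUnionI V ∈ᵢ T)

/-- `B` is a countable base of `T`: its terms are in `T`, and each `U ∈ T` is the union of the
`B i` with `i ∈ I`, for some countable `I ⊆ N`. -/
def IsBase (B : Γ ⟶ Fn (Nn E) (Pw X)) (T : Γ ⟶ Pw (Pw X)) : Γ ⟶ Om E :=
  (all (Nn E) fun n => app ↟B n ∈ᵢ T) ∧ᵢ
  (all (Pw X) fun U => U ∈ᵢ T →ᵢ ex (Pw (Nn E)) fun I => IsCountable I ∧ᵢ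
    all X fun x => x ∈ᵢ U ↔ᵢ ex (Nn E) fun i => i ∈ᵢ I ∧ᵢ x ∈ᵢ app ↟B i)

/-- `h` is a `σ`-homomorphism from the topology `T` to `Σ`; only the values of `h` on `T` matter. -/
def IsSigmaHom (T : Γ ⟶ Pw (Pw X)) (h : Γ ⟶ Fn (Pw X) (Om E)) : Γ ⟶ Om E :=
  (all (Pw X) fun U => U ∈ᵢ T →ᵢ IsSd (app ↟h U)) ∧ᵢ
  app ↟h univI ∧ᵢ
  (all (Pw X) fun U => all (Pw X) fun V => ↟U ∈ᵢ ↟T →ᵢ V ∈ᵢ ↟T →ᵢ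
    (app ↟h (interI U V) ↔ᵢ (app ↟h U ∧ᵢ app ↟h V))) ∧ᵢ
  ¬ᵢ (app ↟h emptyI) ∧ᵢ
  (all (Fn (Nn E) (Pw X)) fun V => (all (Nn E) fun n => app ↟V n ∈ᵢ ↟T) →ᵢ
    (app ↟h (iUnionI V) ↔ᵢ ex (Nn E) fun n => app ↟h (app ↟V n)))

/-- `(X, T)` is sober: the neighborhood filter, which sends `x` to the `σ`-homomorphism
`U ↦ (x ∈ U)`, is injective and surjective onto the `σ`-homomorphisms from `T` to `Σ`. -/
def IsSober (T : Γ ⟶ Pw (Pw X)) : Γ ⟶ Om E :=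
  (all X fun x => all X fun y =>
    (all (Pw X) fun U => U ∈ᵢ T →ᵢ (x ∈ᵢ U ↔ᵢ y ∈ᵢ U)) →ᵢ x =ᵢ y) ∧ᵢ
  (all (Fn (Pw X) (Om E)) fun h => IsSigmaHom T h →ᵢ
    ex X fun x => all (Pw X) fun U => U ∈ᵢ T →ᵢ (app ↟h U ↔ᵢ x ∈ᵢ U))

/-- The sequence `a` is dense with respect to `T`. -/
def IsDenseSeq (T : Γ ⟶ Pw (Pw X)) (a : Γ ⟶ Fn (Nn E) X) : Γ ⟶ Om E :=
  all (Pw X) fun U => U ∈ᵢ T →ᵢ (ex X fun x => x ∈ᵢ U) →ᵢ ex (Nn E) fun n => app ↟a n ∈ᵢ ↟U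

/-- The subset `D` is dense with respect to `T`. -/
def IsDenseSet (T : Γ ⟶ Pw (Pw X)) (D : Γ ⟶ Pw X) : Γ ⟶ Om E :=
  all (Pw X) fun U => U ∈ᵢ T →ᵢ (ex X fun x => x ∈ᵢ U) →ᵢ ex X fun x => x ∈ᵢ D ∧ᵢ x ∈ᵢ U

/-- `(X, T)` is separable: it has a countable dense subset. -/
def IsSeparable (T : Γ ⟶ Pw (Pw X)) : Γ ⟶ Om E :=
  ex (Pw X) fun D => IsCountable D ∧ᵢ IsDenseSet T D

/-- `T` is a topology on `X` with a countable base. -/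
def IsCountablyBased (T : Γ ⟶ Pw (Pw X)) : Γ ⟶ Om E :=
  IsTopology T ∧ᵢ ex (Fn (Nn E) (Pw X)) fun B => IsBase B T

end Topology

/-! ### Non-negative real numbers and metric spaces -/

section Metric

variable [NaturalNumbersObject E] {Γ M : E}

/-- Fractions: `(a, b)` stands for the rational number `a / (b + 1)`. -/
abbrev Frac (E : Type u) [Category.{v} E] [CartesianMonoidalCategory E] [NaturalNumbersObject E] :
    E := Nn E ⊗ Nn E

/-- Numerator. -/
def numI (q : Γ ⟶ Frac E) : Γ ⟶ Nn E := q ≫ fst (Nn E) (Nn E)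

/-- Denominator. -/
def denI (q : Γ ⟶ Frac E) : Γ ⟶ Nn E := succI (q ≫ snd (Nn E) (Nn E))

/-- `p < q` for fractions. -/
def ltFrac (p q : Γ ⟶ Frac E) : Γ ⟶ Om E := ltI (numI p *ᵢ denI q) (numI q *ᵢ denI p)

/-- The sum of fractions, `a / (b + 1) + c / (d + 1)`, with denominator `b * (d + 1) + d + 1`. -/
def addFrac (p q : Γ ⟶ Frac E) : Γ ⟶ Frac E :=
  lift (numI p *ᵢ denI q +ᵢ numI q *ᵢ denI p)
    ((p ≫ snd (Nn E) (Nn E)) *ᵢ denI q +ᵢ (q ≫ snd (Nn E) (Nn E)))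

/-- The fraction `0`. -/
def zeroFrac : Γ ⟶ Frac E := lift zeroI zeroI

/-- The fraction `1 / (k + 1)`. -/
def recipFrac (k : Γ ⟶ Nn E) : Γ ⟶ Frac E := lift (succI zeroI) k

/-- Pairs (lower cut, upper cut) of sets of non-negative rationals. -/
abbrev Cuts (E : Type u) [Category.{v} E] [CartesianMonoidalCategory E] [MonoidalClosed E]
    [HasSubobjectClassifier E] [NaturalNumbersObject E] : E := Pw (Frac E) ⊗ Pw (Frac E)

/-- The lower cut `{q | q < r}`. -/
def lowerI (r : Γ ⟶ Cuts E) : Γ ⟶ Pw (Frac E) := r ≫ fst (Pw (Frac E)) (Pw (Frac E))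

/-- The upper cut `{q | r < q}`. -/
def upperI (r : Γ ⟶ Cuts E) : Γ ⟶ Pw (Frac E) := r ≫ snd (Pw (Frac E)) (Pw (Frac E))

/-- `r` is a non-negative Dedekind real: its upper cut is inhabited, both cuts are rounded, they
are disjoint and located.  (The lower cut has only non-negative rationals, so it may be empty.) -/
def IsReal (r : Γ ⟶ Cuts E) : Γ ⟶ Om E :=
  (ex (Frac E) fun q => q ∈ᵢ upperI r) ∧ᵢ
  (all (Frac E) fun q => q ∈ᵢ lowerI r ↔ᵢ ex (Frac E) fun p => ltFrac q p ∧ᵢ p ∈ᵢ lowerI r) ∧ᵢ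
  (all (Frac E) fun q => q ∈ᵢ upperI r ↔ᵢ ex (Frac E) fun p => ltFrac p q ∧ᵢ p ∈ᵢ upperI r) ∧ᵢ
  (all (Frac E) fun q => ¬ᵢ (q ∈ᵢ lowerI r ∧ᵢ q ∈ᵢ upperI r)) ∧ᵢ
  (all (Frac E) fun p => all (Frac E) fun q =>
    ltFrac p q →ᵢ (p ∈ᵢ lowerI r ∨ᵢ q ∈ᵢ upperI r))

/-- The real number `0`. -/
def zeroReal : Γ ⟶ Cuts E := lift emptyI (compr (Frac E) fun q => ltFrac zeroFrac q)

/-- `r < s` for reals. -/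
def ltReal (r s : Γ ⟶ Cuts E) : Γ ⟶ Om E :=
  ex (Frac E) fun q => q ∈ᵢ upperI r ∧ᵢ q ∈ᵢ lowerI s

/-- `r ≤ s + t` for reals. -/
def leSumReal (r s t : Γ ⟶ Cuts E) : Γ ⟶ Om E :=
  all (Frac E) fun p => all (Frac E) fun q =>
    p ∈ᵢ upperI s →ᵢ q ∈ᵢ upperI t →ᵢ addFrac p q ∈ᵢ upperI r

/-- `d x y`. -/
def distI (d : Γ ⟶ Fn (M ⊗ M) (Cuts E)) (x y : Γ ⟶ M) : Γ ⟶ Cuts E := app d (lift x y)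

/-- `d` is a metric on `M`. -/
def IsMetric (d : Γ ⟶ Fn (M ⊗ M) (Cuts E)) : Γ ⟶ Om E :=
  (all M fun x => all M fun y => IsReal (distI d x y)) ∧ᵢ
  (all M fun x => all M fun y => distI d x y =ᵢ zeroReal ↔ᵢ x =ᵢ y) ∧ᵢ
  (all M fun x => all M fun y => distI d x y =ᵢ distI d y x) ∧ᵢ
  (all M fun x => all M fun y => all M fun z =>
    leSumReal (distI d ↟x z) (distI d ↟x ↟y) (distI d ↟y z))

/-- `d x y < 1 / (k + 1)`. -/
def IsNear (d : Γ ⟶ Fn (M ⊗ M) (Cuts E)) (k : Γ ⟶ Nn E) (x y : Γ ⟶ M) : Γ ⟶ Om E :=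
  recipFrac k ∈ᵢ upperI (distI d x y)

/-- Every Cauchy sequence converges. -/
def IsCompleteMetric (d : Γ ⟶ Fn (M ⊗ M) (Cuts E)) : Γ ⟶ Om E :=
  all (Fn (Nn E) M) fun a =>
    (all (Nn E) fun k => ex (Nn E) fun m => all (Nn E) fun i => all (Nn E) fun j =>
      leI m i →ᵢ leI m j →ᵢ IsNear d k (app ↟a i) (app ↟a j)) →ᵢ
    ex M fun x => all (Nn E) fun k => ex (Nn E) fun m => all (Nn E) fun i =>
      leI m i →ᵢ IsNear d k (app ↟a i) ↟x

/-- There is a countable subset of `M` which comes arbitrarily close to every point. -/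
def IsSeparableMetric (d : Γ ⟶ Fn (M ⊗ M) (Cuts E)) : Γ ⟶ Om E :=
  ex (Pw M) fun D => IsCountable D ∧ᵢ
    all M fun x => all (Nn E) fun k => ex M fun y => y ∈ᵢ D ∧ᵢ IsNear d k x y

/-- The open ball with center `x` and radius `r`. -/
def ballI (d : Γ ⟶ Fn (M ⊗ M) (Cuts E)) (x : Γ ⟶ M) (r : Γ ⟶ Cuts E) : Γ ⟶ Pw M :=
  compr M fun y => ltReal (distI d x y) r

/-- The metric topology: the countable unions of open balls, i.e. the unions of sequences whose
terms are open balls or empty. -/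
def metricTopology (d : Γ ⟶ Fn (M ⊗ M) (Cuts E)) : Γ ⟶ Pw (Pw M) :=
  compr (Pw M) fun U => ex (Fn (Nn E) (Pw M)) fun V =>
    (all (Nn E) fun n => app ↟V n =ᵢ emptyI ∨ᵢ
      ex M fun x => ex (Cuts E) fun r => IsReal r ∧ᵢ app ↟V n =ᵢ ballI d ↟x r) ∧ᵢ
    U =ᵢ iUnionI V

end Metric

/-! ### Domains -/

section Domains

variable [NaturalNumbersObject E] {Γ P : E}

/-- `x ≤ y`, for `le` a relation on `P`. -/
def relI (le : Γ ⟶ Pw (P ⊗ P)) (x y : Γ ⟶ P) : Γ ⟶ Om E := lift x y ∈ᵢ le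

/-- `le` is a partial order. -/
def IsPartialOrder (le : Γ ⟶ Pw (P ⊗ P)) : Γ ⟶ Om E :=
  (all P fun x => relI le x x) ∧ᵢ
  (all P fun x => all P fun y => all P fun z =>
    relI le ↟x ↟y →ᵢ relI le ↟y z →ᵢ relI le ↟x z) ∧ᵢ
  (all P fun x => all P fun y => relI le x y →ᵢ relI le y x →ᵢ x =ᵢ y)

/-- `c` is a chain. -/
def IsChain (le : Γ ⟶ Pw (P ⊗ P)) (c : Γ ⟶ Fn (Nn E) P) : Γ ⟶ Om E :=
  all (Nn E) fun n => relI le (app ↟c n) (app ↟c (succI n))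

/-- `s` is the supremum of the subset `D`. -/
def IsSup (le : Γ ⟶ Pw (P ⊗ P)) (D : Γ ⟶ Pw P) (s : Γ ⟶ P) : Γ ⟶ Om E :=
  (all P fun x => x ∈ᵢ D →ᵢ relI le x s) ∧ᵢ
  (all P fun u => (all P fun x => x ∈ᵢ D →ᵢ relI le x u) →ᵢ relI le s u)

/-- The set of terms of the sequence `c`. -/
def rangeI (c : Γ ⟶ Fn (Nn E) P) : Γ ⟶ Pw P :=
  compr P fun x => ex (Nn E) fun n => x =ᵢ app ↟c n

/-- `le` is an `ω`-cpo: a partial order in which every chain has a supremum. -/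
def IsOmegaCpo (le : Γ ⟶ Pw (P ⊗ P)) : Γ ⟶ Om E :=
  IsPartialOrder le ∧ᵢ
  (all (Fn (Nn E) P) fun c => IsChain le c →ᵢ ex P fun s => IsSup le (rangeI c) s)

/-- The way-below relation. -/
def wayBelow (le : Γ ⟶ Pw (P ⊗ P)) (x y : Γ ⟶ P) : Γ ⟶ Om E :=
  all (Fn (Nn E) P) fun c => all P fun s =>
    IsChain le ↟c →ᵢ IsSup le (rangeI ↟c) s →ᵢ relI le y s →ᵢ
    ex (Nn E) fun m => relI le x (app ↟c m)

/-- The set of compact elements. -/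
def compacts (le : Γ ⟶ Pw (P ⊗ P)) : Γ ⟶ Pw P := compr P fun x => wayBelow le x x

/-- The set of compact elements below `x`. -/
def compactsBelow (le : Γ ⟶ Pw (P ⊗ P)) (x : Γ ⟶ P) : Γ ⟶ Pw P :=
  compr P fun y => y ∈ᵢ compacts le ∧ᵢ relI le y x

/-- The subset `D` is directed: inhabited, and any two elements have an upper bound in `D`. -/
def IsDirected (le : Γ ⟶ Pw (P ⊗ P)) (D : Γ ⟶ Pw P) : Γ ⟶ Om E :=
  (ex P fun x => x ∈ᵢ D) ∧ᵢ
  (all P fun x => all P fun y => ↟x ∈ᵢ ↟D →ᵢ y ∈ᵢ ↟D →ᵢ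
    ex P fun z => z ∈ᵢ D ∧ᵢ relI le x z ∧ᵢ relI le y z)

/-- `le` is `ω`-algebraic: the compact elements are countable with decidable order, and the
compact elements below any `x` form a countable directed subset with supremum `x`. -/
def IsOmegaAlgebraic (le : Γ ⟶ Pw (P ⊗ P)) : Γ ⟶ Om E :=
  IsCountable (compacts le) ∧ᵢ
  (all P fun x => all P fun y => ↟x ∈ᵢ compacts ↟le →ᵢ y ∈ᵢ compacts ↟le →ᵢ
    (relI le x y ∨ᵢ ¬ᵢ (relI le x y))) ∧ᵢ
  (all P fun x => IsCountable (compactsBelow le x) ∧ᵢ IsDirected le (compactsBelow le x) ∧ᵢ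
    IsSup le (compactsBelow le x) x)

/-- The Scott topology: the semidecidable subsets which are upward closed and inaccessible by
suprema of chains. -/
def scottTopology (le : Γ ⟶ Pw (P ⊗ P)) : Γ ⟶ Pw (Pw P) :=
  compr (Pw P) fun U =>
    IsSdSet U ∧ᵢ
    (all P fun x => all P fun y => ↟x ∈ᵢ ↟U →ᵢ relI le ↟x y →ᵢ y ∈ᵢ ↟U) ∧ᵢ
    (all (Fn (Nn E) P) fun c => all P fun s =>
      IsChain le ↟c →ᵢ IsSup le (rangeI ↟c) s →ᵢ s ∈ᵢ U →ᵢ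
      ex (Nn E) fun m => app ↟c m ∈ᵢ ↟U)

end Domains

end

end SynthTopos

namespace SynthTopos
open CategoryTheory CategoryTheory.Limits MonoidalCategory CartesianMonoidalCategory
set_option linter.unusedSectionVars false

/-! ### Kripke-Joyal semantics -/

section Weaken

variable {E : Type u} [Category.{v} E] [CartesianMonoidalCategory E]

/-! Everything is proved by Kripke-Joyal forcing. A formula in context `Γ` is `Valid` when it equals
`tt`. Each connective gets a clause over stages `σ : Δ ⟶ Γ`: implication and universal
quantification speak of all later stages, existence means a witness after an epimorphism, and truth
descends along epimorphisms (`Valid.of_epi`). An internal argument then becomes an ordinary one with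
a change of stage at each elimination of an existential quantifier.

The heart is the density statement. Let `D` be countable and dense for a countably based sober
topology, let `S` be semidecidable and `x ∈ S`. The statement that `D` meets `S` is semidecidable,
so by the Markov principle it may be proved by contradiction; suppose that `D` misses `S`. Countable
choice gives points `y k ∈ D` that lie in the first `k` listed basic neighbourhoods of `x`
(`exists_approximation`). For a semidecidable `p = ∃ n, n ∈ A` with `A` decidable, let `Q` contain
`x` if `p` fails, and `y k` if `k` is the least element of `A`. This `Q` has at most one element and
is not empty. For open `U` the inclusion `Q ⊆ U` is semidecidable: either a basic neighbourhood of
`x` inside `U` is listed while `A` has shown no element yet, and it then contains whatever `Q` may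
contain; or the least `k ∈ A` has been found and `y k ∈ U`. Hence `U ↦ (Q ⊆ U)` is a
`σ`-homomorphism, and sobriety gives a point `w` to which every element of `Q` is equal
(`exists_point_of_isSober`). Since `x ∈ S` and `D` misses `S`, the statement `¬p` is equivalent to
`w ∈ S`, so it is semidecidable (`isSd_not_of_disjoint`). But negation cannot preserve
semidecidability, by diagonalization against an enumeration of the countable, that is semidecidable,
subsets of `N` (`false_of_isSd_not`).

So `D` is dense for the intrinsic topology (`isDenseSet_intrinsic`). Overtness follows, because `∃
x, x ∈ S` reduces to an existential statement over the countable set `D`.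

For metric spaces and domains only topological facts remain. Both topologies consist of the
countable unions of a sequence of basic sets: the rational balls around a countable dense set, or
the upper sets of compact elements. `FormalBase` isolates what makes such unions a topology, and
`isSober_genTop` reduces sobriety to realizing every `PointFilter` by a point. In the metric case
this point is the limit of the centers of balls of radius `1 / (n + 1)` in the filter
(`exists_limit`); in a domain it is the supremum of a cofinal chain of the compact elements named by
the filter (`isSober_scott`). -/

@[simp] theorem wk_refl (Γ : E) : (Extends.wk : Γ ⟶ Γ) = 𝟙 Γ := (rfl)

@[simp] theorem wk_step (X Δ Γ : E) [Extends Δ Γ] :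
    (Extends.wk : X ⊗ Δ ⟶ Γ) = snd X Δ ≫ Extends.wk := (rfl)

end Weaken

noncomputable section

variable {E : Type u} [Category.{v} E] [CartesianMonoidalCategory E] [HasFiniteLimits E]
  [MonoidalClosed E] [HasSubobjectClassifier E]

/-! ### Forcing clauses for equality, connectives and quantifiers -/

section Logic

variable {Γ Δ X Y Z : E}

attribute [local simp] comp_lift_assoc

@[simp] theorem comp_tt (σ : Δ ⟶ Γ) : σ ≫ (tt : Γ ⟶ Om E) = tt := by
  unfold tt
  rw [← Category.assoc]
  congr 1
  exact Subsingleton.elim _ _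

/-- This is the universal property of the pullback square defining `χ m`. Equality is a
characteristic map and every connective is built from equality, so all forcing clauses go back to
this one. -/
theorem valid_comp_χ {U : E} (m : U ⟶ X) [Mono m] (f : Γ ⟶ X) :
    Valid (f ≫ HasSubobjectClassifier.χ m) ↔ ∃ g : Γ ⟶ U, g ≫ m = f := by
  have hP := HasSubobjectClassifier.isPullback_χ m
  constructor
  · intro h
    exact ⟨hP.lift f _ h, hP.lift_fst _ _ _⟩
  · rintro ⟨g, rfl⟩
    unfold Valid tt
    rw [Category.assoc, hP.w, ← Category.assoc]
    congr 1
    exact Subsingleton.elim _ _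

@[simp] theorem valid_tt : Valid (tt : Γ ⟶ Om E) := (rfl)

theorem Valid.comp {p : Γ ⟶ Om E} (h : Valid p) (σ : Δ ⟶ Γ) : Valid (σ ≫ p) := by
  unfold Valid at h ⊢
  rw [h, comp_tt]

theorem Valid.on {p : Γ ⟶ Om E} (h : Valid p) (σ : Δ ⟶ Γ) {q : Δ ⟶ Om E}
    (e : σ ≫ p = q := by first | (simp; done) | (simp; rfl)) : Valid q := e ▸ h.comp σ

/-- Truth is local. Once witnesses have been found on a cover `σ`, a conclusion that does not
mention them descends to `Γ`. -/
theorem Valid.of_epi (σ : Δ ⟶ Γ) [Epi σ] {p : Γ ⟶ Om E} (h : Valid (σ ≫ p)) : Valid p := by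
  unfold Valid at h ⊢
  rwa [← comp_tt σ, cancel_epi] at h

/-- Truth values are determined by the stages at which they are true. -/
theorem omega_ext {p q : Γ ⟶ Om E}
    (h : ∀ ⦃Δ : E⦄ (σ : Δ ⟶ Γ), Valid (σ ≫ p) ↔ Valid (σ ≫ q)) : p = q := by
  obtain ⟨A, i, _, hp⟩ := HasSubobjectClassifier.exists_classifier.some.surjective_χ p
  obtain ⟨B, j, _, hq⟩ := HasSubobjectClassifier.exists_classifier.some.surjective_χ q
  change p = HasSubobjectClassifier.χ i at hp
  change q = HasSubobjectClassifier.χ j at hq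
  -- The subobjects classified by `p` and `q` factor through each other, hence are isomorphic, and
  -- characteristic maps are unique.
  obtain ⟨f, hf⟩ := (valid_comp_χ j i).1
    (hq ▸ (h i).1 (hp ▸ (valid_comp_χ i i).2 ⟨𝟙 _, Category.id_comp _⟩))
  obtain ⟨g, hg⟩ := (valid_comp_χ i j).1
    (hp ▸ (h j).2 (hq ▸ (valid_comp_χ j j).2 ⟨𝟙 _, Category.id_comp _⟩))
  have hfg : f ≫ g = 𝟙 _ := by rw [← cancel_mono i, Category.assoc, hg, hf, Category.id_comp]
  have hgf : g ≫ f = 𝟙 _ := by rw [← cancel_mono j, Category.assoc, hf, hg, Category.id_comp]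
  rw [hp]
  have hP := HasSubobjectClassifier.isPullback_χ i
  rw [hq]
  refine HasSubobjectClassifier.unique j _ ?_
  exact hP.of_iso ⟨f, g, hfg, hgf⟩ (Iso.refl _) (Iso.refl _) (Iso.refl _)
    (by simp [hf]) (Subsingleton.elim _ _) (by simp) (by simp)

/-- The extent of a truth value. -/
theorem exists_extent (p : Γ ⟶ Om E) : ∃ (A : E) (i : A ⟶ Γ), Mono i ∧
    Valid (i ≫ p) ∧ ∀ ⦃Δ : E⦄ (σ : Δ ⟶ Γ), Valid (σ ≫ p) → ∃ τ : Δ ⟶ A, τ ≫ i = σ := by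
  obtain ⟨A, i, hi, hp⟩ := HasSubobjectClassifier.exists_classifier.some.surjective_χ p
  change p = HasSubobjectClassifier.χ i at hp
  subst hp
  exact ⟨A, i, hi, (valid_comp_χ i i).2 ⟨𝟙 _, Category.id_comp _⟩, fun Δ σ => (valid_comp_χ i σ).1⟩

@[simp] theorem comp_eqI (σ : Δ ⟶ Γ) (x y : Γ ⟶ X) : σ ≫ (x =ᵢ y) = (σ ≫ x =ᵢ σ ≫ y) := by
  simp [eqI]

@[simp] theorem valid_eqI {x y : Γ ⟶ X} : Valid (x =ᵢ y) ↔ x = y := by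
  unfold eqI
  rw [valid_comp_χ]
  constructor
  · rintro ⟨g, hg⟩
    have h1 := hg =≫ fst _ _
    have h2 := hg =≫ snd _ _
    simp at h1 h2
    rw [← h1, h2]
  · rintro rfl
    exact ⟨x, by simp⟩

@[simp] theorem comp_andI (σ : Δ ⟶ Γ) (p q : Γ ⟶ Om E) :
    σ ≫ (p ∧ᵢ q) = (σ ≫ p ∧ᵢ σ ≫ q) := by
  simp [andI]

@[simp] theorem valid_andI {p q : Γ ⟶ Om E} : Valid (p ∧ᵢ q) ↔ Valid p ∧ Valid q := by
  unfold andI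
  rw [valid_eqI]
  constructor
  · intro h
    have h1 := h =≫ fst _ _
    have h2 := h =≫ snd _ _
    simp at h1 h2
    exact ⟨h1, h2⟩
  · rintro ⟨h1, h2⟩
    unfold Valid at h1 h2
    rw [h1, h2]

@[simp] theorem comp_impI (σ : Δ ⟶ Γ) (p q : Γ ⟶ Om E) :
    σ ≫ (p →ᵢ q) = (σ ≫ p →ᵢ σ ≫ q) := by
  simp [impI]

theorem valid_impI {p q : Γ ⟶ Om E} :
    Valid (p →ᵢ q) ↔ ∀ ⦃Δ : E⦄ (σ : Δ ⟶ Γ), Valid (σ ≫ p) → Valid (σ ≫ q) := by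
  unfold impI
  rw [valid_eqI]
  constructor
  · intro h Δ σ hp
    have := congrArg (fun t => σ ≫ t) h
    simp only [comp_andI] at this
    rw [← this] at hp
    exact (valid_andI.1 hp).2
  · intro h
    refine omega_ext fun Δ σ => ?_
    rw [comp_andI, valid_andI]
    exact ⟨fun h => h.1, fun hp => ⟨hp, h σ hp⟩⟩

theorem Valid.mp {p q : Γ ⟶ Om E} (h : Valid (p →ᵢ q)) (hp : Valid p) : Valid q := by
  simpa using valid_impI.1 h (𝟙 Γ) (by simpa using hp)

@[simp] theorem comp_iffI (σ : Δ ⟶ Γ) (p q : Γ ⟶ Om E) :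
    σ ≫ (p ↔ᵢ q) = (σ ≫ p ↔ᵢ σ ≫ q) := by
  simp [iffI]

@[simp] theorem valid_iffI {p q : Γ ⟶ Om E} : Valid (p ↔ᵢ q) ↔ p = q := valid_eqI

theorem comp_compr (σ : Δ ⟶ Γ) (φ : (X ⊗ Γ ⟶ X) → (X ⊗ Γ ⟶ Om E)) :
    σ ≫ compr X φ = compr X fun _ => X ◁ σ ≫ φ (fst X Γ) := by
  unfold compr
  rw [MonoidalClosed.curry_natural_left]

attribute [local simp] comp_compr

@[simp] theorem comp_app (σ : Δ ⟶ Γ) (f : Γ ⟶ Fn X Y) (x : Γ ⟶ X) :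
    σ ≫ app f x = app (σ ≫ f) (σ ≫ x) := by
  simp [app]

@[simp] theorem comp_app_assoc (σ : Δ ⟶ Γ) (f : Γ ⟶ Fn X Y) (x : Γ ⟶ X) (k : Y ⟶ Z) :
    σ ≫ app f x ≫ k = app (σ ≫ f) (σ ≫ x) ≫ k := by
  rw [← Category.assoc, comp_app]

@[simp] theorem comp_memI (σ : Δ ⟶ Γ) (x : Γ ⟶ X) (S : Γ ⟶ Pw X) :
    σ ≫ (x ∈ᵢ S) = (σ ≫ x ∈ᵢ σ ≫ S) := comp_app ..

/-- The function `x ↦ t x`. -/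
def lam (X : E) (t : (X ⊗ Γ ⟶ X) → (X ⊗ Γ ⟶ Y)) : Γ ⟶ Fn X Y :=
  MonoidalClosed.curry (t (fst X Γ))

theorem comp_lam (σ : Δ ⟶ Γ) (t : (X ⊗ Γ ⟶ X) → (X ⊗ Γ ⟶ Y)) :
    σ ≫ lam X t = lam X fun _ => X ◁ σ ≫ t (fst X Γ) := by
  unfold lam
  rw [MonoidalClosed.curry_natural_left]

theorem app_lam (t : (X ⊗ Γ ⟶ X) → (X ⊗ Γ ⟶ Y)) (x : Γ ⟶ X) :
    app (lam X t) x = lift x (𝟙 Γ) ≫ t (fst X Γ) := by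
  unfold app lam
  have h := MonoidalClosed.uncurry_curry (t (fst X Γ))
  rw [MonoidalClosed.uncurry_eq] at h
  conv_rhs => rw [← h]
  rw [lift_whiskerLeft_assoc, Category.id_comp]

theorem memI_compr (x : Γ ⟶ X) (φ : (X ⊗ Γ ⟶ X) → (X ⊗ Γ ⟶ Om E)) :
    (x ∈ᵢ compr X φ) = lift x (𝟙 Γ) ≫ φ (fst X Γ) := app_lam φ x

attribute [local simp] comp_lam app_lam memI_compr

theorem fn_ext {f g : Γ ⟶ Fn X Y}
    (h : ∀ ⦃Δ : E⦄ (σ : Δ ⟶ Γ) (x : Δ ⟶ X), app (σ ≫ f) x = app (σ ≫ g) x) : f = g := by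
  apply MonoidalClosed.uncurry_injective
  have := h (snd X Γ) (fst X Γ)
  unfold app at this
  rw [MonoidalClosed.uncurry_eq, MonoidalClosed.uncurry_eq]
  convert! this using 2 <;> ext <;> simp

theorem set_ext {S T : Γ ⟶ Pw X}
    (h : ∀ ⦃Δ : E⦄ (σ : Δ ⟶ Γ) (x : Δ ⟶ X), Valid (x ∈ᵢ σ ≫ S) ↔ Valid (x ∈ᵢ σ ≫ T)) :
    S = T := by
  refine fn_ext fun Δ σ x => omega_ext fun Θ τ => ?_
  have := h (τ ≫ σ) (τ ≫ x)
  simpa [memI] using this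

theorem compr_congr {φ ψ : (X ⊗ Γ ⟶ X) → (X ⊗ Γ ⟶ Om E)} (h : φ (fst X Γ) = ψ (fst X Γ)) :
    compr X φ = compr X ψ := by
  unfold compr
  rw [h]

theorem all_congr {φ ψ : (X ⊗ Γ ⟶ X) → (X ⊗ Γ ⟶ Om E)} (h : φ (fst X Γ) = ψ (fst X Γ)) :
    all X φ = all X ψ := by
  unfold all compr
  rw [h]

theorem comp_all (σ : Δ ⟶ Γ) (φ : (X ⊗ Γ ⟶ X) → (X ⊗ Γ ⟶ Om E)) :
    σ ≫ all X φ = all X fun _ => X ◁ σ ≫ φ (fst X Γ) := by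
  simp [all]

attribute [local simp] comp_all

theorem valid_all {φ : (X ⊗ Γ ⟶ X) → (X ⊗ Γ ⟶ Om E)} :
    Valid (all X φ) ↔ ∀ ⦃Δ : E⦄ (σ : Δ ⟶ Γ) (x : Δ ⟶ X), Valid (lift x σ ≫ φ (fst X Γ)) := by
  unfold all
  rw [valid_eqI]
  constructor
  · intro h Δ σ x
    have := congrArg (fun t => x ∈ᵢ σ ≫ t) h
    simp at this
    exact this
  · intro h
    refine set_ext fun Δ σ x => ?_
    simp [h]

@[simp] theorem comp_ff (σ : Δ ⟶ Γ) : σ ≫ (ff : Γ ⟶ Om E) = ff := by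
  unfold ff
  rw [comp_all]
  exact all_congr (by simp)

theorem Valid.ff_elim (h : Valid (ff : Γ ⟶ Om E)) (p : Γ ⟶ Om E) : Valid p := by
  simpa using valid_all.1 h (𝟙 Γ) p

theorem Valid.ff_elim_eq (h : Valid (ff : Γ ⟶ Om E)) (x y : Γ ⟶ X) : x = y :=
  valid_eqI.1 (h.ff_elim _)

@[simp] theorem comp_notI (σ : Δ ⟶ Γ) (p : Γ ⟶ Om E) : σ ≫ ¬ᵢ p = ¬ᵢ (σ ≫ p) := by
  simp [notI]

theorem valid_notI {p : Γ ⟶ Om E} :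
    Valid (¬ᵢ p) ↔ ∀ ⦃Δ : E⦄ (σ : Δ ⟶ Γ), Valid (σ ≫ p) → Valid (ff : Δ ⟶ Om E) := by
  unfold notI
  rw [valid_impI]
  simp

@[simp] theorem comp_orI (σ : Δ ⟶ Γ) (p q : Γ ⟶ Om E) :
    σ ≫ (p ∨ᵢ q) = (σ ≫ p ∨ᵢ σ ≫ q) := by
  unfold orI
  rw [comp_all]
  exact all_congr (by simp)

/-- The impredicative definition of disjunction is instantiated at `r`. In this form no covering
family of two stages is ever needed. -/
theorem Valid.or_elim {p q : Γ ⟶ Om E} (h : Valid (p ∨ᵢ q)) {r : Γ ⟶ Om E}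
    (hp : ∀ ⦃Δ : E⦄ (σ : Δ ⟶ Γ), Valid (σ ≫ p) → Valid (σ ≫ r))
    (hq : ∀ ⦃Δ : E⦄ (σ : Δ ⟶ Γ), Valid (σ ≫ q) → Valid (σ ≫ r)) : Valid r := by
  have := valid_all.1 h (𝟙 Γ) r
  simp at this
  exact (this.mp (valid_impI.2 hp)).mp (valid_impI.2 hq)

theorem Valid.inl {p : Γ ⟶ Om E} (h : Valid p) (q : Γ ⟶ Om E) : Valid (p ∨ᵢ q) := by
  refine valid_all.2 fun Δ σ r => ?_
  simp
  refine valid_impI.2 fun Θ τ h1 => ?_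
  simp
  refine valid_impI.2 fun Ξ ρ _ => ?_
  have := (h1.comp ρ)
  simp at this ⊢
  exact this.mp (by simpa using h.comp (ρ ≫ τ ≫ σ))

theorem Valid.inr {q : Γ ⟶ Om E} (h : Valid q) (p : Γ ⟶ Om E) : Valid (p ∨ᵢ q) := by
  refine valid_all.2 fun Δ σ r => ?_
  simp
  refine valid_impI.2 fun Θ τ _ => ?_
  simp
  refine valid_impI.2 fun Ξ ρ h1 => ?_
  simp at h1 ⊢
  exact h1.mp (by simpa using h.comp (ρ ≫ τ ≫ σ))

theorem comp_ex (σ : Δ ⟶ Γ) (φ : (X ⊗ Γ ⟶ X) → (X ⊗ Γ ⟶ Om E)) :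
    σ ≫ ex X φ = ex X fun _ => X ◁ σ ≫ φ (fst X Γ) := by
  unfold ex
  rw [comp_all]
  refine all_congr ?_
  have h : X ◁ Om E ◁ σ ≫ X ◁ snd (Om E) Γ = X ◁ snd (Om E) Δ ≫ X ◁ σ := by
    ext <;> simp
  simp only [comp_impI, comp_all, reassoc_of% h]
  simp

attribute [local simp] comp_ex

/-- The cover is the extent of `φ` inside `X ⊗ Γ`, projected to `Γ`; the impredicative definition of
`ex` says exactly enough to make this projection epi. The converse is descent along the cover. -/
theorem valid_ex {φ : (X ⊗ Γ ⟶ X) → (X ⊗ Γ ⟶ Om E)} :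
    Valid (ex X φ) ↔ ∃ (Δ : E) (σ : Δ ⟶ Γ) (x : Δ ⟶ X),
      Epi σ ∧ Valid (lift x σ ≫ φ (fst X Γ)) := by
  constructor
  · intro h
    obtain ⟨A, i, _, hi, hA⟩ := exists_extent (φ (fst X Γ))
    refine ⟨A, i ≫ snd X Γ, i ≫ fst X Γ, ⟨fun {Z} f g hfg => ?_⟩, ?_⟩
    · rw [← valid_eqI]
      -- To see that the projection is epi, the truth value quantified over in `ex` is taken to be
      -- `f = g`.
      have := valid_all.1 h (𝟙 Γ) (f =ᵢ g)
      simp at this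
      refine this.mp (valid_all.2 fun Δ σ x => ?_)
      simp
      refine valid_impI.2 fun Θ τ hτ => ?_
      obtain ⟨ρ, hρ⟩ := hA (lift (τ ≫ x) (τ ≫ σ)) (by simpa [← comp_lift_assoc] using hτ)
      simp
      have h1 : ρ ≫ i ≫ snd X Γ = τ ≫ σ := by rw [← Category.assoc, hρ, lift_snd]
      have h2 := congrArg (fun t => ρ ≫ t) hfg
      simp only [Category.assoc] at h2 h1
      have h3 := congrArg (fun t => t ≫ f) h1
      have h4 := congrArg (fun t => t ≫ g) h1
      simp only [Category.assoc] at h3 h4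
      rw [← h3, ← h4, h2]
    · rw [← comp_lift]
      simpa using hi
  · rintro ⟨Δ, σ, x, hσ, h⟩
    refine Valid.of_epi σ ?_
    rw [comp_ex]
    refine valid_all.2 fun Θ τ r => ?_
    simp
    refine valid_impI.2 fun Ξ ρ h1 => ?_
    simp at h1
    have := valid_all.1 h1 (𝟙 Ξ) (ρ ≫ τ ≫ x)
    simp [← Category.assoc, ← MonoidalCategory.whiskerLeft_comp] at this
    refine this.mp ?_
    have := h.comp (ρ ≫ τ)
    simpa [← comp_lift_assoc] using this

theorem Valid.ex_intro {φ : (X ⊗ Γ ⟶ X) → (X ⊗ Γ ⟶ Om E)} (x : Γ ⟶ X)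
    (h : Valid (lift x (𝟙 Γ) ≫ φ (fst X Γ))) : Valid (ex X φ) :=
  valid_ex.2 ⟨Γ, 𝟙 Γ, x, inferInstance, h⟩

attribute [simp] comp_lift_assoc

/-! Normal forms of the binders: they depend only on the value at the generic element. -/

/-- Set comprehension of a formula on the generic element. -/
def setC (p : X ⊗ Γ ⟶ Om E) : Γ ⟶ Pw X := compr X fun _ => p

/-- The function given by a term on the generic element. -/
def lamC (t : X ⊗ Γ ⟶ Y) : Γ ⟶ Fn X Y := lam X fun _ => t

/-- Universal quantification of a formula on the generic element. -/
def allC (p : X ⊗ Γ ⟶ Om E) : Γ ⟶ Om E := all X fun _ => p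

/-- Existential quantification of a formula on the generic element. -/
def exC (p : X ⊗ Γ ⟶ Om E) : Γ ⟶ Om E := ex X fun _ => p

@[simp] theorem compr_eq (φ : (X ⊗ Γ ⟶ X) → (X ⊗ Γ ⟶ Om E)) :
    compr X φ = setC (φ (fst X Γ)) := (rfl)

@[simp] theorem lam_eq (t : (X ⊗ Γ ⟶ X) → (X ⊗ Γ ⟶ Y)) : lam X t = lamC (t (fst X Γ)) := (rfl)

@[simp] theorem all_eq (φ : (X ⊗ Γ ⟶ X) → (X ⊗ Γ ⟶ Om E)) :
    all X φ = allC (φ (fst X Γ)) := (rfl)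

@[simp] theorem ex_eq (φ : (X ⊗ Γ ⟶ X) → (X ⊗ Γ ⟶ Om E)) : ex X φ = exC (φ (fst X Γ)) := (rfl)

theorem whiskerLeft_eq_lift (σ : Δ ⟶ Γ) : X ◁ σ = lift (fst X Δ) (snd X Δ ≫ σ) := by
  ext <;> simp

@[simp] theorem comp_setC (σ : Δ ⟶ Γ) (p : X ⊗ Γ ⟶ Om E) :
    σ ≫ setC p = setC (lift (fst X Δ) (snd X Δ ≫ σ) ≫ p) := by
  rw [← whiskerLeft_eq_lift]
  exact comp_compr σ _

@[simp] theorem comp_lamC (σ : Δ ⟶ Γ) (t : X ⊗ Γ ⟶ Y) :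
    σ ≫ lamC t = lamC (lift (fst X Δ) (snd X Δ ≫ σ) ≫ t) := by
  rw [← whiskerLeft_eq_lift]
  exact comp_lam σ _

@[simp] theorem comp_allC (σ : Δ ⟶ Γ) (p : X ⊗ Γ ⟶ Om E) :
    σ ≫ allC p = allC (lift (fst X Δ) (snd X Δ ≫ σ) ≫ p) := by
  rw [← whiskerLeft_eq_lift]
  exact comp_all σ _

@[simp] theorem comp_exC (σ : Δ ⟶ Γ) (p : X ⊗ Γ ⟶ Om E) :
    σ ≫ exC p = exC (lift (fst X Δ) (snd X Δ ≫ σ) ≫ p) := by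
  rw [← whiskerLeft_eq_lift]
  exact comp_ex σ _

@[simp] theorem mem_setC (x : Γ ⟶ X) (p : X ⊗ Γ ⟶ Om E) :
    (x ∈ᵢ setC p) = lift x (𝟙 Γ) ≫ p := memI_compr x _

@[simp] theorem app_lamC (t : X ⊗ Γ ⟶ Y) (x : Γ ⟶ X) :
    app (lamC t) x = lift x (𝟙 Γ) ≫ t := app_lam _ x

theorem valid_allC {p : X ⊗ Γ ⟶ Om E} :
    Valid (allC p) ↔ ∀ ⦃Δ : E⦄ (σ : Δ ⟶ Γ) (x : Δ ⟶ X), Valid (lift x σ ≫ p) := valid_all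

theorem valid_exC {p : X ⊗ Γ ⟶ Om E} :
    Valid (exC p) ↔ ∃ (Δ : E) (σ : Δ ⟶ Γ) (x : Δ ⟶ X), Epi σ ∧ Valid (lift x σ ≫ p) := valid_ex

theorem Valid.exC_intro {p : X ⊗ Γ ⟶ Om E} (x : Γ ⟶ X) (h : Valid (lift x (𝟙 Γ) ≫ p)) :
    Valid (exC p) := Valid.ex_intro x h

end Logic

/-! ### Singletons and definite description -/

section Description

variable {Γ Δ X Y Z : E}

@[simp] theorem comp_emptyI (σ : Δ ⟶ Γ) : σ ≫ (emptyI : Γ ⟶ Pw X) = emptyI := by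
  unfold emptyI
  simp

@[simp] theorem comp_univI (σ : Δ ⟶ Γ) : σ ≫ (univI : Γ ⟶ Pw X) = univI := by
  unfold univI
  simp

@[simp] theorem comp_singI (σ : Δ ⟶ Γ) (x : Γ ⟶ X) : σ ≫ singI x = singI (σ ≫ x) := by
  unfold singI
  rw [comp_compr]
  exact compr_congr (by simp)

@[simp] theorem comp_interI (σ : Δ ⟶ Γ) (S T : Γ ⟶ Pw X) :
    σ ≫ interI S T = interI (σ ≫ S) (σ ≫ T) := by
  unfold interI
  rw [comp_compr]
  exact compr_congr (by simp)

@[simp] theorem mem_emptyI (x : Γ ⟶ X) : (x ∈ᵢ emptyI) = ff := by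
  simp [emptyI]

@[simp] theorem mem_univI (x : Γ ⟶ X) : (x ∈ᵢ univI) = tt := by
  simp [univI]

@[simp] theorem mem_singI (x y : Γ ⟶ X) : (x ∈ᵢ singI y) = (x =ᵢ y) := by
  simp [singI]

@[simp] theorem mem_interI (x : Γ ⟶ X) (S T : Γ ⟶ Pw X) :
    (x ∈ᵢ interI S T) = (x ∈ᵢ S ∧ᵢ x ∈ᵢ T) := by
  simp [interI]

theorem singI_injective {x y : Γ ⟶ X} (h : singI x = singI y) : x = y := by
  have := congrArg (fun S => x ∈ᵢ S) h
  simp only [mem_singI] at this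
  rw [← valid_eqI, ← this, valid_eqI]

instance singI_id_mono (X : E) : Mono (singI (𝟙 X)) :=
  ⟨fun f g h => singI_injective (by simpa using h)⟩

/-- Definite description: an element which exists locally and is unique exists globally. -/
theorem exists_of_unique {φ : (X ⊗ Γ ⟶ X) → (X ⊗ Γ ⟶ Om E)} (h : Valid (ex X φ))
    (hu : ∀ ⦃Δ : E⦄ (σ : Δ ⟶ Γ) (x y : Δ ⟶ X), Valid (lift x σ ≫ φ (fst X Γ)) →
      Valid (lift y σ ≫ φ (fst X Γ)) → x = y) :
    ∃ x : Γ ⟶ X, Valid (lift x (𝟙 Γ) ≫ φ (fst X Γ)) := by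
  obtain ⟨Δ, σ, x, _, hx⟩ := valid_ex.1 h
  -- The set of all `x` with `φ x` is a singleton on a cover. Being a singleton is the truth of a
  -- characteristic map, since `singI` is mono, so it descends; a factorization through `singI` is
  -- then a global element.
  have h1 : Valid (compr X φ ≫ HasSubobjectClassifier.χ (singI (𝟙 X))) := by
    refine Valid.of_epi σ ?_
    rw [← Category.assoc, valid_comp_χ]
    refine ⟨x, ?_⟩
    rw [comp_singI, Category.comp_id]
    refine set_ext fun Θ τ y => ?_
    simp only [comp_singI, mem_singI, valid_eqI, compr_eq, comp_setC, mem_setC]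
    simp
    have hx' := hx.on τ rfl
    rw [comp_lift_assoc] at hx'
    constructor
    · rintro rfl
      exact hx'
    · exact fun hy => hu _ _ _ hy hx'
  obtain ⟨y, hy⟩ := (valid_comp_χ _ _).1 h1
  refine ⟨y, ?_⟩
  rw [← memI_compr, ← hy]
  simp

end Description

/-! ### Induction and arithmetic of the natural numbers object -/

section Naturals

variable [NaturalNumbersObject E] {Γ Δ X Y Z : E}

@[simp] theorem comp_zeroI (σ : Δ ⟶ Γ) : σ ≫ (zeroI : Γ ⟶ Nn E) = zeroI := by
  simp [zeroI]

@[simp] theorem comp_succI (σ : Δ ⟶ Γ) (n : Γ ⟶ Nn E) : σ ≫ succI n = succI (σ ≫ n) := by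
  simp [succI]

@[simp] theorem comp_addI (σ : Δ ⟶ Γ) (m n : Γ ⟶ Nn E) : σ ≫ (m +ᵢ n) = σ ≫ m +ᵢ σ ≫ n := by
  simp [addI, comp_lift_assoc]

@[simp] theorem comp_mulI (σ : Δ ⟶ Γ) (m n : Γ ⟶ Nn E) : σ ≫ (m *ᵢ n) = (σ ≫ m) *ᵢ (σ ≫ n) := by
  simp [mulI, comp_lift_assoc]

/-- The formula `ψ` says that a number lies in every inductive set. Its extent `A` contains zero and
is closed under successor, so recursion gives a map from `N` to `A`; by uniqueness of recursion it
is a section of the inclusion, and `ψ` holds everywhere. -/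
theorem mem_of_inductive {S : Γ ⟶ Pw (Nn E)} (h0 : Valid (zeroI ∈ᵢ S))
    (hs : ∀ ⦃Δ : E⦄ (σ : Δ ⟶ Γ) (n : Δ ⟶ Nn E), Valid (n ∈ᵢ σ ≫ S) → Valid (succI n ∈ᵢ σ ≫ S))
    (n : Γ ⟶ Nn E) : Valid (n ∈ᵢ S) := by
  let ψ : Nn E ⟶ Om E := all (Pw (Nn E)) fun T =>
    zeroI ∈ᵢ T →ᵢ (all (Nn E) fun k => k ∈ᵢ ↟T →ᵢ succI k ∈ᵢ ↟T) →ᵢ ↟(𝟙 (Nn E)) ∈ᵢ T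
  have key : ∀ {Θ : E} (k : Θ ⟶ Nn E), Valid (k ≫ ψ) ↔
      ∀ ⦃Ξ : E⦄ (σ : Ξ ⟶ Θ) (T : Ξ ⟶ Pw (Nn E)), Valid (zeroI ∈ᵢ T) →
      (∀ ⦃Δ : E⦄ (τ : Δ ⟶ Ξ) (n : Δ ⟶ Nn E), Valid (n ∈ᵢ τ ≫ T) → Valid (succI n ∈ᵢ τ ≫ T)) →
      Valid (σ ≫ k ∈ᵢ T) := by
    intro Θ k
    simp only [ψ, comp_all, valid_all]
    constructor
    · intro h Ξ σ T hT hT'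
      have := h σ T
      simp at this
      refine (this.mp hT).mp (valid_all.2 fun Δ τ n => ?_)
      simp
      refine valid_impI.2 fun Δ' τ' h => ?_
      have := hT' (τ' ≫ τ) (τ' ≫ n)
      simp at this h ⊢
      exact this h
    · intro h Ξ σ T
      simp
      refine valid_impI.2 fun Δ τ h1 => ?_
      simp at h1 ⊢
      refine valid_impI.2 fun Δ' τ' h2 => ?_
      simp at h2 ⊢
      have := h (τ' ≫ τ ≫ σ) (τ' ≫ τ ≫ T) (by simpa using h1.comp τ')
        (fun Δ'' τ'' n hn => by
          have := valid_all.1 h2 τ'' n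
          simp at this hn ⊢
          exact this.mp hn)
      simpa using this
  obtain ⟨A, i, _, hi, hA⟩ := exists_extent ψ
  obtain ⟨z, hz⟩ := hA NaturalNumbersObject.zero ((key _).2 fun Ξ σ T h0 _ => by
    have : σ ≫ (NaturalNumbersObject.zero : 𝟙_ E ⟶ Nn E) = zeroI := by
      unfold zeroI
      congr 1
      exact toUnit_unique _ _
    rwa [this])
  obtain ⟨s, hs'⟩ := hA (i ≫ NaturalNumbersObject.succ) ((key _).2 fun Ξ σ T h0 hs => by
    have h2 := (key i).1 hi σ T h0 hs
    have := hs (𝟙 Ξ) (σ ≫ i) (by simpa using h2)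
    simpa [succI] using this)
  -- Both sides solve the recursion with data `zero` and `succ`.
  have h1 : NaturalNumbersObject.iter z s ≫ i = 𝟙 _ := by
    rw [NaturalNumbersObject.iter_unique NaturalNumbersObject.zero NaturalNumbersObject.succ
      (NaturalNumbersObject.iter z s ≫ i), ← NaturalNumbersObject.iter_unique]
    · simp
    · simp
    · rw [← Category.assoc, NaturalNumbersObject.zero_iter, hz]
    · rw [← Category.assoc, NaturalNumbersObject.succ_iter, Category.assoc, hs', Category.assoc]
  have h2 : Valid (n ≫ ψ) := by
    have := hi.comp (n ≫ NaturalNumbersObject.iter z s)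
    simp only [Category.assoc] at this
    rw [← Category.assoc _ i, h1] at this
    simpa using this
  simpa using (key n).1 h2 (𝟙 Γ) S h0 hs

/-- Induction. -/
theorem nat_induction (φ : (Nn E ⊗ Γ ⟶ Nn E) → (Nn E ⊗ Γ ⟶ Om E))
    (h0 : Valid (lift zeroI (𝟙 Γ) ≫ φ (fst _ Γ)))
    (hs : ∀ ⦃Δ : E⦄ (σ : Δ ⟶ Γ) (n : Δ ⟶ Nn E), Valid (lift n σ ≫ φ (fst _ Γ)) →
      Valid (lift (succI n) σ ≫ φ (fst _ Γ)))
    (n : Γ ⟶ Nn E) : Valid (lift n (𝟙 Γ) ≫ φ (fst _ Γ)) := by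
  have := mem_of_inductive (S := compr _ φ) (by simpa using h0)
    (fun Δ σ n h => by simpa using hs σ n (by simpa using h)) n
  simpa using this

theorem addI_zeroI (m : Γ ⟶ Nn E) : m +ᵢ zeroI = m := by
  have h := NaturalNumbersObject.zero_iter
    (MonoidalClosed.curry (fst (Nn E) (𝟙_ E))) ((ihom (Nn E)).map NaturalNumbersObject.succ)
  have : lift m (zeroI : Γ ⟶ Nn E) = lift m (toUnit Γ) ≫ Nn E ◁ NaturalNumbersObject.zero := by
    simp [zeroI]
  unfold addI addMor
  rw [this, Category.assoc, ← MonoidalClosed.uncurry_natural_left, h,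
    MonoidalClosed.uncurry_curry, lift_fst]

theorem addI_succI (m n : Γ ⟶ Nn E) : m +ᵢ succI n = succI (m +ᵢ n) := by
  have h := NaturalNumbersObject.succ_iter
    (MonoidalClosed.curry (fst (Nn E) (𝟙_ E))) ((ihom (Nn E)).map NaturalNumbersObject.succ)
  have : lift m (succI n : Γ ⟶ Nn E) = lift m n ≫ Nn E ◁ NaturalNumbersObject.succ := by
    simp [succI]
  unfold addI addMor
  rw [this, Category.assoc, ← MonoidalClosed.uncurry_natural_left, h,
    MonoidalClosed.uncurry_natural_right]
  simp [succI]

theorem mulI_zeroI (m : Γ ⟶ Nn E) : m *ᵢ zeroI = zeroI := by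
  have h := NaturalNumbersObject.zero_iter
    (MonoidalClosed.curry (zeroI : Nn E ⊗ 𝟙_ E ⟶ Nn E))
    (MonoidalClosed.curry
      (addI ((ihom.ev (Nn E)).app (Nn E)) (fst (Nn E) (Fn (Nn E) (Nn E)))))
  have : lift m (zeroI : Γ ⟶ Nn E) = lift m (toUnit Γ) ≫ Nn E ◁ NaturalNumbersObject.zero := by
    simp [zeroI]
  unfold mulI mulMor
  rw [this, Category.assoc, ← MonoidalClosed.uncurry_natural_left, h,
    MonoidalClosed.uncurry_curry, comp_zeroI]

theorem mulI_succI (m n : Γ ⟶ Nn E) : m *ᵢ succI n = m *ᵢ n +ᵢ m := by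
  have h := NaturalNumbersObject.succ_iter
    (MonoidalClosed.curry (zeroI : Nn E ⊗ 𝟙_ E ⟶ Nn E))
    (MonoidalClosed.curry
      (addI ((ihom.ev (Nn E)).app (Nn E)) (fst (Nn E) (Fn (Nn E) (Nn E)))))
  have : lift m (succI n : Γ ⟶ Nn E) = lift m n ≫ Nn E ◁ NaturalNumbersObject.succ := by
    simp [succI]
  unfold mulI mulMor
  rw [this, Category.assoc, ← MonoidalClosed.uncurry_natural_left, h,
    MonoidalClosed.uncurry_natural_left, MonoidalClosed.uncurry_curry, comp_addI, comp_addI]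
  rw [MonoidalClosed.uncurry_eq]
  simp

theorem zeroI_addI (m : Γ ⟶ Nn E) : zeroI +ᵢ m = m := by
  have := nat_induction (fun m : Nn E ⊗ Γ ⟶ Nn E => zeroI +ᵢ m =ᵢ m) (by simp [addI_zeroI])
    (fun Δ σ n h => by simp at h; simp [addI_succI, h]) m
  simpa using this

theorem succI_addI (m n : Γ ⟶ Nn E) : succI m +ᵢ n = succI (m +ᵢ n) := by
  have := nat_induction (fun n : Nn E ⊗ Γ ⟶ Nn E => succI ↟m +ᵢ n =ᵢ succI (↟m +ᵢ n))
    (by simp [addI_zeroI]) (fun Δ σ n h => by simp at h; simp [addI_succI, h]) n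
  simpa using this

theorem addI_comm (m n : Γ ⟶ Nn E) : m +ᵢ n = n +ᵢ m := by
  have := nat_induction (fun n : Nn E ⊗ Γ ⟶ Nn E => ↟m +ᵢ n =ᵢ n +ᵢ ↟m)
    (by simp [addI_zeroI, zeroI_addI])
    (fun Δ σ n h => by simp at h; simp [addI_succI, succI_addI, h]) n
  simpa using this

theorem addI_assoc (m n k : Γ ⟶ Nn E) : m +ᵢ n +ᵢ k = m +ᵢ (n +ᵢ k) := by
  have := nat_induction (fun k : Nn E ⊗ Γ ⟶ Nn E => ↟m +ᵢ ↟n +ᵢ k =ᵢ ↟m +ᵢ (↟n +ᵢ k))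
    (by simp [addI_zeroI]) (fun Δ σ n h => by simp at h; simp [addI_succI, h]) k
  simpa using this

theorem zeroI_mulI (m : Γ ⟶ Nn E) : zeroI *ᵢ m = zeroI := by
  have := nat_induction (fun m : Nn E ⊗ Γ ⟶ Nn E => zeroI *ᵢ m =ᵢ zeroI) (by simp [mulI_zeroI])
    (fun Δ σ n h => by simp at h; simp [mulI_succI, h, addI_zeroI]) m
  simpa using this

theorem succI_mulI (m n : Γ ⟶ Nn E) : succI m *ᵢ n = m *ᵢ n +ᵢ n := by
  have := nat_induction (fun n : Nn E ⊗ Γ ⟶ Nn E => succI ↟m *ᵢ n =ᵢ ↟m *ᵢ n +ᵢ n)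
    (by simp [mulI_zeroI, addI_zeroI])
    (fun Δ σ n h => by
      simp at h
      simp only [addI_succI, mulI_succI, h, addI_assoc, addI_comm n, comp_eqI, valid_eqI,
        comp_mulI, comp_addI, comp_succI, wk_step, wk_refl, lift_fst, lift_snd_assoc,
        Category.comp_id]) n
  simpa using this

theorem mulI_comm (m n : Γ ⟶ Nn E) : m *ᵢ n = n *ᵢ m := by
  have := nat_induction (fun n : Nn E ⊗ Γ ⟶ Nn E => ↟m *ᵢ n =ᵢ n *ᵢ ↟m)
    (by simp [mulI_zeroI, zeroI_mulI])
    (fun Δ σ n h => by simp at h; simp [mulI_succI, succI_mulI, h]) n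
  simpa using this

theorem mulI_addI (m n k : Γ ⟶ Nn E) : m *ᵢ (n +ᵢ k) = m *ᵢ n +ᵢ m *ᵢ k := by
  have := nat_induction (fun k : Nn E ⊗ Γ ⟶ Nn E => ↟m *ᵢ (↟n +ᵢ k) =ᵢ ↟m *ᵢ ↟n +ᵢ ↟m *ᵢ k)
    (by simp [mulI_zeroI, addI_zeroI])
    (fun Δ σ n h => by simp at h; simp [mulI_succI, addI_succI, h, addI_assoc]) k
  simpa using this

theorem mulI_assoc (m n k : Γ ⟶ Nn E) : m *ᵢ n *ᵢ k = m *ᵢ (n *ᵢ k) := by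
  have := nat_induction (fun k : Nn E ⊗ Γ ⟶ Nn E => ↟m *ᵢ ↟n *ᵢ k =ᵢ ↟m *ᵢ (↟n *ᵢ k))
    (by simp [mulI_zeroI]) (fun Δ σ n h => by simp at h; simp [mulI_succI, mulI_addI, h]) k
  simpa using this

instance : Zero (Γ ⟶ Nn E) := ⟨zeroI⟩
instance : One (Γ ⟶ Nn E) := ⟨succI zeroI⟩
instance : Add (Γ ⟶ Nn E) := ⟨addI⟩
instance : Mul (Γ ⟶ Nn E) := ⟨mulI⟩

/-- Generalized natural numbers form a commutative semiring. -/
instance natCommSemiring : CommSemiring (Γ ⟶ Nn E) where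
  nsmul := nsmulRec
  add_assoc := addI_assoc
  zero_add := zeroI_addI
  add_zero := addI_zeroI
  add_comm := addI_comm
  left_distrib := mulI_addI
  right_distrib m n k := by
    change (m +ᵢ n) *ᵢ k = m *ᵢ k +ᵢ n *ᵢ k
    rw [mulI_comm, mulI_addI, mulI_comm, mulI_comm k]
  zero_mul := zeroI_mulI
  mul_zero := mulI_zeroI
  mul_assoc := mulI_assoc
  mul_comm := mulI_comm
  one_mul m := by
    change succI zeroI *ᵢ m = m
    rw [succI_mulI, zeroI_mulI, zeroI_addI]
  mul_one m := by
    change m *ᵢ succI zeroI = m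
    rw [mulI_succI, mulI_zeroI, zeroI_addI]

theorem addI_eq (m n : Γ ⟶ Nn E) : m +ᵢ n = m + n := (rfl)

theorem mulI_eq (m n : Γ ⟶ Nn E) : m *ᵢ n = m * n := (rfl)

theorem zeroI_eq : (zeroI : Γ ⟶ Nn E) = 0 := (rfl)

@[simp] theorem comp_zero_nat (σ : Δ ⟶ Γ) : σ ≫ (0 : Γ ⟶ Nn E) = 0 := comp_zeroI σ

@[simp] theorem comp_one_nat (σ : Δ ⟶ Γ) : σ ≫ (1 : Γ ⟶ Nn E) = 1 := by
  change σ ≫ succI zeroI = succI zeroI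
  rw [comp_succI, comp_zeroI]

@[simp] theorem comp_add_nat (σ : Δ ⟶ Γ) (m n : Γ ⟶ Nn E) : σ ≫ (m + n) = σ ≫ m + σ ≫ n :=
  comp_addI σ m n

@[simp] theorem comp_mul_nat (σ : Δ ⟶ Γ) (m n : Γ ⟶ Nn E) : σ ≫ (m * n) = (σ ≫ m) * (σ ≫ n) :=
  comp_mulI σ m n

theorem succI_eq (m : Γ ⟶ Nn E) : succI m = m + 1 := by
  change succI m = m +ᵢ succI zeroI
  rw [addI_succI, addI_zeroI]

/-- Recursion defines a map from `N` to `Ω` with value false at zero and true at successors. If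
`succI n = zeroI`, then false equals true in the context `Γ`. -/
theorem succI_ne_zeroI {n : Γ ⟶ Nn E} (h : succI n = zeroI) : Valid (ff : Γ ⟶ Om E) := by
  let f : Nn E ⟶ Om E := NaturalNumbersObject.iter (ff : 𝟙_ E ⟶ Om E) (tt : Om E ⟶ Om E)
  have h0 : zeroI ≫ f = (ff : Γ ⟶ Om E) := by
    unfold zeroI
    rw [Category.assoc, NaturalNumbersObject.zero_iter, comp_ff]
  have h1 : succI n ≫ f = (tt : Γ ⟶ Om E) := by
    unfold succI
    rw [Category.assoc, NaturalNumbersObject.succ_iter, comp_tt, comp_tt]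
  rw [h, h0] at h1
  exact h1

theorem succI_injective {m n : Γ ⟶ Nn E} (h : succI m = succI n) : m = n := by
  -- The map `g` sends `n` to the pair of `n` and its predecessor, the predecessor of zero being
  -- zero.
  let g : Nn E ⟶ Nn E ⊗ Nn E := NaturalNumbersObject.iter (lift zeroI zeroI)
    (lift (succI (fst _ _)) (fst _ _))
  have hz : (NaturalNumbersObject.zero : 𝟙_ E ⟶ Nn E) = zeroI := by
    unfold zeroI
    rw [toUnit_unit, Category.id_comp]
  have h1 : g ≫ fst _ _ = 𝟙 _ := by
    rw [NaturalNumbersObject.iter_unique NaturalNumbersObject.zero NaturalNumbersObject.succ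
      (g ≫ fst _ _), ← NaturalNumbersObject.iter_unique]
    · simp
    · simp
    · rw [← Category.assoc, NaturalNumbersObject.zero_iter, lift_fst, hz]
    · rw [← Category.assoc, NaturalNumbersObject.succ_iter]
      simp [succI, g]
  have h2 : NaturalNumbersObject.succ ≫ g ≫ snd _ _ = 𝟙 _ := by
    rw [← Category.assoc, NaturalNumbersObject.succ_iter, Category.assoc, lift_snd, h1]
  have h3 := congrArg (fun t => t ≫ g ≫ snd _ _) h
  simpa [succI, h2] using h3

theorem addI_right_cancel {m n k : Γ ⟶ Nn E} (h : m +ᵢ k = n +ᵢ k) : m = n := by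
  have := nat_induction (fun k : Nn E ⊗ Γ ⟶ Nn E => (↟m +ᵢ k =ᵢ ↟n +ᵢ k) →ᵢ ↟m =ᵢ ↟n)
    (by simp [addI_zeroI, valid_impI])
    (fun Δ σ k h => by
      simp [valid_impI] at h
      simp [addI_succI, valid_impI]
      exact fun Θ τ h' => h τ (succI_injective h')) k
  simp at this
  simpa using this.mp (by simpa using h)

instance : IsCancelAdd (Γ ⟶ Nn E) where
  add_left_cancel m n k h := addI_right_cancel (k := m) (by
    change m + n = m + k at h
    change n + m = k + m
    rw [add_comm n, h, add_comm])
  add_right_cancel m n k h := addI_right_cancel h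

attribute [simp] addI_eq mulI_eq zeroI_eq succI_eq

end Naturals

/-! ### Stability of all internal notions under substitution -/

section Naturality

variable [NaturalNumbersObject E] {Γ Δ X Y M P : E} (σ : Δ ⟶ Γ)

@[simp] theorem comp_leI (m n : Γ ⟶ Nn E) :
    σ ≫ leI m n = leI (σ ≫ m) (σ ≫ n) := by
  simp [leI]

@[simp] theorem comp_ltI (m n : Γ ⟶ Nn E) :
    σ ≫ ltI m n = ltI (σ ≫ m) (σ ≫ n) := by
  simp [ltI]

@[simp] theorem comp_IsDecidable (D : Γ ⟶ Pw X) :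
    σ ≫ IsDecidable D = IsDecidable (σ ≫ D) := by
  simp [IsDecidable]

@[simp] theorem comp_IsSd (p : Γ ⟶ Om E) :
    σ ≫ IsSd p = IsSd (σ ≫ p) := by
  simp [IsSd]

@[simp] theorem comp_IsSdSet (S : Γ ⟶ Pw X) :
    σ ≫ IsSdSet S = IsSdSet (σ ≫ S) := by
  simp [IsSdSet]

@[simp] theorem comp_intrinsic :
    σ ≫ (intrinsic X : Γ ⟶ Pw (Pw X)) = intrinsic X := by
  simp [intrinsic]

@[simp] theorem comp_IsOvert (T : Γ ⟶ Pw X) :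
    σ ≫ IsOvert T = IsOvert (σ ≫ T) := by
  simp [IsOvert]

@[simp] theorem comp_OvertSpace :
    σ ≫ (OvertSpace X : Γ ⟶ Om E) = OvertSpace X := by
  simp [OvertSpace]

@[simp] theorem comp_Enumerates (e : Γ ⟶ Fn (Nn E) (Pw X)) (D : Γ ⟶ Pw X) :
    σ ≫ Enumerates e D = Enumerates (σ ≫ e) (σ ≫ D) := by
  simp [Enumerates]

@[simp] theorem comp_IsCountable (D : Γ ⟶ Pw X) :
    σ ≫ IsCountable D = IsCountable (σ ≫ D) := by
  simp [IsCountable]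

@[simp] theorem comp_iUnionI (V : Γ ⟶ Fn (Nn E) (Pw X)) :
    σ ≫ iUnionI V = iUnionI (σ ≫ V) := by
  simp [iUnionI]

@[simp] theorem comp_IsTopology (T : Γ ⟶ Pw (Pw X)) :
    σ ≫ IsTopology T = IsTopology (σ ≫ T) := by
  simp [IsTopology]

@[simp] theorem comp_IsBase (B : Γ ⟶ Fn (Nn E) (Pw X)) (T : Γ ⟶ Pw (Pw X)) :
    σ ≫ IsBase B T = IsBase (σ ≫ B) (σ ≫ T) := by
  simp [IsBase]

@[simp] theorem comp_IsSigmaHom (T : Γ ⟶ Pw (Pw X)) (h : Γ ⟶ Fn (Pw X) (Om E)) :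
    σ ≫ IsSigmaHom T h = IsSigmaHom (σ ≫ T) (σ ≫ h) := by
  simp [IsSigmaHom]

@[simp] theorem comp_IsSober (T : Γ ⟶ Pw (Pw X)) :
    σ ≫ IsSober T = IsSober (σ ≫ T) := by
  simp [IsSober]

@[simp] theorem comp_IsDenseSeq (T : Γ ⟶ Pw (Pw X)) (a : Γ ⟶ Fn (Nn E) X) :
    σ ≫ IsDenseSeq T a = IsDenseSeq (σ ≫ T) (σ ≫ a) := by
  simp [IsDenseSeq]

@[simp] theorem comp_IsDenseSet (T : Γ ⟶ Pw (Pw X)) (D : Γ ⟶ Pw X) :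
    σ ≫ IsDenseSet T D = IsDenseSet (σ ≫ T) (σ ≫ D) := by
  simp [IsDenseSet]

@[simp] theorem comp_IsSeparable (T : Γ ⟶ Pw (Pw X)) :
    σ ≫ IsSeparable T = IsSeparable (σ ≫ T) := by
  simp [IsSeparable]

@[simp] theorem comp_IsCountablyBased (T : Γ ⟶ Pw (Pw X)) :
    σ ≫ IsCountablyBased T = IsCountablyBased (σ ≫ T) := by
  simp [IsCountablyBased]

@[simp] theorem comp_numI (q : Γ ⟶ Frac E) :
    σ ≫ numI q = numI (σ ≫ q) := by
  simp [numI]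

@[simp] theorem comp_denI (q : Γ ⟶ Frac E) :
    σ ≫ denI q = denI (σ ≫ q) := by
  simp [denI]

@[simp] theorem comp_ltFrac (p q : Γ ⟶ Frac E) :
    σ ≫ ltFrac p q = ltFrac (σ ≫ p) (σ ≫ q) := by
  simp [ltFrac]

@[simp] theorem comp_addFrac (p q : Γ ⟶ Frac E) :
    σ ≫ addFrac p q = addFrac (σ ≫ p) (σ ≫ q) := by
  simp [addFrac]

@[simp] theorem comp_zeroFrac :
    σ ≫ (zeroFrac : Γ ⟶ Frac E) = zeroFrac := by
  simp [zeroFrac]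

@[simp] theorem comp_recipFrac (k : Γ ⟶ Nn E) :
    σ ≫ recipFrac k = recipFrac (σ ≫ k) := by
  simp [recipFrac]

@[simp] theorem comp_lowerI (r : Γ ⟶ Cuts E) :
    σ ≫ lowerI r = lowerI (σ ≫ r) := by
  simp [lowerI]

@[simp] theorem comp_upperI (r : Γ ⟶ Cuts E) :
    σ ≫ upperI r = upperI (σ ≫ r) := by
  simp [upperI]

@[simp] theorem comp_IsReal (r : Γ ⟶ Cuts E) :
    σ ≫ IsReal r = IsReal (σ ≫ r) := by
  simp [IsReal]

@[simp] theorem comp_zeroReal :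
    σ ≫ (zeroReal : Γ ⟶ Cuts E) = zeroReal := by
  simp [zeroReal]

@[simp] theorem comp_ltReal (r s : Γ ⟶ Cuts E) :
    σ ≫ ltReal r s = ltReal (σ ≫ r) (σ ≫ s) := by
  simp [ltReal]

@[simp] theorem comp_leSumReal (r s t : Γ ⟶ Cuts E) :
    σ ≫ leSumReal r s t = leSumReal (σ ≫ r) (σ ≫ s) (σ ≫ t) := by
  simp [leSumReal]

@[simp] theorem comp_distI (d : Γ ⟶ Fn (M ⊗ M) (Cuts E)) (x y : Γ ⟶ M) :
    σ ≫ distI d x y = distI (σ ≫ d) (σ ≫ x) (σ ≫ y) := by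
  simp [distI]

@[simp] theorem comp_IsMetric (d : Γ ⟶ Fn (M ⊗ M) (Cuts E)) :
    σ ≫ IsMetric d = IsMetric (σ ≫ d) := by
  simp [IsMetric]

@[simp] theorem comp_IsNear (d : Γ ⟶ Fn (M ⊗ M) (Cuts E)) (k : Γ ⟶ Nn E) (x y : Γ ⟶ M) :
    σ ≫ IsNear d k x y = IsNear (σ ≫ d) (σ ≫ k) (σ ≫ x) (σ ≫ y) := by
  simp [IsNear]

@[simp] theorem comp_IsCompleteMetric (d : Γ ⟶ Fn (M ⊗ M) (Cuts E)) :
    σ ≫ IsCompleteMetric d = IsCompleteMetric (σ ≫ d) := by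
  simp [IsCompleteMetric]

@[simp] theorem comp_IsSeparableMetric (d : Γ ⟶ Fn (M ⊗ M) (Cuts E)) :
    σ ≫ IsSeparableMetric d = IsSeparableMetric (σ ≫ d) := by
  simp [IsSeparableMetric]

@[simp] theorem comp_ballI (d : Γ ⟶ Fn (M ⊗ M) (Cuts E)) (x : Γ ⟶ M) (r : Γ ⟶ Cuts E) :
    σ ≫ ballI d x r = ballI (σ ≫ d) (σ ≫ x) (σ ≫ r) := by
  simp [ballI]

@[simp] theorem comp_metricTopology (d : Γ ⟶ Fn (M ⊗ M) (Cuts E)) :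
    σ ≫ metricTopology d = metricTopology (σ ≫ d) := by
  simp [metricTopology]

@[simp] theorem comp_relI (le : Γ ⟶ Pw (P ⊗ P)) (x y : Γ ⟶ P) :
    σ ≫ relI le x y = relI (σ ≫ le) (σ ≫ x) (σ ≫ y) := by
  simp [relI]

@[simp] theorem comp_IsPartialOrder (le : Γ ⟶ Pw (P ⊗ P)) :
    σ ≫ IsPartialOrder le = IsPartialOrder (σ ≫ le) := by
  simp [IsPartialOrder]

@[simp] theorem comp_IsChain (le : Γ ⟶ Pw (P ⊗ P)) (c : Γ ⟶ Fn (Nn E) P) :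
    σ ≫ IsChain le c = IsChain (σ ≫ le) (σ ≫ c) := by
  simp [IsChain]

@[simp] theorem comp_IsSup (le : Γ ⟶ Pw (P ⊗ P)) (D : Γ ⟶ Pw P) (s : Γ ⟶ P) :
    σ ≫ IsSup le D s = IsSup (σ ≫ le) (σ ≫ D) (σ ≫ s) := by
  simp [IsSup]

@[simp] theorem comp_rangeI (c : Γ ⟶ Fn (Nn E) P) :
    σ ≫ rangeI c = rangeI (σ ≫ c) := by
  simp [rangeI]

@[simp] theorem comp_IsOmegaCpo (le : Γ ⟶ Pw (P ⊗ P)) :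
    σ ≫ IsOmegaCpo le = IsOmegaCpo (σ ≫ le) := by
  simp [IsOmegaCpo]

@[simp] theorem comp_wayBelow (le : Γ ⟶ Pw (P ⊗ P)) (x y : Γ ⟶ P) :
    σ ≫ wayBelow le x y = wayBelow (σ ≫ le) (σ ≫ x) (σ ≫ y) := by
  simp [wayBelow]

@[simp] theorem comp_compacts (le : Γ ⟶ Pw (P ⊗ P)) :
    σ ≫ compacts le = compacts (σ ≫ le) := by
  simp [compacts]

@[simp] theorem comp_compactsBelow (le : Γ ⟶ Pw (P ⊗ P)) (x : Γ ⟶ P) :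
    σ ≫ compactsBelow le x = compactsBelow (σ ≫ le) (σ ≫ x) := by
  simp [compactsBelow]

@[simp] theorem comp_IsDirected (le : Γ ⟶ Pw (P ⊗ P)) (D : Γ ⟶ Pw P) :
    σ ≫ IsDirected le D = IsDirected (σ ≫ le) (σ ≫ D) := by
  simp [IsDirected]

@[simp] theorem comp_IsOmegaAlgebraic (le : Γ ⟶ Pw (P ⊗ P)) :
    σ ≫ IsOmegaAlgebraic le = IsOmegaAlgebraic (σ ≫ le) := by
  simp [IsOmegaAlgebraic]

@[simp] theorem comp_scottTopology (le : Γ ⟶ Pw (P ⊗ P)) :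
    σ ≫ scottTopology le = scottTopology (σ ≫ le) := by
  simp [scottTopology]

end Naturality

/-! ### Iterated binders -/

section Binders

variable {Γ Δ X Y Z : E}

theorem valid_all_imp {p q : X ⊗ Γ ⟶ Om E} : Valid (allC (p →ᵢ q)) ↔
    ∀ ⦃Δ : E⦄ (σ : Δ ⟶ Γ) (x : Δ ⟶ X), Valid (lift x σ ≫ p) → Valid (lift x σ ≫ q) := by
  rw [valid_allC]
  constructor
  · intro h Δ σ x hp
    have := h σ x
    rw [comp_impI] at this
    exact this.mp hp
  · intro h Δ σ x
    rw [comp_impI, valid_impI]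
    intro Θ τ hp
    simpa using h (τ ≫ σ) (τ ≫ x) (by simpa using hp)

theorem valid_imp_imp {p q r : Γ ⟶ Om E} : Valid (p →ᵢ q →ᵢ r) ↔
    ∀ ⦃Δ : E⦄ (σ : Δ ⟶ Γ), Valid (σ ≫ p) → Valid (σ ≫ q) → Valid (σ ≫ r) := by
  rw [valid_impI]
  constructor
  · intro h Δ σ hp hq
    have := h σ hp
    rw [comp_impI] at this
    exact this.mp hq
  · intro h Δ σ hp
    rw [comp_impI, valid_impI]
    intro Θ τ hq
    simpa using h (τ ≫ σ) (by simpa using hp.comp τ) (by simpa using hq)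

theorem valid_all_imp_imp {p q r : X ⊗ Γ ⟶ Om E} : Valid (allC (p →ᵢ q →ᵢ r)) ↔
    ∀ ⦃Δ : E⦄ (σ : Δ ⟶ Γ) (x : Δ ⟶ X), Valid (lift x σ ≫ p) → Valid (lift x σ ≫ q) →
      Valid (lift x σ ≫ r) := by
  rw [valid_all_imp]
  constructor
  · intro h Δ σ x hp hq
    have := h σ x hp
    rw [comp_impI] at this
    exact this.mp hq
  · intro h Δ σ x hp
    rw [comp_impI, valid_impI]
    intro Θ τ hq
    simpa using h (τ ≫ σ) (τ ≫ x) (by simpa using hp.comp τ) (by simpa using hq)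

theorem valid_all_all {p : Y ⊗ X ⊗ Γ ⟶ Om E} : Valid (allC (allC p)) ↔
    ∀ ⦃Δ : E⦄ (σ : Δ ⟶ Γ) (x : Δ ⟶ X) (y : Δ ⟶ Y), Valid (lift y (lift x σ) ≫ p) := by
  rw [valid_allC]
  constructor
  · intro h Δ σ x y
    have := h σ x
    rw [comp_allC] at this
    simpa using valid_allC.1 this (𝟙 Δ) y
  · intro h Δ σ x
    rw [comp_allC, valid_allC]
    intro Θ τ y
    simpa using h (τ ≫ σ) (τ ≫ x) y

theorem valid_all_all_imp {p q : Y ⊗ X ⊗ Γ ⟶ Om E} : Valid (allC (allC (p →ᵢ q))) ↔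
    ∀ ⦃Δ : E⦄ (σ : Δ ⟶ Γ) (x : Δ ⟶ X) (y : Δ ⟶ Y), Valid (lift y (lift x σ) ≫ p) →
      Valid (lift y (lift x σ) ≫ q) := by
  rw [valid_all_all]
  constructor
  · intro h Δ σ x y hp
    have := h σ x y
    rw [comp_impI] at this
    exact this.mp hp
  · intro h Δ σ x y
    rw [comp_impI, valid_impI]
    intro Θ τ hp
    simpa using h (τ ≫ σ) (τ ≫ x) (τ ≫ y) (by simpa using hp)

theorem valid_all_all_imp_imp {p q r : Y ⊗ X ⊗ Γ ⟶ Om E} :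
    Valid (allC (allC (p →ᵢ q →ᵢ r))) ↔
    ∀ ⦃Δ : E⦄ (σ : Δ ⟶ Γ) (x : Δ ⟶ X) (y : Δ ⟶ Y), Valid (lift y (lift x σ) ≫ p) →
      Valid (lift y (lift x σ) ≫ q) → Valid (lift y (lift x σ) ≫ r) := by
  rw [valid_all_all_imp]
  constructor
  · intro h Δ σ x y hp hq
    have := h σ x y hp
    rw [comp_impI] at this
    exact this.mp hq
  · intro h Δ σ x y hp
    rw [comp_impI, valid_impI]
    intro Θ τ hq
    simpa using h (τ ≫ σ) (τ ≫ x) (τ ≫ y) (by simpa using hp.comp τ) (by simpa using hq)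

theorem valid_all_not {p : X ⊗ Γ ⟶ Om E} : Valid (allC (¬ᵢ p)) ↔
    ∀ ⦃Δ : E⦄ (σ : Δ ⟶ Γ) (x : Δ ⟶ X), Valid (lift x σ ≫ p) → Valid (ff : Δ ⟶ Om E) := by
  unfold notI
  rw [valid_all_imp]
  simp

theorem Valid.not_elim {p : Γ ⟶ Om E} (h : Valid (¬ᵢ p)) (hp : Valid p) :
    Valid (ff : Γ ⟶ Om E) := h.mp hp

/-- A truth value implied by both a statement and its negation is not false. -/
theorem valid_not_not_of_cases {p q : Γ ⟶ Om E}
    (h₁ : ∀ ⦃Δ : E⦄ (σ : Δ ⟶ Γ), Valid (σ ≫ q) → Valid (σ ≫ p))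
    (h₂ : ∀ ⦃Δ : E⦄ (σ : Δ ⟶ Γ), Valid (¬ᵢ (σ ≫ q)) → Valid (σ ≫ p)) : Valid (¬ᵢ ¬ᵢ p) := by
  rw [valid_notI]
  intro Δ σ hn
  simp only [comp_notI] at hn
  refine hn.not_elim (h₂ σ (valid_notI.2 fun Θ τ hq => ?_))
  have := hn.on τ
  exact this.not_elim (by simpa using h₁ (τ ≫ σ) (by simpa using hq))

theorem Valid.not_not {p : Γ ⟶ Om E} (h : Valid p) : Valid (¬ᵢ ¬ᵢ p) :=
  valid_notI.2 fun _ σ hn => by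
    simp only [comp_notI] at hn
    exact hn.not_elim (h.comp σ)

theorem Valid.not_not_bind {p q : Γ ⟶ Om E} (h : Valid (¬ᵢ ¬ᵢ p))
    (hpq : ∀ ⦃Δ : E⦄ (σ : Δ ⟶ Γ), Valid (σ ≫ p) → Valid (¬ᵢ ¬ᵢ (σ ≫ q))) :
    Valid (¬ᵢ ¬ᵢ q) := by
  refine valid_notI.2 fun Δ σ hn => ?_
  simp only [comp_notI] at hn
  have h' := h.on σ (q := ¬ᵢ ¬ᵢ (σ ≫ p))
  refine h'.not_elim (valid_notI.2 fun Θ τ hp => ?_)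
  have h1 := hpq (τ ≫ σ) (by simpa using hp)
  exact h1.not_elim (hn.on τ)

end Binders

/-! ### Order on the natural numbers -/

section Order

variable [NaturalNumbersObject E] {Γ Δ X Y Z : E}

/-- The difference `k` is unique by cancellation, so definite description makes it global. Unpacking
an inequality therefore never requires a further cover. -/
theorem valid_leI {m n : Γ ⟶ Nn E} : Valid (leI m n) ↔ ∃ k, m + k = n := by
  constructor
  · intro h
    obtain ⟨k, hk⟩ := exists_of_unique h (by
      intro Δ σ x y hx hy
      simp at hx hy
      rw [← hy] at hx
      exact add_left_cancel (a := σ ≫ m) hx)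
    simp at hk
    exact ⟨k, hk⟩
  · rintro ⟨k, rfl⟩
    refine Valid.ex_intro k ?_
    simp

theorem valid_ltI {m n : Γ ⟶ Nn E} : Valid (ltI m n) ↔ ∃ k, m + k + 1 = n := by
  unfold ltI
  rw [valid_leI]
  simp only [succI_eq, add_right_comm]

theorem nat_cases (n : Γ ⟶ Nn E) :
    Valid ((n =ᵢ zeroI) ∨ᵢ ex (Nn E) fun k => ↟n =ᵢ succI k) := by
  have := nat_induction
    (fun n : Nn E ⊗ Γ ⟶ Nn E => (n =ᵢ zeroI) ∨ᵢ ex (Nn E) fun k => ↟n =ᵢ succI k)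
    (by
      simp
      exact Valid.inl (by simp) _)
    (fun Δ σ n _ => by
      simp
      exact Valid.inr (Valid.ex_intro n (by simp)) _) n
  simpa using this

theorem nat_cases_elim (n : Γ ⟶ Nn E) {r : Γ ⟶ Om E}
    (h0 : ∀ ⦃Δ : E⦄ (σ : Δ ⟶ Γ), σ ≫ n = 0 → Valid (σ ≫ r))
    (hs : ∀ ⦃Δ : E⦄ (σ : Δ ⟶ Γ) (k : Δ ⟶ Nn E), σ ≫ n = k + 1 → Valid (σ ≫ r)) : Valid r := by
  refine (nat_cases n).or_elim (fun Δ σ h => h0 σ (by simpa using h)) (fun Δ σ h => ?_)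
  simp at h
  obtain ⟨Θ, τ, k, _, hk⟩ := valid_exC.1 h
  simp at hk
  refine Valid.of_epi τ ?_
  simpa using hs (τ ≫ σ) k (by simpa [succI_eq] using hk)

theorem le_or_lt (m n : Γ ⟶ Nn E) : Valid (leI m n ∨ᵢ ltI n m) := by
  have := nat_induction (fun n : Nn E ⊗ Γ ⟶ Nn E => leI ↟m n ∨ᵢ ltI n ↟m)
    (by
      simp
      refine nat_cases_elim m (fun Δ σ h => ?_) (fun Δ σ k h => ?_)
      · simp
        exact Valid.inl (valid_leI.2 ⟨0, by rw [h, add_zero]⟩) _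
      · simp
        exact Valid.inr (valid_ltI.2 ⟨k, by rw [h, zero_add]⟩) _)
    (fun Δ σ n h => by
      simp at h ⊢
      refine h.or_elim (fun Θ τ h => ?_) (fun Θ τ h => ?_)
      · simp at h ⊢
        obtain ⟨k, hk⟩ := valid_leI.1 h
        exact Valid.inl (valid_leI.2 ⟨k + 1, by rw [← hk, add_assoc]⟩) _
      · simp at h ⊢
        obtain ⟨k, hk⟩ := valid_ltI.1 h
        refine nat_cases_elim k (fun Ξ ρ h => ?_) (fun Ξ ρ j h => ?_)
        · simp
          refine Valid.inl (valid_leI.2 ⟨0, ?_⟩) _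
          rw [← hk]
          simp [h]
        · simp
          refine Valid.inr (valid_ltI.2 ⟨j, ?_⟩) _
          rw [← hk]
          simp [h]
          ring) n
  simpa using this

theorem not_add_succ_eq {n k : Γ ⟶ Nn E} (h : n + k + 1 = n) : Valid (ff : Γ ⟶ Om E) := by
  refine succI_ne_zeroI (n := k) (add_left_cancel (a := n) ?_)
  rw [succI_eq, ← add_assoc, h, zeroI_eq, add_zero]

theorem ltI_irrefl {n : Γ ⟶ Nn E} (h : Valid (ltI n n)) : Valid (ff : Γ ⟶ Om E) := by
  obtain ⟨k, hk⟩ := valid_ltI.1 h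
  exact not_add_succ_eq hk

theorem ltI_of_leI_of_ltI {m n k : Γ ⟶ Nn E} (h : Valid (leI m n)) (h' : Valid (ltI n k)) :
    Valid (ltI m k) := by
  obtain ⟨i, rfl⟩ := valid_leI.1 h
  obtain ⟨j, rfl⟩ := valid_ltI.1 h'
  exact valid_ltI.2 ⟨i + j, by ring⟩

theorem ltI_of_ltI_of_leI {m n k : Γ ⟶ Nn E} (h : Valid (ltI m n)) (h' : Valid (leI n k)) :
    Valid (ltI m k) := by
  obtain ⟨i, rfl⟩ := valid_ltI.1 h
  obtain ⟨j, rfl⟩ := valid_leI.1 h'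
  exact valid_ltI.2 ⟨i + j, by ring⟩

theorem le_antisymm_nat {m n : Γ ⟶ Nn E} (h : Valid (leI m n)) (h' : Valid (leI n m)) :
    m = n := by
  rw [← valid_eqI]
  obtain ⟨i, rfl⟩ := valid_leI.1 h
  refine nat_cases_elim i (fun Δ σ h => ?_) (fun Δ σ k h => ?_)
  · simp [h]
  · refine Valid.ff_elim (ltI_irrefl (n := σ ≫ m) (ltI_of_ltI_of_leI ?_ (h'.on σ))) _
    exact valid_ltI.2 ⟨k, by simp [h, add_assoc]⟩

theorem nat_dec_lt (m n : Γ ⟶ Nn E) : Valid (ltI m n ∨ᵢ ¬ᵢ (ltI m n)) := by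
  refine (le_or_lt n m).or_elim (fun Δ σ h => ?_) (fun Δ σ h => ?_)
  · simp at h ⊢
    refine Valid.inr (valid_notI.2 fun Θ τ h' => ?_) _
    simp at h'
    exact ltI_irrefl (ltI_of_leI_of_ltI (h.on τ) h')
  · simp at h ⊢
    exact Valid.inl h _

theorem nat_dec_eq (m n : Γ ⟶ Nn E) : Valid ((m =ᵢ n) ∨ᵢ ¬ᵢ (m =ᵢ n)) := by
  refine (le_or_lt m n).or_elim (fun Δ σ h => ?_) (fun Δ σ h => ?_)
  · simp at h ⊢
    refine (le_or_lt (σ ≫ n) (σ ≫ m)).or_elim (fun Θ τ h' => ?_) (fun Θ τ h' => ?_)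
    · simp at h' ⊢
      exact Valid.inl (valid_eqI.2 (le_antisymm_nat (h.on τ) h')) _
    · simp at h' ⊢
      refine Valid.inr (valid_notI.2 fun Ξ ρ e => ?_) _
      simp at e
      have := h'.on ρ
      rw [e] at this
      exact ltI_irrefl this
  · simp at h ⊢
    refine Valid.inr (valid_notI.2 fun Θ τ e => ?_) _
    simp at e
    have := h.on τ
    rw [e] at this
    exact ltI_irrefl this

end Order

variable [NaturalNumbersObject E]

/-! ### Choice -/

section Choice

variable {Γ Δ X Y Z : E}

/-- The axiom holds over the terminal object and is pulled back to `Γ`. Since the sequence is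
asserted internally to exist, it appears only after a cover `σ`. -/
theorem dependent_choice (hE : SyntheticComputability E) (R : Γ ⟶ Pw (X ⊗ X))
    (hR : ∀ ⦃Δ : E⦄ (σ : Δ ⟶ Γ) (x : Δ ⟶ X),
      ∃ (Θ : E) (τ : Θ ⟶ Δ) (y : Θ ⟶ X), Epi τ ∧ Valid (lift (τ ≫ x) y ∈ᵢ τ ≫ σ ≫ R))
    (x₀ : Γ ⟶ X) :
    ∃ (Δ : E) (σ : Δ ⟶ Γ) (f : Δ ⟶ Fn (Nn E) X), Epi σ ∧ app f 0 = σ ≫ x₀ ∧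
      ∀ ⦃Θ : E⦄ (τ : Θ ⟶ Δ) (n : Θ ⟶ Nn E),
        Valid (lift (app (τ ≫ f) n) (app (τ ≫ f) (n + 1)) ∈ᵢ τ ≫ σ ≫ R) := by
  have h := hE.dependentChoice X
  unfold DependentChoice at h
  simp at h
  have h1 := valid_allC.1 h (toUnit Γ) R
  simp at h1
  have h2 := h1.mp (valid_allC.2 fun Δ σ x => by simpa [valid_exC] using hR σ x)
  have h3 := valid_allC.1 h2 (𝟙 Γ) x₀
  simp at h3
  obtain ⟨Δ, σ, f, hσ, hf⟩ := valid_exC.1 h3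
  simp [valid_allC] at hf
  exact ⟨Δ, σ, f, hσ, hf.1, hf.2⟩

/-- Dependent choice is applied to pairs consisting of a counter and an element: a pair with counter
`n` is followed by one with counter `n + 1` that satisfies `R`. The sequence starts at a pair `(0,
x₀)` with `R 0 x₀`. -/
theorem countable_choice (hE : SyntheticComputability E) (R : Γ ⟶ Pw (Nn E ⊗ X))
    (hR : ∀ ⦃Δ : E⦄ (σ : Δ ⟶ Γ) (n : Δ ⟶ Nn E),
      ∃ (Θ : E) (τ : Θ ⟶ Δ) (x : Θ ⟶ X), Epi τ ∧ Valid (lift (τ ≫ n) x ∈ᵢ τ ≫ σ ≫ R)) :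
    ∃ (Δ : E) (σ : Δ ⟶ Γ) (f : Δ ⟶ Fn (Nn E) X), Epi σ ∧
      ∀ ⦃Θ : E⦄ (τ : Θ ⟶ Δ) (n : Θ ⟶ Nn E),
        Valid (lift n (app (τ ≫ f) n) ∈ᵢ τ ≫ σ ≫ R) := by
  obtain ⟨Δ₀, σ₀, x₀, hσ₀, hx₀⟩ := hR (𝟙 Γ) 0
  simp at hx₀
  let S : Δ₀ ⟶ Pw ((Nn E ⊗ X) ⊗ (Nn E ⊗ X)) := compr _ fun z =>
    (z ≫ snd _ _ ≫ fst _ _ =ᵢ z ≫ fst _ _ ≫ fst _ _ + 1) ∧ᵢ z ≫ snd _ _ ∈ᵢ ↟(σ₀ ≫ R)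
  obtain ⟨Δ, σ, f, hσ, hf0, hf⟩ := dependent_choice hE S (fun Δ σ y => by
    obtain ⟨Θ, τ, x, hτ, hx⟩ := hR (σ ≫ σ₀) (y ≫ fst _ _ + 1)
    simp at hx
    refine ⟨Θ, τ, lift (τ ≫ (y ≫ fst _ _ + 1)) x, hτ, ?_⟩
    simpa [S] using hx) (lift 0 x₀)
  simp [S] at hf hf0
  -- By induction the counter at time `n` equals `n`, so the second component is a choice for `n`.
  have key : ∀ ⦃Θ : E⦄ (τ : Θ ⟶ Δ) (n : Θ ⟶ Nn E), app (τ ≫ f) n ≫ fst _ _ = n ∧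
      Valid (app (τ ≫ f) n ∈ᵢ τ ≫ σ ≫ σ₀ ≫ R) := by
    intro Θ τ n
    have := nat_induction (fun n : Nn E ⊗ Θ ⟶ Nn E =>
      (app (↟(τ ≫ f)) n ≫ fst _ _ =ᵢ n) ∧ᵢ app (↟(τ ≫ f)) n ∈ᵢ ↟(τ ≫ σ ≫ σ₀ ≫ R))
      (by
        have := congrArg (fun t => τ ≫ t) hf0
        simp at this
        simp [this]
        simpa using hx₀.comp (τ ≫ σ))
      (fun Ξ ρ n h => by
        simp at h ⊢
        have := hf (ρ ≫ τ) n
        simp at this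
        rw [this.1, h.1]
        exact ⟨rfl, this.2⟩) n
    simpa using this
  refine ⟨Δ, σ ≫ σ₀, lam _ fun n => app ↟f n ≫ snd _ _, inferInstance, fun Θ τ n => ?_⟩
  obtain ⟨h1, h2⟩ := key τ n
  have : lift n (app (τ ≫ f) n ≫ snd _ _) = app (τ ≫ f) n := by
    ext
    · simp [h1]
    · simp
  simpa [this] using h2

end Choice

/-! ### Pairs of natural numbers -/

section Pairing

variable {Γ Δ X Y Z : E}

/-- The range of a sequence, as a subset. -/
theorem valid_mem_rangeI {f : Γ ⟶ Fn (Nn E) X} {x : Γ ⟶ X} : Valid (x ∈ᵢ rangeI f) ↔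
    ∃ (Δ : E) (σ : Δ ⟶ Γ) (n : Δ ⟶ Nn E), Epi σ ∧ σ ≫ x = app (σ ≫ f) n := by
  simp [rangeI, valid_exC]

/-- Only a surjection from `N` onto `N × N` is needed, so it suffices to walk through the
antidiagonals: `(a + 1, b)` is followed by `(a, b + 1)`, and `(0, b)` by `(b + 1, 0)`. Dependent
choice provides the walk. -/
theorem exists_pairing (hE : SyntheticComputability E) (Γ : E) :
    ∃ (Δ : E) (σ : Δ ⟶ Γ) (g : Δ ⟶ Fn (Nn E) (Nn E ⊗ Nn E)), Epi σ ∧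
      ∀ ⦃Θ : E⦄ (τ : Θ ⟶ Δ) (z : Θ ⟶ Nn E ⊗ Nn E), Valid (z ∈ᵢ rangeI (τ ≫ g)) := by
  let R : Γ ⟶ Pw ((Nn E ⊗ Nn E) ⊗ (Nn E ⊗ Nn E)) := compr _ fun z =>
    ((z ≫ fst _ _ ≫ fst _ _ =ᵢ 0) ∧ᵢ z ≫ snd _ _ =ᵢ lift (z ≫ fst _ _ ≫ snd _ _ + 1) 0) ∨ᵢ
    ex (Nn E) fun c => (↟(z ≫ fst _ _ ≫ fst _ _) =ᵢ c + 1) ∧ᵢ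
      ↟(z ≫ snd _ _) =ᵢ lift c (↟(z ≫ fst _ _ ≫ snd _ _) + 1)
  obtain ⟨Δ, σ, f, hσ, hf0, hf⟩ := dependent_choice hE R (fun Δ σ z => by
    obtain ⟨a, b, rfl⟩ : ∃ a b, z = lift a b := ⟨z ≫ fst _ _, z ≫ snd _ _, by simp⟩
    have next : ∃ (Θ : E) (τ : Θ ⟶ Δ) (y : Θ ⟶ Nn E ⊗ Nn E), Epi τ ∧
        Valid (lift (τ ≫ lift a b) y ∈ᵢ τ ≫ σ ≫ R) := by
      have : Valid (Γ := Δ) (ex (Nn E ⊗ Nn E) fun y => lift (lift ↟a ↟b) y ∈ᵢ ↟(σ ≫ R)) := by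
        simp [R]
        refine nat_cases_elim a (fun Θ τ h => ?_) (fun Θ τ c h => ?_)
        · simp
          refine Valid.exC_intro (lift (τ ≫ b + 1) 0) ?_
          simp
          exact Valid.inl (by simp [h]) _
        · simp
          refine Valid.exC_intro (lift c (τ ≫ b + 1)) ?_
          simp
          refine Valid.inr (Valid.exC_intro c ?_) _
          simp [h]
      simpa [valid_exC] using this
    exact next) (lift 0 0)
  have next0 : ∀ {Θ : E} (ρ : Θ ⟶ Δ) (b : Θ ⟶ Nn E), Valid (lift 0 b ∈ᵢ rangeI (ρ ≫ f)) →
      Valid (lift (b + 1) 0 ∈ᵢ rangeI (ρ ≫ f)) := by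
    intro Θ ρ b h
    obtain ⟨Ξ, τ, n, _, hn⟩ := valid_mem_rangeI.1 h
    have h1 := hf (τ ≫ ρ) n
    simp at hn
    simp [R, ← hn] at h1
    refine Valid.of_epi τ ?_
    simp only [comp_memI, comp_rangeI]
    rw [valid_mem_rangeI]
    refine ⟨_, 𝟙 _, n + 1, inferInstance, ?_⟩
    simp
    rw [← valid_eqI]
    refine h1.or_elim (fun Λ κ h => ?_) (fun Λ κ h => ?_)
    · simp at h ⊢
      exact h.symm
    · simp at h
      obtain ⟨Λ', κ', c, _, hc⟩ := valid_exC.1 h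
      simp at hc
      exact Valid.of_epi κ' ((succI_ne_zeroI (n := c) (by simp [hc.1])).ff_elim _)
  have nextS : ∀ {Θ : E} (ρ : Θ ⟶ Δ) (a b : Θ ⟶ Nn E),
      Valid (lift (a + 1) b ∈ᵢ rangeI (ρ ≫ f)) → Valid (lift a (b + 1) ∈ᵢ rangeI (ρ ≫ f)) := by
    intro Θ ρ a b h
    obtain ⟨Ξ, τ, n, _, hn⟩ := valid_mem_rangeI.1 h
    have h1 := hf (τ ≫ ρ) n
    simp at hn
    simp [R, ← hn] at h1
    refine Valid.of_epi τ ?_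
    simp only [comp_memI, comp_rangeI]
    rw [valid_mem_rangeI]
    refine ⟨_, 𝟙 _, n + 1, inferInstance, ?_⟩
    simp
    rw [← valid_eqI]
    refine h1.or_elim (fun Λ κ h => ?_) (fun Λ κ h => ?_)
    · simp at h
      exact (succI_ne_zeroI (n := κ ≫ τ ≫ a) (by simp [h.1])).ff_elim _
    · simp at h
      obtain ⟨Λ', κ', c, _, hc⟩ := valid_exC.1 h
      simp at hc
      refine Valid.of_epi κ' ?_
      simp [hc.2, hc.1]
  -- Once the walk reaches the start `(s, 0)` of an antidiagonal, induction on `b` shows that it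
  -- meets every `(a, b)` with `a + b = s`.
  have diag : ∀ {Θ : E} (ρ : Θ ⟶ Δ) (s : Θ ⟶ Nn E), Valid (lift s 0 ∈ᵢ rangeI (ρ ≫ f)) →
      ∀ (b a : Θ ⟶ Nn E), a + b = s → Valid (lift a b ∈ᵢ rangeI (ρ ≫ f)) := by
    intro Θ ρ s hs b a hab
    have := nat_induction (fun b : Nn E ⊗ Θ ⟶ Nn E => all (Nn E) fun a =>
      (a + ↟b =ᵢ ↟s) →ᵢ lift a ↟b ∈ᵢ rangeI ↟(ρ ≫ f))
      (by
        simp [valid_all_imp]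
        exact fun Ξ τ => by simpa using hs.comp τ)
      (fun Ξ τ b h => by
        simp [valid_all_imp] at h ⊢
        intro Λ κ x hx
        have h1 := h κ (x + 1) (by rw [← hx]; ring)
        have := nextS (κ ≫ τ ≫ ρ) x (κ ≫ b) (by simpa using h1)
        simpa using this) b
    simp [valid_all_imp] at this
    simpa using this (𝟙 _) a (by simpa using hab)
  have row : ∀ {Θ : E} (ρ : Θ ⟶ Δ) (s : Θ ⟶ Nn E), Valid (lift s 0 ∈ᵢ rangeI (ρ ≫ f)) := by
    intro Θ ρ s
    have := nat_induction (fun s : Nn E ⊗ Θ ⟶ Nn E => lift s 0 ∈ᵢ rangeI ↟(ρ ≫ f))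
      (by
        simp
        rw [valid_mem_rangeI]
        refine ⟨_, 𝟙 _, 0, inferInstance, ?_⟩
        have := congrArg (fun t => ρ ≫ t) hf0
        simp at this
        simp [this])
      (fun Ξ τ s h => by
        simp at h ⊢
        have := next0 (τ ≫ ρ) s (diag (τ ≫ ρ) s (by simpa using h) s 0 (zero_add _))
        simpa using this) s
    simpa using this
  refine ⟨Δ, σ, f, hσ, fun Θ τ z => ?_⟩
  have := diag τ (z ≫ fst _ _ + z ≫ snd _ _) (row τ _) (z ≫ snd _ _) (z ≫ fst _ _) rfl
  simpa using this

end Pairing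

/-! ### Semidecidable truth values -/

section Semidecidable

variable {Γ Δ X Y Z : E}

theorem dec_and {p q : Γ ⟶ Om E} (hp : Valid (p ∨ᵢ ¬ᵢ p)) (hq : Valid (q ∨ᵢ ¬ᵢ q)) :
    Valid ((p ∧ᵢ q) ∨ᵢ ¬ᵢ (p ∧ᵢ q)) := by
  refine hp.or_elim (fun Δ σ hp => ?_) (fun Δ σ hp => ?_)
  · refine (hq.on σ).or_elim (fun Θ τ hq => ?_) (fun Θ τ hq => ?_)
    · simp at hq ⊢
      exact Valid.inl (valid_andI.2 ⟨hp.on τ, hq⟩) _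
    · simp at hq ⊢
      refine Valid.inr (valid_notI.2 fun Ξ ρ h => ?_) _
      simp at h
      exact (hq.on ρ).not_elim h.2
  · simp at hp ⊢
    refine Valid.inr (valid_notI.2 fun Ξ ρ h => ?_) _
    simp at h
    exact (hp.on ρ).not_elim h.1

theorem dec_or {p q : Γ ⟶ Om E} (hp : Valid (p ∨ᵢ ¬ᵢ p)) (hq : Valid (q ∨ᵢ ¬ᵢ q)) :
    Valid ((p ∨ᵢ q) ∨ᵢ ¬ᵢ (p ∨ᵢ q)) := by
  refine hp.or_elim (fun Δ σ hp => ?_) (fun Δ σ hp => ?_)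
  · simp
    exact Valid.inl (Valid.inl hp _) _
  · refine (hq.on σ).or_elim (fun Θ τ hq => ?_) (fun Θ τ hq => ?_)
    · simp at hq ⊢
      exact Valid.inl (Valid.inr hq _) _
    · simp at hp hq ⊢
      refine Valid.inr (valid_notI.2 fun Ξ ρ h => ?_) _
      simp at h
      exact h.or_elim (fun Λ κ h => by simpa using (hp.on (κ ≫ ρ ≫ τ)).not_elim (by simpa using h))
        (fun Λ κ h => by simpa using (hq.on (κ ≫ ρ)).not_elim (by simpa using h))

theorem valid_isDecidable {D : Γ ⟶ Pw X} : Valid (IsDecidable D) ↔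
    ∀ ⦃Δ : E⦄ (σ : Δ ⟶ Γ) (x : Δ ⟶ X), Valid ((x ∈ᵢ σ ≫ D) ∨ᵢ ¬ᵢ (x ∈ᵢ σ ≫ D)) := by
  simp [IsDecidable, valid_allC]

theorem Valid.dec {D : Γ ⟶ Pw X} (h : Valid (IsDecidable D)) (x : Γ ⟶ X) :
    Valid ((x ∈ᵢ D) ∨ᵢ ¬ᵢ (x ∈ᵢ D)) := by
  simpa using valid_isDecidable.1 h (𝟙 Γ) x

theorem valid_isSd {p : Γ ⟶ Om E} : Valid (IsSd p) ↔
    ∃ (Δ : E) (σ : Δ ⟶ Γ) (D : Δ ⟶ Pw (Nn E)), Epi σ ∧ Valid (IsDecidable D) ∧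
      σ ≫ p = ex (Nn E) fun n => n ∈ᵢ ↟D := by
  simp [IsSd, valid_exC]

theorem valid_isSdSet {S : Γ ⟶ Pw X} : Valid (IsSdSet S) ↔
    ∀ ⦃Δ : E⦄ (σ : Δ ⟶ Γ) (x : Δ ⟶ X), Valid (IsSd (x ∈ᵢ σ ≫ S)) := by
  simp [IsSdSet, valid_allC]

theorem Valid.sd {S : Γ ⟶ Pw X} (h : Valid (IsSdSet S)) (x : Γ ⟶ X) :
    Valid (IsSd (x ∈ᵢ S)) := by
  simpa using valid_isSdSet.1 h (𝟙 Γ) x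

theorem isSd_ex_decidable {D : Γ ⟶ Pw (Nn E)} (hD : Valid (IsDecidable D)) :
    Valid (IsSd (ex (Γ := Γ) (Nn E) fun n => n ∈ᵢ ↟D)) :=
  valid_isSd.2 ⟨Γ, 𝟙 Γ, D, inferInstance, hD, by simp⟩

theorem isSd_of_dec {p : Γ ⟶ Om E} (h : Valid (p ∨ᵢ ¬ᵢ p)) : Valid (IsSd p) := by
  have hD : Valid (IsDecidable (compr (Nn E) fun _ => ↟p : Γ ⟶ _)) :=
    valid_isDecidable.2 fun Δ σ x => by simpa using h.comp σ
  have e : p = ex (Γ := Γ) (Nn E) fun n => n ∈ᵢ ↟(compr (Nn E) fun _ => ↟p : Γ ⟶ _) := by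
    refine omega_ext fun Δ σ => ?_
    simp
    constructor
    · intro h
      exact Valid.exC_intro 0 (by simpa using h)
    · intro h
      obtain ⟨Θ, τ, _, _, h⟩ := valid_exC.1 h
      exact Valid.of_epi τ (by simpa using h)
  rw [e]
  exact isSd_ex_decidable hD

theorem isSd_ff : Valid (IsSd (ff : Γ ⟶ Om E)) :=
  isSd_of_dec (Valid.inr (valid_notI.2 fun _ _ h => by simpa using h) _)

/-- A semidecidable subset of the natural numbers is the image of a decidable subset. -/
theorem exists_decidable_preimage (hE : SyntheticComputability E) {S : Γ ⟶ Pw (Nn E)}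
    (hS : Valid (IsSdSet S)) :
    ∃ (Δ : E) (σ : Δ ⟶ Γ) (D : Δ ⟶ Pw (Nn E)) (h : Δ ⟶ Fn (Nn E) (Nn E)), Epi σ ∧
      Valid (IsDecidable D) ∧
      (∀ ⦃Θ : E⦄ (τ : Θ ⟶ Δ) (k : Θ ⟶ Nn E), Valid (k ∈ᵢ τ ≫ D) →
        Valid (app (τ ≫ h) k ∈ᵢ τ ≫ σ ≫ S)) ∧
      ∀ ⦃Θ : E⦄ (τ : Θ ⟶ Δ) (n : Θ ⟶ Nn E), Valid (n ∈ᵢ τ ≫ σ ≫ S) →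
        ∃ (Ξ : E) (ρ : Ξ ⟶ Θ) (k : Ξ ⟶ Nn E), Epi ρ ∧ Valid (k ∈ᵢ ρ ≫ τ ≫ D) ∧
          app (ρ ≫ τ ≫ h) k = ρ ≫ n := by
  -- For each `n` a decidable set `f n` is chosen that is inhabited exactly when `n ∈ S`. Coding
  -- pairs `(n, m)` by `g`, the set `D` of codes with `m ∈ f n` is decidable, and its image under
  -- the first projection is `S`.
  obtain ⟨Δ, σ, f, _, hf⟩ := countable_choice hE (X := Pw (Nn E))
    (compr (Nn E ⊗ Pw (Nn E)) fun z => IsDecidable (z ≫ snd _ _) ∧ᵢ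
      (z ≫ fst _ _ ∈ᵢ ↟S ↔ᵢ ex (Nn E) fun m => m ∈ᵢ ↟(z ≫ snd _ _)))
    (fun Δ σ n => by
      obtain ⟨Θ, τ, D, hτ, hD, h⟩ := valid_isSd.1 (valid_isSdSet.1 hS σ n)
      simp at h
      exact ⟨Θ, τ, D, hτ, by simpa using ⟨hD, h⟩⟩)
  simp at hf
  obtain ⟨Θ, τ, g, _, hg⟩ := exists_pairing hE Δ
  refine ⟨Θ, τ ≫ σ, compr (Nn E) fun k =>
      app ↟g k ≫ snd _ _ ∈ᵢ app ↟(τ ≫ f) (app ↟g k ≫ fst _ _), lam _ fun k => app ↟g k ≫ fst _ _,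
      inferInstance, ?_, ?_, ?_⟩
  · refine valid_isDecidable.2 fun Ξ ρ k => ?_
    have := ((hf (ρ ≫ τ) (app (ρ ≫ g) k ≫ fst _ _)).1).dec (app (ρ ≫ g) k ≫ snd _ _)
    simpa using this
  · intro Ξ ρ k h
    have h1 := (hf (ρ ≫ τ) (app (ρ ≫ g) k ≫ fst _ _)).2
    simp at h h1 ⊢
    rw [h1]
    exact Valid.exC_intro (app (ρ ≫ g) k ≫ snd _ _) (by simpa using h)
  · intro Ξ ρ n h
    have h1 := (hf (ρ ≫ τ) n).2
    simp at h h1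
    rw [h1] at h
    obtain ⟨Λ', κ', m, _, hm⟩ := valid_exC.1 h
    simp at hm
    obtain ⟨Λ'', κ'', k, _, hk⟩ := valid_mem_rangeI.1 (hg (κ' ≫ ρ) (lift (κ' ≫ n) m))
    refine ⟨Λ'', κ'' ≫ κ', k, inferInstance, ?_⟩
    simp at hk ⊢
    rw [← hk]
    simpa using hm.comp κ''

/-- Semidecidable truth values are closed under countable existential quantification. -/
theorem isSd_ex_nat (hE : SyntheticComputability E) {S : Γ ⟶ Pw (Nn E)}
    (hS : Valid (IsSdSet S)) : Valid (IsSd (ex (Γ := Γ) (Nn E) fun n => n ∈ᵢ ↟S)) := by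
  obtain ⟨Δ, σ, D, h, _, hD, hDS, hSD⟩ := exists_decidable_preimage hE hS
  refine Valid.of_epi σ ?_
  have e : σ ≫ (ex (Γ := Γ) (Nn E) fun n => n ∈ᵢ ↟S) = ex (Γ := Δ) (Nn E) fun n => n ∈ᵢ ↟D := by
    refine omega_ext fun Θ τ => ?_
    simp
    constructor
    · intro h1
      obtain ⟨Λ, κ, n, _, h1⟩ := valid_exC.1 h1
      simp at h1
      obtain ⟨Ξ, ρ, k, _, hk, -⟩ := hSD (κ ≫ τ) n (by simpa using h1)
      exact valid_exC.2 ⟨Ξ, ρ ≫ κ, k, inferInstance, by simpa using hk⟩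
    · intro h1
      obtain ⟨Λ, κ, k, _, h1⟩ := valid_exC.1 h1
      simp at h1
      exact valid_exC.2 ⟨Λ, κ, app (κ ≫ τ ≫ h) k, inferInstance,
        by simpa using hDS (κ ≫ τ) k (by simpa using h1)⟩
  rw [comp_IsSd, e]
  exact isSd_ex_decidable hD

theorem isSd_or {p q : Γ ⟶ Om E} (hp : Valid (IsSd p)) (hq : Valid (IsSd q)) :
    Valid (IsSd (p ∨ᵢ q)) := by
  obtain ⟨Δ, σ, D, _, hD, hpD⟩ := valid_isSd.1 hp
  obtain ⟨Θ, τ, D', _, hD', hqD⟩ := valid_isSd.1 (hq.on σ)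
  refine Valid.of_epi (τ ≫ σ) ?_
  have hE : Valid (IsDecidable (compr (Nn E) fun k => k ∈ᵢ ↟(τ ≫ D) ∨ᵢ k ∈ᵢ ↟D' : Θ ⟶ _)) :=
    valid_isDecidable.2 fun Ξ ρ x => by
      simpa using dec_or (Valid.dec (hD.on (ρ ≫ τ)) x) (Valid.dec (hD'.on ρ) x)
  convert! isSd_ex_decidable hE using 1
  have h1 := congrArg (fun t => τ ≫ t) hpD
  simp at h1 hqD
  simp [h1, hqD]
  congr 1
  refine omega_ext fun Ξ ρ => ?_
  simp
  constructor
  · intro h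
    refine h.or_elim (fun Λ κ h => ?_) (fun Λ κ h => ?_)
    · simp at h ⊢
      obtain ⟨Λ', κ', m, _, hm⟩ := valid_exC.1 h
      refine valid_exC.2 ⟨Λ', κ', m, inferInstance, ?_⟩
      simp at hm ⊢
      exact hm.inl _
    · simp at h ⊢
      obtain ⟨Λ', κ', m, _, hm⟩ := valid_exC.1 h
      refine valid_exC.2 ⟨Λ', κ', m, inferInstance, ?_⟩
      simp at hm ⊢
      exact hm.inr _
  · intro h
    obtain ⟨Λ, κ, m, _, hm⟩ := valid_exC.1 h
    simp at hm
    refine Valid.of_epi κ (hm.or_elim (fun Λ' κ' h => ?_) (fun Λ' κ' h => ?_))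
    · simp at h ⊢
      exact (Valid.exC_intro (κ' ≫ m) (by simpa using h)).inl _
    · simp at h ⊢
      exact (Valid.exC_intro (κ' ≫ m) (by simpa using h)).inr _

theorem isSd_dec_and {p q : Γ ⟶ Om E} (hp : Valid (p ∨ᵢ ¬ᵢ p)) (hq : Valid (IsSd q)) :
    Valid (IsSd (p ∧ᵢ q)) := by
  refine hp.or_elim (fun Δ σ h => ?_) (fun Δ σ h => ?_)
  · simp
    convert! hq.comp σ using 1
    simp
    congr 1
    refine omega_ext fun Θ τ => ?_
    simp
    exact fun _ => by simpa using h.comp τ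
  · simp at h ⊢
    have e : (σ ≫ p ∧ᵢ σ ≫ q) = ff := by
      refine omega_ext fun Θ τ => ?_
      simp
      constructor
      · rintro ⟨h1, -⟩
        exact (h.on τ).not_elim h1
      · intro h
        exact ⟨h.ff_elim _, h.ff_elim _⟩
    rw [e]
    exact isSd_ff

/-- Writing `p` as `∃ k, k ∈ D` with `D` decidable, the conjunction becomes `∃ k, k ∈ D ∧ q`, a
countable existential quantification of instances of `isSd_dec_and`. -/
theorem isSd_and (hE : SyntheticComputability E) {p q : Γ ⟶ Om E} (hp : Valid (IsSd p))
    (hq : Valid (IsSd q)) : Valid (IsSd (p ∧ᵢ q)) := by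
  obtain ⟨Δ, σ, D, _, hD, hpD⟩ := valid_isSd.1 hp
  refine Valid.of_epi σ ?_
  have hS : Valid (IsSdSet (compr (Nn E) fun k => k ∈ᵢ ↟D ∧ᵢ ↟(σ ≫ q) : Δ ⟶ _)) :=
    valid_isSdSet.2 fun Ξ ρ x => by
      simpa using isSd_dec_and (Valid.dec (hD.on ρ) x) (hq.on (ρ ≫ σ))
  convert! isSd_ex_nat hE hS using 1
  simp at hpD
  simp [hpD]
  congr 1
  refine omega_ext fun Ξ ρ => ?_
  simp
  constructor
  · rintro ⟨h, h'⟩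
    obtain ⟨Λ, κ, m, _, hm⟩ := valid_exC.1 h
    refine valid_exC.2 ⟨Λ, κ, m, inferInstance, ?_⟩
    simp at hm ⊢
    exact ⟨hm, h'.on κ⟩
  · intro h
    obtain ⟨Λ, κ, m, _, hm⟩ := valid_exC.1 h
    simp at hm
    exact ⟨valid_exC.2 ⟨Λ, κ, m, inferInstance, by simpa using hm.1⟩,
      Valid.of_epi κ (by simpa using hm.2)⟩

/-- This is the form in which the Markov principle is used: a semidecidable statement may be proved
by contradiction, or after assuming anything that is merely not false. -/
theorem isSd_stable (hE : SyntheticComputability E) {p : Γ ⟶ Om E} (hp : Valid (IsSd p))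
    (h : Valid (¬ᵢ ¬ᵢ p)) : Valid p := by
  obtain ⟨Δ, σ, D, _, hD, hpD⟩ := valid_isSd.1 hp
  have hM := hE.markov
  simp [MarkovPrinciple] at hM
  have hM := valid_allC.1 hM (toUnit Δ) D
  simp at hM
  refine Valid.of_epi σ ?_
  rw [hpD]
  simp
  refine (hM.mp hD).mp ?_
  have h1 := h.on σ
  rw [hpD] at h1
  refine valid_notI.2 fun Θ τ hn => ?_
  simp [valid_all_not] at hn
  have h2 := h1.on τ
  refine h2.not_elim (valid_notI.2 fun Ξ ρ hm => ?_)
  simp at hm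
  obtain ⟨Λ, κ, m, _, hm⟩ := valid_exC.1 hm
  exact Valid.of_epi κ (by simpa using hn (κ ≫ ρ) m (by simpa using hm))

end Semidecidable

/-! ### Countable sets -/

section Countable

variable {Γ Δ X Y Z : E}

/-- Elimination of an existential quantifier. -/
theorem Valid.exC_elim {p : X ⊗ Γ ⟶ Om E} {r : Γ ⟶ Om E} (h : Valid (exC p))
    (h' : ∀ ⦃Δ : E⦄ (σ : Δ ⟶ Γ) (x : Δ ⟶ X), Valid (lift x σ ≫ p) → Valid (σ ≫ r)) :
    Valid r := by
  obtain ⟨Δ, σ, x, _, hx⟩ := valid_exC.1 h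
  exact Valid.of_epi σ (h' σ x hx)

theorem valid_isCountable {D : Γ ⟶ Pw X} : Valid (IsCountable D) ↔
    ∃ (Δ : E) (σ : Δ ⟶ Γ) (e : Δ ⟶ Fn (Nn E) (Pw X)), Epi σ ∧ Valid (Enumerates e (σ ≫ D)) := by
  simp [IsCountable, valid_exC]

theorem valid_enumerates {e : Γ ⟶ Fn (Nn E) (Pw X)} {D : Γ ⟶ Pw X} : Valid (Enumerates e D) ↔
    (∀ ⦃Δ : E⦄ (σ : Δ ⟶ Γ) (n : Δ ⟶ Nn E), Valid ((app (σ ≫ e) n =ᵢ emptyI) ∨ᵢ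
      ex X fun x => ↟(app (σ ≫ e) n) =ᵢ singI x)) ∧
    (∀ ⦃Δ : E⦄ (σ : Δ ⟶ Γ) (x : Δ ⟶ X), (x ∈ᵢ σ ≫ D) =
      ex (Nn E) fun n => ↟x ∈ᵢ app ↟(σ ≫ e) n) := by
  simp [Enumerates, valid_allC]

theorem Valid.enumerates_mem {e : Γ ⟶ Fn (Nn E) (Pw X)} {D : Γ ⟶ Pw X}
    (h : Valid (Enumerates e D)) {n : Γ ⟶ Nn E} {x : Γ ⟶ X} (hx : Valid (x ∈ᵢ app e n)) :
    Valid (x ∈ᵢ D) := by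
  have := (valid_enumerates.1 h).2 (𝟙 Γ) x
  simp at this
  rw [this]
  exact Valid.exC_intro n (by simpa using hx)

theorem Valid.exists_enumerates {e : Γ ⟶ Fn (Nn E) (Pw X)} {D : Γ ⟶ Pw X}
    (h : Valid (Enumerates e D)) {x : Γ ⟶ X} (hx : Valid (x ∈ᵢ D)) :
    ∃ (Δ : E) (σ : Δ ⟶ Γ) (n : Δ ⟶ Nn E), Epi σ ∧ Valid (σ ≫ x ∈ᵢ app (σ ≫ e) n) := by
  have := (valid_enumerates.1 h).2 (𝟙 Γ) x
  simp at this
  rw [this] at hx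
  simpa using valid_exC.1 hx

theorem Valid.enumerates_cases {e : Γ ⟶ Fn (Nn E) (Pw X)} {D : Γ ⟶ Pw X}
    (h : Valid (Enumerates e D)) (n : Γ ⟶ Nn E) {r : Γ ⟶ Om E}
    (h0 : ∀ ⦃Δ : E⦄ (σ : Δ ⟶ Γ), app (σ ≫ e) (σ ≫ n) = emptyI → Valid (σ ≫ r))
    (h1 : ∀ ⦃Δ : E⦄ (σ : Δ ⟶ Γ) (x : Δ ⟶ X), app (σ ≫ e) (σ ≫ n) = singI x →
      Valid (x ∈ᵢ σ ≫ D) → Valid (σ ≫ r)) : Valid r := by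
  refine ((valid_enumerates.1 h).1 (𝟙 Γ) n).or_elim (fun Δ σ h' => h0 σ (by simpa using h'))
    (fun Δ σ h' => ?_)
  simp at h'
  obtain ⟨Θ, τ, x, _, hx⟩ := valid_exC.1 h'
  simp at hx
  refine Valid.of_epi τ ?_
  have h2 : Valid (x ∈ᵢ (τ ≫ σ) ≫ D) := by
    have h3 := h.on (τ ≫ σ)
    simp only [Category.assoc] at h3 ⊢
    have h4 : Valid (x ∈ᵢ app (τ ≫ σ ≫ e) (τ ≫ σ ≫ n)) := by simp [hx]
    exact h3.enumerates_mem h4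
  simpa using h1 (τ ≫ σ) x (by simpa using hx) h2

theorem enumerates_of {e : Γ ⟶ Fn (Nn E) (Pw X)} {D : Γ ⟶ Pw X}
    (h : ∀ ⦃Δ : E⦄ (σ : Δ ⟶ Γ) (n : Δ ⟶ Nn E), Valid ((app (σ ≫ e) n =ᵢ emptyI) ∨ᵢ
      ex X fun x => ↟(app (σ ≫ e) n) =ᵢ singI x))
    (h₁ : ∀ ⦃Δ : E⦄ (σ : Δ ⟶ Γ) (n : Δ ⟶ Nn E) (x : Δ ⟶ X), Valid (x ∈ᵢ app (σ ≫ e) n) →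
      Valid (x ∈ᵢ σ ≫ D))
    (h₂ : ∀ ⦃Δ : E⦄ (σ : Δ ⟶ Γ) (x : Δ ⟶ X), Valid (x ∈ᵢ σ ≫ D) →
      ∃ (Θ : E) (τ : Θ ⟶ Δ) (n : Θ ⟶ Nn E), Epi τ ∧ Valid (τ ≫ x ∈ᵢ app (τ ≫ σ ≫ e) n)) :
    Valid (Enumerates e D) := by
  refine valid_enumerates.2 ⟨h, fun Δ σ x => omega_ext fun Θ τ => ?_⟩
  simp
  constructor
  · intro hx
    obtain ⟨Ξ, ρ, n, hρ, hn⟩ := h₂ (τ ≫ σ) (τ ≫ x) (by simpa using hx)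
    exact valid_exC.2 ⟨Ξ, ρ, n, hρ, by simpa using hn⟩
  · intro hx
    obtain ⟨Ξ, ρ, n, hρ, hn⟩ := valid_exC.1 hx
    simp at hn
    exact Valid.of_epi ρ (by simpa using h₁ (ρ ≫ τ ≫ σ) n (ρ ≫ τ ≫ x) (by simpa using hn))

/-- The terms of a sequence form a countable set. -/
theorem isCountable_rangeI (a : Γ ⟶ Fn (Nn E) X) : Valid (IsCountable (rangeI a)) := by
  refine valid_isCountable.2 ⟨Γ, 𝟙 Γ, lam _ fun n => singI (app ↟a n), inferInstance,
    enumerates_of ?_ ?_ ?_⟩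
  · intro Δ σ n
    simp
    exact Valid.inr (Valid.exC_intro (app (σ ≫ a) n) (by simp)) _
  · intro Δ σ n x hx
    simp at hx ⊢
    exact valid_mem_rangeI.2 ⟨Δ, 𝟙 Δ, n, inferInstance, by simpa using hx⟩
  · intro Δ σ x hx
    simp at hx
    obtain ⟨Θ, τ, n, hτ, h⟩ := valid_mem_rangeI.1 hx
    exact ⟨Θ, τ, n, hτ, by simpa using h⟩

/-- Membership in a countable set is semidecidable for elements which can be compared with those
of the set. -/
theorem isSd_mem_countable {D : Γ ⟶ Pw X} (hD : Valid (IsCountable D)) (x : Γ ⟶ X)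
    (h : ∀ ⦃Δ : E⦄ (σ : Δ ⟶ Γ) (y : Δ ⟶ X), Valid (y ∈ᵢ σ ≫ D) →
      Valid ((σ ≫ x =ᵢ y) ∨ᵢ ¬ᵢ (σ ≫ x =ᵢ y))) : Valid (IsSd (x ∈ᵢ D)) := by
  obtain ⟨Δ, σ, e, _, he⟩ := valid_isCountable.1 hD
  refine Valid.of_epi σ ?_
  have h1 := (valid_enumerates.1 he).2 (𝟙 Δ) (σ ≫ x)
  simp at h1
  have h2 : Valid (IsDecidable (compr (Nn E) fun n => ↟(σ ≫ x) ∈ᵢ app ↟e n : Δ ⟶ _)) := by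
    refine valid_isDecidable.2 fun Θ τ n => ?_
    simp
    refine Valid.enumerates_cases (he.on τ) n (fun Ξ ρ h0 => ?_) (fun Ξ ρ y hy hyD => ?_)
    · simp at h0 ⊢
      rw [h0]
      exact Valid.inr (valid_notI.2 fun _ _ h => by simpa using h) _
    · simp at hy ⊢
      rw [hy]
      have := h (ρ ≫ τ ≫ σ) y (by simpa using hyD)
      simpa using this
  have h3 := isSd_ex_decidable h2
  simp at h3 ⊢
  rwa [h1]

theorem isSdSet_of_isCountable {S : Γ ⟶ Pw (Nn E)} (hS : Valid (IsCountable S)) :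
    Valid (IsSdSet S) :=
  valid_isSdSet.2 fun _ σ x => isSd_mem_countable (hS.on σ) x fun _ _ _ _ => nat_dec_eq _ _

/-- Each step of an enumeration is known to be a skip or a singleton. The truth value is false in
the first case and the value of `S` at the listed element in the second. -/
theorem isSd_ex_term {D S : Γ ⟶ Pw X} {e : Γ ⟶ Fn (Nn E) (Pw X)}
    (he : Valid (Enumerates e D)) (n : Γ ⟶ Nn E)
    (hS : ∀ ⦃Δ : E⦄ (σ : Δ ⟶ Γ) (x : Δ ⟶ X), Valid (x ∈ᵢ σ ≫ D) →
      Valid (IsSd (x ∈ᵢ σ ≫ S))) :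
    Valid (IsSd (ex (Γ := Γ) X fun x => x ∈ᵢ app ↟e ↟n ∧ᵢ x ∈ᵢ ↟S)) := by
  refine Valid.enumerates_cases he n (fun Ξ ρ h0 => ?_) (fun Ξ ρ y hy hyD => ?_)
  · simp at h0 ⊢
    rw [show exC (fst X Ξ ∈ᵢ app (snd X Ξ ≫ ρ ≫ e) (snd X Ξ ≫ ρ ≫ n) ∧ᵢ
      fst X Ξ ∈ᵢ snd X Ξ ≫ ρ ≫ S) = ff from ?_]
    · exact isSd_ff
    · refine omega_ext fun Λ κ => ?_
      simp
      refine ⟨fun h => ?_, fun h => h.ff_elim _⟩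
      obtain ⟨Λ', κ', x, _, hx⟩ := valid_exC.1 h
      have h1 := congrArg (fun t => κ' ≫ κ ≫ t) h0
      simp at hx h1
      rw [h1] at hx
      exact Valid.of_epi κ' (by simpa using hx.1)
  · simp at hy ⊢
    rw [show exC (fst X Ξ ∈ᵢ app (snd X Ξ ≫ ρ ≫ e) (snd X Ξ ≫ ρ ≫ n) ∧ᵢ
      fst X Ξ ∈ᵢ snd X Ξ ≫ ρ ≫ S) = (y ∈ᵢ ρ ≫ S) from ?_]
    · exact hS ρ y hyD
    · refine omega_ext fun Λ κ => ?_
      have h1 := congrArg (fun t => κ ≫ t) hy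
      simp at h1 ⊢
      constructor
      · intro h
        obtain ⟨Λ', κ', x, _, hx⟩ := valid_exC.1 h
        have h2 := congrArg (fun t => κ' ≫ t) h1
        simp at hx h2
        rw [h2] at hx
        simp at hx
        exact Valid.of_epi κ' (by simpa [hx.1] using hx.2)
      · intro h
        exact Valid.exC_intro (κ ≫ y) (by simpa [h1] using h)

/-- Semidecidability of `∃ x ∈ D, x ∈ S` for countable `D`. -/
theorem isSd_ex_countable (hE : SyntheticComputability E) {D S : Γ ⟶ Pw X}
    (hD : Valid (IsCountable D)) (hS : ∀ ⦃Δ : E⦄ (σ : Δ ⟶ Γ) (x : Δ ⟶ X), Valid (x ∈ᵢ σ ≫ D) →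
      Valid (IsSd (x ∈ᵢ σ ≫ S))) :
    Valid (IsSd (ex (Γ := Γ) X fun x => x ∈ᵢ ↟D ∧ᵢ x ∈ᵢ ↟S)) := by
  obtain ⟨Δ, σ, e, _, he⟩ := valid_isCountable.1 hD
  refine Valid.of_epi σ ?_
  let F : Δ ⟶ Pw (Nn E) := compr _ fun n => ex X fun x => x ∈ᵢ app ↟e ↟n ∧ᵢ x ∈ᵢ ↟(σ ≫ S)
  have hF : Valid (IsSdSet F) := by
    refine valid_isSdSet.2 fun Θ τ n => ?_
    simpa [F] using isSd_ex_term (he.on τ) n (S := τ ≫ σ ≫ S)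
      fun Ξ ρ x hx => by simpa using hS (ρ ≫ τ ≫ σ) x (by simpa using hx)
  have h3 := isSd_ex_nat hE hF
  have e : σ ≫ (ex (Γ := Γ) X fun x => x ∈ᵢ ↟D ∧ᵢ x ∈ᵢ ↟S) =
      ex (Γ := Δ) (Nn E) fun n => n ∈ᵢ ↟F := by
    refine omega_ext fun Θ τ => ?_
    simp [F]
    constructor
    · intro h
      obtain ⟨Λ, κ, x, _, hx⟩ := valid_exC.1 h
      simp at hx
      obtain ⟨Ξ, ρ, n, _, hn⟩ := Valid.exists_enumerates (he.on (κ ≫ τ)) (x := x)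
        (by simpa using hx.1)
      refine valid_exC.2 ⟨Ξ, ρ ≫ κ, n, inferInstance, ?_⟩
      simp at hn ⊢
      exact Valid.exC_intro (ρ ≫ x) (by simpa using ⟨hn, hx.2.on ρ⟩)
    · intro h
      obtain ⟨Λ, κ, n, _, hn⟩ := valid_exC.1 h
      simp at hn
      obtain ⟨Ξ, ρ, x, _, hx⟩ := valid_exC.1 hn
      simp at hx
      refine valid_exC.2 ⟨Ξ, ρ ≫ κ, x, inferInstance, ?_⟩
      have := (he.on (ρ ≫ κ ≫ τ)).enumerates_mem hx.1
      simpa using ⟨this, hx.2⟩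
  rw [comp_IsSd, e]
  exact h3

/-- A semidecidable part of a countable set is countable. -/
theorem isCountable_inter (hE : SyntheticComputability E) {D S : Γ ⟶ Pw X}
    (hD : Valid (IsCountable D)) (hS : ∀ ⦃Δ : E⦄ (σ : Δ ⟶ Γ) (x : Δ ⟶ X), Valid (x ∈ᵢ σ ≫ D) →
      Valid (IsSd (x ∈ᵢ σ ≫ S))) : Valid (IsCountable (interI D S)) := by
  obtain ⟨Δ, σ, e, _, he⟩ := valid_isCountable.1 hD
  let F : Δ ⟶ Pw (Nn E) := compr _ fun n => ex X fun x => x ∈ᵢ app ↟e ↟n ∧ᵢ x ∈ᵢ ↟(σ ≫ S)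
  have hF : Valid (IsSdSet F) := by
    refine valid_isSdSet.2 fun Θ τ n => ?_
    simpa [F] using isSd_ex_term (he.on τ) n (S := τ ≫ σ ≫ S)
      fun Ξ ρ x hx => by simpa using hS (ρ ≫ τ ≫ σ) x (by simpa using hx)
  -- The set `F` of steps of `e` whose element lies in `S` is only semidecidable, so it is presented
  -- as the image under `h` of a decidable `A`. The new enumeration lists `e (h k)` when `k ∈ A` and
  -- skips otherwise.
  obtain ⟨Θ, τ, A, h, _, hA, hAF, hFA⟩ := exists_decidable_preimage hE hF
  refine valid_isCountable.2 ⟨Θ, τ ≫ σ, lam _ fun k => compr X fun x =>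
    x ∈ᵢ app ↟(τ ≫ e) ↟(app ↟h k) ∧ᵢ ↟k ∈ᵢ ↟A, inferInstance, enumerates_of ?_ ?_ ?_⟩
  · intro Ξ ρ k
    refine (hA.on ρ).dec k |>.or_elim (fun Λ κ hk => ?_) (fun Λ κ hk => ?_)
    · refine Valid.enumerates_cases (he.on (κ ≫ ρ ≫ τ)) (app (κ ≫ ρ ≫ h) (κ ≫ k))
        (fun Λ' κ' h0 => ?_) (fun Λ' κ' x hx _ => ?_)
      · simp at h0 hk ⊢
        refine Valid.inl ?_ _
        simp
        refine set_ext fun M μ x => ?_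
        have h1 := congrArg (fun t => μ ≫ t) h0
        simp at h1 ⊢
        rw [h1]
        simp
        exact fun h => (h.ff_elim _)
      · simp at hx hk ⊢
        refine Valid.inr (Valid.exC_intro x ?_) _
        simp
        refine set_ext fun M μ y => ?_
        have h1 := congrArg (fun t => μ ≫ t) hx
        simp at h1 ⊢
        rw [h1]
        simp
        intro _
        simpa using hk.comp (μ ≫ κ')
    · simp at hk ⊢
      refine Valid.inl ?_ _
      simp
      refine set_ext fun M μ x => ?_
      simp
      constructor
      · rintro ⟨-, h⟩
        exact (hk.on μ).not_elim h
      · intro h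
        exact ⟨h.ff_elim _, h.ff_elim _⟩
  · intro Ξ ρ k x hx
    simp at hx
    have h1 := hAF ρ k hx.2
    have h2 := (he.on (ρ ≫ τ)).enumerates_mem hx.1
    simp [F] at h1 h2 ⊢
    refine ⟨h2, ?_⟩
    refine Valid.enumerates_cases (he.on (ρ ≫ τ)) (app (ρ ≫ h) k)
      (fun Λ' κ' h0 => ?_) (fun Λ' κ' z hz _ => ?_)
    · have := hx.1.comp κ'
      simp at this h0
      rw [h0] at this
      simp at this
      exact this.ff_elim _
    · have h3 := hx.1.comp κ'
      have h1 := h1.on κ'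
      refine h1.exC_elim fun N ν y hy => ?_
      simp at h3 hz hy ⊢
      have h4 := congrArg (fun t => ν ≫ t) hz
      simp at h4
      rw [hz] at h3
      rw [h4] at hy
      simp at h3 hy
      simpa [h3, hy.1] using hy.2
  · intro Ξ ρ x hx
    simp at hx
    obtain ⟨Λ, κ, n, _, hn⟩ := Valid.exists_enumerates (he.on (ρ ≫ τ)) (x := x)
      (by simpa using hx.1)
    obtain ⟨Λ', κ', k, _, hk, hk'⟩ := hFA (κ ≫ ρ) n (by
      simp [F]
      exact Valid.exC_intro (κ ≫ x) (by simpa using ⟨by simpa using hn, hx.2.on κ⟩))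
    refine ⟨Λ', κ' ≫ κ, k, inferInstance, ?_⟩
    simp at hk hk' hn ⊢
    rw [hk']
    exact ⟨by simpa using hn.comp κ', hk⟩

/-- Together with `isSdSet_of_isCountable` this identifies the countable with the semidecidable
subsets of `N`. The Enumerability Axiom thereby enumerates `Σ ^ N`. -/
theorem isCountable_of_isSdSet (hE : SyntheticComputability E) {S : Γ ⟶ Pw (Nn E)}
    (hS : Valid (IsSdSet S)) : Valid (IsCountable S) := by
  have h := isCountable_inter hE (isCountable_rangeI (lam (Nn E) fun n => n : Γ ⟶ _)) (S := S)
    (fun _ σ x _ => (hS.on σ).sd x)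
  have e : interI (rangeI (lam (Nn E) fun n => n : Γ ⟶ _)) S = S := by
    refine set_ext fun Δ σ x => ?_
    simp
    intro _
    exact valid_mem_rangeI.2 ⟨Δ, 𝟙 Δ, x, inferInstance, by simp⟩
  rwa [e] at h

/-- The complements of semidecidable truth values are not always semidecidable. -/
theorem false_of_isSd_not (hE : SyntheticComputability E)
    (h : ∀ ⦃Δ : E⦄ (_ : Δ ⟶ Γ) (p : Δ ⟶ Om E), Valid (IsSd p) → Valid (IsSd (¬ᵢ p))) :
    Valid (ff : Γ ⟶ Om E) := by
  have hA := (hE.enumerability).comp (toUnit Γ)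
  simp [EnumerabilityAxiom] at hA
  obtain ⟨Δ, σ, W, _, hW⟩ := valid_isCountable.1 hA
  refine Valid.of_epi σ ?_
  have memK : ∀ ⦃Θ : E⦄ (τ : Θ ⟶ Δ) (n : Θ ⟶ Nn E) (S : Θ ⟶ Pw (Nn E)),
      app (τ ≫ W) n = singI S → (n ∈ᵢ τ ≫ compr (Nn E) fun n => ex (Pw (Nn E)) fun S =>
        S ∈ᵢ app ↟W ↟n ∧ᵢ ↟n ∈ᵢ S) = (n ∈ᵢ S) := by
    intro Θ τ n S hS
    refine omega_ext fun Λ κ => ?_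
    have h1 := congrArg (fun t => κ ≫ t) hS
    simp at h1 ⊢
    constructor
    · intro h
      obtain ⟨Λ', κ', x, _, hx⟩ := valid_exC.1 h
      have h2 := congrArg (fun t => κ' ≫ t) h1
      simp at hx h2
      rw [h2] at hx
      simp at hx
      exact Valid.of_epi κ' (by simpa [hx.1] using hx.2)
    · intro h
      exact Valid.exC_intro (κ ≫ S) (by simpa [h1] using h)
  -- The diagonal set: `n ∈ K` if step `n` of the enumeration lists a set that contains `n`. If its
  -- complement were semidecidable, it would be listed at some step `n`, and then `n ∈ K` would be
  -- equivalent to its negation.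
  set K : Δ ⟶ Pw (Nn E) := compr (Nn E) fun n => ex (Pw (Nn E)) fun S =>
    S ∈ᵢ app ↟W ↟n ∧ᵢ ↟n ∈ᵢ S with hK
  have sdK : Valid (IsSdSet K) := by
    refine valid_isSdSet.2 fun Θ τ n => ?_
    have := isSd_ex_term (hW.on τ) n (S := compr _ fun S => ↟n ∈ᵢ S) fun Ξ _ S hS => by
      simp at hS ⊢
      exact (isSdSet_of_isCountable hS).sd _
    simpa [K] using this
  have sdK' : Valid (IsSdSet (compr (Nn E) fun n => ¬ᵢ (n ∈ᵢ ↟K) : Δ ⟶ _)) := by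
    refine valid_isSdSet.2 fun Θ τ n => ?_
    have := h (τ ≫ σ) _ ((sdK.on τ).sd n)
    simpa using this
  have cK' := isCountable_of_isSdSet hE sdK'
  obtain ⟨Θ, τ, n, _, hn⟩ := hW.exists_enumerates (x := compr (Nn E) fun n => ¬ᵢ (n ∈ᵢ ↟K))
    (by simpa using cK')
  refine Valid.of_epi τ ?_
  refine Valid.enumerates_cases (hW.on τ) n (fun Ξ ρ h0 => ?_) (fun Ξ ρ S hS hSW => ?_)
  · have := hn.comp ρ
    simp at this h0 ⊢
    rw [h0] at this
    simpa using this
  · have h2 := memK (ρ ≫ τ) (ρ ≫ n) S (by simpa using hS)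
    have h3 := hn.comp ρ
    rw [comp_memI, comp_app, hS, mem_singI, valid_eqI] at h3
    rw [← h3] at h2
    simp only [Category.assoc, compr_eq] at h2
    simp at h2
    have h4 : Valid (¬ᵢ (ρ ≫ n ∈ᵢ ρ ≫ τ ≫ K)) := by
      refine valid_notI.2 fun Λ κ h => ?_
      have h5 := h
      rw [h2] at h5
      simp at h5 h
      exact h5.not_elim h
    simp
    refine h4.not_elim ?_
    rw [h2]
    exact h4

end Countable

/-! ### Topologies -/

section Topology

variable {Γ Δ X Y Z : E}

theorem valid_all_iff {p q : X ⊗ Γ ⟶ Om E} : Valid (allC (p ↔ᵢ q)) ↔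
    ∀ ⦃Δ : E⦄ (σ : Δ ⟶ Γ) (x : Δ ⟶ X), lift x σ ≫ p = lift x σ ≫ q := by
  simp [valid_allC, -IsEmpty.forall_iff]

theorem valid_isTopology {T : Γ ⟶ Pw (Pw X)} : Valid (IsTopology T) ↔
    (∀ ⦃Δ : E⦄ (σ : Δ ⟶ Γ) (U : Δ ⟶ Pw X), Valid (U ∈ᵢ σ ≫ T) → Valid (IsSdSet U)) ∧
    Valid (univI ∈ᵢ T) ∧
    (∀ ⦃Δ : E⦄ (σ : Δ ⟶ Γ) (U V : Δ ⟶ Pw X), Valid (U ∈ᵢ σ ≫ T) → Valid (V ∈ᵢ σ ≫ T) →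
      Valid (interI U V ∈ᵢ σ ≫ T)) ∧
    Valid (emptyI ∈ᵢ T) ∧
    (∀ ⦃Δ : E⦄ (σ : Δ ⟶ Γ) (V : Δ ⟶ Fn (Nn E) (Pw X)),
      (∀ ⦃Θ : E⦄ (τ : Θ ⟶ Δ) (n : Θ ⟶ Nn E), Valid (app (τ ≫ V) n ∈ᵢ τ ≫ σ ≫ T)) →
      Valid (iUnionI V ∈ᵢ σ ≫ T)) := by
  simp [IsTopology, valid_all_imp, valid_all_all_imp_imp, -IsEmpty.forall_iff]
  simp [valid_allC, -IsEmpty.forall_iff]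

theorem valid_isBase {B : Γ ⟶ Fn (Nn E) (Pw X)} {T : Γ ⟶ Pw (Pw X)} : Valid (IsBase B T) ↔
    (∀ ⦃Δ : E⦄ (σ : Δ ⟶ Γ) (n : Δ ⟶ Nn E), Valid (app (σ ≫ B) n ∈ᵢ σ ≫ T)) ∧
    (∀ ⦃Δ : E⦄ (σ : Δ ⟶ Γ) (U : Δ ⟶ Pw X), Valid (U ∈ᵢ σ ≫ T) →
      ∃ (Θ : E) (τ : Θ ⟶ Δ) (I : Θ ⟶ Pw (Nn E)), Epi τ ∧ Valid (IsCountable I) ∧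
        ∀ ⦃Ξ : E⦄ (ρ : Ξ ⟶ Θ) (x : Ξ ⟶ X), (x ∈ᵢ ρ ≫ τ ≫ U) =
          ex (Nn E) fun i => i ∈ᵢ ↟(ρ ≫ I) ∧ᵢ ↟x ∈ᵢ app ↟(ρ ≫ τ ≫ σ ≫ B) i) := by
  simp [IsBase, valid_all_imp, valid_exC, valid_all_iff, -exists_and_left, -IsEmpty.forall_iff]
  simp [valid_allC, -IsEmpty.forall_iff]

theorem valid_isSigmaHom {T : Γ ⟶ Pw (Pw X)} {h : Γ ⟶ Fn (Pw X) (Om E)} :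
    Valid (IsSigmaHom T h) ↔
    (∀ ⦃Δ : E⦄ (σ : Δ ⟶ Γ) (U : Δ ⟶ Pw X), Valid (U ∈ᵢ σ ≫ T) →
      Valid (IsSd (app (σ ≫ h) U))) ∧
    Valid (app h univI) ∧
    (∀ ⦃Δ : E⦄ (σ : Δ ⟶ Γ) (U V : Δ ⟶ Pw X), Valid (U ∈ᵢ σ ≫ T) → Valid (V ∈ᵢ σ ≫ T) →
      app (σ ≫ h) (interI U V) = (app (σ ≫ h) U ∧ᵢ app (σ ≫ h) V)) ∧
    Valid (¬ᵢ (app h emptyI)) ∧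
    (∀ ⦃Δ : E⦄ (σ : Δ ⟶ Γ) (V : Δ ⟶ Fn (Nn E) (Pw X)),
      (∀ ⦃Θ : E⦄ (τ : Θ ⟶ Δ) (n : Θ ⟶ Nn E), Valid (app (τ ≫ V) n ∈ᵢ τ ≫ σ ≫ T)) →
      app (σ ≫ h) (iUnionI V) = ex (Nn E) fun n => app ↟(σ ≫ h) (app ↟V n)) := by
  simp [IsSigmaHom, valid_all_imp, valid_all_all_imp_imp, -IsEmpty.forall_iff]
  simp [valid_allC, -IsEmpty.forall_iff]

theorem valid_isSober {T : Γ ⟶ Pw (Pw X)} : Valid (IsSober T) ↔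
    (∀ ⦃Δ : E⦄ (σ : Δ ⟶ Γ) (x y : Δ ⟶ X),
      (∀ ⦃Θ : E⦄ (τ : Θ ⟶ Δ) (U : Θ ⟶ Pw X), Valid (U ∈ᵢ τ ≫ σ ≫ T) →
        (τ ≫ x ∈ᵢ U) = (τ ≫ y ∈ᵢ U)) → x = y) ∧
    (∀ ⦃Δ : E⦄ (σ : Δ ⟶ Γ) (h : Δ ⟶ Fn (Pw X) (Om E)), Valid (IsSigmaHom (σ ≫ T) h) →
      ∃ (Θ : E) (τ : Θ ⟶ Δ) (x : Θ ⟶ X), Epi τ ∧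
        ∀ ⦃Ξ : E⦄ (ρ : Ξ ⟶ Θ) (U : Ξ ⟶ Pw X), Valid (U ∈ᵢ ρ ≫ τ ≫ σ ≫ T) →
          app (ρ ≫ τ ≫ h) U = (ρ ≫ x ∈ᵢ U)) := by
  simp [IsSober, valid_all_imp, valid_all_all_imp, valid_exC, -exists_and_left, -IsEmpty.forall_iff]

theorem valid_isDenseSet {T : Γ ⟶ Pw (Pw X)} {D : Γ ⟶ Pw X} : Valid (IsDenseSet T D) ↔
    ∀ ⦃Δ : E⦄ (σ : Δ ⟶ Γ) (U : Δ ⟶ Pw X) (x : Δ ⟶ X), Valid (U ∈ᵢ σ ≫ T) → Valid (x ∈ᵢ U) →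
      ∃ (Θ : E) (τ : Θ ⟶ Δ) (y : Θ ⟶ X), Epi τ ∧ Valid (y ∈ᵢ τ ≫ σ ≫ D) ∧
        Valid (y ∈ᵢ τ ≫ U) := by
  simp [IsDenseSet, valid_all_imp_imp, -exists_and_left, -IsEmpty.forall_iff]
  constructor
  · intro h Δ σ U x hU hx
    obtain ⟨Θ, τ, y, hτ, hy⟩ := valid_exC.1 (h σ U hU (Valid.exC_intro x (by simpa using hx)))
    simp at hy
    exact ⟨Θ, τ, y, hτ, hy⟩
  · intro h Δ σ U hU hx
    refine hx.exC_elim fun Δ' σ' x hx => ?_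
    simp at hx
    obtain ⟨Θ, τ, y, hτ, hy⟩ := h (σ' ≫ σ) (σ' ≫ U) x (by simpa using hU.comp σ') hx
    simpa using valid_exC.2 ⟨Θ, τ, y, hτ, by simpa using hy⟩

/-- A dense sequence is traded for its range, so that statements on sequences and on countable
subsets have a common proof. -/
theorem valid_isDenseSeq {T : Γ ⟶ Pw (Pw X)} {a : Γ ⟶ Fn (Nn E) X} :
    Valid (IsDenseSeq T a) ↔ Valid (IsDenseSet T (rangeI a)) := by
  have e : ∀ (Δ : E) (σ : Δ ⟶ Γ) (U : Δ ⟶ Pw X),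
      (ex (Γ := Δ) (Nn E) fun n => app ↟(σ ≫ a) n ∈ᵢ ↟U) =
        ex X fun x => x ∈ᵢ ↟(rangeI (σ ≫ a)) ∧ᵢ x ∈ᵢ ↟U := by
    intro Δ σ U
    refine omega_ext fun Θ τ => ?_
    simp
    constructor
    · intro h
      refine h.exC_elim fun Ξ ρ n hn => ?_
      simp at hn ⊢
      exact Valid.exC_intro _ (by
        simpa using ⟨valid_mem_rangeI.2 ⟨Ξ, 𝟙 Ξ, n, inferInstance, by simp⟩, hn⟩)
    · intro h
      refine h.exC_elim fun Ξ ρ x hx => ?_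
      simp at hx
      obtain ⟨Λ, κ, n, _, hn⟩ := valid_mem_rangeI.1 hx.1
      refine Valid.of_epi κ ?_
      have h2 := hx.2.comp κ
      simp at hn h2 ⊢
      rw [hn] at h2
      exact Valid.exC_intro n (by simpa using h2)
  simp [IsDenseSet, IsDenseSeq, valid_all_imp_imp]
  refine forall_congr' fun Δ => forall_congr' fun σ => forall_congr' fun U => ?_
  have := e Δ σ U
  simp at this
  rw [this]

theorem valid_isSeparable {T : Γ ⟶ Pw (Pw X)} : Valid (IsSeparable T) ↔
    ∃ (Δ : E) (σ : Δ ⟶ Γ) (D : Δ ⟶ Pw X), Epi σ ∧ Valid (IsCountable D) ∧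
      Valid (IsDenseSet (σ ≫ T) D) := by
  simp [IsSeparable, valid_exC]

theorem valid_isCountablyBased {T : Γ ⟶ Pw (Pw X)} : Valid (IsCountablyBased T) ↔
    Valid (IsTopology T) ∧ ∃ (Δ : E) (σ : Δ ⟶ Γ) (B : Δ ⟶ Fn (Nn E) (Pw X)), Epi σ ∧
      Valid (IsBase B (σ ≫ T)) := by
  simp [IsCountablyBased, valid_exC]

theorem tt_andI (p : Γ ⟶ Om E) : (tt ∧ᵢ p) = p := omega_ext fun _ _ => by simp

theorem valid_overtSpace : Valid (OvertSpace X : Γ ⟶ Om E) ↔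
    ∀ ⦃Δ : E⦄ (_ : Δ ⟶ Γ) (S : Δ ⟶ Pw X), Valid (IsSdSet S) →
      Valid (IsSd (ex (Γ := Δ) X fun x => x ∈ᵢ ↟S)) := by
  simp [OvertSpace, IsOvert, valid_all_imp, tt_andI]

end Topology

/-! ### First elements of decidable sets -/

section First

variable {Γ Δ X Y Z : E}

theorem valid_lt_succ_cases {j k : Γ ⟶ Nn E} (h : Valid (ltI j (k + 1))) :
    Valid (ltI j k ∨ᵢ j =ᵢ k) := by
  obtain ⟨i, hi⟩ := valid_ltI.1 h
  have hi : j + i = k := add_right_cancel hi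
  refine nat_cases_elim i (fun Δ σ h0 => ?_) (fun Δ σ m hm => ?_)
  · simp
    refine Valid.inr (valid_eqI.2 ?_) _
    rw [← hi, comp_add_nat, h0, add_zero]
  · simp
    refine Valid.inl (valid_ltI.2 ⟨m, ?_⟩) _
    rw [← hi, comp_add_nat, hm, add_assoc]

theorem ltI_succ (k : Γ ⟶ Nn E) : Valid (ltI k (k + 1)) := valid_ltI.2 ⟨0, by simp⟩

theorem ltI_succ_of_ltI {j k : Γ ⟶ Nn E} (h : Valid (ltI j k)) : Valid (ltI j (k + 1)) := by
  obtain ⟨i, hi⟩ := valid_ltI.1 h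
  exact valid_ltI.2 ⟨i + 1, by rw [← hi]; ring⟩

theorem not_ltI_zero {j : Γ ⟶ Nn E} (h : Valid (ltI j 0)) : Valid (ff : Γ ⟶ Om E) := by
  obtain ⟨i, hi⟩ := valid_ltI.1 h
  exact succI_ne_zeroI (n := j + i) (by simpa using hi)

/-- No number below `k` belongs to `A`. -/
def noneBelow (A : Γ ⟶ Pw (Nn E)) (k : Γ ⟶ Nn E) : Γ ⟶ Om E :=
  all (Nn E) fun j => ltI j ↟k →ᵢ ¬ᵢ (j ∈ᵢ ↟A)

@[simp] theorem comp_noneBelow (σ : Δ ⟶ Γ) (A : Γ ⟶ Pw (Nn E)) (k : Γ ⟶ Nn E) :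
    σ ≫ noneBelow A k = noneBelow (σ ≫ A) (σ ≫ k) := by
  simp [noneBelow]

theorem valid_noneBelow {A : Γ ⟶ Pw (Nn E)} {k : Γ ⟶ Nn E} : Valid (noneBelow A k) ↔
    ∀ ⦃Δ : E⦄ (σ : Δ ⟶ Γ) (j : Δ ⟶ Nn E), Valid (ltI j (σ ≫ k)) → Valid (j ∈ᵢ σ ≫ A) →
      Valid (ff : Δ ⟶ Om E) := by
  simp [noneBelow, valid_all_imp_imp, notI, -IsEmpty.forall_iff]

theorem noneBelow_zero (A : Γ ⟶ Pw (Nn E)) : Valid (noneBelow A 0) :=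
  valid_noneBelow.2 fun Δ σ j h _ => not_ltI_zero (by simpa using h)

theorem noneBelow_succ (A : Γ ⟶ Pw (Nn E)) (k : Γ ⟶ Nn E) :
    noneBelow A (k + 1) = (noneBelow A k ∧ᵢ ¬ᵢ (k ∈ᵢ A)) := by
  refine omega_ext fun Δ σ => ?_
  simp [valid_noneBelow, valid_notI, -IsEmpty.forall_iff]
  constructor
  · intro h
    exact ⟨fun Θ τ j hj hA => h τ j (ltI_succ_of_ltI hj) hA,
      fun Θ τ hA => h τ (τ ≫ σ ≫ k) (ltI_succ _) hA⟩
  · rintro ⟨h, h'⟩ Θ τ j hj hA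
    refine (valid_lt_succ_cases hj).or_elim (fun Ξ ρ hl => ?_) (fun Ξ ρ he => ?_)
    · simp at hl ⊢
      exact h (ρ ≫ τ) (ρ ≫ j) (by simpa using hl) (by simpa using hA.comp ρ)
    · have := hA.comp ρ
      simp at he this ⊢
      exact h' (ρ ≫ τ) (by simpa [he] using this)

theorem dec_noneBelow {A : Γ ⟶ Pw (Nn E)} (hA : Valid (IsDecidable A)) (k : Γ ⟶ Nn E) :
    Valid (noneBelow A k ∨ᵢ ¬ᵢ (noneBelow A k)) := by
  have := nat_induction (fun k : Nn E ⊗ Γ ⟶ Nn E => noneBelow ↟A k ∨ᵢ ¬ᵢ (noneBelow ↟A k))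
    (by
      simp
      exact Valid.inl (noneBelow_zero _) _)
    (fun Δ σ k h => by
      simp at h ⊢
      rw [noneBelow_succ]
      refine dec_and h (((hA.on σ).dec k).or_elim (fun Θ τ h => ?_) (fun Θ τ h => ?_))
      · simp at h ⊢
        exact Valid.inr h.not_not _
      · simp at h ⊢
        exact Valid.inl h _) k
  simpa using this

/-- Bounded search: by induction on the bound, either no element of `A` lies below it or a least
element exists. The bound `k + 1` excludes the first alternative. -/
theorem exists_first {A : Γ ⟶ Pw (Nn E)} (hA : Valid (IsDecidable A)) {k : Γ ⟶ Nn E}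
    (hk : Valid (k ∈ᵢ A)) : ∃ (Δ : E) (σ : Δ ⟶ Γ) (m : Δ ⟶ Nn E), Epi σ ∧
      Valid (m ∈ᵢ σ ≫ A) ∧ Valid (noneBelow (σ ≫ A) m) := by
  have := nat_induction (fun k : Nn E ⊗ Γ ⟶ Nn E => noneBelow ↟A k ∨ᵢ
      ex (Nn E) fun m => m ∈ᵢ ↟A ∧ᵢ noneBelow ↟A m)
    (by
      simp
      exact Valid.inl (noneBelow_zero _) _)
    (fun Δ σ k h => by
      simp at h ⊢
      rw [noneBelow_succ]
      refine h.or_elim (fun Θ τ h => ?_) (fun Θ τ h => ?_)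
      · refine (hA.on (τ ≫ σ)).dec (τ ≫ k) |>.or_elim (fun Ξ ρ h' => ?_) (fun Ξ ρ h' => ?_)
        · have := h.comp ρ
          simp at h' this ⊢
          exact Valid.inr (Valid.exC_intro (ρ ≫ τ ≫ k) (by simpa using ⟨h', this⟩)) _
        · have := h.comp ρ
          simp at h' this ⊢
          exact Valid.inl (valid_andI.2 ⟨this, h'⟩) _
      · simp at h ⊢
        exact Valid.inr h _) (k + 1)
  simp [noneBelow_succ] at this
  have h2 : Valid (ex (Γ := Γ) (Nn E) fun m => m ∈ᵢ ↟A ∧ᵢ noneBelow ↟A m) := by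
    refine this.or_elim (fun Δ σ h => ?_) (fun Δ σ h => ?_)
    · simp at h ⊢
      exact (h.2.not_elim (hk.on σ)).ff_elim _
    · simpa using h
  simp at h2
  obtain ⟨Δ, σ, m, hσ, hm⟩ := valid_exC.1 h2
  exact ⟨Δ, σ, m, hσ, by simpa using hm⟩

theorem first_unique {A : Γ ⟶ Pw (Nn E)} {m n : Γ ⟶ Nn E} (hm : Valid (m ∈ᵢ A))
    (hm' : Valid (noneBelow A m)) (hn : Valid (n ∈ᵢ A)) (hn' : Valid (noneBelow A n)) : m = n := by
  rw [← valid_eqI]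
  refine (le_or_lt m n).or_elim (fun Δ σ h => ?_) (fun Δ σ h => ?_)
  · refine (le_or_lt (σ ≫ n) (σ ≫ m)).or_elim (fun Θ τ h' => ?_) (fun Θ τ h' => ?_)
    · have := h.comp τ
      simp at this h' ⊢
      exact le_antisymm_nat this h'
    · simp at h' ⊢
      exact (valid_noneBelow.1 hn' (τ ≫ σ) _ (by simpa using h')
        (by simpa using hm.comp (τ ≫ σ))).ff_elim_eq _ _
  · simp at h ⊢
    exact (valid_noneBelow.1 hm' σ _ h (by simpa using hn.comp σ)).ff_elim_eq _ _

end First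

/-! ### Points of sober spaces -/

section Sober

variable {Γ Δ X Y Z : E}

/-- In a sober space a subsingleton which is not empty lies in a singleton, as soon as the
truth values `Q ⊆ U` are semidecidable for open `U`. -/
theorem exists_point_of_isSober (hE : SyntheticComputability E) {T : Γ ⟶ Pw (Pw X)}
    (hT : Valid (IsSober T)) {Q : Γ ⟶ Pw X}
    (hQ : ∀ ⦃Δ : E⦄ (σ : Δ ⟶ Γ) (z w : Δ ⟶ X), Valid (z ∈ᵢ σ ≫ Q) → Valid (w ∈ᵢ σ ≫ Q) → z = w)
    (hQ' : Valid (¬ᵢ ¬ᵢ (ex (Γ := Γ) X fun z => z ∈ᵢ ↟Q)))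
    (hU : ∀ ⦃Δ : E⦄ (σ : Δ ⟶ Γ) (U : Δ ⟶ Pw X), Valid (U ∈ᵢ σ ≫ T) →
      Valid (IsSd (all (Γ := Δ) X fun z => z ∈ᵢ ↟(σ ≫ Q) →ᵢ z ∈ᵢ ↟U))) :
    ∃ (Δ : E) (σ : Δ ⟶ Γ) (y : Δ ⟶ X), Epi σ ∧
      ∀ ⦃Θ : E⦄ (τ : Θ ⟶ Δ) (z : Θ ⟶ X), Valid (z ∈ᵢ τ ≫ σ ≫ Q) → z = τ ≫ y := by
  -- The candidate homomorphism is `h U = (Q ⊆ U)`. It is the neighbourhood filter of the element of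
  -- `Q` whenever there is one.
  let h : Γ ⟶ Fn (Pw X) (Om E) := lam _ fun U => all X fun z => z ∈ᵢ ↟Q →ᵢ z ∈ᵢ ↟U
  have mem_h : ∀ ⦃Δ : E⦄ (σ : Δ ⟶ Γ) (U : Δ ⟶ Pw X), Valid (app (σ ≫ h) U) ↔
      ∀ ⦃Θ : E⦄ (τ : Θ ⟶ Δ) (z : Θ ⟶ X), Valid (z ∈ᵢ τ ≫ σ ≫ Q) → Valid (z ∈ᵢ τ ≫ U) := by
    intro Δ σ U
    simp [h, valid_all_imp, -IsEmpty.forall_iff]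
  have sd_h : ∀ ⦃Δ : E⦄ (σ : Δ ⟶ Γ) (U : Δ ⟶ Pw X), Valid (U ∈ᵢ σ ≫ T) →
      Valid (IsSd (app (σ ≫ h) U)) := by
    intro Δ σ U hU'
    simpa [h] using hU σ U hU'
  have hh : Valid (IsSigmaHom T h) := by
    refine valid_isSigmaHom.2 ⟨sd_h, ?_, ?_, ?_, ?_⟩
    · have := mem_h (𝟙 Γ) univI
      simp at this
      rw [this]
      simp
    · intro Δ σ U V _ _
      refine omega_ext fun Θ τ => ?_
      simp only [comp_app, comp_interI, comp_andI, valid_andI]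
      have h1 := mem_h (τ ≫ σ)
      simp only [Category.assoc] at h1
      rw [h1, h1, h1]
      simp
      exact ⟨fun h => ⟨fun Ξ ρ z hz => (h ρ z hz).1, fun Ξ ρ z hz => (h ρ z hz).2⟩,
        fun h Ξ ρ z hz => ⟨h.1 ρ z hz, h.2 ρ z hz⟩⟩
    -- An inclusion of `Q` in the empty set would contradict that `Q` is not empty.
    · refine valid_notI.2 fun Δ σ hn => ?_
      have h1 := hQ'.on σ
      refine h1.not_elim (valid_notI.2 fun Θ τ hz => ?_)
      simp at hz
      refine hz.exC_elim fun Ξ ρ z hz => ?_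
      have h2 := (mem_h (ρ ≫ τ ≫ σ) emptyI).1 (by simpa using hn.comp (ρ ≫ τ)) (𝟙 Ξ) z
        (by simpa using hz)
      simpa using h2
    · intro Δ σ V hV
      refine omega_ext fun Θ τ => ?_
      have h1 := mem_h (τ ≫ σ) (iUnionI (τ ≫ V))
      simp only [comp_app, comp_iUnionI, Category.assoc] at h1 ⊢
      rw [h1]
      constructor
      · intro h2
        -- Preservation of joins: the goal, that `Q` is included in some `V n`, is semidecidable, so
        -- an element `z` of `Q` may be assumed. It lies in some `V n`, and then so does `Q`, which
        -- has no other element.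
        have h3 : Valid (IsSdSet (compr (Nn E) fun n => app ↟(τ ≫ σ ≫ h) (app ↟(τ ≫ V) n)
            : Θ ⟶ _)) := valid_isSdSet.2 fun Ξ ρ n => by
          simpa using sd_h (ρ ≫ τ ≫ σ) (app (ρ ≫ τ ≫ V) n) (by simpa using hV (ρ ≫ τ) n)
        have h3 := isSd_ex_nat hE h3
        have h4 := hQ'.on (τ ≫ σ)
        simp at h3 h4 ⊢
        refine isSd_stable hE h3 (h4.not_not_bind fun Ξ ρ hz => Valid.not_not ?_)
        simp at hz ⊢
        refine hz.exC_elim fun Λ κ z hz => ?_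
        have h5 := h2 (κ ≫ ρ) z (by simpa using hz)
        simp [iUnionI] at h5 ⊢
        refine h5.exC_elim fun M μ n hn => ?_
        simp at hn ⊢
        refine Valid.exC_intro n ?_
        have h6 := mem_h (μ ≫ κ ≫ ρ ≫ τ ≫ σ) (app (μ ≫ κ ≫ ρ ≫ τ ≫ V) n)
        simp at h6 ⊢
        refine h6.2 fun N ν w hw => ?_
        simp at hz
        rw [hQ (ν ≫ μ ≫ κ ≫ ρ ≫ τ ≫ σ) w (ν ≫ μ ≫ z) (by simpa using hw)
          (by simpa using hz.comp (ν ≫ μ))]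
        simpa using hn.comp ν
      · intro h2 Ξ ρ z hz
        simp at h2
        have h2 := h2.on ρ
        refine h2.exC_elim fun Λ κ n hn => ?_
        simp [iUnionI] at hn ⊢
        refine Valid.exC_intro n ?_
        have h3 := (mem_h (κ ≫ ρ ≫ τ ≫ σ) (app (κ ≫ ρ ≫ τ ≫ V) n)).1 (by simpa using hn) (𝟙 _)
          (κ ≫ z) (by simpa using hz.comp κ)
        simpa using h3
  obtain ⟨Δ, σ, y, hσ, hy⟩ := (valid_isSober.1 hT).2 (𝟙 Γ) h (by simpa using hh)
  -- For `z ∈ Q` and open `U`, `z ∈ U` is equivalent to `Q ⊆ U` and hence to `y ∈ U`; points with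
  -- the same open neighbourhoods are equal.
  refine ⟨Δ, σ, y, hσ, fun Θ τ z hz => (valid_isSober.1 hT).1 (τ ≫ σ) _ _ fun Ξ ρ U hU => ?_⟩
  have h1 := hy (ρ ≫ τ) U (by simpa using hU)
  have h2 := mem_h (ρ ≫ τ ≫ σ) U
  simp at h1 h2
  rw [← h1]
  refine omega_ext fun Λ κ => ?_
  have h3 := mem_h (κ ≫ ρ ≫ τ ≫ σ) (κ ≫ U)
  simp at h3 ⊢
  rw [h3]
  constructor
  · intro h4 M μ w hw
    rw [hQ (μ ≫ κ ≫ ρ ≫ τ ≫ σ) w (μ ≫ κ ≫ ρ ≫ z) (by simpa using hw)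
      (by simpa using hz.comp (μ ≫ κ ≫ ρ))]
    simpa using h4.comp μ
  · intro h4
    have := h4 (𝟙 _) (κ ≫ ρ ≫ z) (by simpa using hz.comp (κ ≫ ρ))
    simpa using this

end Sober

/-! ### Density in the intrinsic topology -/

section Density

variable {Γ Δ X Y Z : E}

/-- The intersection of the basic sets `B i` with `i ∈ e j` for some `j < k`. -/
def finInter (B : Γ ⟶ Fn (Nn E) (Pw X)) (e : Γ ⟶ Fn (Nn E) (Pw (Nn E))) (k : Γ ⟶ Nn E) :
    Γ ⟶ Pw X :=
  compr X fun z => all (Nn E) fun j => all (Nn E) fun i =>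
    ltI ↟j ↟k →ᵢ i ∈ᵢ app ↟e ↟j →ᵢ ↟z ∈ᵢ app ↟B i

@[simp] theorem comp_finInter (σ : Δ ⟶ Γ) (B : Γ ⟶ Fn (Nn E) (Pw X))
    (e : Γ ⟶ Fn (Nn E) (Pw (Nn E))) (k : Γ ⟶ Nn E) :
    σ ≫ finInter B e k = finInter (σ ≫ B) (σ ≫ e) (σ ≫ k) := by
  simp [finInter]

theorem valid_mem_finInter {B : Γ ⟶ Fn (Nn E) (Pw X)} {e : Γ ⟶ Fn (Nn E) (Pw (Nn E))}
    {k : Γ ⟶ Nn E} {z : Γ ⟶ X} : Valid (z ∈ᵢ finInter B e k) ↔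
      ∀ ⦃Δ : E⦄ (σ : Δ ⟶ Γ) (j i : Δ ⟶ Nn E), Valid (ltI j (σ ≫ k)) →
        Valid (i ∈ᵢ app (σ ≫ e) j) → Valid (σ ≫ z ∈ᵢ app (σ ≫ B) i) := by
  simp [finInter, valid_all_all_imp_imp, -IsEmpty.forall_iff]

theorem finInter_zero (B : Γ ⟶ Fn (Nn E) (Pw X)) (e : Γ ⟶ Fn (Nn E) (Pw (Nn E))) :
    finInter B e 0 = univI := by
  refine set_ext fun Δ σ z => ?_
  simp [valid_mem_finInter, -IsEmpty.forall_iff]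
  intro Θ τ j i hj _
  exact (not_ltI_zero hj).ff_elim _

theorem finInter_succ (B : Γ ⟶ Fn (Nn E) (Pw X)) (e : Γ ⟶ Fn (Nn E) (Pw (Nn E)))
    (k : Γ ⟶ Nn E) : finInter B e (k + 1) = interI (finInter B e k) (compr X fun z =>
      all (Nn E) fun i => i ∈ᵢ app ↟e ↟k →ᵢ ↟z ∈ᵢ app ↟B i) := by
  refine set_ext fun Δ σ z => ?_
  simp [valid_mem_finInter, valid_all_imp, -IsEmpty.forall_iff]
  constructor
  · intro h
    exact ⟨fun Θ τ j i hj hi => h τ j i (ltI_succ_of_ltI hj) hi,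
      fun Θ τ i hi => h τ _ i (ltI_succ _) hi⟩
  · rintro ⟨h, h'⟩ Θ τ j i hj hi
    refine (valid_lt_succ_cases hj).or_elim (fun Ξ ρ hl => ?_) (fun Ξ ρ he => ?_)
    · have := h (ρ ≫ τ) (ρ ≫ j) (ρ ≫ i) (by simpa using hl) (by simpa using hi.comp ρ)
      simpa using this
    · have := hi.comp ρ
      simp at he this ⊢
      rw [he] at this
      simpa using h' (ρ ≫ τ) (ρ ≫ i) (by simpa using this)

/-- The intersection of `B i` for `i` in a set which is empty or a singleton. -/
theorem finInter_mem {T : Γ ⟶ Pw (Pw X)} (hT : Valid (IsTopology T))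
    {B : Γ ⟶ Fn (Nn E) (Pw X)}
    (hB : ∀ ⦃Δ : E⦄ (σ : Δ ⟶ Γ) (n : Δ ⟶ Nn E), Valid (app (σ ≫ B) n ∈ᵢ σ ≫ T))
    {e : Γ ⟶ Fn (Nn E) (Pw (Nn E))} {F : Γ ⟶ Pw (Nn E)} (he : Valid (Enumerates e F))
    (k : Γ ⟶ Nn E) : Valid (finInter B e k ∈ᵢ T) := by
  have := nat_induction (fun k : Nn E ⊗ Γ ⟶ Nn E => finInter ↟B ↟e k ∈ᵢ ↟T)
    (by
      simp [finInter_zero]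
      exact (valid_isTopology.1 hT).2.1)
    (fun Δ σ k h => by
      simp [finInter_succ] at h ⊢
      refine (valid_isTopology.1 hT).2.2.1 σ _ _ h ?_
      -- The factor added at step `k` is the whole space if the enumeration skips and a basic set
      -- otherwise; both are open.
      refine (he.on σ).enumerates_cases k (fun Θ τ h0 => ?_) (fun Θ τ i hi _ => ?_)
      · have h1 := (valid_isTopology.1 hT).2.1.on (τ ≫ σ)
        simp at h0 h1 ⊢
        rwa [show setC _ = (univI : Θ ⟶ Pw X) from ?_]
        refine set_ext fun Ξ ρ z => ?_
        have h2 := congrArg (fun t => ρ ≫ t) h0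
        simp at h2
        simp [valid_all_imp, -IsEmpty.forall_iff]
        intro Λ κ i hi
        have h3 := congrArg (fun t => κ ≫ t) h2
        simp at h3
        rw [h3] at hi
        simp at hi
        exact hi.ff_elim _
      · have h1 := hB (τ ≫ σ) i
        simp at hi h1 ⊢
        rwa [show setC _ = app (τ ≫ σ ≫ B) i from ?_]
        refine set_ext fun Ξ ρ z => ?_
        have h2 := congrArg (fun t => ρ ≫ t) hi
        simp at h2
        simp [valid_all_imp, -IsEmpty.forall_iff]
        constructor
        · intro h3
          have h4 := h3 (𝟙 Ξ) (ρ ≫ i) (by simp [h2])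
          simpa using h4
        · intro h3 Λ κ j hj
          have h4 := congrArg (fun t => κ ≫ t) h2
          simp at h4
          rw [h4] at hj
          simp at hj
          rw [hj]
          simpa using h3.comp κ) k
  simpa using this

/-- A dense set contains a sequence which converges to a given point of a countably based space. -/
theorem exists_approximation (hE : SyntheticComputability E) {T : Γ ⟶ Pw (Pw X)}
    (hT : Valid (IsTopology T)) {B : Γ ⟶ Fn (Nn E) (Pw X)} (hB : Valid (IsBase B T))
    {D : Γ ⟶ Pw X} (hD : Valid (IsDenseSet T D)) (x : Γ ⟶ X) :
    ∃ (Δ : E) (σ : Δ ⟶ Γ) (e : Δ ⟶ Fn (Nn E) (Pw (Nn E))) (y : Δ ⟶ Fn (Nn E) X), Epi σ ∧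
      Valid (Enumerates e (σ ≫ compr (Nn E) fun i => ↟x ∈ᵢ app ↟B i)) ∧
      ∀ ⦃Θ : E⦄ (τ : Θ ⟶ Δ) (k : Θ ⟶ Nn E), Valid (app (τ ≫ y) k ∈ᵢ τ ≫ σ ≫ D) ∧
        Valid (app (τ ≫ y) k ∈ᵢ finInter (τ ≫ σ ≫ B) (τ ≫ e) k) := by
  have hB' := (valid_isBase.1 hB).1
  have hF : Valid (IsSdSet (compr (Nn E) fun i => ↟x ∈ᵢ app ↟B i : Γ ⟶ _)) :=
    valid_isSdSet.2 fun Δ σ i => by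
      simpa using ((valid_isTopology.1 hT).1 σ _ (hB' σ i)).sd (σ ≫ x)
  -- The indices of basic sets containing `x` form a semidecidable set, so they can be enumerated.
  -- Each finite intersection along the enumeration is an open neighbourhood of `x` and hence meets
  -- `D`.
  obtain ⟨Δ, σ, e, _, he⟩ := valid_isCountable.1 (isCountable_of_isSdSet hE hF)
  obtain ⟨Θ, τ, y, _, hy⟩ := countable_choice hE (X := X) (Γ := Δ)
    (compr (Nn E ⊗ X) fun w => (w ≫ snd _ _ ∈ᵢ ↟(σ ≫ D)) ∧ᵢ
      (w ≫ snd _ _ ∈ᵢ finInter ↟(σ ≫ B) ↟e (w ≫ fst _ _)))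
    (fun Θ τ k => by
      have hT' := hT.on (τ ≫ σ)
      have h1 := finInter_mem hT' (B := τ ≫ σ ≫ B)
        (fun Ξ ρ n => by simpa using hB' (ρ ≫ τ ≫ σ) n) (he.on τ) k
      obtain ⟨Ξ, ρ, y, hρ, hyD, hyV⟩ := valid_isDenseSet.1 hD (τ ≫ σ) _ (τ ≫ σ ≫ x)
        (by simpa using h1) (by
          refine valid_mem_finInter.2 fun Λ κ j i hj hi => ?_
          have := (he.on (κ ≫ τ)).enumerates_mem hi
          simpa using this)
      exact ⟨Ξ, ρ, y, hρ, by simpa using ⟨by simpa using hyD, by simpa using hyV⟩⟩)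
  simp at hy
  exact ⟨Θ, τ ≫ σ, τ ≫ e, y, inferInstance, by simpa using he.comp τ, by simpa using hy⟩

/-- If the dense countable set `D` misses the semidecidable neighbourhood `S` of `x`, then
semidecidable truth values are closed under negation. -/
theorem isSd_not_of_disjoint (hE : SyntheticComputability E) {T : Γ ⟶ Pw (Pw X)}
    (hT : Valid (IsTopology T)) (hT' : Valid (IsSober T)) {B : Γ ⟶ Fn (Nn E) (Pw X)}
    (hB : Valid (IsBase B T)) {D S : Γ ⟶ Pw X} {x : Γ ⟶ X} {e : Γ ⟶ Fn (Nn E) (Pw (Nn E))}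
    {y : Γ ⟶ Fn (Nn E) X} (he : Valid (Enumerates e (compr (Nn E) fun i => ↟x ∈ᵢ app ↟B i)))
    (hy : ∀ ⦃Δ : E⦄ (σ : Δ ⟶ Γ) (k : Δ ⟶ Nn E), Valid (app (σ ≫ y) k ∈ᵢ σ ≫ D) ∧
      Valid (app (σ ≫ y) k ∈ᵢ finInter (σ ≫ B) (σ ≫ e) k))
    (hS : Valid (IsSdSet S)) (hx : Valid (x ∈ᵢ S))
    (hDS : ∀ ⦃Δ : E⦄ (σ : Δ ⟶ Γ) (z : Δ ⟶ X), Valid (z ∈ᵢ σ ≫ D) → Valid (z ∈ᵢ σ ≫ S) →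
      Valid (ff : Δ ⟶ Om E)) {p : Γ ⟶ Om E} (hp : Valid (IsSd p)) : Valid (IsSd (¬ᵢ p)) := by
  obtain ⟨Δ, σ, A, _, hA, hpA⟩ := valid_isSd.1 hp
  refine Valid.of_epi σ ?_
  -- `Q` contains `x` if `p` fails and `y k` if `k` is the first witness of `p`. Which case holds
  -- cannot be decided, so `Q` is not known to be inhabited.
  let Q : Δ ⟶ Pw X := compr X fun z => (¬ᵢ ↟(σ ≫ p) ∧ᵢ z =ᵢ ↟(σ ≫ x)) ∨ᵢ
    ex (Nn E) fun k => k ∈ᵢ ↟A ∧ᵢ noneBelow ↟A k ∧ᵢ ↟z =ᵢ app ↟(σ ≫ y) k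
  have not_p : ∀ ⦃Θ : E⦄ (τ : Θ ⟶ Δ), Valid (¬ᵢ (τ ≫ σ ≫ p)) → ∀ k : Θ ⟶ Nn E,
      Valid (k ∈ᵢ τ ≫ A) → Valid (ff : Θ ⟶ Om E) := by
    intro Θ τ h k hk
    refine h.not_elim ?_
    rw [hpA]
    simp
    exact Valid.exC_intro k (by simpa using hk)
  have Q_elim : ∀ ⦃Θ : E⦄ (τ : Θ ⟶ Δ) (z : Θ ⟶ X) (r : Θ ⟶ Om E), Valid (z ∈ᵢ τ ≫ Q) →
      (∀ ⦃Ξ : E⦄ (ρ : Ξ ⟶ Θ), Valid (¬ᵢ (ρ ≫ τ ≫ σ ≫ p)) → ρ ≫ z = ρ ≫ τ ≫ σ ≫ x →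
        Valid (ρ ≫ r)) →
      (∀ ⦃Ξ : E⦄ (ρ : Ξ ⟶ Θ) (k : Ξ ⟶ Nn E), Valid (k ∈ᵢ ρ ≫ τ ≫ A) →
        Valid (noneBelow (ρ ≫ τ ≫ A) k) → ρ ≫ z = app (ρ ≫ τ ≫ σ ≫ y) k → Valid (ρ ≫ r)) →
      Valid r := by
    intro Θ τ z r hz h1 h2
    simp [Q] at hz
    refine hz.or_elim (fun Ξ ρ h => ?_) (fun Ξ ρ h => ?_)
    · simp at h
      exact h1 ρ h.1 h.2
    · simp at h
      refine h.exC_elim fun Λ κ k hk => ?_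
      simp at hk
      simpa using h2 (κ ≫ ρ) k (by simpa using hk.1) (by simpa using hk.2.1) (by simpa using hk.2.2)
  have Q_left : ∀ ⦃Θ : E⦄ (τ : Θ ⟶ Δ), Valid (¬ᵢ (τ ≫ σ ≫ p)) →
      Valid (τ ≫ σ ≫ x ∈ᵢ τ ≫ Q) := by
    intro Θ τ h
    simp [Q]
    exact Valid.inl (by simpa using h) _
  have Q_right : ∀ ⦃Θ : E⦄ (τ : Θ ⟶ Δ) (k : Θ ⟶ Nn E), Valid (k ∈ᵢ τ ≫ A) →
      Valid (noneBelow (τ ≫ A) k) → Valid (app (τ ≫ σ ≫ y) k ∈ᵢ τ ≫ Q) := by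
    intro Θ τ k h h'
    simp [Q]
    exact Valid.inr (Valid.exC_intro k (by simpa using ⟨h, h'⟩)) _
  have Q_unique : ∀ ⦃Θ : E⦄ (τ : Θ ⟶ Δ) (z w : Θ ⟶ X), Valid (z ∈ᵢ τ ≫ Q) →
      Valid (w ∈ᵢ τ ≫ Q) → z = w := by
    intro Θ τ z w hz hw
    rw [← valid_eqI]
    refine Q_elim τ z _ hz (fun Ξ ρ hp hz => ?_) (fun Ξ ρ k hk hk' hz => ?_)
    · refine Q_elim (ρ ≫ τ) (ρ ≫ w) _ (by simpa using hw.comp ρ) (fun Λ κ _ hw => ?_)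
        (fun Λ κ l hl _ hw => ?_)
      · simp at hw
        simp [hw, hz]
      · exact (not_p (κ ≫ ρ ≫ τ) (by simpa using hp.comp κ) l (by simpa using hl)).ff_elim _
    · refine Q_elim (ρ ≫ τ) (ρ ≫ w) _ (by simpa using hw.comp ρ) (fun Λ κ hp hw => ?_)
        (fun Λ κ l hl hl' hw => ?_)
      · exact (not_p (κ ≫ ρ ≫ τ) (by simpa using hp) (κ ≫ k) (by simpa using hk.comp κ)).ff_elim _
      · have e := first_unique (A := κ ≫ ρ ≫ τ ≫ A) (m := κ ≫ k) (n := l)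
          (by simpa using hk.comp κ) (by simpa using hk'.comp κ) (by simpa using hl)
          (by simpa using hl')
        have e' := congrArg (fun t => κ ≫ t) hz
        simp at hw e' ⊢
        rw [e', hw, e]
  have Q_inhabited : Valid (¬ᵢ ¬ᵢ (ex (Γ := Δ) X fun z => z ∈ᵢ ↟Q)) := by
    refine valid_not_not_of_cases (q := σ ≫ p) (fun Θ τ h => ?_) (fun Θ τ h => ?_)
    · rw [hpA] at h
      simp at h ⊢
      refine h.exC_elim fun Ξ ρ k hk => ?_
      simp at hk ⊢
      obtain ⟨Λ, κ, m, _, hm, hm'⟩ := exists_first (hA.on (ρ ≫ τ)) (by simpa using hk)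
      refine Valid.of_epi κ ?_
      simp
      exact Valid.exC_intro _ (by
        simpa using Q_right (κ ≫ ρ ≫ τ) m (by simpa using hm) (by simpa using hm'))
    · simp
      exact Valid.exC_intro _ (by simpa using Q_left τ h)
  -- The inclusion `Q ⊆ U` is shown to be equivalent to the disjunction of two searches, `h1` and
  -- `h2`.
  have Q_sd : ∀ ⦃Θ : E⦄ (τ : Θ ⟶ Δ) (U : Θ ⟶ Pw X), Valid (U ∈ᵢ τ ≫ σ ≫ T) →
      Valid (IsSd (all (Γ := Θ) X fun z => z ∈ᵢ ↟(τ ≫ Q) →ᵢ z ∈ᵢ ↟U)) := by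
    intro Θ τ U hU
    obtain ⟨Ξ, ρ, I, _, hI, hUI⟩ := (valid_isBase.1 hB).2 (τ ≫ σ) U (by simpa using hU)
    refine Valid.of_epi ρ ?_
    have hA' := hA.on (ρ ≫ τ)
    -- First search: a step `k` at which `e` lists an `i` with `B i` among the basic sets composing
    -- `U`, while no number up to and including `k` is in `A`. The bound `k + 1` matters: a first
    -- witness `m` then satisfies `k < m`, so `y m` was chosen inside `B i`.
    have h1 : Valid (IsSdSet (compr (Nn E) fun k => noneBelow ↟(ρ ≫ τ ≫ A) (k + 1) ∧ᵢ
        ex (Nn E) fun i => i ∈ᵢ app ↟(ρ ≫ τ ≫ σ ≫ e) ↟k ∧ᵢ i ∈ᵢ ↟I : Ξ ⟶ _)) := by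
      refine valid_isSdSet.2 fun Λ κ k => ?_
      have h2 := dec_noneBelow (hA'.on κ) (k + 1)
      have h3 := isSd_ex_term (he.on (κ ≫ ρ ≫ τ ≫ σ)) k (S := κ ≫ I) fun M μ i _ => by
        simpa using (isSdSet_of_isCountable (hI.on (μ ≫ κ))).sd i
      simpa using isSd_dec_and h2 h3
    -- Second search: the first element `k` of `A`, followed by a verification that `y k ∈ U`.
    have h2 : Valid (IsSdSet (compr (Nn E) fun k => (k ∈ᵢ ↟(ρ ≫ τ ≫ A) ∧ᵢ
        noneBelow ↟(ρ ≫ τ ≫ A) k) ∧ᵢ app ↟(ρ ≫ τ ≫ σ ≫ y) k ∈ᵢ ↟(ρ ≫ U) : Ξ ⟶ _)) := by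
      refine valid_isSdSet.2 fun Λ κ k => ?_
      have h3 := dec_noneBelow (hA'.on κ) k
      have h4 := (valid_isTopology.1 hT).1 (κ ≫ ρ ≫ τ ≫ σ) (κ ≫ ρ ≫ U)
        (by simpa using hU.comp (κ ≫ ρ))
      simpa using isSd_dec_and (dec_and ((hA'.on κ).dec k) h3)
        (h4.sd (app (κ ≫ ρ ≫ τ ≫ σ ≫ y) k))
    have h3 := isSd_or (isSd_ex_nat hE h1) (isSd_ex_nat hE h2)
    set q : Ξ ⟶ Om E := _ ∨ᵢ _ with hq
    change Valid (IsSd q) at h3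
    suffices e : (ρ ≫ all (Γ := Θ) X fun z => z ∈ᵢ ↟(τ ≫ Q) →ᵢ z ∈ᵢ ↟U) = q by
      rw [comp_IsSd, e]
      exact h3
    refine omega_ext fun Λ κ => ?_
    simp [valid_all_imp, -IsEmpty.forall_iff]
    constructor
    · intro h
      have h4 := Q_inhabited.on (κ ≫ ρ ≫ τ)
      -- The disjunction is semidecidable, so an element of `Q` may be assumed; its two possible
      -- origins make the respective searches succeed.
      refine isSd_stable hE (by simpa using h3.comp κ)
        (h4.not_not_bind fun M μ hz => Valid.not_not ?_)
      simp at hz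
      refine hz.exC_elim fun N ν z hz => ?_
      simp at hz
      have hzU := h (ν ≫ μ) z (by simpa using hz)
      refine Q_elim (ν ≫ μ ≫ κ ≫ ρ ≫ τ) z _ (by simpa using hz) (fun M' μ' hp hz => ?_)
        (fun M' μ' k hk hk' hz => ?_)
      · have h5 := hzU.comp μ'
        simp at hz h5
        rw [hz] at h5
        have h6 := hUI (μ' ≫ ν ≫ μ ≫ κ) (μ' ≫ ν ≫ μ ≫ κ ≫ ρ ≫ τ ≫ σ ≫ x)
        simp at h6
        rw [h6] at h5
        refine h5.exC_elim fun N' ν' i hi => ?_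
        simp at hi
        obtain ⟨Λ', κ', k, _, hk⟩ := Valid.exists_enumerates
          (he.on (ν' ≫ μ' ≫ ν ≫ μ ≫ κ ≫ ρ ≫ τ ≫ σ)) (x := i) (by simpa using hi.2)
        refine Valid.of_epi κ' ?_
        simp [hq]
        refine Valid.inl (Valid.exC_intro k ?_) _
        simp at hk ⊢
        refine ⟨valid_noneBelow.2 fun _ η j _ hj => not_p (η ≫ κ' ≫ ν' ≫ μ' ≫ ν ≫ μ ≫ κ ≫ ρ ≫ τ)
          (by simpa using hp.comp (η ≫ κ' ≫ ν')) j (by simpa using hj),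
          Valid.exC_intro (κ' ≫ i) ?_⟩
        simp
        exact ⟨hk, hi.1.on κ'⟩
      · have h5 := hzU.comp μ'
        simp at hz h5 hk hk'
        rw [hz] at h5
        simp [hq]
        exact Valid.inr (Valid.exC_intro k (by simpa using ⟨⟨hk, hk'⟩, h5⟩)) _
    · intro h M μ z hz
      simp [hq] at h
      have h := h.on μ
      refine h.or_elim (fun N ν h => ?_) (fun N ν h => ?_)
      · simp at h
        refine h.exC_elim fun N' ν' k hk => ?_
        simp at hk
        obtain ⟨hk, hi⟩ := hk
        refine hi.exC_elim fun M' μ' i hi => ?_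
        simp at hi
        have hz' := hz.comp (μ' ≫ ν' ≫ ν)
        simp at hz' ⊢
        refine Q_elim (μ' ≫ ν' ≫ ν ≫ μ ≫ κ ≫ ρ ≫ τ) _ _ (by simpa using hz')
          (fun M'' μ'' hp hz => ?_) (fun M'' μ'' m hm hm' hz => ?_)
        · simp at hz ⊢
          rw [hz]
          have h6 := hUI (μ'' ≫ μ' ≫ ν' ≫ ν ≫ μ ≫ κ)
            (μ'' ≫ μ' ≫ ν' ≫ ν ≫ μ ≫ κ ≫ ρ ≫ τ ≫ σ ≫ x)
          simp at h6
          rw [h6]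
          have h7 := (he.on (μ' ≫ ν' ≫ ν ≫ μ ≫ κ ≫ ρ ≫ τ ≫ σ)).enumerates_mem hi.1
          exact Valid.exC_intro (μ'' ≫ i)
            (by simpa using ⟨hi.2.on μ'', by simpa using h7.comp μ''⟩)
        -- For `m ≤ k` the first search would have seen `m ∈ A`. For `k < m` the basic set listed at
        -- step `k` is one of the sets intersected in the choice of `y m`.
        · refine (le_or_lt m (μ'' ≫ μ' ≫ k)).or_elim (fun N'' ν'' hl => ?_) (fun N'' ν'' hl => ?_)
          · simp at hl hm
            have := valid_noneBelow.1 hk (ν'' ≫ μ'' ≫ μ') (ν'' ≫ m)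
              (by simpa using ltI_of_leI_of_ltI hl (ltI_succ _)) (by simpa using hm.comp ν'')
            exact this.ff_elim _
          · have h8 := congrArg (fun t => ν'' ≫ t) hz
            simp at h8 hl ⊢
            rw [h8]
            have h6 := hUI (ν'' ≫ μ'' ≫ μ' ≫ ν' ≫ ν ≫ μ ≫ κ)
              (app (ν'' ≫ μ'' ≫ μ' ≫ ν' ≫ ν ≫ μ ≫ κ ≫ ρ ≫ τ ≫ σ ≫ y) (ν'' ≫ m))
            simp at h6
            rw [h6]
            have h7 := valid_mem_finInter.1
              (hy (ν'' ≫ μ'' ≫ μ' ≫ ν' ≫ ν ≫ μ ≫ κ ≫ ρ ≫ τ ≫ σ) (ν'' ≫ m)).2 (𝟙 _)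
              (ν'' ≫ μ'' ≫ μ' ≫ k) (ν'' ≫ μ'' ≫ i) (by simpa using hl)
              (by simpa using hi.1.comp (ν'' ≫ μ''))
            exact Valid.exC_intro (ν'' ≫ μ'' ≫ i)
              (by simpa using ⟨hi.2.on (ν'' ≫ μ''), by simpa using h7⟩)
      · simp at h
        refine h.exC_elim fun N' ν' k hk => ?_
        simp at hk ⊢
        have h5 := Q_unique (ν' ≫ ν ≫ μ ≫ κ ≫ ρ ≫ τ) (ν' ≫ ν ≫ z) _
          (by simpa using hz.comp (ν' ≫ ν))
          (Q_right (ν' ≫ ν ≫ μ ≫ κ ≫ ρ ≫ τ) k (by simpa using hk.1.1) (by simpa using hk.1.2))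
        rw [h5]
        simpa using hk.2
  obtain ⟨Θ, τ, w, _, hw⟩ := exists_point_of_isSober hE (hT'.on σ) Q_unique Q_inhabited
    (by simpa using Q_sd)
  refine Valid.of_epi τ ?_
  -- If `p` fails, then `x ∈ Q` and `w = x ∈ S`. If `p` holds with first witness `m`, then `w = y m
  -- ∈ D`, which excludes `w ∈ S`.
  have e : (τ ≫ σ ≫ ¬ᵢ p) = (w ∈ᵢ τ ≫ σ ≫ S) := by
    refine omega_ext fun Ξ ρ => ?_
    simp
    constructor
    · intro h
      rw [← hw ρ _ (by simpa using Q_left (ρ ≫ τ) (by simpa using h))]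
      simpa using hx.comp (ρ ≫ τ ≫ σ)
    · intro h
      refine valid_notI.2 fun Λ κ hp => ?_
      rw [hpA] at hp
      simp at hp
      refine hp.exC_elim fun M μ k hk => ?_
      obtain ⟨N, ν, m, _, hm, hm'⟩ := exists_first (hA.on (μ ≫ κ ≫ ρ ≫ τ)) (by simpa using hk)
      refine Valid.of_epi ν ?_
      have h1 := hw (ν ≫ μ ≫ κ ≫ ρ) _ (by
        simpa using Q_right (ν ≫ μ ≫ κ ≫ ρ ≫ τ) m (by simpa using hm) (by simpa using hm'))
      have h2 := h.comp (ν ≫ μ ≫ κ)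
      simp at h1 h2 ⊢
      rw [← h1] at h2
      have h3 := hDS (ν ≫ μ ≫ κ ≫ ρ ≫ τ ≫ σ) _
        (by simpa using (hy (ν ≫ μ ≫ κ ≫ ρ ≫ τ ≫ σ) m).1) (by simpa using h2)
      simpa using h3
  have h1 := (hS.on (τ ≫ σ)).sd w
  simp only [comp_IsSd]
  rw [e]
  exact h1

end Density

/-! ### Overtness of separable sober spaces -/

section Overt

variable {Γ Δ X Y Z : E}

/-- Countability of `D` makes `∃ y ∈ D, y ∈ S` semidecidable, so it may be assumed false. Then
`isSd_not_of_disjoint` closes semidecidability under negation, against `false_of_isSd_not`. -/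
theorem isDenseSet_intrinsic (hE : SyntheticComputability E) {T : Γ ⟶ Pw (Pw X)}
    (hT : Valid (IsCountablyBased T)) (hT' : Valid (IsSober T)) {D : Γ ⟶ Pw X}
    (hD : Valid (IsCountable D)) (hDT : Valid (IsDenseSet T D)) :
    Valid (IsDenseSet (intrinsic X) D) := by
  obtain ⟨hT, Δ₀, σ₀, B, _, hB⟩ := valid_isCountablyBased.1 hT
  refine Valid.of_epi σ₀ ?_
  simp
  refine valid_isDenseSet.2 fun Δ σ S x hS hx => ?_
  simp [intrinsic] at hS
  have hG := isSd_ex_countable hE (hD.on (σ ≫ σ₀)) (S := S) fun Θ τ y _ => (hS.on τ).sd y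
  have := isSd_stable hE hG (valid_notI.2 fun Θ τ hn => ?_)
  · simp at this
    obtain ⟨Θ, τ, y, hτ, hy⟩ := valid_exC.1 this
    exact ⟨Θ, τ, y, hτ, by simpa using hy⟩
  obtain ⟨Ξ, ρ, e, y, _, he, hy⟩ := exists_approximation hE (hT.on (τ ≫ σ ≫ σ₀))
    (hB.on (τ ≫ σ)) (hDT.on (τ ≫ σ ≫ σ₀)) (τ ≫ x)
  refine Valid.of_epi ρ ?_
  simp only [comp_ff]
  refine false_of_isSd_not hE fun Λ κ p hp => ?_
  refine isSd_not_of_disjoint hE (hT.on (κ ≫ ρ ≫ τ ≫ σ ≫ σ₀)) (hT'.on (κ ≫ ρ ≫ τ ≫ σ ≫ σ₀))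
    (hB.on (κ ≫ ρ ≫ τ ≫ σ)) (D := κ ≫ ρ ≫ τ ≫ σ ≫ σ₀ ≫ D) (S := κ ≫ ρ ≫ τ ≫ S)
    (x := κ ≫ ρ ≫ τ ≫ x) (e := κ ≫ e) (y := κ ≫ y)
    (by simpa using he.comp κ) (fun M μ k => by simpa using hy (μ ≫ κ) k) (hS.on (κ ≫ ρ ≫ τ))
    (hx.on (κ ≫ ρ ≫ τ)) (fun M μ z hz hz' => ?_) hp
  simp at hn
  have hn := hn.on (μ ≫ κ ≫ ρ)
  exact hn.not_elim (Valid.exC_intro z (by simpa using ⟨hz, hz'⟩))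

theorem isDenseSeq_intrinsic (hE : SyntheticComputability E) {T : Γ ⟶ Pw (Pw X)}
    (hT : Valid (IsCountablyBased T)) (hT' : Valid (IsSober T)) {a : Γ ⟶ Fn (Nn E) X}
    (ha : Valid (IsDenseSeq T a)) : Valid (IsDenseSeq (intrinsic X) a) :=
  valid_isDenseSeq.2 (isDenseSet_intrinsic hE hT hT' (isCountable_rangeI a) (valid_isDenseSeq.1 ha))

/-- By density in the intrinsic topology, `S` is inhabited exactly when it contains an element of
the countable set `D`, which is semidecidable. -/
theorem overtSpace_of_isSeparable (hE : SyntheticComputability E) {T : Γ ⟶ Pw (Pw X)}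
    (hT : Valid (IsCountablyBased T)) (hT' : Valid (IsSober T)) (hT'' : Valid (IsSeparable T)) :
    Valid (OvertSpace X : Γ ⟶ Om E) := by
  obtain ⟨Δ, σ, D, _, hD, hDT⟩ := valid_isSeparable.1 hT''
  refine Valid.of_epi σ ?_
  simp
  refine valid_overtSpace.2 fun Θ τ S hS => ?_
  have h := isDenseSet_intrinsic hE (hT.on σ) (hT'.on σ) hD hDT
  have h1 := isSd_ex_countable hE (hD.on τ) (S := S) fun Θ τ y _ => (hS.on τ).sd y
  have e : (ex (Γ := Θ) X fun x => x ∈ᵢ ↟S) = ex X fun x => x ∈ᵢ ↟(τ ≫ D) ∧ᵢ x ∈ᵢ ↟S := by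
    refine omega_ext fun Ξ ρ => ?_
    simp
    constructor
    · intro hx
      refine hx.exC_elim fun Λ κ x hx => ?_
      obtain ⟨M, μ, y, _, hy, hy'⟩ := valid_isDenseSet.1 h (κ ≫ ρ ≫ τ) (κ ≫ ρ ≫ S) x
        (by simpa [intrinsic] using hS.comp (κ ≫ ρ)) (by simpa using hx)
      refine Valid.of_epi μ ?_
      simp
      exact Valid.exC_intro y (by simpa using ⟨by simpa using hy, hy'⟩)
    · intro hx
      refine hx.exC_elim fun Λ κ x hx => ?_
      simp at hx ⊢
      exact Valid.exC_intro x (by simpa using hx.2)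
  rw [e]
  exact h1

end Overt

/-! ### Topologies generated by a base -/

section GeneratedTopology

variable {Γ Δ X Y Z : E}

/-- The union of the basic sets with index in `I`. -/
def baseUnion (B : Γ ⟶ Fn (Nn E) (Pw X)) (I : Γ ⟶ Pw (Nn E)) : Γ ⟶ Pw X :=
  compr X fun x => ex (Nn E) fun i => i ∈ᵢ ↟I ∧ᵢ ↟x ∈ᵢ app ↟B i

@[simp] theorem comp_baseUnion (σ : Δ ⟶ Γ) (B : Γ ⟶ Fn (Nn E) (Pw X)) (I : Γ ⟶ Pw (Nn E)) :
    σ ≫ baseUnion B I = baseUnion (σ ≫ B) (σ ≫ I) := by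
  simp [baseUnion]

theorem mem_baseUnion (B : Γ ⟶ Fn (Nn E) (Pw X)) (I : Γ ⟶ Pw (Nn E)) (x : Γ ⟶ X) :
    (x ∈ᵢ baseUnion B I) = ex (Nn E) fun i => i ∈ᵢ ↟I ∧ᵢ ↟x ∈ᵢ app ↟B i := by
  simp [baseUnion]

theorem valid_mem_baseUnion {B : Γ ⟶ Fn (Nn E) (Pw X)} {I : Γ ⟶ Pw (Nn E)} {x : Γ ⟶ X} :
    Valid (x ∈ᵢ baseUnion B I) ↔ ∃ (Δ : E) (σ : Δ ⟶ Γ) (i : Δ ⟶ Nn E), Epi σ ∧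
      Valid (i ∈ᵢ σ ≫ I) ∧ Valid (σ ≫ x ∈ᵢ app (σ ≫ B) i) := by
  simp [mem_baseUnion, valid_exC, -exists_and_left]

theorem mem_baseUnion_intro {B : Γ ⟶ Fn (Nn E) (Pw X)} {I : Γ ⟶ Pw (Nn E)} {x : Γ ⟶ X}
    {i : Γ ⟶ Nn E} (hi : Valid (i ∈ᵢ I)) (hx : Valid (x ∈ᵢ app B i)) :
    Valid (x ∈ᵢ baseUnion B I) :=
  valid_mem_baseUnion.2 ⟨Γ, 𝟙 Γ, i, inferInstance, by simpa using hi, by simpa using hx⟩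

/-- The countable unions of basic sets. -/
def genTop (B : Γ ⟶ Fn (Nn E) (Pw X)) : Γ ⟶ Pw (Pw X) :=
  compr (Pw X) fun U => ex (Pw (Nn E)) fun I => IsCountable I ∧ᵢ ↟U =ᵢ baseUnion ↟B I

@[simp] theorem comp_genTop (σ : Δ ⟶ Γ) (B : Γ ⟶ Fn (Nn E) (Pw X)) :
    σ ≫ genTop B = genTop (σ ≫ B) := by
  simp [genTop]

theorem valid_mem_genTop {B : Γ ⟶ Fn (Nn E) (Pw X)} {U : Γ ⟶ Pw X} :
    Valid (U ∈ᵢ genTop B) ↔ ∃ (Δ : E) (σ : Δ ⟶ Γ) (I : Δ ⟶ Pw (Nn E)), Epi σ ∧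
      Valid (IsCountable I) ∧ σ ≫ U = baseUnion (σ ≫ B) I := by
  simp [genTop, valid_exC, -exists_and_left]

theorem baseUnion_mem_genTop (B : Γ ⟶ Fn (Nn E) (Pw X)) {I : Γ ⟶ Pw (Nn E)}
    (hI : Valid (IsCountable I)) : Valid (baseUnion B I ∈ᵢ genTop B) :=
  valid_mem_genTop.2 ⟨Γ, 𝟙 Γ, I, inferInstance, hI, by simp⟩

theorem isCountable_singI (x : Γ ⟶ X) : Valid (IsCountable (singI x)) := by
  have h := isCountable_rangeI (lam (Nn E) fun _ => ↟x : Γ ⟶ _)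
  have e : rangeI (lam (Nn E) fun _ => ↟x : Γ ⟶ _) = singI x := by
    refine set_ext fun Δ σ y => ?_
    simp
    constructor
    · intro h
      obtain ⟨Θ, τ, n, _, hn⟩ := valid_mem_rangeI.1 h
      rw [← valid_eqI]
      exact Valid.of_epi τ (by simpa using hn)
    · rintro rfl
      exact valid_mem_rangeI.2 ⟨Δ, 𝟙 Δ, 0, inferInstance, by simp⟩
  rwa [e] at h

theorem baseUnion_singI (B : Γ ⟶ Fn (Nn E) (Pw X)) (i : Γ ⟶ Nn E) :
    baseUnion B (singI i) = app B i := by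
  refine set_ext fun Δ σ x => ?_
  simp
  constructor
  · intro h
    obtain ⟨Θ, τ, j, _, hj, hx⟩ := valid_mem_baseUnion.1 h
    simp at hj hx
    rw [hj] at hx
    exact Valid.of_epi τ (by simpa using hx)
  · intro h
    exact mem_baseUnion_intro (i := σ ≫ i) (by simp) h

theorem baseUnion_emptyI (B : Γ ⟶ Fn (Nn E) (Pw X)) : baseUnion B emptyI = emptyI := by
  refine set_ext fun Δ σ x => ?_
  simp
  refine ⟨fun h => ?_, fun h => h.ff_elim _⟩
  obtain ⟨Θ, τ, j, _, hj, hx⟩ := valid_mem_baseUnion.1 h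
  exact Valid.of_epi τ (by simpa using hj)

theorem app_mem_genTop (B : Γ ⟶ Fn (Nn E) (Pw X)) (i : Γ ⟶ Nn E) :
    Valid (app B i ∈ᵢ genTop B) := by
  rw [← baseUnion_singI]
  exact baseUnion_mem_genTop B (isCountable_singI i)

/-- `B` is a family of semidecidable sets which covers `X`, and `R` a semidecidable relation
between indices which implies inclusion, such that any point of `B i ∩ B j` lies in some
`B l` with `R l i` and `R l j`. -/
structure FormalBase (B : Γ ⟶ Fn (Nn E) (Pw X)) (R : Γ ⟶ Pw (Nn E ⊗ Nn E)) : Prop where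
  sd : ∀ ⦃Δ : E⦄ (σ : Δ ⟶ Γ) (n : Δ ⟶ Nn E), Valid (IsSdSet (app (σ ≫ B) n))
  sd_rel : Valid (IsSdSet R)
  cover : ∀ ⦃Δ : E⦄ (σ : Δ ⟶ Γ) (x : Δ ⟶ X), ∃ (Θ : E) (τ : Θ ⟶ Δ) (n : Θ ⟶ Nn E), Epi τ ∧
    Valid (τ ≫ x ∈ᵢ app (τ ≫ σ ≫ B) n)
  sub : ∀ ⦃Δ : E⦄ (σ : Δ ⟶ Γ) (l i : Δ ⟶ Nn E) (x : Δ ⟶ X), Valid (lift l i ∈ᵢ σ ≫ R) →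
    Valid (x ∈ᵢ app (σ ≫ B) l) → Valid (x ∈ᵢ app (σ ≫ B) i)
  inter : ∀ ⦃Δ : E⦄ (σ : Δ ⟶ Γ) (i j : Δ ⟶ Nn E) (x : Δ ⟶ X), Valid (x ∈ᵢ app (σ ≫ B) i) →
    Valid (x ∈ᵢ app (σ ≫ B) j) → ∃ (Θ : E) (τ : Θ ⟶ Δ) (l : Θ ⟶ Nn E), Epi τ ∧
      Valid (lift l (τ ≫ i) ∈ᵢ τ ≫ σ ≫ R) ∧ Valid (lift l (τ ≫ j) ∈ᵢ τ ≫ σ ≫ R) ∧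
      Valid (τ ≫ x ∈ᵢ app (τ ≫ σ ≫ B) l)

theorem FormalBase.on {B : Γ ⟶ Fn (Nn E) (Pw X)} {R : Γ ⟶ Pw (Nn E ⊗ Nn E)}
    (h : FormalBase B R) (σ : Δ ⟶ Γ) : FormalBase (σ ≫ B) (σ ≫ R) where
  sd Θ τ n := by simpa using h.sd (τ ≫ σ) n
  sd_rel := h.sd_rel.on σ
  cover Θ τ x := by simpa using h.cover (τ ≫ σ) x
  sub Θ τ l i x hR hx := by
    simpa using h.sub (τ ≫ σ) l i x (by simpa using hR) (by simpa using hx)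
  inter Θ τ i j x hi hj := by
    simpa using h.inter (τ ≫ σ) i j x (by simpa using hi) (by simpa using hj)

/-- The common refinements of the elements of `I` and `J`. -/
def refinements (R : Γ ⟶ Pw (Nn E ⊗ Nn E)) (I J : Γ ⟶ Pw (Nn E)) : Γ ⟶ Pw (Nn E) :=
  compr (Nn E) fun l => (ex (Nn E) fun i => i ∈ᵢ ↟I ∧ᵢ lift ↟l i ∈ᵢ ↟R) ∧ᵢ
    ex (Nn E) fun j => j ∈ᵢ ↟J ∧ᵢ lift ↟l j ∈ᵢ ↟R

@[simp] theorem comp_refinements (σ : Δ ⟶ Γ) (R : Γ ⟶ Pw (Nn E ⊗ Nn E)) (I J : Γ ⟶ Pw (Nn E)) :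
    σ ≫ refinements R I J = refinements (σ ≫ R) (σ ≫ I) (σ ≫ J) := by
  simp [refinements]

/-- Inclusion of basic sets carries no evidence of semidecidability. The relation `R`, which implies
inclusion and is semidecidable, is what makes the set of common refinements countable. -/
theorem isCountable_refinements (hE : SyntheticComputability E) {R : Γ ⟶ Pw (Nn E ⊗ Nn E)}
    (hR : Valid (IsSdSet R)) {I J : Γ ⟶ Pw (Nn E)} (hI : Valid (IsCountable I))
    (hJ : Valid (IsCountable J)) : Valid (IsCountable (refinements R I J)) := by
  refine isCountable_of_isSdSet hE (valid_isSdSet.2 fun Δ σ l => ?_)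
  have key : ∀ I : Γ ⟶ Pw (Nn E), Valid (IsCountable I) →
      Valid (IsSd (ex (Γ := Δ) (Nn E) fun i => i ∈ᵢ ↟(σ ≫ I) ∧ᵢ lift ↟l i ∈ᵢ ↟(σ ≫ R))) := by
    intro I hI
    have := isSd_ex_countable hE (hI.on σ) (S := compr _ fun i => lift ↟l i ∈ᵢ ↟(σ ≫ R))
      fun Θ τ i _ => by simpa using (hR.on (τ ≫ σ)).sd (lift (τ ≫ l) i)
    simpa using this
  simpa [refinements] using isSd_and hE (key I hI) (key J hJ)

theorem valid_mem_refinements {R : Γ ⟶ Pw (Nn E ⊗ Nn E)} {I J : Γ ⟶ Pw (Nn E)} {l : Γ ⟶ Nn E} :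
    Valid (l ∈ᵢ refinements R I J) ↔ ∃ (Δ : E) (σ : Δ ⟶ Γ) (i j : Δ ⟶ Nn E), Epi σ ∧
      Valid (i ∈ᵢ σ ≫ I) ∧ Valid (j ∈ᵢ σ ≫ J) ∧ Valid (lift (σ ≫ l) i ∈ᵢ σ ≫ R) ∧
      Valid (lift (σ ≫ l) j ∈ᵢ σ ≫ R) := by
  simp [refinements, -exists_and_left]
  constructor
  · rintro ⟨h, h'⟩
    obtain ⟨Δ, σ, i, _, hi⟩ := valid_exC.1 h
    have h' := h'.on σ
    obtain ⟨Θ, τ, j, _, hj⟩ := valid_exC.1 h'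
    simp at hi hj
    exact ⟨Θ, τ ≫ σ, τ ≫ i, j, inferInstance, by simpa using hi.1.comp τ, by simpa using hj.1,
      by simpa using hi.2.comp τ, by simpa using hj.2⟩
  · rintro ⟨Δ, σ, i, j, _, hi, hj, hi', hj'⟩
    exact ⟨valid_exC.2 ⟨Δ, σ, i, inferInstance, by simpa using ⟨hi, hi'⟩⟩,
      valid_exC.2 ⟨Δ, σ, j, inferInstance, by simpa using ⟨hj, hj'⟩⟩⟩

theorem FormalBase.interI_baseUnion {B : Γ ⟶ Fn (Nn E) (Pw X)} {R : Γ ⟶ Pw (Nn E ⊗ Nn E)}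
    (h : FormalBase B R) (I J : Γ ⟶ Pw (Nn E)) :
    interI (baseUnion B I) (baseUnion B J) = baseUnion B (refinements R I J) := by
  refine set_ext fun Δ σ x => ?_
  simp
  constructor
  · rintro ⟨h1, h2⟩
    obtain ⟨Θ, τ, i, _, hi, hx⟩ := valid_mem_baseUnion.1 h1
    have h2 := h2.on τ
    obtain ⟨Ξ, ρ, j, _, hj, hx'⟩ := valid_mem_baseUnion.1 h2
    obtain ⟨Λ, κ, l, _, hl, hl', hx⟩ := h.inter (ρ ≫ τ ≫ σ) (ρ ≫ i) j (ρ ≫ τ ≫ x)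
      (by simpa using hx.comp ρ) (by simpa using hx')
    refine valid_mem_baseUnion.2 ⟨Λ, κ ≫ ρ ≫ τ, l, inferInstance, ?_, by simpa using hx⟩
    simp at hi hj hl hl' ⊢
    exact valid_mem_refinements.2 ⟨Λ, 𝟙 Λ, κ ≫ ρ ≫ i, κ ≫ j, inferInstance,
      by simpa using hi.comp (κ ≫ ρ), by simpa using hj.comp κ, by simpa using hl,
      by simpa using hl'⟩
  · intro h1
    obtain ⟨Θ, τ, l, _, hl, hx⟩ := valid_mem_baseUnion.1 h1
    simp at hl
    obtain ⟨Ξ, ρ, i, j, _, hi, hj, hi', hj'⟩ := valid_mem_refinements.1 hl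
    exact ⟨valid_mem_baseUnion.2 ⟨Ξ, ρ ≫ τ, i, inferInstance, by simpa using hi, by
        simpa using h.sub (ρ ≫ τ ≫ σ) (ρ ≫ l) i (ρ ≫ τ ≫ x) (by simpa using hi')
          (by simpa using hx.comp ρ)⟩,
      valid_mem_baseUnion.2 ⟨Ξ, ρ ≫ τ, j, inferInstance, by simpa using hj, by
        simpa using h.sub (ρ ≫ τ ≫ σ) (ρ ≫ l) j (ρ ≫ τ ≫ x) (by simpa using hj')
          (by simpa using hx.comp ρ)⟩⟩

theorem isCountable_univI_nat : Valid (IsCountable (univI : Γ ⟶ Pw (Nn E))) := by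
  have h := isCountable_rangeI (lam (Nn E) fun n => n : Γ ⟶ _)
  have e : rangeI (lam (Nn E) fun n => n : Γ ⟶ _) = univI := by
    refine set_ext fun Δ σ y => ?_
    simp
    exact valid_mem_rangeI.2 ⟨Δ, 𝟙 Δ, y, inferInstance, by simp⟩
  rwa [e] at h

theorem FormalBase.baseUnion_univI {B : Γ ⟶ Fn (Nn E) (Pw X)} {R : Γ ⟶ Pw (Nn E ⊗ Nn E)}
    (h : FormalBase B R) : baseUnion B univI = univI := by
  refine set_ext fun Δ σ x => ?_
  simp
  obtain ⟨Θ, τ, n, _, hn⟩ := h.cover σ x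
  exact valid_mem_baseUnion.2 ⟨Θ, τ, n, inferInstance, by simp, hn⟩

theorem FormalBase.isTopology (hE : SyntheticComputability E) {B : Γ ⟶ Fn (Nn E) (Pw X)}
    {R : Γ ⟶ Pw (Nn E ⊗ Nn E)} (h : FormalBase B R) : Valid (IsTopology (genTop B)) := by
  refine valid_isTopology.2 ⟨?_, ?_, ?_, ?_, ?_⟩
  · intro Δ σ U hU
    simp at hU
    obtain ⟨Θ, τ, I, _, hI, e⟩ := valid_mem_genTop.1 hU
    refine Valid.of_epi τ ?_
    rw [comp_IsSdSet, e]
    refine valid_isSdSet.2 fun Ξ ρ x => ?_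
    have := isSd_ex_countable hE (hI.on ρ) (S := compr _ fun i => ↟x ∈ᵢ app ↟(ρ ≫ τ ≫ σ ≫ B) i)
      fun Λ κ i _ => by simpa using (h.sd (κ ≫ ρ ≫ τ ≫ σ) i).sd (κ ≫ x)
    simpa [mem_baseUnion] using this
  · rw [← h.baseUnion_univI]
    exact baseUnion_mem_genTop B isCountable_univI_nat
  · intro Δ σ U V hU hV
    simp at hU hV ⊢
    obtain ⟨Θ, τ, I, _, hI, e⟩ := valid_mem_genTop.1 hU
    have hV := hV.on τ
    obtain ⟨Ξ, ρ, J, _, hJ, e'⟩ := valid_mem_genTop.1 hV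
    refine Valid.of_epi (ρ ≫ τ) ?_
    have e := congrArg (fun t => ρ ≫ t) e
    simp at e e' ⊢
    rw [e, e']
    have := (h.on (ρ ≫ τ ≫ σ)).interI_baseUnion (ρ ≫ I) J
    simp only [Category.assoc] at this
    rw [this]
    exact baseUnion_mem_genTop _
      (isCountable_refinements hE (h.sd_rel.on (ρ ≫ τ ≫ σ)) (hI.on ρ) hJ)
  · rw [← baseUnion_emptyI B]
    exact baseUnion_mem_genTop B (isCountable_of_isSdSet hE (valid_isSdSet.2 fun Δ σ n => by
      simpa using isSd_ff))
  · intro Δ σ V hV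
    -- Index sets for the `V n` have to be chosen simultaneously. Their union is semidecidable,
    -- hence countable, and indexes the union of the `V n`.
    obtain ⟨Θ, τ, I, _, hI⟩ := countable_choice hE (X := Pw (Nn E)) (Γ := Δ)
      (compr (Nn E ⊗ Pw (Nn E)) fun w => IsCountable (w ≫ snd _ _) ∧ᵢ
        app ↟V (w ≫ fst _ _) =ᵢ baseUnion ↟(σ ≫ B) (w ≫ snd _ _)) (fun Θ τ n => by
        have h1 := hV τ n
        simp at h1
        obtain ⟨Ξ, ρ, I, hρ, hI, e⟩ := valid_mem_genTop.1 h1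
        simp at e
        exact ⟨Ξ, ρ, I, hρ, by simpa using ⟨hI, e⟩⟩)
    simp at hI
    refine Valid.of_epi τ ?_
    simp
    rw [show iUnionI (τ ≫ V) = baseUnion (τ ≫ σ ≫ B)
      (compr (Nn E) fun i => ex (Nn E) fun n => ↟i ∈ᵢ app ↟I n : Θ ⟶ _) from ?_]
    · refine baseUnion_mem_genTop _ (isCountable_of_isSdSet hE (valid_isSdSet.2 fun Ξ ρ i => ?_))
      have := isSd_ex_nat hE (Γ := Ξ) (S := compr (Nn E) fun n => ↟i ∈ᵢ app ↟(ρ ≫ I) n)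
        (valid_isSdSet.2 fun Λ κ n => by
          simpa using (isSdSet_of_isCountable (hI (κ ≫ ρ) n).1).sd (κ ≫ i))
      simpa using this
    · refine set_ext fun Ξ ρ x => ?_
      simp [iUnionI]
      constructor
      · intro hx
        refine hx.exC_elim fun Λ κ n hn => ?_
        have h1 := (hI (κ ≫ ρ) n).2
        simp at hn h1 ⊢
        rw [h1] at hn
        obtain ⟨M, μ, i, _, hi, hx⟩ := valid_mem_baseUnion.1 hn
        refine valid_mem_baseUnion.2 ⟨M, μ, i, inferInstance, ?_, hx⟩
        simp at hi ⊢
        exact Valid.exC_intro (μ ≫ n) (by simpa using hi)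
      · intro hx
        obtain ⟨M, μ, i, _, hi, hx⟩ := valid_mem_baseUnion.1 hx
        simp at hi
        refine Valid.of_epi μ (hi.exC_elim fun Λ κ n hn => ?_)
        simp at hn hx ⊢
        have h1 := (hI (κ ≫ μ ≫ ρ) n).2
        refine Valid.exC_intro n ?_
        simp at h1 ⊢
        rw [h1]
        exact mem_baseUnion_intro hn (by simpa using hx.comp κ)

theorem isBase_genTop (B : Γ ⟶ Fn (Nn E) (Pw X)) : Valid (IsBase B (genTop B)) := by
  refine valid_isBase.2 ⟨fun Δ σ n => by simpa using app_mem_genTop (σ ≫ B) n, fun Δ σ U hU => ?_⟩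
  simp at hU
  obtain ⟨Θ, τ, I, hτ, hI, e⟩ := valid_mem_genTop.1 hU
  refine ⟨Θ, τ, I, hτ, hI, fun Ξ ρ x => ?_⟩
  rw [e]
  simp [mem_baseUnion]

end GeneratedTopology

/-! ### Sobriety of generated topologies -/

section Sobriety

variable {Γ Δ X Y Z : E}

theorem Valid.sigmaHom_mono {T : Γ ⟶ Pw (Pw X)} {h : Γ ⟶ Fn (Pw X) (Om E)}
    (hh : Valid (IsSigmaHom T h)) {U V : Γ ⟶ Pw X} (hU : Valid (U ∈ᵢ T)) (hV : Valid (V ∈ᵢ T))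
    (hUV : ∀ ⦃Δ : E⦄ (σ : Δ ⟶ Γ) (x : Δ ⟶ X), Valid (x ∈ᵢ σ ≫ U) → Valid (x ∈ᵢ σ ≫ V))
    (h1 : Valid (app h U)) : Valid (app h V) := by
  have e : interI U V = U := by
    refine set_ext fun Δ σ x => ?_
    simp
    exact hUV σ x
  have h2 := (valid_isSigmaHom.1 hh).2.2.1 (𝟙 Γ) U V (by simpa using hU) (by simpa using hV)
  simp [e] at h2
  rw [h2] at h1
  exact (valid_andI.1 h1).2

theorem iUnionI_baseUnion {B : Γ ⟶ Fn (Nn E) (Pw X)} {I : Γ ⟶ Pw (Nn E)}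
    {e : Γ ⟶ Fn (Nn E) (Pw (Nn E))} (he : Valid (Enumerates e I)) :
    iUnionI (lam (Nn E) fun k => baseUnion ↟B (app ↟e k) : Γ ⟶ _) = baseUnion B I := by
  refine set_ext fun Θ τ x => ?_
  simp [iUnionI]
  constructor
  · intro hx
    refine hx.exC_elim fun Ξ ρ k hk => ?_
    simp at hk ⊢
    obtain ⟨Λ, κ, i, _, hi, hx⟩ := valid_mem_baseUnion.1 hk
    have h1 := (he.on (κ ≫ ρ ≫ τ)).enumerates_mem (by simpa using hi)
    exact valid_mem_baseUnion.2 ⟨Λ, κ, i, inferInstance, by simpa using h1, by simpa using hx⟩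
  · intro hx
    obtain ⟨Ξ, ρ, i, _, hi, hx⟩ := valid_mem_baseUnion.1 hx
    obtain ⟨Λ, κ, k, _, hk⟩ := (he.on (ρ ≫ τ)).exists_enumerates (x := i) (by simpa using hi)
    refine Valid.of_epi (κ ≫ ρ) ?_
    simp
    refine Valid.exC_intro k ?_
    simp
    exact mem_baseUnion_intro (i := κ ≫ i) (by simpa using hk) (by simpa using hx.comp κ)

/-- Homomorphisms preserve unions of sequences, whereas an enumeration of `I` may skip. The sequence
used is therefore `k ↦ baseUnion B (e k)`, whose terms are empty or basic. -/
theorem Valid.sigmaHom_baseUnion {T : Γ ⟶ Pw (Pw X)} {h : Γ ⟶ Fn (Pw X) (Om E)}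
    (hh : Valid (IsSigmaHom T h)) (hT : Valid (IsTopology T)) {B : Γ ⟶ Fn (Nn E) (Pw X)}
    (hB : ∀ ⦃Δ : E⦄ (σ : Δ ⟶ Γ) (n : Δ ⟶ Nn E), Valid (app (σ ≫ B) n ∈ᵢ σ ≫ T))
    {I : Γ ⟶ Pw (Nn E)} (hI : Valid (IsCountable I)) :
    app h (baseUnion B I) = ex (Nn E) fun i => i ∈ᵢ ↟I ∧ᵢ app ↟h (app ↟B i) := by
  obtain ⟨Δ, σ, e, _, he⟩ := valid_isCountable.1 hI
  rw [← cancel_epi σ]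
  let V : Δ ⟶ Fn (Nn E) (Pw X) := lam (Nn E) fun k => baseUnion ↟(σ ≫ B) (app ↟e k)
  have hV : ∀ ⦃Θ : E⦄ (τ : Θ ⟶ Δ) (k : Θ ⟶ Nn E),
      app (τ ≫ V) k = baseUnion (τ ≫ σ ≫ B) (app (τ ≫ e) k) := by
    intro Θ τ k
    simp [V]
  have hVT : ∀ ⦃Θ : E⦄ (τ : Θ ⟶ Δ) (k : Θ ⟶ Nn E), Valid (app (τ ≫ V) k ∈ᵢ τ ≫ σ ≫ T) := by
    intro Θ τ k
    rw [hV]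
    refine (he.on τ).enumerates_cases k (fun Ξ ρ h0 => ?_) (fun Ξ ρ i hi _ => ?_)
    · simp at h0 ⊢
      rw [h0, baseUnion_emptyI]
      simpa using (valid_isTopology.1 hT).2.2.2.1.comp (ρ ≫ τ ≫ σ)
    · simp at hi ⊢
      rw [hi, baseUnion_singI]
      simpa using hB (ρ ≫ τ ≫ σ) i
  have hU : baseUnion (σ ≫ B) (σ ≫ I) = iUnionI V := (iUnionI_baseUnion he).symm
  have h1 := (valid_isSigmaHom.1 hh).2.2.2.2 σ V hVT
  simp only [comp_app, comp_baseUnion]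
  rw [hU, h1]
  refine omega_ext fun Θ τ => ?_
  simp
  constructor
  · intro h2
    refine h2.exC_elim fun Ξ ρ k hk => ?_
    refine (he.on (ρ ≫ τ)).enumerates_cases k (fun Λ κ h0 => ?_) (fun Λ κ i hi hiI => ?_)
    · have h3 := hk.comp κ
      simp [V] at h3 h0
      rw [h0, baseUnion_emptyI] at h3
      have h4 := (valid_isSigmaHom.1 hh).2.2.2.1.on (κ ≫ ρ ≫ τ ≫ σ)
      exact (h4.not_elim (by simpa using h3)).ff_elim _
    · have h3 := hk.comp κ
      simp [V] at h3 hi hiI ⊢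
      rw [hi, baseUnion_singI] at h3
      exact Valid.exC_intro i (by simpa using ⟨hiI, h3⟩)
  · intro h2
    refine h2.exC_elim fun Ξ ρ i hi => ?_
    simp at hi
    obtain ⟨Λ, κ, k, _, hk⟩ := (he.on (ρ ≫ τ)).exists_enumerates (x := i) (by simpa using hi.1)
    refine Valid.of_epi κ ?_
    simp
    refine Valid.exC_intro k ?_
    have h3 := hi.2.comp κ
    have h4 := hVT (κ ≫ ρ ≫ τ) k
    have h5 := hB (κ ≫ ρ ≫ τ ≫ σ) (κ ≫ i)
    simp [V] at h3 h4 h5 ⊢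
    refine Valid.sigmaHom_mono (hh.on (κ ≫ ρ ≫ τ ≫ σ)) h5 h4 (fun M μ x hx => ?_) h3
    simp at hx ⊢
    exact mem_baseUnion_intro (i := μ ≫ κ ≫ i) (by simpa using hk.comp μ) hx

/-- `F` has the properties of the set of indices of the basic neighbourhoods of a point. -/
structure PointFilter (B : Γ ⟶ Fn (Nn E) (Pw X)) (R : Γ ⟶ Pw (Nn E ⊗ Nn E))
    (F : Γ ⟶ Pw (Nn E)) : Prop where
  sd : Valid (IsSdSet F)
  prime : ∀ ⦃Δ : E⦄ (σ : Δ ⟶ Γ) (I : Δ ⟶ Pw (Nn E)), Valid (IsCountable I) →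
    baseUnion (σ ≫ B) I = univI → ∃ (Θ : E) (τ : Θ ⟶ Δ) (j : Θ ⟶ Nn E), Epi τ ∧
      Valid (j ∈ᵢ τ ≫ I) ∧ Valid (j ∈ᵢ τ ≫ σ ≫ F)
  directed : ∀ ⦃Δ : E⦄ (σ : Δ ⟶ Γ) (i j : Δ ⟶ Nn E), Valid (i ∈ᵢ σ ≫ F) → Valid (j ∈ᵢ σ ≫ F) →
    ∃ (Θ : E) (τ : Θ ⟶ Δ) (l : Θ ⟶ Nn E), Epi τ ∧ Valid (l ∈ᵢ τ ≫ σ ≫ F) ∧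
      Valid (lift l (τ ≫ i) ∈ᵢ τ ≫ σ ≫ R) ∧ Valid (lift l (τ ≫ j) ∈ᵢ τ ≫ σ ≫ R)
  mono : ∀ ⦃Δ : E⦄ (σ : Δ ⟶ Γ) (i j : Δ ⟶ Nn E), Valid (i ∈ᵢ σ ≫ F) →
    (∀ ⦃Θ : E⦄ (τ : Θ ⟶ Δ) (x : Θ ⟶ X), Valid (x ∈ᵢ app (τ ≫ σ ≫ B) (τ ≫ i)) →
      Valid (x ∈ᵢ app (τ ≫ σ ≫ B) (τ ≫ j))) → Valid (j ∈ᵢ σ ≫ F)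
  nonempty : ∀ ⦃Δ : E⦄ (σ : Δ ⟶ Γ) (i : Δ ⟶ Nn E), Valid (i ∈ᵢ σ ≫ F) →
    app (σ ≫ B) i = emptyI → Valid (ff : Δ ⟶ Om E)

theorem pointFilter_of_isSigmaHom (hE : SyntheticComputability E) {B : Γ ⟶ Fn (Nn E) (Pw X)}
    {R : Γ ⟶ Pw (Nn E ⊗ Nn E)} (hB : FormalBase B R) {h : Γ ⟶ Fn (Pw X) (Om E)}
    (hh : Valid (IsSigmaHom (genTop B) h)) :
    PointFilter B R (compr (Nn E) fun i => app ↟h (app ↟B i)) := by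
  have hT := hB.isTopology hE
  have hB' : ∀ ⦃Δ : E⦄ (σ : Δ ⟶ Γ) (n : Δ ⟶ Nn E), Valid (app (σ ≫ B) n ∈ᵢ σ ≫ genTop B) := by
    intro Δ σ n
    simpa using app_mem_genTop (σ ≫ B) n
  have key : ∀ ⦃Δ : E⦄ (σ : Δ ⟶ Γ) (I : Δ ⟶ Pw (Nn E)), Valid (IsCountable I) →
      Valid (app (σ ≫ h) (baseUnion (σ ≫ B) I)) → ∃ (Θ : E) (τ : Θ ⟶ Δ) (j : Θ ⟶ Nn E), Epi τ ∧
      Valid (j ∈ᵢ τ ≫ I) ∧ Valid (app (τ ≫ σ ≫ h) (app (τ ≫ σ ≫ B) j)) := by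
    intro Δ σ I hI h1
    rw [(hh.on σ).sigmaHom_baseUnion (hT.on σ) (fun Θ τ n => by
      simpa using hB' (τ ≫ σ) n) hI] at h1
    simp at h1
    obtain ⟨Θ, τ, j, hτ, hj⟩ := valid_exC.1 h1
    exact ⟨Θ, τ, j, hτ, by simpa using hj⟩
  constructor
  · refine valid_isSdSet.2 fun Δ σ i => ?_
    simpa using (valid_isSigmaHom.1 hh).1 σ _ (hB' σ i)
  · intro Δ σ I hI hU
    obtain ⟨Θ, τ, j, hτ, hj, hj'⟩ := key σ I hI (by
      rw [hU]
      simpa using (valid_isSigmaHom.1 hh).2.1.comp σ)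
    exact ⟨Θ, τ, j, hτ, hj, by simpa using hj'⟩
  · intro Δ σ i j hi hj
    simp at hi hj
    have h1 := (valid_isSigmaHom.1 hh).2.2.1 σ _ _ (hB' σ i) (hB' σ j)
    have h2 : Valid (app (σ ≫ h) (interI (app (σ ≫ B) i) (app (σ ≫ B) j))) := by
      rw [h1]
      exact valid_andI.2 ⟨hi, hj⟩
    -- The intersection of two basic sets is the union over their common refinements, so the
    -- homomorphism is true at one of these.
    rw [← baseUnion_singI, ← baseUnion_singI, (hB.on σ).interI_baseUnion] at h2
    obtain ⟨Θ, τ, l, _, hl, hl'⟩ := key σ _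
      (isCountable_refinements hE (hB.on σ).sd_rel (isCountable_singI i) (isCountable_singI j)) h2
    simp at hl
    obtain ⟨Ξ, ρ, i', j', _, hi', hj', h3, h4⟩ := valid_mem_refinements.1 hl
    simp at hi' hj' h3 h4
    rw [hi'] at h3
    rw [hj'] at h4
    exact ⟨Ξ, ρ ≫ τ, ρ ≫ l, inferInstance, by simpa using hl'.comp ρ, by simpa using h3,
      by simpa using h4⟩
  · intro Δ σ i j hi hij
    simp at hi ⊢
    exact (hh.on σ).sigmaHom_mono (hB' σ i) (hB' σ j) (fun Θ τ x hx => by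
      simpa using hij τ x (by simpa using hx)) hi
  · intro Δ σ i hi h0
    simp at hi
    rw [h0] at hi
    have h4 := (valid_isSigmaHom.1 hh).2.2.2.1.on σ
    exact h4.not_elim (by simpa using hi)

theorem PointFilter.on {B : Γ ⟶ Fn (Nn E) (Pw X)} {R : Γ ⟶ Pw (Nn E ⊗ Nn E)}
    {F : Γ ⟶ Pw (Nn E)} (h : PointFilter B R F) (σ : Δ ⟶ Γ) :
    PointFilter (σ ≫ B) (σ ≫ R) (σ ≫ F) where
  sd := h.sd.on σ
  prime Θ τ I hI hU := by
    simpa using h.prime (τ ≫ σ) I hI (by simpa using hU)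
  directed Θ τ i j hi hj := by
    simpa using h.directed (τ ≫ σ) i j (by simpa using hi) (by simpa using hj)
  mono Θ τ i j hi hij := by
    simpa using h.mono (τ ≫ σ) i j (by simpa using hi) (by simpa using hij)
  nonempty Θ τ i hi h0 := by
    simpa using h.nonempty (τ ≫ σ) i (by simpa using hi) (by simpa using h0)

/-- A `σ`-homomorphism on countable unions of basic sets is determined by its values on the basic
sets, and the indices where it is true form a `PointFilter`. Sobriety is thus a matter of indices
only. -/
theorem isSober_genTop (hE : SyntheticComputability E) {B : Γ ⟶ Fn (Nn E) (Pw X)}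
    {R : Γ ⟶ Pw (Nn E ⊗ Nn E)} (hB : FormalBase B R)
    (inj : ∀ ⦃Δ : E⦄ (σ : Δ ⟶ Γ) (x y : Δ ⟶ X), (∀ ⦃Θ : E⦄ (τ : Θ ⟶ Δ) (i : Θ ⟶ Nn E),
      (τ ≫ x ∈ᵢ app (τ ≫ σ ≫ B) i) = (τ ≫ y ∈ᵢ app (τ ≫ σ ≫ B) i)) → x = y)
    (surj : ∀ ⦃Δ : E⦄ (σ : Δ ⟶ Γ) (F : Δ ⟶ Pw (Nn E)), PointFilter (σ ≫ B) (σ ≫ R) F →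
      ∃ (Θ : E) (τ : Θ ⟶ Δ) (x : Θ ⟶ X), Epi τ ∧ ∀ ⦃Ξ : E⦄ (ρ : Ξ ⟶ Θ) (i : Ξ ⟶ Nn E),
        Valid (i ∈ᵢ ρ ≫ τ ≫ F) ↔ Valid (ρ ≫ x ∈ᵢ app (ρ ≫ τ ≫ σ ≫ B) i)) :
    Valid (IsSober (genTop B)) := by
  refine valid_isSober.2 ⟨fun Δ σ x y h => inj σ x y fun Θ τ i => h τ _ ?_, fun Δ σ h hh => ?_⟩
  · simpa using app_mem_genTop (τ ≫ σ ≫ B) i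
  · simp at hh
    obtain ⟨Θ, τ, x, hτ, hx⟩ := surj σ _ (pointFilter_of_isSigmaHom hE (hB.on σ) hh)
    refine ⟨Θ, τ, x, hτ, fun Ξ ρ U hU => ?_⟩
    simp at hU
    obtain ⟨Λ, κ, I, _, hI, e⟩ := valid_mem_genTop.1 hU
    rw [← cancel_epi κ]
    simp at e ⊢
    rw [e, (hh.on (κ ≫ ρ ≫ τ)).sigmaHom_baseUnion (by
      simpa using (hB.isTopology hE).on (κ ≫ ρ ≫ τ ≫ σ)) (fun M μ n => by
      simpa using app_mem_genTop (μ ≫ κ ≫ ρ ≫ τ ≫ σ ≫ B) n) hI, mem_baseUnion]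
    refine omega_ext fun M μ => ?_
    simp
    constructor
    · intro h
      refine h.exC_elim fun N ν i hi => ?_
      simp at hi ⊢
      exact Valid.exC_intro i (by
        simpa using ⟨hi.1, by simpa using (hx (ν ≫ μ ≫ κ ≫ ρ) i).1 (by simpa using hi.2)⟩)
    · intro h
      refine h.exC_elim fun N ν i hi => ?_
      simp at hi ⊢
      exact Valid.exC_intro i (by
        simpa using ⟨hi.1, by simpa using (hx (ν ≫ μ ≫ κ ≫ ρ) i).2 (by simpa using hi.2)⟩)

end Sobriety

/-! ### Domains -/

section Domains

variable {Γ Δ X Y Z P : E}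

theorem valid_all_all_all_imp_imp {p q r : Z ⊗ Y ⊗ X ⊗ Γ ⟶ Om E} :
    Valid (allC (allC (allC (p →ᵢ q →ᵢ r)))) ↔
    ∀ ⦃Δ : E⦄ (σ : Δ ⟶ Γ) (x : Δ ⟶ X) (y : Δ ⟶ Y) (z : Δ ⟶ Z),
      Valid (lift z (lift y (lift x σ)) ≫ p) → Valid (lift z (lift y (lift x σ)) ≫ q) →
      Valid (lift z (lift y (lift x σ)) ≫ r) := by
  rw [valid_allC]
  constructor
  · intro h Δ σ x y z hp hq
    have := h σ x
    rw [comp_allC, comp_allC, valid_all_all] at this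
    have := this (𝟙 Δ) y z
    simp at this
    exact (this.mp hp).mp hq
  · intro h Δ σ x
    rw [comp_allC, comp_allC, valid_all_all]
    intro Θ τ y z
    simp
    rw [valid_imp_imp]
    intro Ξ ρ hp hq
    have := h (ρ ≫ τ ≫ σ) (ρ ≫ τ ≫ x) (ρ ≫ y) (ρ ≫ z)
    simp at this hp hq ⊢
    exact this hp hq

theorem valid_all_all_imp_imp_imp {p q r s : Y ⊗ X ⊗ Γ ⟶ Om E} :
    Valid (allC (allC (p →ᵢ q →ᵢ r →ᵢ s))) ↔
    ∀ ⦃Δ : E⦄ (σ : Δ ⟶ Γ) (x : Δ ⟶ X) (y : Δ ⟶ Y), Valid (lift y (lift x σ) ≫ p) →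
      Valid (lift y (lift x σ) ≫ q) → Valid (lift y (lift x σ) ≫ r) →
      Valid (lift y (lift x σ) ≫ s) := by
  rw [valid_all_all_imp_imp]
  constructor
  · intro h Δ σ x y hp hq hr
    have := h σ x y hp hq
    rw [comp_impI] at this
    exact this.mp hr
  · intro h Δ σ x y hp hq
    rw [comp_impI, valid_impI]
    intro Θ τ hr
    simpa using h (τ ≫ σ) (τ ≫ x) (τ ≫ y) (by simpa using hp.comp τ) (by simpa using hq.comp τ)
      (by simpa using hr)

theorem valid_isPartialOrder {le : Γ ⟶ Pw (P ⊗ P)} : Valid (IsPartialOrder le) ↔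
    (∀ ⦃Δ : E⦄ (σ : Δ ⟶ Γ) (x : Δ ⟶ P), Valid (relI (σ ≫ le) x x)) ∧
    (∀ ⦃Δ : E⦄ (σ : Δ ⟶ Γ) (x y z : Δ ⟶ P), Valid (relI (σ ≫ le) x y) →
      Valid (relI (σ ≫ le) y z) → Valid (relI (σ ≫ le) x z)) ∧
    (∀ ⦃Δ : E⦄ (σ : Δ ⟶ Γ) (x y : Δ ⟶ P), Valid (relI (σ ≫ le) x y) →
      Valid (relI (σ ≫ le) y x) → x = y) := by
  simp [IsPartialOrder, valid_all_all_imp_imp, valid_all_all_all_imp_imp, -IsEmpty.forall_iff]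
  simp [valid_allC, -IsEmpty.forall_iff]

theorem valid_isChain {le : Γ ⟶ Pw (P ⊗ P)} {c : Γ ⟶ Fn (Nn E) P} : Valid (IsChain le c) ↔
    ∀ ⦃Δ : E⦄ (σ : Δ ⟶ Γ) (n : Δ ⟶ Nn E),
      Valid (relI (σ ≫ le) (app (σ ≫ c) n) (app (σ ≫ c) (n + 1))) := by
  simp [IsChain, valid_allC, -IsEmpty.forall_iff]

theorem valid_isSup {le : Γ ⟶ Pw (P ⊗ P)} {D : Γ ⟶ Pw P} {s : Γ ⟶ P} : Valid (IsSup le D s) ↔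
    (∀ ⦃Δ : E⦄ (σ : Δ ⟶ Γ) (x : Δ ⟶ P), Valid (x ∈ᵢ σ ≫ D) → Valid (relI (σ ≫ le) x (σ ≫ s))) ∧
    (∀ ⦃Δ : E⦄ (σ : Δ ⟶ Γ) (u : Δ ⟶ P),
      (∀ ⦃Θ : E⦄ (τ : Θ ⟶ Δ) (x : Θ ⟶ P), Valid (x ∈ᵢ τ ≫ σ ≫ D) →
        Valid (relI (τ ≫ σ ≫ le) x (τ ≫ u))) → Valid (relI (σ ≫ le) (σ ≫ s) u)) := by
  simp [IsSup, valid_all_imp, -IsEmpty.forall_iff]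

theorem valid_isOmegaCpo {le : Γ ⟶ Pw (P ⊗ P)} : Valid (IsOmegaCpo le) ↔
    Valid (IsPartialOrder le) ∧ ∀ ⦃Δ : E⦄ (σ : Δ ⟶ Γ) (c : Δ ⟶ Fn (Nn E) P),
      Valid (IsChain (σ ≫ le) c) → ∃ (Θ : E) (τ : Θ ⟶ Δ) (s : Θ ⟶ P), Epi τ ∧
        Valid (IsSup (τ ≫ σ ≫ le) (rangeI (τ ≫ c)) s) := by
  simp [IsOmegaCpo, valid_all_imp, valid_exC, -IsEmpty.forall_iff, -exists_and_left]

theorem valid_mem_compacts {le : Γ ⟶ Pw (P ⊗ P)} {x : Γ ⟶ P} : Valid (x ∈ᵢ compacts le) ↔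
    ∀ ⦃Δ : E⦄ (σ : Δ ⟶ Γ) (c : Δ ⟶ Fn (Nn E) P) (s : Δ ⟶ P), Valid (IsChain (σ ≫ le) c) →
      Valid (IsSup (σ ≫ le) (rangeI c) s) → Valid (relI (σ ≫ le) (σ ≫ x) s) →
      ∃ (Θ : E) (τ : Θ ⟶ Δ) (m : Θ ⟶ Nn E), Epi τ ∧
        Valid (relI (τ ≫ σ ≫ le) (τ ≫ σ ≫ x) (app (τ ≫ c) m)) := by
  simp [compacts, wayBelow, valid_all_all_imp_imp_imp, valid_exC, -IsEmpty.forall_iff,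
    -exists_and_left]

theorem valid_isDirected {le : Γ ⟶ Pw (P ⊗ P)} {D : Γ ⟶ Pw P} : Valid (IsDirected le D) ↔
    (∃ (Δ : E) (σ : Δ ⟶ Γ) (x : Δ ⟶ P), Epi σ ∧ Valid (x ∈ᵢ σ ≫ D)) ∧
    (∀ ⦃Δ : E⦄ (σ : Δ ⟶ Γ) (x y : Δ ⟶ P), Valid (x ∈ᵢ σ ≫ D) → Valid (y ∈ᵢ σ ≫ D) →
      ∃ (Θ : E) (τ : Θ ⟶ Δ) (z : Θ ⟶ P), Epi τ ∧ Valid (z ∈ᵢ τ ≫ σ ≫ D) ∧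
        Valid (relI (τ ≫ σ ≫ le) (τ ≫ x) z) ∧ Valid (relI (τ ≫ σ ≫ le) (τ ≫ y) z)) := by
  simp [IsDirected, valid_all_all_imp_imp, valid_exC, -IsEmpty.forall_iff, -exists_and_left]

theorem valid_mem_compactsBelow {le : Γ ⟶ Pw (P ⊗ P)} {x y : Γ ⟶ P} :
    Valid (y ∈ᵢ compactsBelow le x) ↔ Valid (y ∈ᵢ compacts le) ∧ Valid (relI le y x) := by
  simp [compactsBelow]

theorem valid_isOmegaAlgebraic {le : Γ ⟶ Pw (P ⊗ P)} : Valid (IsOmegaAlgebraic le) ↔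
    Valid (IsCountable (compacts le)) ∧
    (∀ ⦃Δ : E⦄ (σ : Δ ⟶ Γ) (x y : Δ ⟶ P), Valid (x ∈ᵢ compacts (σ ≫ le)) →
      Valid (y ∈ᵢ compacts (σ ≫ le)) →
      Valid (relI (σ ≫ le) x y ∨ᵢ ¬ᵢ (relI (σ ≫ le) x y))) ∧
    (∀ ⦃Δ : E⦄ (σ : Δ ⟶ Γ) (x : Δ ⟶ P), Valid (IsCountable (compactsBelow (σ ≫ le) x)) ∧
      Valid (IsDirected (σ ≫ le) (compactsBelow (σ ≫ le) x)) ∧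
      Valid (IsSup (σ ≫ le) (compactsBelow (σ ≫ le) x) x)) := by
  simp [IsOmegaAlgebraic, valid_all_all_imp_imp, -IsEmpty.forall_iff, -exists_and_left]
  simp [valid_allC, -IsEmpty.forall_iff, -exists_and_left]

theorem valid_mem_scottTopology {le : Γ ⟶ Pw (P ⊗ P)} {U : Γ ⟶ Pw P} :
    Valid (U ∈ᵢ scottTopology le) ↔ Valid (IsSdSet U) ∧
    (∀ ⦃Δ : E⦄ (σ : Δ ⟶ Γ) (x y : Δ ⟶ P), Valid (x ∈ᵢ σ ≫ U) → Valid (relI (σ ≫ le) x y) →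
      Valid (y ∈ᵢ σ ≫ U)) ∧
    (∀ ⦃Δ : E⦄ (σ : Δ ⟶ Γ) (c : Δ ⟶ Fn (Nn E) P) (s : Δ ⟶ P), Valid (IsChain (σ ≫ le) c) →
      Valid (IsSup (σ ≫ le) (rangeI c) s) → Valid (s ∈ᵢ σ ≫ U) →
      ∃ (Θ : E) (τ : Θ ⟶ Δ) (m : Θ ⟶ Nn E), Epi τ ∧ Valid (app (τ ≫ c) m ∈ᵢ τ ≫ σ ≫ U)) := by
  simp [scottTopology, valid_all_all_imp_imp_imp, valid_exC, -IsEmpty.forall_iff,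
    -exists_and_left]
  simp [valid_all_all_imp_imp, -IsEmpty.forall_iff, -exists_and_left]

theorem enumerates_unique {D : Γ ⟶ Pw X} {e : Γ ⟶ Fn (Nn E) (Pw X)} (he : Valid (Enumerates e D))
    {n : Γ ⟶ Nn E} {x y : Γ ⟶ X} (hx : Valid (x ∈ᵢ app e n)) (hy : Valid (y ∈ᵢ app e n)) :
    x = y := by
  rw [← valid_eqI]
  refine he.enumerates_cases n (fun Δ σ h => ?_) (fun Δ σ z h _ => ?_)
  · have := hx.comp σ
    simp at this
    rw [h] at this
    simp at this
    exact this.ff_elim _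
  · have h1 := hx.comp σ
    have h2 := hy.comp σ
    simp at h1 h2
    rw [h] at h1 h2
    simp at h1 h2
    simp [h1, h2]

/-- A countable directed set has a cofinal chain. -/
theorem exists_cofinal_chain (hE : SyntheticComputability E) {le : Γ ⟶ Pw (P ⊗ P)}
    (hle : Valid (IsPartialOrder le)) {D : Γ ⟶ Pw P} (hD : Valid (IsCountable D))
    (hD' : Valid (IsDirected le D)) :
    ∃ (Δ : E) (σ : Δ ⟶ Γ) (c : Δ ⟶ Fn (Nn E) P), Epi σ ∧ Valid (IsChain (σ ≫ le) c) ∧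
      (∀ ⦃Θ : E⦄ (τ : Θ ⟶ Δ) (n : Θ ⟶ Nn E), Valid (app (τ ≫ c) n ∈ᵢ τ ≫ σ ≫ D)) ∧
      ∀ ⦃Θ : E⦄ (τ : Θ ⟶ Δ) (x : Θ ⟶ P), Valid (x ∈ᵢ τ ≫ σ ≫ D) →
        ∃ (Ξ : E) (ρ : Ξ ⟶ Θ) (n : Ξ ⟶ Nn E), Epi ρ ∧
          Valid (relI (ρ ≫ τ ≫ σ ≫ le) (ρ ≫ x) (app (ρ ≫ τ ≫ c) n)) := by
  obtain ⟨⟨Δ₀, σ₀, x₀, _, hx₀⟩, hdir⟩ := valid_isDirected.1 hD'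
  obtain ⟨Δ₁, σ₁, e, _, he⟩ := valid_isCountable.1 (hD.on σ₀)
  obtain ⟨Δ, σ, n₀, _, hn₀⟩ := he.exists_enumerates (x := σ₁ ≫ x₀) (by simpa using hx₀.comp σ₁)
  -- A state is a counter `m` with the index `n` of the current element. The next state has counter
  -- `m + 1` and the index of an element above both the current one and, unless it is a skip, the
  -- one listed at step `m`.
  let Q : Δ ⟶ Pw ((Nn E ⊗ Nn E) ⊗ (Nn E ⊗ Nn E)) := compr _ fun w =>
    (w ≫ snd _ _ ≫ fst _ _ =ᵢ w ≫ fst _ _ ≫ fst _ _ + 1) ∧ᵢ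
    all P fun x => x ∈ᵢ app ↟(σ ≫ e) ↟(w ≫ fst _ _ ≫ snd _ _) →ᵢ
      ex P fun y => y ∈ᵢ app ↟(σ ≫ e) ↟(w ≫ snd _ _ ≫ snd _ _) ∧ᵢ
        relI ↟(σ ≫ σ₁ ≫ σ₀ ≫ le) ↟x y ∧ᵢ
        all P fun d => d ∈ᵢ app ↟(σ ≫ e) ↟(w ≫ fst _ _ ≫ fst _ _) →ᵢ
          relI ↟(σ ≫ σ₁ ≫ σ₀ ≫ le) d ↟y
  have mem_Q : ∀ ⦃Θ : E⦄ (τ : Θ ⟶ Δ) (z z' : Θ ⟶ Nn E ⊗ Nn E),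
      Valid (lift z z' ∈ᵢ τ ≫ Q) ↔ z' ≫ fst _ _ = z ≫ fst _ _ + 1 ∧
        ∀ ⦃Ξ : E⦄ (ρ : Ξ ⟶ Θ) (x : Ξ ⟶ P), Valid (x ∈ᵢ app (ρ ≫ τ ≫ σ ≫ e) (ρ ≫ z ≫ snd _ _)) →
          ∃ (Λ : E) (κ : Λ ⟶ Ξ) (y : Λ ⟶ P), Epi κ ∧
            Valid (y ∈ᵢ app (κ ≫ ρ ≫ τ ≫ σ ≫ e) (κ ≫ ρ ≫ z' ≫ snd _ _)) ∧
            Valid (relI (κ ≫ ρ ≫ τ ≫ σ ≫ σ₁ ≫ σ₀ ≫ le) (κ ≫ x) y) ∧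
            ∀ ⦃M : E⦄ (μ : M ⟶ Λ) (d : M ⟶ P),
              Valid (d ∈ᵢ app (μ ≫ κ ≫ ρ ≫ τ ≫ σ ≫ e) (μ ≫ κ ≫ ρ ≫ z ≫ fst _ _)) →
              Valid (relI (μ ≫ κ ≫ ρ ≫ τ ≫ σ ≫ σ₁ ≫ σ₀ ≫ le) d (μ ≫ y)) := by
    intro Θ τ z z'
    simp [Q, valid_all_imp, valid_exC, -IsEmpty.forall_iff, -exists_and_left]
  have he' : ∀ ⦃Θ : E⦄ (τ : Θ ⟶ Δ), Valid (Enumerates (τ ≫ σ ≫ e) (τ ≫ σ ≫ σ₁ ≫ σ₀ ≫ D)) :=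
    fun Θ τ => he.on (τ ≫ σ)
  have hle' : ∀ ⦃Θ : E⦄ (τ : Θ ⟶ Δ), Valid (IsPartialOrder (τ ≫ σ ≫ σ₁ ≫ σ₀ ≫ le)) :=
    fun Θ τ => hle.on (τ ≫ σ ≫ σ₁ ≫ σ₀)
  have total : ∀ ⦃Θ : E⦄ (τ : Θ ⟶ Δ) (z : Θ ⟶ Nn E ⊗ Nn E),
      Valid (ex (Γ := Θ) (Nn E ⊗ Nn E) fun z' => lift ↟z z' ∈ᵢ ↟(τ ≫ Q)) := by
    intro Θ τ z
    -- If the current index is a skip, the condition on the next state is vacuous, which keeps the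
    -- relation total on all states.
    refine (he' τ).enumerates_cases (z ≫ snd _ _) (fun Ξ ρ h0 => ?_) (fun Ξ ρ x hx hxD => ?_)
    · simp
      refine Valid.exC_intro (lift (ρ ≫ z ≫ fst _ _ + 1) 0) ?_
      have := (mem_Q (ρ ≫ τ) (ρ ≫ z) (lift (ρ ≫ z ≫ fst _ _ + 1) 0)).2 ⟨by simp, fun Λ κ y hy => by
        have h1 := congrArg (fun t => κ ≫ t) h0
        simp at h1 hy
        rw [h1] at hy
        simp at hy
        exact ⟨Λ, 𝟙 Λ, y, inferInstance, hy.ff_elim _, hy.ff_elim _, fun M μ d _ =>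
          Valid.ff_elim (by simpa using hy.comp μ) _⟩⟩
      simpa using this
    · have step : ∀ ⦃Λ : E⦄ (κ : Λ ⟶ Ξ) (y : Λ ⟶ P), Valid (y ∈ᵢ κ ≫ ρ ≫ τ ≫ σ ≫ σ₁ ≫ σ₀ ≫ D) →
          Valid (relI (κ ≫ ρ ≫ τ ≫ σ ≫ σ₁ ≫ σ₀ ≫ le) (κ ≫ x) y) →
          (∀ ⦃M : E⦄ (μ : M ⟶ Λ) (d : M ⟶ P),
              Valid (d ∈ᵢ app (μ ≫ κ ≫ ρ ≫ τ ≫ σ ≫ e) (μ ≫ κ ≫ ρ ≫ z ≫ fst _ _)) →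
              Valid (relI (μ ≫ κ ≫ ρ ≫ τ ≫ σ ≫ σ₁ ≫ σ₀ ≫ le) d (μ ≫ y))) →
          Valid (κ ≫ ρ ≫ ex (Γ := Θ) (Nn E ⊗ Nn E) fun z' => lift ↟z z' ∈ᵢ ↟(τ ≫ Q)) := by
        intro Λ κ y hy hxy hyd
        obtain ⟨M, μ, n', _, hn'⟩ := (he' (κ ≫ ρ ≫ τ)).exists_enumerates (x := y)
          (by simpa using hy)
        refine Valid.of_epi μ ?_
        simp
        refine Valid.exC_intro (lift (μ ≫ κ ≫ ρ ≫ z ≫ fst _ _ + 1) n') ?_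
        have := (mem_Q (μ ≫ κ ≫ ρ ≫ τ) (μ ≫ κ ≫ ρ ≫ z)
          (lift (μ ≫ κ ≫ ρ ≫ z ≫ fst _ _ + 1) n')).2 ⟨by simp, fun N ν x' hx' => by
            have h1 := congrArg (fun t => ν ≫ μ ≫ κ ≫ t) hx
            simp at h1 hx'
            rw [h1] at hx'
            simp at hx'
            refine ⟨N, 𝟙 N, ν ≫ μ ≫ y, inferInstance, ?_, ?_, fun N' ν' d hd => ?_⟩
            · simpa using hn'.comp ν
            · rw [hx']
              simpa using hxy.comp (ν ≫ μ)
            · simpa using hyd (ν' ≫ ν ≫ μ) d (by simpa using hd)⟩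
        simpa using this
      refine (he' (ρ ≫ τ)).enumerates_cases (ρ ≫ z ≫ fst _ _) (fun Λ κ h0 => ?_)
        (fun Λ κ d hd hdD => ?_)
      · refine step κ (κ ≫ x) (by simpa using hxD.comp κ) ?_ (fun M μ d hd => ?_)
        · simpa using (valid_isPartialOrder.1 (hle' (κ ≫ ρ ≫ τ))).1 (𝟙 Λ) (κ ≫ x)
        · have h1 := congrArg (fun t => μ ≫ t) h0
          simp at h1
          rw [h1] at hd
          simp at hd
          exact hd.ff_elim _
      · obtain ⟨M, μ, y, _, hy, hxy, hdy⟩ := hdir (κ ≫ ρ ≫ τ ≫ σ ≫ σ₁ ≫ σ₀) (κ ≫ x) d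
          (by simpa using hxD.comp κ) (by simpa using hdD)
        refine Valid.of_epi μ ?_
        have := step (μ ≫ κ) y (by simpa using hy) (by simpa using hxy) (fun N ν d' hd' => by
          have h1 := congrArg (fun t => ν ≫ μ ≫ t) hd
          simp at h1 hd'
          rw [h1] at hd'
          simp at hd'
          rw [hd']
          simpa using hdy.comp ν)
        simpa only [Category.assoc] using this
  obtain ⟨Δ₂, σ₂, f, _, hf0, hf⟩ := dependent_choice hE Q (fun Θ τ z => by
    obtain ⟨Ξ, ρ, z', hρ, h⟩ := valid_exC.1 (total τ z)
    exact ⟨Ξ, ρ, z', hρ, by simpa using h⟩) (lift 0 n₀)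
  have hf' := fun (Θ : E) (τ : Θ ⟶ Δ₂) (n : Θ ⟶ Nn E) =>
    (mem_Q (τ ≫ σ₂) _ _).1 (by simpa using hf τ n)
  -- Along the sequence the counter equals the time and the current index is never a skip, since the
  -- start `n₀` lists an element.
  have hfn : ∀ ⦃Θ : E⦄ (τ : Θ ⟶ Δ₂) (n : Θ ⟶ Nn E), app (τ ≫ f) n ≫ fst _ _ = n ∧
      Valid (ex (Γ := Θ) P fun x => x ∈ᵢ app ↟(τ ≫ σ₂ ≫ σ ≫ e) ↟(app (τ ≫ f) n ≫ snd _ _)) := by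
    intro Θ τ n
    have := nat_induction (fun n : Nn E ⊗ Θ ⟶ Nn E =>
      (app (↟(τ ≫ f)) n ≫ fst _ _ =ᵢ n) ∧ᵢ
        ex P fun x => x ∈ᵢ app ↟(τ ≫ σ₂ ≫ σ ≫ e) ↟(app ↟(τ ≫ f) n ≫ snd _ _))
      (by
        have h1 := congrArg (fun t => τ ≫ t) hf0
        simp at h1
        simp [h1]
        exact Valid.exC_intro (τ ≫ σ₂ ≫ σ ≫ σ₁ ≫ x₀) (by simpa [h1] using hn₀.comp (τ ≫ σ₂)))
      (fun Ξ ρ n h => by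
        have h1 := hf' Ξ (ρ ≫ τ) n
        simp [-exists_and_left] at h h1 ⊢
        refine ⟨by rw [h1.1, h.1], h.2.exC_elim fun Λ κ x hx => ?_⟩
        obtain ⟨M, μ, y, _, hy, -⟩ := h1.2 κ x (by simpa using hx)
        refine Valid.of_epi μ ?_
        simp
        exact Valid.exC_intro y (by simpa using hy)) n
    simpa using this
  obtain ⟨Δ₃, σ₃, c, _, hc⟩ := countable_choice hE (X := P) (Γ := Δ₂) (compr (Nn E ⊗ P) fun w =>
    w ≫ snd _ _ ∈ᵢ app ↟(σ₂ ≫ σ ≫ e) (app ↟f (w ≫ fst _ _) ≫ snd _ _)) (fun Θ τ n => by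
      obtain ⟨Ξ, ρ, x, hρ, h⟩ := valid_exC.1 (hfn τ n).2
      exact ⟨Ξ, ρ, x, hρ, by simpa using h⟩)
  simp at hc
  have key : ∀ ⦃Θ : E⦄ (τ : Θ ⟶ Δ₃) (n : Θ ⟶ Nn E),
      Valid (relI (τ ≫ σ₃ ≫ σ₂ ≫ σ ≫ σ₁ ≫ σ₀ ≫ le) (app (τ ≫ c) n) (app (τ ≫ c) (n + 1))) ∧
      ∀ d : Θ ⟶ P, Valid (d ∈ᵢ app (τ ≫ σ₃ ≫ σ₂ ≫ σ ≫ e) n) →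
        Valid (relI (τ ≫ σ₃ ≫ σ₂ ≫ σ ≫ σ₁ ≫ σ₀ ≫ le) d (app (τ ≫ c) (n + 1))) := by
    intro Θ τ n
    have h1 := hf' Θ (τ ≫ σ₃) n
    have h2 := hc τ n
    obtain ⟨Ξ, ρ, y, _, hy, hcy, hdy⟩ := h1.2 (𝟙 Θ) (app (τ ≫ c) n) (by simpa using h2)
    have h3 := (hc τ (n + 1)).comp ρ
    -- The bound given by the transition relation and the chosen element are both listed at one
    -- step, so they agree.
    have h4 : y = app (ρ ≫ τ ≫ c) (ρ ≫ n + 1) :=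
      enumerates_unique (he' (ρ ≫ τ ≫ σ₃ ≫ σ₂)) (n := app (ρ ≫ τ ≫ σ₃ ≫ f) (ρ ≫ n + 1) ≫ snd _ _)
        (by simpa using hy) (by simpa using h3)
    subst h4
    have h5 := (hfn (τ ≫ σ₃) n).1
    simp at h5
    refine ⟨Valid.of_epi ρ (by simpa using hcy), fun d hd => Valid.of_epi ρ ?_⟩
    have h6 := hdy (𝟙 Ξ) (ρ ≫ d) (by simpa [h5] using hd.comp ρ)
    simpa using h6
  refine ⟨Δ₃, σ₃ ≫ σ₂ ≫ σ ≫ σ₁ ≫ σ₀, c, inferInstance, valid_isChain.2 fun Θ τ n => by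
    simpa using (key τ n).1, fun Θ τ n => ?_, fun Θ τ x hx => ?_⟩
  · have := (he' (τ ≫ σ₃ ≫ σ₂)).enumerates_mem (by simpa using hc τ n)
    simpa using this
  · obtain ⟨Ξ, ρ, n, hρ, hn⟩ := (he' (τ ≫ σ₃ ≫ σ₂)).exists_enumerates (x := x) (by simpa using hx)
    exact ⟨Ξ, ρ, n + 1, hρ, by simpa using (key (ρ ≫ τ) n).2 (ρ ≫ x) (by simpa using hn)⟩

end Domains

/-! ### The Scott topology -/

section Scott

variable {Γ Δ P : E}

theorem dec_eq_compacts {le : Γ ⟶ Pw (P ⊗ P)} (hP : Valid (IsOmegaCpo le))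
    (hA : Valid (IsOmegaAlgebraic le)) {x y : Γ ⟶ P} (hx : Valid (x ∈ᵢ compacts le))
    (hy : Valid (y ∈ᵢ compacts le)) : Valid ((x =ᵢ y) ∨ᵢ ¬ᵢ (x =ᵢ y)) := by
  have hle := valid_isPartialOrder.1 (valid_isOmegaCpo.1 hP).1
  have hdec := (valid_isOmegaAlgebraic.1 hA).2.1 (𝟙 Γ)
  have h := dec_and (hdec x y (by simpa using hx) (by simpa using hy))
    (hdec y x (by simpa using hy) (by simpa using hx))
  have e : (relI (𝟙 Γ ≫ le) x y ∧ᵢ relI (𝟙 Γ ≫ le) y x) = (x =ᵢ y) := by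
    refine omega_ext fun Δ σ => ?_
    simp
    constructor
    · rintro ⟨h, h'⟩
      exact hle.2.2 σ _ _ h h'
    · intro h
      rw [h]
      exact ⟨hle.1 σ _, hle.1 σ _⟩
  rwa [e] at h

/-- For compact `c`, `c ≤ x` is membership in the countable set of compact elements below `x`, and
equality of compact elements is decidable by antisymmetry. -/
theorem isSd_relI_compact {le : Γ ⟶ Pw (P ⊗ P)} (hP : Valid (IsOmegaCpo le))
    (hA : Valid (IsOmegaAlgebraic le)) {c : Γ ⟶ P} (hc : Valid (c ∈ᵢ compacts le)) (x : Γ ⟶ P) :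
    Valid (IsSd (relI le c x)) := by
  have h := (valid_isOmegaAlgebraic.1 hA).2.2 (𝟙 Γ) x
  simp only [Category.id_comp] at h
  have := isSd_mem_countable h.1 c fun Δ σ y hy => by
    simp [valid_mem_compactsBelow] at hy
    exact dec_eq_compacts (hP.on σ) (hA.on σ) (by simpa using hc.comp σ) hy.1
  rwa [show (c ∈ᵢ compactsBelow le x) = relI le c x from omega_ext fun Δ σ => ?_] at this
  simp [valid_mem_compactsBelow]
  exact fun _ => by simpa using hc.comp σ

/-- The base of the Scott topology given by the upper sets of the compact elements. -/
def scottBase (le : Γ ⟶ Pw (P ⊗ P)) (e : Γ ⟶ Fn (Nn E) (Pw P)) : Γ ⟶ Fn (Nn E) (Pw P) :=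
  lam (Nn E) fun n => compr P fun x => ex P fun c => c ∈ᵢ app ↟e ↟n ∧ᵢ relI ↟le c ↟x

@[simp] theorem comp_scottBase (σ : Δ ⟶ Γ) (le : Γ ⟶ Pw (P ⊗ P)) (e : Γ ⟶ Fn (Nn E) (Pw P)) :
    σ ≫ scottBase le e = scottBase (σ ≫ le) (σ ≫ e) := by
  simp [scottBase]

theorem mem_scottBase (le : Γ ⟶ Pw (P ⊗ P)) (e : Γ ⟶ Fn (Nn E) (Pw P)) (n : Γ ⟶ Nn E)
    (x : Γ ⟶ P) : (x ∈ᵢ app (scottBase le e) n) =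
      ex P fun c => c ∈ᵢ app ↟e ↟n ∧ᵢ c ∈ᵢ ↟(compr P fun c => relI ↟le c ↟x : Γ ⟶ _) := by
  simp [scottBase]

theorem valid_mem_scottBase {le : Γ ⟶ Pw (P ⊗ P)} {e : Γ ⟶ Fn (Nn E) (Pw P)} {n : Γ ⟶ Nn E}
    {x : Γ ⟶ P} : Valid (x ∈ᵢ app (scottBase le e) n) ↔
      ∃ (Δ : E) (σ : Δ ⟶ Γ) (c : Δ ⟶ P), Epi σ ∧ Valid (c ∈ᵢ app (σ ≫ e) (σ ≫ n)) ∧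
        Valid (relI (σ ≫ le) c (σ ≫ x)) := by
  simp [scottBase, valid_exC, -exists_and_left]

theorem mem_scottBase_intro {le : Γ ⟶ Pw (P ⊗ P)} {e : Γ ⟶ Fn (Nn E) (Pw P)} {n : Γ ⟶ Nn E}
    {c x : Γ ⟶ P} (hc : Valid (c ∈ᵢ app e n)) (hx : Valid (relI le c x)) :
    Valid (x ∈ᵢ app (scottBase le e) n) :=
  valid_mem_scottBase.2 ⟨Γ, 𝟙 Γ, c, inferInstance, by simpa using hc, by simpa using hx⟩

/-- The relation between indices which expresses inclusion of the basic sets. -/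
def scottRel (le : Γ ⟶ Pw (P ⊗ P)) (e : Γ ⟶ Fn (Nn E) (Pw P)) : Γ ⟶ Pw (Nn E ⊗ Nn E) :=
  compr (Nn E ⊗ Nn E) fun w => ex P fun c => c ∈ᵢ app ↟e ↟(w ≫ fst _ _) ∧ᵢ
    ex P fun c' => c' ∈ᵢ app ↟e ↟(w ≫ snd _ _) ∧ᵢ relI ↟le c' ↟c

@[simp] theorem comp_scottRel (σ : Δ ⟶ Γ) (le : Γ ⟶ Pw (P ⊗ P)) (e : Γ ⟶ Fn (Nn E) (Pw P)) :
    σ ≫ scottRel le e = scottRel (σ ≫ le) (σ ≫ e) := by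
  simp [scottRel]

theorem valid_mem_scottRel {le : Γ ⟶ Pw (P ⊗ P)} {e : Γ ⟶ Fn (Nn E) (Pw P)} {l i : Γ ⟶ Nn E} :
    Valid (lift l i ∈ᵢ scottRel le e) ↔
      ∃ (Δ : E) (σ : Δ ⟶ Γ) (c c' : Δ ⟶ P), Epi σ ∧ Valid (c ∈ᵢ app (σ ≫ e) (σ ≫ l)) ∧
        Valid (c' ∈ᵢ app (σ ≫ e) (σ ≫ i)) ∧ Valid (relI (σ ≫ le) c' c) := by
  simp [scottRel, -exists_and_left]
  constructor
  · intro h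
    obtain ⟨Δ, σ, c, _, hc⟩ := valid_exC.1 h
    simp at hc
    obtain ⟨Θ, τ, c', _, hc'⟩ := valid_exC.1 hc.2
    exact ⟨Θ, τ ≫ σ, τ ≫ c, c', inferInstance, by simpa using hc.1.comp τ, by simpa using hc'⟩
  · rintro ⟨Δ, σ, c, c', _, hc, hc', h⟩
    refine valid_exC.2 ⟨Δ, σ, c, inferInstance, ?_⟩
    simp
    exact ⟨hc, Valid.exC_intro c' (by simpa using ⟨hc', h⟩)⟩

/-- If `x` is above the compact elements `c` and `c'`, directedness of the compact elements below
`x` yields a compact `b ≤ x` above both, and its upper set is the required refinement. -/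
theorem formalBase_scott {le : Γ ⟶ Pw (P ⊗ P)} (hP : Valid (IsOmegaCpo le))
    (hA : Valid (IsOmegaAlgebraic le)) {e : Γ ⟶ Fn (Nn E) (Pw P)}
    (he : Valid (Enumerates e (compacts le))) :
    FormalBase (scottBase le e) (scottRel le e) := by
  have hle := valid_isPartialOrder.1 (valid_isOmegaCpo.1 hP).1
  have hA' := (valid_isOmegaAlgebraic.1 hA).2.2
  have he' : ∀ ⦃Δ : E⦄ (σ : Δ ⟶ Γ), Valid (Enumerates (σ ≫ e) (compacts (σ ≫ le))) :=
    fun Δ σ => he.on σ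
  constructor
  · intro Δ σ n
    refine valid_isSdSet.2 fun Θ τ x => ?_
    simp only [comp_app, comp_scottBase, mem_scottBase]
    refine isSd_ex_term (by simpa using he' (τ ≫ σ)) _ fun Ξ ρ c hc => ?_
    simpa using isSd_relI_compact (hP.on (ρ ≫ τ ≫ σ)) (hA.on (ρ ≫ τ ≫ σ)) (by simpa using hc)
      (ρ ≫ x)
  · refine valid_isSdSet.2 fun Δ σ w => ?_
    have := isSd_ex_term (he' σ) (w ≫ fst _ _) (S := compr P fun c => ex P fun c' =>
      c' ∈ᵢ app ↟(σ ≫ e) ↟(w ≫ snd _ _) ∧ᵢ relI ↟(σ ≫ le) c' ↟c) fun Θ τ c hc => by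
        have := isSd_ex_term (he' (τ ≫ σ)) (τ ≫ w ≫ snd _ _)
          (S := compr P fun c' => relI ↟(τ ≫ σ ≫ le) c' ↟c) fun Ξ ρ c' hc' => by
            simpa using isSd_relI_compact (hP.on (ρ ≫ τ ≫ σ)) (hA.on (ρ ≫ τ ≫ σ))
              (by simpa using hc') (ρ ≫ c)
        simpa using this
    simpa [scottRel] using this
  · intro Δ σ x
    obtain ⟨Θ, τ, c, _, hc⟩ := (valid_isDirected.1 (hA' σ x).2.1).1
    simp [valid_mem_compactsBelow] at hc
    obtain ⟨Ξ, ρ, n, _, hn⟩ := (he' (τ ≫ σ)).exists_enumerates (x := c) (by simpa using hc.1)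
    refine ⟨Ξ, ρ ≫ τ, n, inferInstance, ?_⟩
    simp at hn ⊢
    exact mem_scottBase_intro hn (by simpa using hc.2.comp ρ)
  · intro Δ σ l i x hR hx
    simp at hR hx ⊢
    obtain ⟨Θ, τ, c, c', _, hc, hc', h⟩ := valid_mem_scottRel.1 hR
    have hx := hx.on τ
    obtain ⟨Ξ, ρ, b, _, hb, hbx⟩ := valid_mem_scottBase.1 hx
    have hc := hc.comp ρ
    simp at hc hb hbx
    have := enumerates_unique (he' (ρ ≫ τ ≫ σ)) (by simpa using hc) (by simpa using hb)
    subst this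
    refine Valid.of_epi (ρ ≫ τ) ?_
    simp
    refine mem_scottBase_intro (c := ρ ≫ c') (by simpa using hc'.comp ρ) ?_
    have := hle.2.1 (ρ ≫ τ ≫ σ) (ρ ≫ c') (ρ ≫ c) (ρ ≫ τ ≫ x) (by simpa using h.comp ρ)
      (by simpa using hbx)
    simpa using this
  · intro Δ σ i j x hi hj
    simp at hi hj
    obtain ⟨Θ, τ, c, _, hc, hcx⟩ := valid_mem_scottBase.1 hi
    have hj := hj.on τ
    obtain ⟨Ξ, ρ, c', _, hc', hcx'⟩ := valid_mem_scottBase.1 hj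
    have h1 := (he' (τ ≫ σ)).enumerates_mem (by simpa using hc)
    have h2 := (he' (ρ ≫ τ ≫ σ)).enumerates_mem (by simpa using hc')
    obtain ⟨Λ, κ, b, _, hb, hcb, hcb'⟩ := (valid_isDirected.1 (hA' (ρ ≫ τ ≫ σ)
      (ρ ≫ τ ≫ x)).2.1).2 (𝟙 _) (ρ ≫ c) c'
      (by simpa [valid_mem_compactsBelow] using
        ⟨by simpa using h1.comp ρ, by simpa using hcx.comp ρ⟩)
      (by simpa [valid_mem_compactsBelow] using ⟨by simpa using h2, by simpa using hcx'⟩)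
    simp [valid_mem_compactsBelow] at hb hcb hcb'
    obtain ⟨M, μ, l, _, hl⟩ := (he' (κ ≫ ρ ≫ τ ≫ σ)).exists_enumerates (x := b)
      (by simpa using hb.1)
    refine ⟨M, μ ≫ κ ≫ ρ ≫ τ, l, inferInstance, ?_, ?_, ?_⟩
    · simp at hl ⊢
      exact valid_mem_scottRel.2 ⟨M, 𝟙 M, μ ≫ b, μ ≫ κ ≫ ρ ≫ c, inferInstance, by simpa using hl,
        by simpa using hc.comp (μ ≫ κ ≫ ρ), by simpa using hcb.comp μ⟩
    · simp at hl ⊢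
      exact valid_mem_scottRel.2 ⟨M, 𝟙 M, μ ≫ b, μ ≫ κ ≫ c', inferInstance, by simpa using hl,
        by simpa using hc'.comp (μ ≫ κ), by simpa using hcb'.comp μ⟩
    · simp at hl ⊢
      exact mem_scottBase_intro hl (by simpa using hb.2.comp μ)

theorem isSup_rangeI_of_cofinal {le : Γ ⟶ Pw (P ⊗ P)} (hP : Valid (IsPartialOrder le))
    {D : Γ ⟶ Pw P} {s : Γ ⟶ P} (hs : Valid (IsSup le D s)) {c : Γ ⟶ Fn (Nn E) P}
    (hc : ∀ ⦃Δ : E⦄ (σ : Δ ⟶ Γ) (n : Δ ⟶ Nn E), Valid (app (σ ≫ c) n ∈ᵢ σ ≫ D))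
    (hc' : ∀ ⦃Δ : E⦄ (σ : Δ ⟶ Γ) (x : Δ ⟶ P), Valid (x ∈ᵢ σ ≫ D) →
        ∃ (Θ : E) (τ : Θ ⟶ Δ) (n : Θ ⟶ Nn E), Epi τ ∧
          Valid (relI (τ ≫ σ ≫ le) (τ ≫ x) (app (τ ≫ σ ≫ c) n))) :
    Valid (IsSup le (rangeI c) s) := by
  have hle := valid_isPartialOrder.1 hP
  refine valid_isSup.2 ⟨fun Δ σ x hx => ?_, fun Δ σ u hu => ?_⟩
  · simp at hx
    obtain ⟨Θ, τ, n, _, hn⟩ := valid_mem_rangeI.1 hx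
    refine Valid.of_epi τ ?_
    have := (valid_isSup.1 hs).1 (τ ≫ σ) (τ ≫ x) (by simpa [hn] using hc (τ ≫ σ) n)
    simpa using this
  · refine (valid_isSup.1 hs).2 σ u fun Θ τ x hx => ?_
    obtain ⟨Ξ, ρ, n, _, hn⟩ := hc' (τ ≫ σ) x (by simpa using hx)
    refine Valid.of_epi ρ ?_
    have h1 := hu (ρ ≫ τ) (app (ρ ≫ τ ≫ σ ≫ c) n) (by
      simp
      exact valid_mem_rangeI.2 ⟨Ξ, 𝟙 Ξ, n, inferInstance, by simp⟩)
    have := hle.2.1 (ρ ≫ τ ≫ σ) _ _ _ (by simpa using hn) (by simpa using h1)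
    simpa using this

/-- A point of a Scott open `U` is the supremum of a chain of compact elements below it, so `U`
contains one of these; hence `U` is the union of the upper sets of its compact elements. Conversely,
compactness makes upper sets of compact elements inaccessible by suprema of chains. -/
theorem scottTopology_eq_genTop (hE : SyntheticComputability E) {le : Γ ⟶ Pw (P ⊗ P)}
    (hP : Valid (IsOmegaCpo le)) (hA : Valid (IsOmegaAlgebraic le)) {e : Γ ⟶ Fn (Nn E) (Pw P)}
    (he : Valid (Enumerates e (compacts le))) : scottTopology le = genTop (scottBase le e) := by
  have hle := valid_isPartialOrder.1 (valid_isOmegaCpo.1 hP).1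
  have hA' := (valid_isOmegaAlgebraic.1 hA).2.2
  have he' : ∀ ⦃Δ : E⦄ (σ : Δ ⟶ Γ), Valid (Enumerates (σ ≫ e) (compacts (σ ≫ le))) :=
    fun Δ σ => he.on σ
  refine set_ext fun Δ σ U => ?_
  simp
  constructor
  · intro hU
    obtain ⟨hU, hup, hin⟩ := valid_mem_scottTopology.1 hU
    refine valid_mem_genTop.2 ⟨Δ, 𝟙 Δ, compr (Nn E) fun n => ex P fun c =>
      c ∈ᵢ app ↟(σ ≫ e) ↟n ∧ᵢ c ∈ᵢ ↟U, inferInstance, isCountable_of_isSdSet hE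
        (valid_isSdSet.2 fun Θ τ n => ?_), set_ext fun Θ τ x => ?_⟩
    · have := isSd_ex_term (he' (τ ≫ σ)) n (S := τ ≫ U) fun Ξ ρ x _ => (hU.on (ρ ≫ τ)).sd x
      simpa using this
    · simp
      constructor
      · intro hx
        obtain ⟨hc, hd, hs⟩ := hA' (τ ≫ σ) x
        obtain ⟨Ξ, ρ, c, _, hch, hcD, hcof⟩ :=
          exists_cofinal_chain hE (valid_isOmegaCpo.1 (hP.on (τ ≫ σ))).1 hc hd
        have hs' := isSup_rangeI_of_cofinal (le := ρ ≫ τ ≫ σ ≫ le)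
          (valid_isOmegaCpo.1 (hP.on (ρ ≫ τ ≫ σ))).1 (by simpa using hs.comp ρ)
          (by simpa using hcD) (by simpa using hcof)
        obtain ⟨Λ, κ, m, _, hm⟩ := hin (ρ ≫ τ) c (ρ ≫ x) (by simpa using hch) (by simpa using hs')
          (by simpa using hx.comp ρ)
        have hm' := hcD κ m
        simp [valid_mem_compactsBelow] at hm'
        obtain ⟨M, μ, n, _, hn⟩ := (he' (κ ≫ ρ ≫ τ ≫ σ)).exists_enumerates (x := app (κ ≫ c) m)
          (by simpa using hm'.1)
        refine valid_mem_baseUnion.2 ⟨M, μ ≫ κ ≫ ρ, n, inferInstance, ?_, ?_⟩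
        · simp at hn ⊢
          exact Valid.exC_intro (app (μ ≫ κ ≫ c) (μ ≫ m)) (by
            simpa using ⟨hn, by simpa using hm.comp μ⟩)
        · simp at hn ⊢
          exact mem_scottBase_intro hn (by simpa using hm'.2.comp μ)
      · intro hx
        obtain ⟨Ξ, ρ, i, _, hi, hx⟩ := valid_mem_baseUnion.1 hx
        simp at hi hx
        refine Valid.of_epi ρ (hi.exC_elim fun Λ κ c hc => ?_)
        have hx := hx.on κ
        obtain ⟨M, μ, c', _, hc', hcx⟩ := valid_mem_scottBase.1 hx
        have hc := hc.comp μ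
        simp at hc hc' hcx
        have := enumerates_unique (he' (μ ≫ κ ≫ ρ ≫ τ ≫ σ)) (by simpa using hc.1)
          (by simpa using hc')
        subst this
        refine Valid.of_epi μ ?_
        have := hup (μ ≫ κ ≫ ρ ≫ τ) (μ ≫ c) (μ ≫ κ ≫ ρ ≫ x) (by simpa using hc.2)
          (by simpa using hcx)
        simpa using this
  · intro hU
    obtain ⟨Θ, τ, I, _, hI, hUI⟩ := valid_mem_genTop.1 hU
    refine Valid.of_epi τ ?_
    simp at hUI ⊢
    rw [hUI]
    refine valid_mem_scottTopology.2 ⟨?_, fun Ξ ρ x y hx hxy => ?_, fun Ξ ρ c s hc hs hsI => ?_⟩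
    · have h1 := baseUnion_mem_genTop (scottBase (τ ≫ σ ≫ le) (τ ≫ σ ≫ e)) hI
      have h2 := (valid_isTopology.1 ((formalBase_scott hP hA he).isTopology hE)).1 (τ ≫ σ) _
        (by simpa using h1)
      exact h2
    · simp at hx hxy ⊢
      obtain ⟨Λ, κ, i, _, hi, hx⟩ := valid_mem_baseUnion.1 hx
      simp at hx
      obtain ⟨M, μ, c, _, hc, hcx⟩ := valid_mem_scottBase.1 hx
      refine valid_mem_baseUnion.2 ⟨M, μ ≫ κ, μ ≫ i, inferInstance, by simpa using hi.comp μ, ?_⟩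
      have h3 := hle.2.1 (μ ≫ κ ≫ ρ ≫ τ ≫ σ) c (μ ≫ κ ≫ x) (μ ≫ κ ≫ y) (by simpa using hcx)
        (by simpa using hxy.comp (μ ≫ κ))
      simp at hc ⊢
      exact mem_scottBase_intro hc (by simpa using h3)
    · simp at hsI
      obtain ⟨Λ, κ, i, _, hi, hx⟩ := valid_mem_baseUnion.1 hsI
      simp at hx
      obtain ⟨M, μ, b, _, hb, hbs⟩ := valid_mem_scottBase.1 hx
      have hb' := (he' (μ ≫ κ ≫ ρ ≫ τ ≫ σ)).enumerates_mem (by simpa using hb)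
      obtain ⟨N, ν, m, _, hm⟩ := valid_mem_compacts.1 hb' (𝟙 M) (μ ≫ κ ≫ c) (μ ≫ κ ≫ s)
        (by simpa using hc.comp (μ ≫ κ)) (by simpa using hs.comp (μ ≫ κ)) (by simpa using hbs)
      refine ⟨N, ν ≫ μ ≫ κ, m, inferInstance, ?_⟩
      simp at hb hm ⊢
      exact mem_baseUnion_intro (i := ν ≫ μ ≫ i) (by simpa using hi.comp (ν ≫ μ))
        (mem_scottBase_intro (by simpa using hb.comp ν) hm)

/-- Each point is the supremum of the compact elements below it, which gives injectivity. For
surjectivity, the compact elements named by a point filter form a countable directed set, and the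
supremum of a cofinal chain is the point. -/
theorem isSober_scott (hE : SyntheticComputability E) {le : Γ ⟶ Pw (P ⊗ P)}
    (hP : Valid (IsOmegaCpo le)) (hA : Valid (IsOmegaAlgebraic le)) {e : Γ ⟶ Fn (Nn E) (Pw P)}
    (he : Valid (Enumerates e (compacts le))) : Valid (IsSober (genTop (scottBase le e))) := by
  have hle := valid_isPartialOrder.1 (valid_isOmegaCpo.1 hP).1
  have hA' := (valid_isOmegaAlgebraic.1 hA).2.2
  have hB := formalBase_scott hP hA he
  have he' : ∀ ⦃Δ : E⦄ (σ : Δ ⟶ Γ), Valid (Enumerates (σ ≫ e) (compacts (σ ≫ le))) :=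
    fun Δ σ => he.on σ
  refine isSober_genTop hE hB (fun Δ σ x y hxy => ?_) (fun Δ σ F hF => ?_)
  · have key : ∀ x y : Δ ⟶ P, (∀ ⦃Θ : E⦄ (τ : Θ ⟶ Δ) (i : Θ ⟶ Nn E),
        (τ ≫ x ∈ᵢ app (τ ≫ σ ≫ scottBase le e) i) = (τ ≫ y ∈ᵢ app (τ ≫ σ ≫ scottBase le e) i)) →
        Valid (relI (σ ≫ le) x y) := by
      intro x y hxy
      have h := (valid_isSup.1 (hA' σ x).2.2).2 (𝟙 Δ) y fun Θ τ c hc => ?_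
      · simpa using h
      · simp [valid_mem_compactsBelow] at hc
        obtain ⟨Ξ, ρ, n, _, hn⟩ := (he' (τ ≫ σ)).exists_enumerates (x := c) (by simpa using hc.1)
        refine Valid.of_epi ρ ?_
        have h1 := hxy (ρ ≫ τ) n
        simp at h1 hn
        have h2 := mem_scottBase_intro hn (by simpa using hc.2.comp ρ)
        rw [h1] at h2
        obtain ⟨Λ, κ, c', _, hc', hcy⟩ := valid_mem_scottBase.1 h2
        have h3 := hn.comp κ
        have := enumerates_unique (he' (κ ≫ ρ ≫ τ ≫ σ)) (by simpa using h3) (by simpa using hc')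
        subst this
        refine Valid.of_epi κ ?_
        simpa using hcy
    exact hle.2.2 σ x y (key x y hxy) (key y x fun Θ τ i => (hxy τ i).symm)
  -- An index in the filter cannot be a skip, since the basic set of a skip is empty.
  · have inh : ∀ ⦃Θ : E⦄ (τ : Θ ⟶ Δ) (i : Θ ⟶ Nn E), Valid (i ∈ᵢ τ ≫ F) →
        ∃ (Ξ : E) (ρ : Ξ ⟶ Θ) (c : Ξ ⟶ P), Epi ρ ∧ Valid (c ∈ᵢ app (ρ ≫ τ ≫ σ ≫ e) (ρ ≫ i)) := by
      intro Θ τ i hi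
      have : Valid (ex (Γ := Θ) P fun c => c ∈ᵢ app ↟(τ ≫ σ ≫ e) ↟i) := by
        refine (he' (τ ≫ σ)).enumerates_cases i (fun Ξ ρ h0 => ?_) (fun Ξ ρ x hx _ => ?_)
        · refine Valid.ff_elim (hF.nonempty (ρ ≫ τ) (ρ ≫ i) (by simpa using hi.comp ρ) ?_) _
          refine set_ext fun Λ κ x => ?_
          simp
          refine ⟨fun hx => ?_, fun h => h.ff_elim _⟩
          obtain ⟨M, μ, c, _, hc, _⟩ := valid_mem_scottBase.1 hx
          have h1 := congrArg (fun t => μ ≫ κ ≫ t) h0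
          simp at hc h1
          rw [h1] at hc
          exact Valid.of_epi μ (by simpa using hc)
        · simp at hx ⊢
          exact Valid.exC_intro x (by simp [hx])
      obtain ⟨Ξ, ρ, c, hρ, hc⟩ := valid_exC.1 this
      exact ⟨Ξ, ρ, c, hρ, by simpa using hc⟩
    let D : Δ ⟶ Pw P := compr P fun c => ex (Nn E) fun n => n ∈ᵢ ↟F ∧ᵢ ↟c ∈ᵢ app ↟(σ ≫ e) n
    have mem_D : ∀ ⦃Θ : E⦄ (τ : Θ ⟶ Δ) (c : Θ ⟶ P), Valid (c ∈ᵢ τ ≫ D) ↔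
        ∃ (Ξ : E) (ρ : Ξ ⟶ Θ) (n : Ξ ⟶ Nn E), Epi ρ ∧ Valid (n ∈ᵢ ρ ≫ τ ≫ F) ∧
          Valid (ρ ≫ c ∈ᵢ app (ρ ≫ τ ≫ σ ≫ e) n) := by
      intro Θ τ c
      simp [D, valid_exC, -exists_and_left]
    have hFc := isCountable_of_isSdSet hE hF.sd
    have D_compact : ∀ ⦃Θ : E⦄ (τ : Θ ⟶ Δ) (c : Θ ⟶ P), Valid (c ∈ᵢ τ ≫ D) →
        Valid (c ∈ᵢ compacts (τ ≫ σ ≫ le)) := by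
      intro Θ τ c hc
      obtain ⟨Ξ, ρ, n, _, _, hn⟩ := (mem_D τ c).1 hc
      have := (he' (ρ ≫ τ ≫ σ)).enumerates_mem (by simpa using hn)
      exact Valid.of_epi ρ (by simpa using this)
    -- `D` is a semidecidable part of the countable set of compact elements: it is searched through
    -- `F`, comparing compact elements for equality.
    have D_countable : Valid (IsCountable D) := by
      have h := isCountable_inter hE (D := compacts (σ ≫ le)) (S := D)
        (valid_isOmegaAlgebraic.1 (hA.on σ)).1 fun Θ τ c hc => ?_
      · rwa [show interI (compacts (σ ≫ le)) D = D from set_ext fun Θ τ c => ?_] at h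
        simp
        exact fun h => by simpa using D_compact τ c h
      · have := isSd_ex_countable hE (hFc.on τ)
          (S := compr (Nn E) fun n => ↟c ∈ᵢ app ↟(τ ≫ σ ≫ e) n) fun Ξ ρ n _ => ?_
        · simpa [D] using this
        · refine isSd_of_dec ((he' (ρ ≫ τ ≫ σ)).enumerates_cases n (fun Λ κ h0 => ?_)
            (fun Λ κ x hx hxc => ?_))
          · simp at h0 ⊢
            rw [h0]
            exact Valid.inr (valid_notI.2 fun _ _ h => by simpa using h) _
          · simp at hx hxc hc ⊢
            rw [hx]
            simpa using dec_eq_compacts (hP.on (κ ≫ ρ ≫ τ ≫ σ)) (hA.on (κ ≫ ρ ≫ τ ≫ σ))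
              (x := κ ≫ ρ ≫ c) (by simpa using hc.comp (κ ≫ ρ)) (by simpa using hxc)
    have D_directed : Valid (IsDirected (σ ≫ le) D) := by
      refine valid_isDirected.2 ⟨?_, fun Θ τ x y hx hy => ?_⟩
      -- Inhabitedness is primeness of the filter for the cover by all basic sets.
      · obtain ⟨Θ, τ, j, _, _, hj⟩ := hF.prime (𝟙 Δ) univI isCountable_univI_nat
          (by simpa using (hB.on σ).baseUnion_univI)
        obtain ⟨Ξ, ρ, c, _, hc⟩ := inh τ j (by simpa using hj)
        exact ⟨Ξ, ρ ≫ τ, c, inferInstance, (mem_D _ _).2 ⟨Ξ, 𝟙 Ξ, ρ ≫ j, inferInstance,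
          by simpa using hj.comp ρ, by simpa using hc⟩⟩
      · obtain ⟨Ξ, ρ, i, _, hi, hxi⟩ := (mem_D τ x).1 hx
        obtain ⟨Λ, κ, j, _, hj, hyj⟩ := (mem_D (ρ ≫ τ) (ρ ≫ y)).1 (by simpa using hy.comp ρ)
        obtain ⟨M, μ, l, _, hl, hli, hlj⟩ := hF.directed (κ ≫ ρ ≫ τ) (κ ≫ i) j
          (by simpa using hi.comp κ) (by simpa using hj)
        simp at hli hlj
        obtain ⟨N, ν, c, x', _, hc, hx', hxc⟩ := valid_mem_scottRel.1 hli
        have hlj := hlj.on ν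
        obtain ⟨N', ν', c', y', _, hc', hy', hyc⟩ := valid_mem_scottRel.1 hlj
        have hc := hc.comp ν'
        have h1 := hxi.comp (ν ≫ μ ≫ κ)
        have h2 := hyj.comp (ν' ≫ ν ≫ μ)
        simp at hc hc' h1 h2 hx' hy' hxc hyc
        have e1 := enumerates_unique (he' (ν ≫ μ ≫ κ ≫ ρ ≫ τ ≫ σ)) (by simpa using h1)
          (by simpa using hx')
        have e2 := enumerates_unique (he' (ν' ≫ ν ≫ μ ≫ κ ≫ ρ ≫ τ ≫ σ)) (by simpa using h2)
          (by simpa using hy')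
        have e3 := enumerates_unique (he' (ν' ≫ ν ≫ μ ≫ κ ≫ ρ ≫ τ ≫ σ)) (by simpa using hc)
          (by simpa using hc')
        subst e1 e2 e3
        refine ⟨N', ν' ≫ ν ≫ μ ≫ κ ≫ ρ, ν' ≫ c, inferInstance, ?_, ?_, ?_⟩
        · have := (mem_D (ν' ≫ ν ≫ μ ≫ κ ≫ ρ ≫ τ) (ν' ≫ c)).2 ⟨N', 𝟙 N', ν' ≫ ν ≫ l,
            inferInstance, by simpa using hl.comp (ν' ≫ ν), by simpa using hc⟩
          simpa using this
        · simpa using hxc.comp ν'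
        · simpa using hyc
    obtain ⟨Θ, τ, c, _, hch, hcD, hcof⟩ := exists_cofinal_chain hE
      (valid_isOmegaCpo.1 (hP.on σ)).1 D_countable D_directed
    obtain ⟨Ξ, ρ, s, _, hs⟩ := (valid_isOmegaCpo.1 hP).2 (τ ≫ σ) c (by simpa using hch)
    have hcs : ∀ ⦃Λ : E⦄ (κ : Λ ⟶ Ξ) (n : Λ ⟶ Nn E), Valid (relI (κ ≫ ρ ≫ τ ≫ σ ≫ le)
        (app (κ ≫ ρ ≫ c) n) (κ ≫ s)) := by
      intro Λ κ n
      have := (valid_isSup.1 hs).1 κ (app (κ ≫ ρ ≫ c) n) (by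
        simp
        exact valid_mem_rangeI.2 ⟨Λ, 𝟙 Λ, n, inferInstance, by simp⟩)
      simpa using this
    refine ⟨Ξ, ρ ≫ τ, s, inferInstance, fun Λ κ i => ⟨fun hi => ?_, fun hi => ?_⟩⟩
    · obtain ⟨M, μ, b, _, hb⟩ := inh (κ ≫ ρ ≫ τ) i (by simpa using hi)
      obtain ⟨N, ν, n, _, hn⟩ := hcof (μ ≫ κ ≫ ρ) b (by
        have := (mem_D (μ ≫ κ ≫ ρ ≫ τ) b).2 ⟨M, 𝟙 M, μ ≫ i, inferInstance,
          by simpa using hi.comp μ, by simpa using hb⟩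
        simpa using this)
      have h1 := hle.2.1 (ν ≫ μ ≫ κ ≫ ρ ≫ τ ≫ σ) (ν ≫ b) _ (ν ≫ μ ≫ κ ≫ s) (by simpa using hn)
        (by simpa using hcs (ν ≫ μ ≫ κ) n)
      refine Valid.of_epi (ν ≫ μ) ?_
      simp
      exact mem_scottBase_intro (c := ν ≫ b) (by simpa using hb.comp ν) (by simpa using h1)
    · simp at hi ⊢
      obtain ⟨M, μ, b, _, hb, hbs⟩ := valid_mem_scottBase.1 hi
      -- The element `b` is compact and below the supremum `s`, so it is below some term of the
      -- chain. That term is named by an index in the filter, and its upper set is included in that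
      -- of `b`.
      have hb' := (he' (μ ≫ κ ≫ ρ ≫ τ ≫ σ)).enumerates_mem (by simpa using hb)
      obtain ⟨N, ν, m, _, hm⟩ := valid_mem_compacts.1 hb' (𝟙 M) (μ ≫ κ ≫ ρ ≫ c) (μ ≫ κ ≫ s)
        (by simpa using hch.comp (μ ≫ κ ≫ ρ)) (by simpa using hs.comp (μ ≫ κ))
        (by simpa using hbs)
      obtain ⟨N', ν', n, _, hn, hmn⟩ := (mem_D (ν ≫ μ ≫ κ ≫ ρ ≫ τ)
        (app (ν ≫ μ ≫ κ ≫ ρ ≫ c) m)).1 (by simpa using hcD (ν ≫ μ ≫ κ ≫ ρ) m)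
      refine Valid.of_epi (ν' ≫ ν ≫ μ) ?_
      have := hF.mono (ν' ≫ ν ≫ μ ≫ κ ≫ ρ ≫ τ) n (ν' ≫ ν ≫ μ ≫ i) (by simpa using hn)
        fun L l x hx => ?_
      · simpa using this
      simp at hx ⊢
      obtain ⟨L', l', a, _, ha, hax⟩ := valid_mem_scottBase.1 hx
      have h1 := hmn.comp (l' ≫ l)
      have e1 := enumerates_unique (he' (l' ≫ l ≫ ν' ≫ ν ≫ μ ≫ κ ≫ ρ ≫ τ ≫ σ))
        (by simpa using h1) (by simpa using ha)
      subst e1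
      refine Valid.of_epi l' ?_
      simp
      refine mem_scottBase_intro (c := l' ≫ l ≫ ν' ≫ ν ≫ b)
        (by simpa using hb.comp (l' ≫ l ≫ ν' ≫ ν)) ?_
      have := hle.2.1 (l' ≫ l ≫ ν' ≫ ν ≫ μ ≫ κ ≫ ρ ≫ τ ≫ σ) (l' ≫ l ≫ ν' ≫ ν ≫ b) _ (l' ≫ x)
        (by simpa using hm.comp (l' ≫ l ≫ ν')) (by simpa using hax)
      simpa using this

theorem isSeparable_scott {le : Γ ⟶ Pw (P ⊗ P)} (hP : Valid (IsOmegaCpo le))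
    (hA : Valid (IsOmegaAlgebraic le)) {e : Γ ⟶ Fn (Nn E) (Pw P)}
    (he : Valid (Enumerates e (compacts le))) :
    Valid (IsSeparable (genTop (scottBase le e))) := by
  have hle := valid_isPartialOrder.1 (valid_isOmegaCpo.1 hP).1
  refine valid_isSeparable.2 ⟨Γ, 𝟙 Γ, compacts le, inferInstance,
    (valid_isOmegaAlgebraic.1 hA).1, valid_isDenseSet.2 fun Δ σ U x hU hx => ?_⟩
  simp at hU
  obtain ⟨Θ, τ, I, _, _, e'⟩ := valid_mem_genTop.1 hU
  have hx := hx.comp τ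
  simp only [comp_memI, e'] at hx
  obtain ⟨Ξ, ρ, i, _, hi, hx⟩ := valid_mem_baseUnion.1 hx
  simp at hx
  obtain ⟨Λ, κ, c, _, hc, _⟩ := valid_mem_scottBase.1 hx
  refine ⟨Λ, κ ≫ ρ ≫ τ, c, inferInstance, ?_, ?_⟩
  · have := (he.on (κ ≫ ρ ≫ τ ≫ σ)).enumerates_mem (by simpa using hc)
    simpa using this
  · have h1 := congrArg (fun t => κ ≫ ρ ≫ t) e'
    simp at h1 ⊢
    rw [h1]
    exact mem_baseUnion_intro (i := κ ≫ i) (by simpa using hi.comp κ)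
      (mem_scottBase_intro hc (by simpa using hle.1 (κ ≫ ρ ≫ τ ≫ σ) c))

theorem scott_main (hE : SyntheticComputability E) {le : Γ ⟶ Pw (P ⊗ P)}
    (hP : Valid (IsOmegaCpo le)) (hA : Valid (IsOmegaAlgebraic le)) :
    Valid (IsCountablyBased (scottTopology le)) ∧ Valid (IsSober (scottTopology le)) ∧
      Valid (IsSeparable (scottTopology le)) ∧ Valid (OvertSpace P : Γ ⟶ Om E) := by
  have h : Valid (IsCountablyBased (scottTopology le)) ∧ Valid (IsSober (scottTopology le)) ∧
      Valid (IsSeparable (scottTopology le)) := by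
    -- The enumeration of the compact elements exists only on a cover, but the conclusions do not
    -- mention it and descend.
    obtain ⟨Δ, σ, e, _, he⟩ := valid_isCountable.1 (valid_isOmegaAlgebraic.1 hA).1
    have hP := hP.on σ
    have hA := hA.on σ
    simp at he
    have e1 := scottTopology_eq_genTop hE hP hA he
    refine ⟨Valid.of_epi σ ?_, Valid.of_epi σ ?_, Valid.of_epi σ ?_⟩
    · simp [e1]
      exact valid_isCountablyBased.2 ⟨(formalBase_scott hP hA he).isTopology hE, Δ, 𝟙 Δ, _,
        inferInstance, by simpa using isBase_genTop _⟩
    · simpa [e1] using isSober_scott hE hP hA he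
    · simpa [e1] using isSeparable_scott hP hA he
  exact ⟨h.1, h.2.1, h.2.2, overtSpace_of_isSeparable hE h.1 h.2.1 h.2.2⟩

end Scott

/-! ### Fractions -/

section Fractions

variable {Γ Δ X : E}

theorem ltI_of_mul_ltI_mul {m n k : Γ ⟶ Nn E} (h : Valid (ltI (m * (k + 1)) (n * (k + 1)))) :
    Valid (ltI m n) := by
  refine (le_or_lt n m).or_elim (fun Δ σ h' => ?_) (fun Δ σ h' => by simpa using h')
  have h := h.comp σ
  simp at h h'
  obtain ⟨i, hi⟩ := valid_leI.1 h'
  obtain ⟨j, hj⟩ := valid_ltI.1 h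
  exact (not_add_succ_eq (n := (σ ≫ n) * (σ ≫ k + 1)) (k := i * (σ ≫ k + 1) + j) (by
    rw [← hi] at hj
    linear_combination hj)).ff_elim _

theorem valid_ltFrac {p q : Γ ⟶ Frac E} : Valid (ltFrac p q) ↔
    ∃ k, (p ≫ fst _ _) * (q ≫ snd _ _ + 1) + k + 1 = (q ≫ fst _ _) * (p ≫ snd _ _ + 1) := by
  simp [ltFrac, valid_ltI, numI, denI]

theorem ltFrac_intro {p q : Γ ⟶ Frac E} (k : Γ ⟶ Nn E)
    (h : (p ≫ fst _ _) * (q ≫ snd _ _ + 1) + k + 1 = (q ≫ fst _ _) * (p ≫ snd _ _ + 1)) :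
    Valid (ltFrac p q) := valid_ltFrac.2 ⟨k, h⟩

@[simp] theorem addFrac_fst (p q : Γ ⟶ Frac E) : addFrac p q ≫ fst _ _ =
    (p ≫ fst _ _) * (q ≫ snd _ _ + 1) + (q ≫ fst _ _) * (p ≫ snd _ _ + 1) := by
  simp [addFrac, numI, denI]

@[simp] theorem addFrac_snd (p q : Γ ⟶ Frac E) : addFrac p q ≫ snd _ _ =
    (p ≫ snd _ _) * (q ≫ snd _ _ + 1) + q ≫ snd _ _ := by
  simp [addFrac, numI, denI]

@[simp] theorem recipFrac_fst (k : Γ ⟶ Nn E) : recipFrac k ≫ fst _ _ = (1 : Γ ⟶ Nn E) := by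
  simp [recipFrac]

@[simp] theorem recipFrac_snd (k : Γ ⟶ Nn E) : recipFrac k ≫ snd _ _ = k := by
  simp [recipFrac]

@[simp] theorem zeroFrac_fst : (zeroFrac : Γ ⟶ Frac E) ≫ fst _ _ = (0 : Γ ⟶ Nn E) := by
  simp [zeroFrac]

@[simp] theorem zeroFrac_snd : (zeroFrac : Γ ⟶ Frac E) ≫ snd _ _ = (0 : Γ ⟶ Nn E) := by
  simp [zeroFrac]

theorem frac_ext {p q : Γ ⟶ Frac E} (h : p ≫ fst _ _ = q ≫ fst _ _)
    (h' : p ≫ snd _ _ = q ≫ snd _ _) : p = q := by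
  ext
  · exact h
  · exact h'

theorem addFrac_comm (p q : Γ ⟶ Frac E) : addFrac p q = addFrac q p := by
  refine frac_ext ?_ ?_
  · simp only [addFrac_fst]
    ring
  · simp only [addFrac_snd]
    ring

theorem addFrac_assoc (p q r : Γ ⟶ Frac E) :
    addFrac (addFrac p q) r = addFrac p (addFrac q r) := by
  refine frac_ext ?_ ?_
  · simp only [addFrac_fst, addFrac_snd]
    ring
  · simp only [addFrac_snd]
    ring

theorem zero_addFrac (p : Γ ⟶ Frac E) : addFrac zeroFrac p = p := by
  refine frac_ext ?_ ?_
  · simp only [addFrac_fst, zeroFrac_fst, zeroFrac_snd]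
    ring
  · simp only [addFrac_snd, zeroFrac_snd]
    ring

theorem ltFrac_trans {p q r : Γ ⟶ Frac E} (h : Valid (ltFrac p q)) (h' : Valid (ltFrac q r)) :
    Valid (ltFrac p r) := by
  obtain ⟨k, hk⟩ := valid_ltFrac.1 h
  obtain ⟨l, hl⟩ := valid_ltFrac.1 h'
  refine valid_ltFrac.2 (valid_ltI.1 (ltI_of_mul_ltI_mul (k := q ≫ snd _ _) (valid_ltI.2
    ⟨(k + 1) * (r ≫ snd _ _ + 1) + l * (p ≫ snd _ _ + 1) + p ≫ snd _ _, ?_⟩)))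
  linear_combination (r ≫ snd _ _ + 1) * hk + (p ≫ snd _ _ + 1) * hl

theorem ltFrac_irrefl {p : Γ ⟶ Frac E} (h : Valid (ltFrac p p)) : Valid (ff : Γ ⟶ Om E) := by
  obtain ⟨k, hk⟩ := valid_ltFrac.1 h
  exact not_add_succ_eq hk

theorem dec_ltFrac (p q : Γ ⟶ Frac E) : Valid (ltFrac p q ∨ᵢ ¬ᵢ (ltFrac p q)) := nat_dec_lt _ _

theorem ltFrac_add_right {p q : Γ ⟶ Frac E} (h : Valid (ltFrac p q)) (r : Γ ⟶ Frac E) :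
    Valid (ltFrac (addFrac p r) (addFrac q r)) := by
  obtain ⟨k, hk⟩ := valid_ltFrac.1 h
  refine ltFrac_intro (k * (r ≫ snd _ _ + 1) * (r ≫ snd _ _ + 1) + (r ≫ snd _ _) * (r ≫ snd _ _) +
    r ≫ snd _ _ + r ≫ snd _ _) ?_
  simp only [addFrac_fst, addFrac_snd]
  linear_combination (r ≫ snd _ _ + 1) * (r ≫ snd _ _ + 1) * hk

theorem ltFrac_add_left {p q : Γ ⟶ Frac E} (h : Valid (ltFrac p q)) (r : Γ ⟶ Frac E) :
    Valid (ltFrac (addFrac r p) (addFrac r q)) := by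
  rw [addFrac_comm r p, addFrac_comm r q]
  exact ltFrac_add_right h r

theorem ltFrac_add {p q p' q' : Γ ⟶ Frac E} (h : Valid (ltFrac p q)) (h' : Valid (ltFrac p' q')) :
    Valid (ltFrac (addFrac p p') (addFrac q q')) :=
  ltFrac_trans (ltFrac_add_right h p') (ltFrac_add_left h' q)

/-- Room for two equal errors is what the later triangle inequalities need: one for approximating a
point by the dense set, one for the radius of a small ball. -/
theorem exists_recip {p q : Γ ⟶ Frac E} (h : Valid (ltFrac p q)) :
    ∃ k, Valid (ltFrac (addFrac p (addFrac (recipFrac k) (recipFrac k))) q) := by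
  obtain ⟨t, ht⟩ := valid_ltFrac.1 h
  -- Distinct fractions differ by at least the reciprocal of the product of their denominators, and
  -- `2 / (k + 1)` is smaller than that.
  obtain ⟨k, hk⟩ : ∃ k, k = 2 * (p ≫ snd _ _ + 1) * (q ≫ snd _ _ + 1) := ⟨_, rfl⟩
  refine ⟨k, ltFrac_intro ((k + 1) * t * (k + 1) + k) ?_⟩
  simp only [addFrac_fst, addFrac_snd, recipFrac_fst, recipFrac_snd]
  linear_combination (k + 1) * (k + 1) * ht - (k + 1) * hk

theorem recipFrac_lt {k l : Γ ⟶ Nn E} (h : Valid (ltI k l)) :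
    Valid (ltFrac (recipFrac l) (recipFrac k)) := by
  obtain ⟨i, hi⟩ := valid_ltI.1 h
  refine ltFrac_intro i ?_
  simp only [recipFrac_fst, recipFrac_snd]
  linear_combination hi

theorem zero_ltFrac_recip (k : Γ ⟶ Nn E) : Valid (ltFrac zeroFrac (recipFrac k)) := by
  refine ltFrac_intro 0 ?_
  simp

theorem zero_ltFrac_of_ltFrac {p q : Γ ⟶ Frac E} (h : Valid (ltFrac p q)) :
    Valid (ltFrac zeroFrac q) := by
  obtain ⟨k, hk⟩ := valid_ltFrac.1 h
  refine valid_ltFrac.2 (valid_ltI.1 (ltI_of_mul_ltI_mul (k := p ≫ snd _ _) (valid_ltI.2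
    ⟨(p ≫ fst _ _) * (q ≫ snd _ _ + 1) + k, ?_⟩)))
  simp only [zeroFrac_fst, zeroFrac_snd]
  linear_combination hk

theorem ltFrac_of_addFrac_lt {p q r : Γ ⟶ Frac E} (h : Valid (ltFrac (addFrac p q) r)) :
    Valid (ltFrac p r) := by
  obtain ⟨k, hk⟩ := valid_ltFrac.1 h
  refine valid_ltFrac.2 (valid_ltI.1 (ltI_of_mul_ltI_mul (k := q ≫ snd _ _) (valid_ltI.2
    ⟨(q ≫ fst _ _) * (p ≫ snd _ _ + 1) * (r ≫ snd _ _ + 1) + k, ?_⟩)))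
  simp only [addFrac_fst, addFrac_snd] at hk
  linear_combination hk

theorem ltFrac_addFrac {p r : Γ ⟶ Frac E} (h : Valid (ltFrac zeroFrac r)) :
    Valid (ltFrac p (addFrac p r)) := by
  have := ltFrac_add_right h p
  rwa [zero_addFrac, addFrac_comm] at this

theorem exists_between {p q : Γ ⟶ Frac E} (h : Valid (ltFrac p q)) :
    ∃ r, Valid (ltFrac p r) ∧ Valid (ltFrac r q) := by
  obtain ⟨k, hk⟩ := exists_recip h
  refine ⟨addFrac p (recipFrac k), ltFrac_addFrac (zero_ltFrac_recip k), ?_⟩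
  rw [← addFrac_assoc] at hk
  exact ltFrac_of_addFrac_lt hk

theorem ltFrac_cotrans {p s : Γ ⟶ Frac E} (h : Valid (ltFrac p s)) (q : Γ ⟶ Frac E) :
    Valid (ltFrac p q ∨ᵢ ltFrac q s) := by
  refine (le_or_lt (numI q *ᵢ denI p) (numI p *ᵢ denI q)).or_elim (fun Δ σ h' => ?_)
    (fun Δ σ h' => ?_)
  · have h := h.comp σ
    simp at h
    obtain ⟨k, hk⟩ := valid_ltFrac.1 h
    simp [numI, denI] at h' hk ⊢
    obtain ⟨l, hl⟩ := valid_leI.1 h'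
    refine Valid.inr (valid_ltFrac.2 (valid_ltI.1 (ltI_of_mul_ltI_mul (k := σ ≫ p ≫ snd _ _)
      (valid_ltI.2 ⟨l * (σ ≫ s ≫ snd _ _ + 1) + k * (σ ≫ q ≫ snd _ _ + 1) + σ ≫ q ≫ snd _ _,
        ?_⟩)))) _
    simp
    linear_combination (σ ≫ s ≫ snd _ _ + 1) * hl + (σ ≫ q ≫ snd _ _ + 1) * hk
  · have h' : Valid (σ ≫ ltFrac p q) := h'
    simp only [comp_orI]
    exact Valid.inl h' _

end Fractions

/-! ### Real numbers -/

section Reals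

variable {Γ Δ X : E}

theorem valid_isReal {r : Γ ⟶ Cuts E} : Valid (IsReal r) ↔
    (∃ (Δ : E) (σ : Δ ⟶ Γ) (q : Δ ⟶ Frac E), Epi σ ∧ Valid (q ∈ᵢ upperI (σ ≫ r))) ∧
    (∀ ⦃Δ : E⦄ (σ : Δ ⟶ Γ) (q : Δ ⟶ Frac E), (q ∈ᵢ lowerI (σ ≫ r)) =
      ex (Frac E) fun p => ltFrac ↟q p ∧ᵢ p ∈ᵢ lowerI ↟(σ ≫ r)) ∧
    (∀ ⦃Δ : E⦄ (σ : Δ ⟶ Γ) (q : Δ ⟶ Frac E), (q ∈ᵢ upperI (σ ≫ r)) =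
      ex (Frac E) fun p => ltFrac p ↟q ∧ᵢ p ∈ᵢ upperI ↟(σ ≫ r)) ∧
    (∀ ⦃Δ : E⦄ (σ : Δ ⟶ Γ) (q : Δ ⟶ Frac E), Valid (q ∈ᵢ lowerI (σ ≫ r)) →
      Valid (q ∈ᵢ upperI (σ ≫ r)) → Valid (ff : Δ ⟶ Om E)) ∧
    (∀ ⦃Δ : E⦄ (σ : Δ ⟶ Γ) (p q : Δ ⟶ Frac E), Valid (ltFrac p q) →
      Valid ((p ∈ᵢ lowerI (σ ≫ r)) ∨ᵢ (q ∈ᵢ upperI (σ ≫ r)))) := by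
  simp [IsReal, valid_exC, valid_all_iff, valid_all_not, valid_all_all_imp, -exists_and_left,
    -IsEmpty.forall_iff]

theorem Valid.lower_round {r : Γ ⟶ Cuts E} (h : Valid (IsReal r)) {q : Γ ⟶ Frac E}
    (hq : Valid (q ∈ᵢ lowerI r)) : ∃ (Δ : E) (σ : Δ ⟶ Γ) (p : Δ ⟶ Frac E), Epi σ ∧
      Valid (ltFrac (σ ≫ q) p) ∧ Valid (p ∈ᵢ lowerI (σ ≫ r)) := by
  have h1 := (valid_isReal.1 h).2.1 (𝟙 Γ) q
  simp at h1
  rw [h1] at hq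
  obtain ⟨Δ, σ, p, hσ, hp⟩ := valid_exC.1 hq
  exact ⟨Δ, σ, p, hσ, by simpa using hp⟩

theorem Valid.lower_down {r : Γ ⟶ Cuts E} (h : Valid (IsReal r)) {p q : Γ ⟶ Frac E}
    (hpq : Valid (ltFrac p q)) (hq : Valid (q ∈ᵢ lowerI r)) : Valid (p ∈ᵢ lowerI r) := by
  have h1 := (valid_isReal.1 h).2.1 (𝟙 Γ) p
  simp at h1
  rw [h1]
  exact Valid.exC_intro q (by simpa using ⟨hpq, hq⟩)

theorem Valid.upper_round {r : Γ ⟶ Cuts E} (h : Valid (IsReal r)) {q : Γ ⟶ Frac E}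
    (hq : Valid (q ∈ᵢ upperI r)) : ∃ (Δ : E) (σ : Δ ⟶ Γ) (p : Δ ⟶ Frac E), Epi σ ∧
      Valid (ltFrac p (σ ≫ q)) ∧ Valid (p ∈ᵢ upperI (σ ≫ r)) := by
  have h1 := (valid_isReal.1 h).2.2.1 (𝟙 Γ) q
  simp at h1
  rw [h1] at hq
  obtain ⟨Δ, σ, p, hσ, hp⟩ := valid_exC.1 hq
  exact ⟨Δ, σ, p, hσ, by simpa using hp⟩

theorem Valid.upper_up {r : Γ ⟶ Cuts E} (h : Valid (IsReal r)) {p q : Γ ⟶ Frac E}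
    (hpq : Valid (ltFrac p q)) (hp : Valid (p ∈ᵢ upperI r)) : Valid (q ∈ᵢ upperI r) := by
  have h1 := (valid_isReal.1 h).2.2.1 (𝟙 Γ) q
  simp at h1
  rw [h1]
  exact Valid.exC_intro p (by simpa using ⟨hpq, hp⟩)

/-- A truth value `q` is semidecidable if it is equivalent to `∃ n ∈ A, ¬ n ∈ P`, where `A` is
decidable and every `n ∈ A` satisfies `n ∈ P` or `q`. -/
theorem isSd_of_located (hE : SyntheticComputability E) {A P : Γ ⟶ Pw (Nn E)} {q : Γ ⟶ Om E}
    (hA : Valid (IsDecidable A))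
    (hAP : ∀ ⦃Δ : E⦄ (σ : Δ ⟶ Γ) (n : Δ ⟶ Nn E), Valid (n ∈ᵢ σ ≫ A) →
      Valid ((n ∈ᵢ σ ≫ P) ∨ᵢ σ ≫ q))
    (hq : ∀ ⦃Δ : E⦄ (σ : Δ ⟶ Γ), Valid (σ ≫ q) → ∃ (Θ : E) (τ : Θ ⟶ Δ) (n : Θ ⟶ Nn E), Epi τ ∧
      Valid (n ∈ᵢ τ ≫ σ ≫ A) ∧ Valid (¬ᵢ (n ∈ᵢ τ ≫ σ ≫ P))) : Valid (IsSd q) := by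
  -- Countable choice turns the disjunctions into a binary sequence: the value 0 at `n` certifies
  -- that `n ∈ A` implies `n ∈ P`, the value 1 certifies `q`. Then `q` holds exactly when the value
  -- 1 occurs.
  let R : Γ ⟶ Pw (Nn E ⊗ Nn E) := compr (Nn E ⊗ Nn E) fun w =>
    ((w ≫ snd _ _ =ᵢ 0) ∧ᵢ (w ≫ fst _ _ ∈ᵢ ↟A →ᵢ w ≫ fst _ _ ∈ᵢ ↟P)) ∨ᵢ
      (w ≫ snd _ _ =ᵢ 1) ∧ᵢ ↟q
  have total : ∀ ⦃Δ : E⦄ (σ : Δ ⟶ Γ) (n : Δ ⟶ Nn E),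
      Valid (ex (Γ := Δ) (Nn E) fun t => lift ↟n t ∈ᵢ ↟(σ ≫ R)) := by
    intro Δ σ n
    refine ((hA.on σ).dec n).or_elim (fun Θ τ h => ?_) (fun Θ τ h => ?_)
    · simp at h
      refine (hAP (τ ≫ σ) (τ ≫ n) (by simpa using h)).or_elim (fun Ξ ρ h => ?_) (fun Ξ ρ h => ?_)
      · simp [R] at h ⊢
        refine Valid.exC_intro 0 ?_
        simp
        refine Valid.inl (valid_andI.2 ⟨by simp, valid_impI.2 fun Λ κ _ => ?_⟩) _
        simpa using h.comp κ
      · simp [R] at h ⊢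
        refine Valid.exC_intro 1 ?_
        simp
        exact Valid.inr (valid_andI.2 ⟨by simp, h⟩) _
    · simp [R] at h ⊢
      refine Valid.exC_intro 0 ?_
      simp
      refine Valid.inl (valid_andI.2 ⟨by simp, valid_impI.2 fun Λ κ h' => ?_⟩) _
      simp at h'
      exact ((h.on κ).not_elim h').ff_elim _
  obtain ⟨Δ, σ, f, _, hf⟩ := countable_choice hE R fun Δ σ n => by
    obtain ⟨Θ, τ, t, hτ, ht⟩ := valid_exC.1 (total σ n)
    exact ⟨Θ, τ, t, hτ, by simpa using ht⟩
  refine Valid.of_epi σ ?_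
  have hD : Valid (IsDecidable (compr (Nn E) fun n => app ↟f n =ᵢ 1 : Δ ⟶ _)) :=
    valid_isDecidable.2 fun Θ τ n => by simpa using nat_dec_eq (app (τ ≫ f) n) 1
  have e : σ ≫ q = ex (Γ := Δ) (Nn E) fun n =>
      n ∈ᵢ ↟(compr (Nn E) fun n => app ↟f n =ᵢ 1 : Δ ⟶ _) := by
    refine omega_ext fun Θ τ => ?_
    simp
    constructor
    · intro h
      obtain ⟨Ξ, ρ, n, _, hn, hn'⟩ := hq (τ ≫ σ) (by simpa using h)
      refine Valid.of_epi ρ ?_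
      simp
      refine Valid.exC_intro n ?_
      have h1 := hf (ρ ≫ τ) n
      simp [R] at h1
      refine h1.or_elim (fun Λ κ h => ?_) (fun Λ κ h => ?_)
      · simp at h
        have hn := hn.comp κ
        have hn' := hn'.comp κ
        simp at hn hn'
        exact (hn'.not_elim (h.2.mp hn)).ff_elim _
      · simp at h ⊢
        exact h.1
    · intro h
      refine h.exC_elim fun Ξ ρ n hn => ?_
      have h1 := hf (ρ ≫ τ) n
      simp at hn
      simp [R, hn] at h1
      refine h1.or_elim (fun Λ κ h => ?_) (fun Λ κ h => ?_)
      · simp at h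
        exact Valid.ff_elim (succI_ne_zeroI (n := 0) (by simpa using h.1)) _
      · simpa using h
  rw [comp_IsSd, e]
  exact isSd_ex_decidable hD

/-- For `p < q`, locatedness gives `p < r` or `r < q`. Conversely, if `r < q`, roundedness gives `p
< q` with `r < p`, and this `p` is not in the lower cut. Hence `isSd_of_located` applies. -/
theorem isSd_upper (hE : SyntheticComputability E) {r : Γ ⟶ Cuts E} (hr : Valid (IsReal r))
    (q : Γ ⟶ Frac E) : Valid (IsSd (q ∈ᵢ upperI r)) := by
  obtain ⟨Δ, σ, g, _, hg⟩ := exists_pairing hE Γ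
  refine Valid.of_epi σ ?_
  simp
  refine isSd_of_located hE (A := compr (Nn E) fun n => ltFrac (app ↟g n) ↟(σ ≫ q))
    (P := compr (Nn E) fun n => app ↟g n ∈ᵢ lowerI ↟(σ ≫ r))
    (valid_isDecidable.2 fun Θ τ n => by
      simpa using dec_ltFrac (app (τ ≫ g) n) (τ ≫ σ ≫ q)) (fun Θ τ n hn => ?_) (fun Θ τ h => ?_)
  · simp at hn ⊢
    simpa using (valid_isReal.1 hr).2.2.2.2 (τ ≫ σ) _ _ hn
  · simp at h
    obtain ⟨Ξ, ρ, p, _, hp, hpU⟩ := (hr.on (τ ≫ σ)).upper_round (by simpa using h)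
    obtain ⟨Λ, κ, n, _, hn⟩ := valid_mem_rangeI.1 (hg (ρ ≫ τ) p)
    refine ⟨Λ, κ ≫ ρ, n, inferInstance, ?_, valid_notI.2 fun M μ h' => ?_⟩
    · simp at hn ⊢
      rw [← hn]
      simpa using hp.comp κ
    · have hn := congrArg (fun t => μ ≫ t) hn
      simp at hn h'
      rw [← hn] at h'
      exact (valid_isReal.1 hr).2.2.2.1 (μ ≫ κ ≫ ρ ≫ τ ≫ σ) (μ ≫ κ ≫ p) (by simpa using h')
        (by simpa using hpU.comp (μ ≫ κ))

theorem isSd_lower (hE : SyntheticComputability E) {r : Γ ⟶ Cuts E} (hr : Valid (IsReal r))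
    (q : Γ ⟶ Frac E) : Valid (IsSd (q ∈ᵢ lowerI r)) := by
  obtain ⟨Δ, σ, g, _, hg⟩ := exists_pairing hE Γ
  refine Valid.of_epi σ ?_
  simp
  refine isSd_of_located hE (A := compr (Nn E) fun n => ltFrac ↟(σ ≫ q) (app ↟g n))
    (P := compr (Nn E) fun n => app ↟g n ∈ᵢ upperI ↟(σ ≫ r))
    (valid_isDecidable.2 fun Θ τ n => by
      simpa using dec_ltFrac (τ ≫ σ ≫ q) (app (τ ≫ g) n)) (fun Θ τ n hn => ?_) (fun Θ τ h => ?_)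
  · simp at hn ⊢
    refine ((valid_isReal.1 hr).2.2.2.2 (τ ≫ σ) _ _ hn).or_elim (fun Ξ ρ h => ?_)
      (fun Ξ ρ h => ?_)
    · simp at h ⊢
      exact Valid.inr h _
    · simp at h ⊢
      exact Valid.inl h _
  · simp at h
    obtain ⟨Ξ, ρ, p, _, hp, hpU⟩ := (hr.on (τ ≫ σ)).lower_round (by simpa using h)
    obtain ⟨Λ, κ, n, _, hn⟩ := valid_mem_rangeI.1 (hg (ρ ≫ τ) p)
    refine ⟨Λ, κ ≫ ρ, n, inferInstance, ?_, valid_notI.2 fun M μ h' => ?_⟩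
    · simp at hn ⊢
      rw [← hn]
      simpa using hp.comp κ
    · have hn := congrArg (fun t => μ ≫ t) hn
      simp at hn h'
      rw [← hn] at h'
      exact (valid_isReal.1 hr).2.2.2.1 (μ ≫ κ ≫ ρ ≫ τ ≫ σ) (μ ≫ κ ≫ p)
        (by simpa using hpU.comp (μ ≫ κ)) (by simpa using h')

/-- The real number given by a fraction. -/
def fracReal (q : Γ ⟶ Frac E) : Γ ⟶ Cuts E :=
  lift (compr (Frac E) fun p => ltFrac p ↟q) (compr (Frac E) fun p => ltFrac ↟q p)

@[simp] theorem lowerI_fracReal (q : Γ ⟶ Frac E) :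
    lowerI (fracReal q) = compr (Frac E) fun p => ltFrac p ↟q := by
  simp [lowerI, fracReal]

@[simp] theorem upperI_fracReal (q : Γ ⟶ Frac E) :
    upperI (fracReal q) = compr (Frac E) fun p => ltFrac ↟q p := by
  simp [upperI, fracReal]

@[simp] theorem comp_fracReal (σ : Δ ⟶ Γ) (q : Γ ⟶ Frac E) :
    σ ≫ fracReal q = fracReal (σ ≫ q) := by
  simp [fracReal]

theorem isReal_fracReal (q : Γ ⟶ Frac E) : Valid (IsReal (fracReal q)) := by
  refine valid_isReal.2 ⟨?_, fun Δ σ p => omega_ext fun Θ τ => ?_,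
    fun Δ σ p => omega_ext fun Θ τ => ?_, fun Δ σ p h h' => ?_, fun Δ σ p s h => ?_⟩
  · refine ⟨Γ, 𝟙 Γ, addFrac q (recipFrac 0), inferInstance, ?_⟩
    simpa using ltFrac_addFrac (zero_ltFrac_recip 0)
  · simp
    constructor
    · intro h
      obtain ⟨s, hs, hs'⟩ := exists_between h
      exact Valid.exC_intro s (by simpa using ⟨hs, hs'⟩)
    · intro h
      refine h.exC_elim fun Ξ ρ s hs => ?_
      simp at hs ⊢
      exact ltFrac_trans hs.1 hs.2
  · simp
    constructor
    · intro h
      obtain ⟨s, hs, hs'⟩ := exists_between h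
      exact Valid.exC_intro s (by simpa using ⟨hs', hs⟩)
    · intro h
      refine h.exC_elim fun Ξ ρ s hs => ?_
      simp at hs ⊢
      exact ltFrac_trans hs.2 hs.1
  · simp at h h'
    exact ltFrac_irrefl (ltFrac_trans h h')
  · simpa using ltFrac_cotrans h (σ ≫ q)

end Reals

/-! ### Metric spaces -/

section Metric

variable {Γ Δ M : E}

/-- `d x y < q`. -/
def nearI (d : Γ ⟶ Fn (M ⊗ M) (Cuts E)) (q : Γ ⟶ Frac E) (x y : Γ ⟶ M) : Γ ⟶ Om E :=
  q ∈ᵢ upperI (distI d x y)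

@[simp] theorem comp_nearI (σ : Δ ⟶ Γ) (d : Γ ⟶ Fn (M ⊗ M) (Cuts E)) (q : Γ ⟶ Frac E)
    (x y : Γ ⟶ M) : σ ≫ nearI d q x y = nearI (σ ≫ d) (σ ≫ q) (σ ≫ x) (σ ≫ y) := by
  simp [nearI]

@[simp] theorem mem_upperI_distI (d : Γ ⟶ Fn (M ⊗ M) (Cuts E)) (q : Γ ⟶ Frac E) (x y : Γ ⟶ M) :
    (q ∈ᵢ upperI (distI d x y)) = nearI d q x y := (rfl)

@[simp] theorem isNear_eq (d : Γ ⟶ Fn (M ⊗ M) (Cuts E)) (k : Γ ⟶ Nn E) (x y : Γ ⟶ M) :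
    IsNear d k x y = nearI d (recipFrac k) x y := (rfl)

@[simp] theorem tt_impI (p : Γ ⟶ Om E) : (tt →ᵢ p) = p := by
  refine omega_ext fun Δ σ => ?_
  simp only [comp_impI, comp_tt]
  rw [valid_impI]
  exact ⟨fun h => by simpa using h (𝟙 Δ) (by simp), fun h Θ τ _ => h.comp τ⟩

theorem valid_isMetric {d : Γ ⟶ Fn (M ⊗ M) (Cuts E)} : Valid (IsMetric d) ↔
    (∀ ⦃Δ : E⦄ (σ : Δ ⟶ Γ) (x y : Δ ⟶ M), Valid (IsReal (distI (σ ≫ d) x y))) ∧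
    (∀ ⦃Δ : E⦄ (σ : Δ ⟶ Γ) (x y : Δ ⟶ M), (distI (σ ≫ d) x y =ᵢ zeroReal) = (x =ᵢ y)) ∧
    (∀ ⦃Δ : E⦄ (σ : Δ ⟶ Γ) (x y : Δ ⟶ M), distI (σ ≫ d) x y = distI (σ ≫ d) y x) ∧
    (∀ ⦃Δ : E⦄ (σ : Δ ⟶ Γ) (x y z : Δ ⟶ M), Valid (leSumReal (distI (σ ≫ d) x z)
      (distI (σ ≫ d) x y) (distI (σ ≫ d) y z))) := by
  have key : ∀ p : M ⊗ M ⊗ M ⊗ Γ ⟶ Om E, Valid (allC (allC (allC p))) ↔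
      ∀ ⦃Δ : E⦄ (σ : Δ ⟶ Γ) (x y z : Δ ⟶ M), Valid (lift z (lift y (lift x σ)) ≫ p) := by
    intro p
    have := valid_all_all_all_imp_imp (p := tt) (q := tt) (r := p)
    simpa [-IsEmpty.forall_iff] using this
  simp [IsMetric, key, valid_all_all, -IsEmpty.forall_iff]

theorem nearI_self {d : Γ ⟶ Fn (M ⊗ M) (Cuts E)} (hd : Valid (IsMetric d)) {q : Γ ⟶ Frac E}
    (hq : Valid (ltFrac zeroFrac q)) (x : Γ ⟶ M) : Valid (nearI d q x x) := by
  have h := (valid_isMetric.1 hd).2.1 (𝟙 Γ) x x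
  have h1 : distI d x x = zeroReal := by
    rw [← valid_eqI]
    simp at h
    rw [h]
    simp
  rw [nearI, h1]
  simpa [zeroReal, upperI] using hq

theorem nearI_symm {d : Γ ⟶ Fn (M ⊗ M) (Cuts E)} (hd : Valid (IsMetric d)) {q : Γ ⟶ Frac E}
    {x y : Γ ⟶ M} (h : Valid (nearI d q x y)) : Valid (nearI d q y x) := by
  have h1 := (valid_isMetric.1 hd).2.2.1 (𝟙 Γ) x y
  simp at h1
  rwa [nearI, ← h1]

theorem nearI_trans {d : Γ ⟶ Fn (M ⊗ M) (Cuts E)} (hd : Valid (IsMetric d)) {p q : Γ ⟶ Frac E}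
    {x y z : Γ ⟶ M} (h : Valid (nearI d p x y)) (h' : Valid (nearI d q y z)) :
    Valid (nearI d (addFrac p q) x z) := by
  have h1 := (valid_isMetric.1 hd).2.2.2 (𝟙 Γ) x y z
  simp [leSumReal, valid_all_all_imp_imp, -IsEmpty.forall_iff] at h1
  simpa using h1 (𝟙 Γ) p q (by simpa using h) (by simpa using h')

theorem nearI_mono {d : Γ ⟶ Fn (M ⊗ M) (Cuts E)} (hd : Valid (IsMetric d)) {p q : Γ ⟶ Frac E}
    {x y : Γ ⟶ M} (hpq : Valid (ltFrac p q)) (h : Valid (nearI d p x y)) :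
    Valid (nearI d q x y) := by
  have h1 := (valid_isMetric.1 hd).1 (𝟙 Γ) x y
  simp at h1
  exact h1.upper_up hpq h

theorem nearI_round {d : Γ ⟶ Fn (M ⊗ M) (Cuts E)} (hd : Valid (IsMetric d)) {q : Γ ⟶ Frac E}
    {x y : Γ ⟶ M} (h : Valid (nearI d q x y)) :
    ∃ (Δ : E) (σ : Δ ⟶ Γ) (p : Δ ⟶ Frac E), Epi σ ∧ Valid (ltFrac p (σ ≫ q)) ∧
      Valid (nearI (σ ≫ d) p (σ ≫ x) (σ ≫ y)) := by
  have h1 := (valid_isMetric.1 hd).1 (𝟙 Γ) x y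
  simp at h1
  simpa [-exists_and_left] using h1.upper_round h

theorem isSd_nearI (hE : SyntheticComputability E) {d : Γ ⟶ Fn (M ⊗ M) (Cuts E)}
    (hd : Valid (IsMetric d)) (q : Γ ⟶ Frac E) (x y : Γ ⟶ M) : Valid (IsSd (nearI d q x y)) := by
  have h1 := (valid_isMetric.1 hd).1 (𝟙 Γ) x y
  simp at h1
  exact isSd_upper hE h1 q

/-- The distance has the cuts of zero. An element of its lower cut would, by roundedness, lie under
a positive `p` in the lower cut, while `p` is also in the upper cut; and elements of the upper cut
are positive, again by roundedness. -/
theorem eq_of_nearI {d : Γ ⟶ Fn (M ⊗ M) (Cuts E)} (hd : Valid (IsMetric d)) {x y : Γ ⟶ M}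
    (h : ∀ ⦃Δ : E⦄ (σ : Δ ⟶ Γ) (q : Δ ⟶ Frac E), Valid (ltFrac zeroFrac q) →
      Valid (nearI (σ ≫ d) q (σ ≫ x) (σ ≫ y))) : x = y := by
  have h0 := (valid_isMetric.1 hd).1 (𝟙 Γ) x y
  have h1 := (valid_isMetric.1 hd).2.1 (𝟙 Γ) x y
  simp at h0 h1
  rw [← valid_eqI, ← h1, valid_eqI]
  unfold zeroReal
  ext
  · simp
    refine set_ext fun Δ σ q => ?_
    simp
    refine ⟨fun hq => ?_, fun h => h.ff_elim _⟩
    have hq' : Valid (q ∈ᵢ lowerI (σ ≫ distI d x y)) := by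
      unfold lowerI
      simpa only [Category.assoc] using hq
    obtain ⟨Θ, τ, p, _, hqp, hp⟩ := (h0.on σ).lower_round (by simpa using hq')
    refine Valid.of_epi τ ?_
    have h2 := h (τ ≫ σ) p (zero_ltFrac_of_ltFrac hqp)
    simpa using (valid_isReal.1 h0).2.2.2.1 (τ ≫ σ) p (by simpa using hp) (by simpa using h2)
  · simp
    refine set_ext fun Δ σ q => ?_
    simp
    constructor
    · intro hq
      have hq' : Valid (q ∈ᵢ upperI (σ ≫ distI d x y)) := by
        unfold upperI
        simpa only [Category.assoc] using hq
      obtain ⟨Θ, τ, p, _, hqp, hp⟩ := (h0.on σ).upper_round (by simpa using hq')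
      exact Valid.of_epi τ (by simpa using zero_ltFrac_of_ltFrac hqp)
    · intro hq
      have h2 := h σ q hq
      unfold nearI at h2
      rw [← comp_distI] at h2
      simpa only [upperI, Category.assoc] using h2

end Metric

/-! ### The metric topology -/

section MetricTopology

variable {Γ Δ M : E}

theorem valid_ltReal {r s : Γ ⟶ Cuts E} : Valid (ltReal r s) ↔
    ∃ (Δ : E) (σ : Δ ⟶ Γ) (q : Δ ⟶ Frac E), Epi σ ∧ Valid (q ∈ᵢ upperI (σ ≫ r)) ∧
      Valid (q ∈ᵢ lowerI (σ ≫ s)) := by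
  simp [ltReal, valid_exC, -exists_and_left]

theorem valid_mem_ballI {d : Γ ⟶ Fn (M ⊗ M) (Cuts E)} {x y : Γ ⟶ M} {r : Γ ⟶ Cuts E} :
    Valid (y ∈ᵢ ballI d x r) ↔ ∃ (Δ : E) (σ : Δ ⟶ Γ) (q : Δ ⟶ Frac E), Epi σ ∧
      Valid (nearI (σ ≫ d) q (σ ≫ x) (σ ≫ y)) ∧ Valid (q ∈ᵢ lowerI (σ ≫ r)) := by
  simp [ballI, valid_ltReal, -exists_and_left]

/-- `S` is an open ball. -/
def IsBall (d : Γ ⟶ Fn (M ⊗ M) (Cuts E)) (S : Γ ⟶ Pw M) : Γ ⟶ Om E :=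
  ex M fun x => ex (Cuts E) fun r => IsReal r ∧ᵢ ↟S =ᵢ ballI ↟d ↟x r

@[simp] theorem comp_IsBall (σ : Δ ⟶ Γ) (d : Γ ⟶ Fn (M ⊗ M) (Cuts E)) (S : Γ ⟶ Pw M) :
    σ ≫ IsBall d S = IsBall (σ ≫ d) (σ ≫ S) := by
  simp [IsBall]

theorem valid_isBall {d : Γ ⟶ Fn (M ⊗ M) (Cuts E)} {S : Γ ⟶ Pw M} : Valid (IsBall d S) ↔
    ∃ (Δ : E) (σ : Δ ⟶ Γ) (x : Δ ⟶ M) (r : Δ ⟶ Cuts E), Epi σ ∧ Valid (IsReal r) ∧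
      σ ≫ S = ballI (σ ≫ d) x r := by
  constructor
  · intro h
    simp [IsBall] at h
    obtain ⟨Δ, σ, x, _, h⟩ := valid_exC.1 h
    simp at h
    obtain ⟨Θ, τ, r, _, hr⟩ := valid_exC.1 h
    simp at hr
    exact ⟨Θ, τ ≫ σ, τ ≫ x, r, inferInstance, hr.1, by simpa using hr.2⟩
  · rintro ⟨Δ, σ, x, r, _, hr, e⟩
    simp [IsBall]
    refine valid_exC.2 ⟨Δ, σ, x, inferInstance, ?_⟩
    simp
    exact Valid.exC_intro r (by simpa using ⟨hr, e⟩)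

theorem valid_mem_metricTopology {d : Γ ⟶ Fn (M ⊗ M) (Cuts E)} {U : Γ ⟶ Pw M} :
    Valid (U ∈ᵢ metricTopology d) ↔ ∃ (Δ : E) (σ : Δ ⟶ Γ) (V : Δ ⟶ Fn (Nn E) (Pw M)), Epi σ ∧
      (∀ ⦃Θ : E⦄ (τ : Θ ⟶ Δ) (n : Θ ⟶ Nn E),
        Valid ((app (τ ≫ V) n =ᵢ emptyI) ∨ᵢ IsBall (τ ≫ σ ≫ d) (app (τ ≫ V) n))) ∧
      σ ≫ U = iUnionI V := by
  simp [metricTopology, IsBall, valid_exC, valid_allC, -exists_and_left]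

theorem valid_all_ex {X Y : E} {p : Y ⊗ X ⊗ Γ ⟶ Om E} : Valid (allC (exC p)) ↔
    ∀ ⦃Δ : E⦄ (σ : Δ ⟶ Γ) (x : Δ ⟶ X), ∃ (Θ : E) (τ : Θ ⟶ Δ) (y : Θ ⟶ Y), Epi τ ∧
      Valid (lift y (lift (τ ≫ x) (τ ≫ σ)) ≫ p) := by
  simp [valid_allC, valid_exC]

theorem valid_isCompleteMetric {d : Γ ⟶ Fn (M ⊗ M) (Cuts E)} : Valid (IsCompleteMetric d) ↔
    ∀ ⦃Δ : E⦄ (σ : Δ ⟶ Γ) (a : Δ ⟶ Fn (Nn E) M),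
      (∀ ⦃Θ : E⦄ (τ : Θ ⟶ Δ) (k : Θ ⟶ Nn E), ∃ (Ξ : E) (ρ : Ξ ⟶ Θ) (m : Ξ ⟶ Nn E), Epi ρ ∧
        ∀ ⦃Λ : E⦄ (κ : Λ ⟶ Ξ) (i j : Λ ⟶ Nn E), Valid (leI (κ ≫ m) i) → Valid (leI (κ ≫ m) j) →
          Valid (nearI (κ ≫ ρ ≫ τ ≫ σ ≫ d) (recipFrac (κ ≫ ρ ≫ k)) (app (κ ≫ ρ ≫ τ ≫ a) i)
            (app (κ ≫ ρ ≫ τ ≫ a) j))) →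
      ∃ (Θ : E) (τ : Θ ⟶ Δ) (x : Θ ⟶ M), Epi τ ∧ ∀ ⦃Ξ : E⦄ (ρ : Ξ ⟶ Θ) (k : Ξ ⟶ Nn E),
        ∃ (Λ : E) (κ : Λ ⟶ Ξ) (m : Λ ⟶ Nn E), Epi κ ∧ ∀ ⦃Ψ : E⦄ (μ : Ψ ⟶ Λ) (i : Ψ ⟶ Nn E),
          Valid (leI (μ ≫ m) i) → Valid (nearI (μ ≫ κ ≫ ρ ≫ τ ≫ σ ≫ d) (recipFrac (μ ≫ κ ≫ k))
            (app (μ ≫ κ ≫ ρ ≫ τ ≫ a) i) (μ ≫ κ ≫ ρ ≫ x)) := by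
  simp [IsCompleteMetric, valid_all_ex, valid_exC, valid_all_imp, valid_all_all_imp_imp,
    -exists_and_left, -IsEmpty.forall_iff]

theorem valid_isSeparableMetric {d : Γ ⟶ Fn (M ⊗ M) (Cuts E)} : Valid (IsSeparableMetric d) ↔
    ∃ (Δ : E) (σ : Δ ⟶ Γ) (D : Δ ⟶ Pw M), Epi σ ∧ Valid (IsCountable D) ∧
      ∀ ⦃Θ : E⦄ (τ : Θ ⟶ Δ) (x : Θ ⟶ M) (k : Θ ⟶ Nn E),
        ∃ (Ξ : E) (ρ : Ξ ⟶ Θ) (y : Ξ ⟶ M), Epi ρ ∧ Valid (y ∈ᵢ ρ ≫ τ ≫ D) ∧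
          Valid (nearI (ρ ≫ τ ≫ σ ≫ d) (recipFrac (ρ ≫ k)) (ρ ≫ x) y) := by
  simp [IsSeparableMetric, valid_exC, valid_all_all, -exists_and_left]

end MetricTopology

/-! ### The base of rational balls -/

section RationalBalls

variable {Γ Δ M : E}

/-- The center of the `n`-th rational ball, as a set with at most one element. -/
def centerI (e : Γ ⟶ Fn (Nn E) (Pw M)) (g : Γ ⟶ Fn (Nn E) (Nn E ⊗ Frac E)) (n : Γ ⟶ Nn E) :
    Γ ⟶ Pw M :=
  app e (app g n ≫ fst _ _)

@[simp] theorem comp_centerI (σ : Δ ⟶ Γ) (e : Γ ⟶ Fn (Nn E) (Pw M))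
    (g : Γ ⟶ Fn (Nn E) (Nn E ⊗ Frac E)) (n : Γ ⟶ Nn E) :
    σ ≫ centerI e g n = centerI (σ ≫ e) (σ ≫ g) (σ ≫ n) := by
  simp only [centerI, comp_app, ← Category.assoc]

/-- The radius of the `n`-th rational ball. -/
def radiusI (g : Γ ⟶ Fn (Nn E) (Nn E ⊗ Frac E)) (n : Γ ⟶ Nn E) : Γ ⟶ Frac E :=
  app g n ≫ snd _ _

@[simp] theorem comp_radiusI (σ : Δ ⟶ Γ) (g : Γ ⟶ Fn (Nn E) (Nn E ⊗ Frac E)) (n : Γ ⟶ Nn E) :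
    σ ≫ radiusI g n = radiusI (σ ≫ g) (σ ≫ n) := by
  simp only [radiusI, comp_app, ← Category.assoc]

/-- The sequence of rational balls. -/
def metricBase (d : Γ ⟶ Fn (M ⊗ M) (Cuts E)) (e : Γ ⟶ Fn (Nn E) (Pw M))
    (g : Γ ⟶ Fn (Nn E) (Nn E ⊗ Frac E)) : Γ ⟶ Fn (Nn E) (Pw M) :=
  lam (Nn E) fun n => compr M fun x => ex M fun c =>
    c ∈ᵢ centerI ↟e ↟g ↟n ∧ᵢ nearI ↟d (radiusI ↟g ↟n) c ↟x

@[simp] theorem comp_metricBase (σ : Δ ⟶ Γ) (d : Γ ⟶ Fn (M ⊗ M) (Cuts E))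
    (e : Γ ⟶ Fn (Nn E) (Pw M)) (g : Γ ⟶ Fn (Nn E) (Nn E ⊗ Frac E)) :
    σ ≫ metricBase d e g = metricBase (σ ≫ d) (σ ≫ e) (σ ≫ g) := by
  simp [metricBase]

theorem valid_mem_metricBase {d : Γ ⟶ Fn (M ⊗ M) (Cuts E)} {e : Γ ⟶ Fn (Nn E) (Pw M)}
    {g : Γ ⟶ Fn (Nn E) (Nn E ⊗ Frac E)} {n : Γ ⟶ Nn E} {x : Γ ⟶ M} :
    Valid (x ∈ᵢ app (metricBase d e g) n) ↔ ∃ (Δ : E) (σ : Δ ⟶ Γ) (c : Δ ⟶ M), Epi σ ∧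
      Valid (c ∈ᵢ centerI (σ ≫ e) (σ ≫ g) (σ ≫ n)) ∧
      Valid (nearI (σ ≫ d) (radiusI (σ ≫ g) (σ ≫ n)) c (σ ≫ x)) := by
  simp [metricBase, valid_exC, -exists_and_left]

theorem mem_metricBase_intro {d : Γ ⟶ Fn (M ⊗ M) (Cuts E)} {e : Γ ⟶ Fn (Nn E) (Pw M)}
    {g : Γ ⟶ Fn (Nn E) (Nn E ⊗ Frac E)} {n : Γ ⟶ Nn E} {c x : Γ ⟶ M}
    (hc : Valid (c ∈ᵢ centerI e g n)) (hx : Valid (nearI d (radiusI g n) c x)) :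
    Valid (x ∈ᵢ app (metricBase d e g) n) :=
  valid_mem_metricBase.2 ⟨Γ, 𝟙 Γ, c, inferInstance, by simpa using hc, by simpa using hx⟩

/-- `d x y + q < r`. -/
def insideI (d : Γ ⟶ Fn (M ⊗ M) (Cuts E)) (q r : Γ ⟶ Frac E) (x y : Γ ⟶ M) : Γ ⟶ Om E :=
  ex (Frac E) fun p => nearI ↟d p ↟x ↟y ∧ᵢ ltFrac (addFrac p ↟q) ↟r

@[simp] theorem comp_insideI (σ : Δ ⟶ Γ) (d : Γ ⟶ Fn (M ⊗ M) (Cuts E)) (q r : Γ ⟶ Frac E)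
    (x y : Γ ⟶ M) : σ ≫ insideI d q r x y =
      insideI (σ ≫ d) (σ ≫ q) (σ ≫ r) (σ ≫ x) (σ ≫ y) := by
  simp [insideI]

/-- The relation between indices which expresses that the distance of the centers is less than
the difference of the radii. -/
def metricRel (d : Γ ⟶ Fn (M ⊗ M) (Cuts E)) (e : Γ ⟶ Fn (Nn E) (Pw M))
    (g : Γ ⟶ Fn (Nn E) (Nn E ⊗ Frac E)) : Γ ⟶ Pw (Nn E ⊗ Nn E) :=
  compr (Nn E ⊗ Nn E) fun w => ex M fun c => c ∈ᵢ centerI ↟e ↟g ↟(w ≫ fst _ _) ∧ᵢ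
    ex M fun c' => c' ∈ᵢ centerI ↟e ↟g ↟(w ≫ snd _ _) ∧ᵢ
      insideI ↟d (radiusI ↟g ↟(w ≫ fst _ _)) (radiusI ↟g ↟(w ≫ snd _ _)) c' ↟c

@[simp] theorem comp_metricRel (σ : Δ ⟶ Γ) (d : Γ ⟶ Fn (M ⊗ M) (Cuts E))
    (e : Γ ⟶ Fn (Nn E) (Pw M)) (g : Γ ⟶ Fn (Nn E) (Nn E ⊗ Frac E)) :
    σ ≫ metricRel d e g = metricRel (σ ≫ d) (σ ≫ e) (σ ≫ g) := by
  simp [metricRel]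

theorem valid_mem_metricRel {d : Γ ⟶ Fn (M ⊗ M) (Cuts E)} {e : Γ ⟶ Fn (Nn E) (Pw M)}
    {g : Γ ⟶ Fn (Nn E) (Nn E ⊗ Frac E)} {l i : Γ ⟶ Nn E} :
    Valid (lift l i ∈ᵢ metricRel d e g) ↔
      ∃ (Δ : E) (σ : Δ ⟶ Γ) (c c' : Δ ⟶ M) (p : Δ ⟶ Frac E), Epi σ ∧
        Valid (c ∈ᵢ centerI (σ ≫ e) (σ ≫ g) (σ ≫ l)) ∧
        Valid (c' ∈ᵢ centerI (σ ≫ e) (σ ≫ g) (σ ≫ i)) ∧ Valid (nearI (σ ≫ d) p c' c) ∧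
        Valid (ltFrac (addFrac p (radiusI (σ ≫ g) (σ ≫ l))) (radiusI (σ ≫ g) (σ ≫ i))) := by
  simp [metricRel, insideI, -exists_and_left]
  constructor
  · intro h
    obtain ⟨Δ, σ, c, _, hc⟩ := valid_exC.1 h
    simp at hc
    obtain ⟨Θ, τ, c', _, hc'⟩ := valid_exC.1 hc.2
    simp at hc'
    obtain ⟨Ξ, ρ, p, _, hp⟩ := valid_exC.1 hc'.2
    exact ⟨Ξ, ρ ≫ τ ≫ σ, ρ ≫ τ ≫ c, ρ ≫ c', p, inferInstance, by simpa using hc.1.comp (ρ ≫ τ),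
      by simpa using hc'.1.comp ρ, by simpa using hp⟩
  · rintro ⟨Δ, σ, c, c', p, _, hc, hc', hp, h⟩
    refine valid_exC.2 ⟨Δ, σ, c, inferInstance, ?_⟩
    simp
    refine ⟨hc, Valid.exC_intro c' ?_⟩
    simp
    exact ⟨hc', Valid.exC_intro p (by simpa using ⟨hp, h⟩)⟩

/-- `e` enumerates a dense set `D` of the metric space `(M, d)`, and `g` enumerates the pairs of
natural numbers and fractions. -/
structure MetricPresentation (d : Γ ⟶ Fn (M ⊗ M) (Cuts E)) (D : Γ ⟶ Pw M)
    (e : Γ ⟶ Fn (Nn E) (Pw M)) (g : Γ ⟶ Fn (Nn E) (Nn E ⊗ Frac E)) : Prop where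
  metric : Valid (IsMetric d)
  enum : Valid (Enumerates e D)
  dense : ∀ ⦃Δ : E⦄ (σ : Δ ⟶ Γ) (x : Δ ⟶ M) (k : Δ ⟶ Nn E), ∃ (Θ : E) (τ : Θ ⟶ Δ) (y : Θ ⟶ M),
    Epi τ ∧ Valid (y ∈ᵢ τ ≫ σ ≫ D) ∧ Valid (nearI (τ ≫ σ ≫ d) (recipFrac (τ ≫ k)) (τ ≫ x) y)
  surj : ∀ ⦃Δ : E⦄ (σ : Δ ⟶ Γ) (z : Δ ⟶ Nn E ⊗ Frac E), ∃ (Θ : E) (τ : Θ ⟶ Δ) (n : Θ ⟶ Nn E),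
    Epi τ ∧ app (τ ≫ σ ≫ g) n = τ ≫ z

namespace MetricPresentation

variable {d : Γ ⟶ Fn (M ⊗ M) (Cuts E)} {D : Γ ⟶ Pw M} {e : Γ ⟶ Fn (Nn E) (Pw M)}
  {g : Γ ⟶ Fn (Nn E) (Nn E ⊗ Frac E)}

theorem on (h : MetricPresentation d D e g) (σ : Δ ⟶ Γ) :
    MetricPresentation (σ ≫ d) (σ ≫ D) (σ ≫ e) (σ ≫ g) where
  metric := h.metric.on σ
  enum := h.enum.on σ
  dense Θ τ x k := by simpa using h.dense (τ ≫ σ) x k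
  surj Θ τ z := by simpa using h.surj (τ ≫ σ) z

theorem exists_index (h : MetricPresentation d D e g) {c : Γ ⟶ M} (hc : Valid (c ∈ᵢ D))
    (q : Γ ⟶ Frac E) : ∃ (Δ : E) (σ : Δ ⟶ Γ) (n : Δ ⟶ Nn E), Epi σ ∧
      Valid (σ ≫ c ∈ᵢ centerI (σ ≫ e) (σ ≫ g) n) ∧ radiusI (σ ≫ g) n = σ ≫ q := by
  obtain ⟨Δ, σ, m, _, hm⟩ := h.enum.exists_enumerates hc
  obtain ⟨Θ, τ, n, _, hn⟩ := h.surj σ (lift m (σ ≫ q))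
  refine ⟨Θ, τ ≫ σ, n, inferInstance, ?_, ?_⟩
  · simp [centerI, hn]
    simpa using hm.comp τ
  · simp [radiusI, hn]

theorem center_unique (h : MetricPresentation d D e g) {n : Γ ⟶ Nn E} {c c' : Γ ⟶ M}
    (hc : Valid (c ∈ᵢ centerI e g n)) (hc' : Valid (c' ∈ᵢ centerI e g n)) : c = c' :=
  enumerates_unique h.enum hc hc'

theorem center_mem (h : MetricPresentation d D e g) {n : Γ ⟶ Nn E} {c : Γ ⟶ M}
    (hc : Valid (c ∈ᵢ centerI e g n)) : Valid (c ∈ᵢ D) :=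
  h.enum.enumerates_mem hc

theorem near_of_mem (h : MetricPresentation d D e g) {n : Γ ⟶ Nn E} {c x : Γ ⟶ M}
    (hc : Valid (c ∈ᵢ centerI e g n)) (hx : Valid (x ∈ᵢ app (metricBase d e g) n)) :
    Valid (nearI d (radiusI g n) c x) := by
  obtain ⟨Δ, σ, c', _, hc', hx⟩ := valid_mem_metricBase.1 hx
  have := (h.on σ).center_unique (c := σ ≫ c) (by simpa using hc.comp σ) hc'
  subst this
  exact Valid.of_epi σ (by simpa using hx)

/-- The second components of `g` enumerate all fractions, so this is an existential quantification
over a countable set. -/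
theorem isSd_ex_frac (h : MetricPresentation d D e g) (hE : SyntheticComputability E)
    {S : Γ ⟶ Pw (Frac E)} (hS : Valid (IsSdSet S)) :
    Valid (IsSd (ex (Γ := Γ) (Frac E) fun q => q ∈ᵢ ↟S)) := by
  have hc := isCountable_rangeI (lam (Nn E) fun n => app ↟g n ≫ snd _ _ : Γ ⟶ Fn (Nn E) (Frac E))
  have := isSd_ex_countable hE hc (S := S) fun Δ σ q _ => (hS.on σ).sd q
  convert! this using 2
  refine omega_ext fun Δ σ => ?_
  simp
  constructor
  · intro hq
    refine hq.exC_elim fun Θ τ q hq => ?_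
    obtain ⟨Ξ, ρ, n, _, hn⟩ := h.surj (τ ≫ σ) (lift 0 q)
    refine Valid.of_epi ρ ?_
    simp at hq hn ⊢
    refine Valid.exC_intro (ρ ≫ q) ?_
    simp
    exact ⟨valid_mem_rangeI.2 ⟨Ξ, 𝟙 Ξ, n, inferInstance, by simp [hn]⟩, by simpa using hq.comp ρ⟩
  · intro hq
    refine hq.exC_elim fun Θ τ q hq => ?_
    simp at hq ⊢
    exact Valid.exC_intro q (by simpa using hq.2)

theorem isSd_ex_center (h : MetricPresentation d D e g) (n : Γ ⟶ Nn E) {S : Γ ⟶ Pw M}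
    (hS : Valid (IsSdSet S)) :
    Valid (IsSd (ex (Γ := Γ) M fun c => c ∈ᵢ centerI ↟e ↟g ↟n ∧ᵢ c ∈ᵢ ↟S)) := by
  have := isSd_ex_term h.enum (app g n ≫ fst _ _) (S := S) fun Δ σ c _ => (hS.on σ).sd c
  simpa only [centerI, comp_app, ← Category.assoc] using this

theorem isSd_inside (h : MetricPresentation d D e g) (hE : SyntheticComputability E)
    (q r : Γ ⟶ Frac E) (x y : Γ ⟶ M) : Valid (IsSd (insideI d q r x y)) := by
  have := h.isSd_ex_frac hE (S := compr (Frac E) fun p =>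
    nearI ↟d p ↟x ↟y ∧ᵢ ltFrac (addFrac p ↟q) ↟r) (valid_isSdSet.2 fun Δ σ p => by
      simpa using isSd_and hE (isSd_nearI hE (h.on σ).metric p (σ ≫ x) (σ ≫ y))
        (isSd_of_dec (dec_ltFrac (addFrac p (σ ≫ q)) (σ ≫ r))))
  simpa [insideI] using this

end MetricPresentation

theorem recip_shrink {p q : Γ ⟶ Frac E} {k l : Γ ⟶ Nn E} (hkl : Valid (ltI k l))
    (h : Valid (ltFrac (addFrac p (addFrac (recipFrac k) (recipFrac k))) q)) :
    Valid (ltFrac (addFrac p (addFrac (recipFrac l) (recipFrac l))) q) :=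
  ltFrac_trans (ltFrac_add_left (ltFrac_add (recipFrac_lt hkl) (recipFrac_lt hkl)) p) h

end RationalBalls

/-! ### The metric topology is generated by the rational balls -/

section MetricBase

variable {Γ Δ M : E} {d : Γ ⟶ Fn (M ⊗ M) (Cuts E)} {D : Γ ⟶ Pw M} {e : Γ ⟶ Fn (Nn E) (Pw M)}
  {g : Γ ⟶ Fn (Nn E) (Nn E ⊗ Frac E)}

theorem ltI_add_succ_left (m n : Γ ⟶ Nn E) : Valid (ltI m (m + n + 1)) := valid_ltI.2 ⟨n, rfl⟩

theorem ltI_add_succ_right (m n : Γ ⟶ Nn E) : Valid (ltI n (m + n + 1)) :=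
  valid_ltI.2 ⟨m, by ring⟩

namespace MetricPresentation

/-- If `x` lies in two rational balls, there is a margin between its distance to each center and the
radius. A ball of radius `1 / (t + 1)` around a dense point that close to `x` fits into both, once
`2 / (t + 1)` is below both margins. -/
theorem formalBase (h : MetricPresentation d D e g) (hE : SyntheticComputability E) :
    FormalBase (metricBase d e g) (metricRel d e g) := by
  constructor
  · intro Δ σ n
    refine valid_isSdSet.2 fun Θ τ x => ?_
    have := (h.on (τ ≫ σ)).isSd_ex_center (τ ≫ n) (S := compr M fun c =>
      nearI ↟(τ ≫ σ ≫ d) (radiusI ↟(τ ≫ σ ≫ g) ↟(τ ≫ n)) c ↟x) (valid_isSdSet.2 fun Ξ ρ c => by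
        simpa using isSd_nearI hE (h.on (ρ ≫ τ ≫ σ)).metric
          (radiusI (ρ ≫ τ ≫ σ ≫ g) (ρ ≫ τ ≫ n)) c (ρ ≫ x))
    simpa [metricBase] using this
  · refine valid_isSdSet.2 fun Δ σ w => ?_
    have := (h.on σ).isSd_ex_center (w ≫ fst _ _) (S := compr M fun c => ex M fun c' =>
      c' ∈ᵢ centerI ↟(σ ≫ e) ↟(σ ≫ g) ↟(w ≫ snd _ _) ∧ᵢ insideI ↟(σ ≫ d)
        (radiusI ↟(σ ≫ g) ↟(w ≫ fst _ _)) (radiusI ↟(σ ≫ g) ↟(w ≫ snd _ _)) c' ↟c)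
      (valid_isSdSet.2 fun Θ τ c => by
        have := (h.on (τ ≫ σ)).isSd_ex_center (τ ≫ w ≫ snd _ _) (S := compr M fun c' =>
          insideI ↟(τ ≫ σ ≫ d) (radiusI ↟(τ ≫ σ ≫ g) ↟(τ ≫ w ≫ fst _ _))
            (radiusI ↟(τ ≫ σ ≫ g) ↟(τ ≫ w ≫ snd _ _)) c' ↟c)
          (valid_isSdSet.2 fun Ξ ρ c' => by
            simpa using (h.on (ρ ≫ τ ≫ σ)).isSd_inside hE
              (radiusI (ρ ≫ τ ≫ σ ≫ g) (ρ ≫ τ ≫ w ≫ fst _ _))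
              (radiusI (ρ ≫ τ ≫ σ ≫ g) (ρ ≫ τ ≫ w ≫ snd _ _)) c' (ρ ≫ c))
        simpa using this)
    simpa [metricRel] using this
  · intro Δ σ x
    obtain ⟨Θ, τ, c, _, hc, hcx⟩ := h.dense σ x 0
    obtain ⟨Ξ, ρ, n, _, hn, hr⟩ := (h.on (τ ≫ σ)).exists_index (by simpa using hc) (recipFrac 0)
    refine ⟨Ξ, ρ ≫ τ, n, inferInstance, ?_⟩
    simp at hn hr hcx ⊢
    refine mem_metricBase_intro hn ?_
    rw [hr]
    simpa using nearI_symm (h.on (ρ ≫ τ ≫ σ)).metric (by simpa using hcx.comp ρ)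
  · intro Δ σ l i x hR hx
    simp at hR hx ⊢
    obtain ⟨Θ, τ, c, c', p, _, hc, hc', hp, hlt⟩ := valid_mem_metricRel.1 hR
    refine Valid.of_epi τ ?_
    simp at hc hc' hp hlt ⊢
    have hx' := (h.on (τ ≫ σ)).near_of_mem (x := τ ≫ x) (by simpa using hc)
      (by simpa using hx.comp τ)
    refine mem_metricBase_intro hc' ?_
    have := nearI_trans (h.on (τ ≫ σ)).metric (by simpa using hp) hx'
    simpa using nearI_mono (h.on (τ ≫ σ)).metric (by simpa using hlt) this
  · intro Δ σ i j x hi hj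
    simp at hi hj
    obtain ⟨Θ, τ, c, _, hc, hcx⟩ := valid_mem_metricBase.1 hi
    have hj := hj.on τ
    obtain ⟨Ξ, ρ, c', _, hc', hcx'⟩ := valid_mem_metricBase.1 hj
    have hcx := hcx.comp ρ
    simp at hcx hcx'
    obtain ⟨Λ, κ, p, _, hpi, hp⟩ := nearI_round (h.on (ρ ≫ τ ≫ σ)).metric (by simpa using hcx)
    obtain ⟨Ψ, μ, p', _, hpj, hp'⟩ := nearI_round (h.on (κ ≫ ρ ≫ τ ≫ σ)).metric
      (by simpa using hcx'.comp κ)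
    obtain ⟨k, hk⟩ := exists_recip hpi
    obtain ⟨k', hk'⟩ := exists_recip hpj
    have hk := recip_shrink (ltI_add_succ_left (μ ≫ k) k') (by simpa using hk.comp μ)
    have hk' := recip_shrink (ltI_add_succ_right (μ ≫ k) k') hk'
    -- The number `t` exceeds both `k` and `k'`, so it respects both margins.
    obtain ⟨t, ht⟩ : ∃ t, t = μ ≫ k + k' + 1 := ⟨_, rfl⟩
    rw [← ht] at hk hk'
    obtain ⟨Ψ, ν, b, _, hb, hbx⟩ := h.dense (μ ≫ κ ≫ ρ ≫ τ ≫ σ) (μ ≫ κ ≫ ρ ≫ τ ≫ x) t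
    obtain ⟨Φ, π, l, _, hl, hr⟩ := (h.on (ν ≫ μ ≫ κ ≫ ρ ≫ τ ≫ σ)).exists_index (c := b)
      (by simpa using hb) (recipFrac (ν ≫ t))
    have hm := (h.on (π ≫ ν ≫ μ ≫ κ ≫ ρ ≫ τ ≫ σ)).metric
    simp only [Category.assoc] at hm
    refine ⟨Φ, π ≫ ν ≫ μ ≫ κ ≫ ρ ≫ τ, l, inferInstance, ?_, ?_, ?_⟩
    · simp at hl hr ⊢
      refine valid_mem_metricRel.2 ⟨Φ, 𝟙 Φ, π ≫ b, π ≫ ν ≫ μ ≫ κ ≫ ρ ≫ c,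
        addFrac (π ≫ ν ≫ μ ≫ p) (recipFrac (π ≫ ν ≫ t)), inferInstance, by simpa using hl,
        by simpa using hc.comp (π ≫ ν ≫ μ ≫ κ ≫ ρ), ?_, ?_⟩
      · have := nearI_trans hm (p := π ≫ ν ≫ μ ≫ p) (by simpa using hp.comp (π ≫ ν ≫ μ))
          (by simpa using hbx.comp π)
        simpa using this
      · simp [hr, addFrac_assoc]
        simpa using hk.comp (π ≫ ν)
    · simp at hl hr ⊢
      refine valid_mem_metricRel.2 ⟨Φ, 𝟙 Φ, π ≫ b, π ≫ ν ≫ μ ≫ κ ≫ c',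
        addFrac (π ≫ ν ≫ p') (recipFrac (π ≫ ν ≫ t)), inferInstance, by simpa using hl,
        by simpa using hc'.comp (π ≫ ν ≫ μ ≫ κ), ?_, ?_⟩
      · have := nearI_trans hm (p := π ≫ ν ≫ p') (by simpa using hp'.comp (π ≫ ν))
          (by simpa using hbx.comp π)
        simpa using this
      · simp [hr, addFrac_assoc]
        simpa using hk'.comp (π ≫ ν)
    · simp at hl hr ⊢
      refine mem_metricBase_intro hl ?_
      rw [hr]
      exact nearI_symm hm (by simpa using hbx.comp π)

theorem isSeparable (h : MetricPresentation d D e g) :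
    Valid (IsSeparable (genTop (metricBase d e g))) := by
  refine valid_isSeparable.2 ⟨Γ, 𝟙 Γ, D, inferInstance,
    valid_isCountable.2 ⟨Γ, 𝟙 Γ, e, inferInstance, by simpa using h.enum⟩,
    valid_isDenseSet.2 fun Δ σ U x hU hx => ?_⟩
  simp at hU
  obtain ⟨Θ, τ, I, _, _, e'⟩ := valid_mem_genTop.1 hU
  have hx := hx.comp τ
  simp only [comp_memI, e'] at hx
  obtain ⟨Ξ, ρ, i, _, hi, hx⟩ := valid_mem_baseUnion.1 hx
  simp at hx
  obtain ⟨Λ, κ, c, _, hc, hcx⟩ := valid_mem_metricBase.1 hx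
  have hcx := hcx.on (𝟙 _)
  -- Zero is admitted as a radius. Since the ball contains a point, its radius exceeds some `p` and
  -- is positive, so the ball contains its center.
  obtain ⟨Ψ, μ, p, _, hp, _⟩ := nearI_round (h.on (κ ≫ ρ ≫ τ ≫ σ)).metric
    (by simpa using hcx)
  refine ⟨Ψ, μ ≫ κ ≫ ρ ≫ τ, μ ≫ c, inferInstance, ?_, ?_⟩
  · simpa using ((h.on (κ ≫ ρ ≫ τ ≫ σ)).center_mem (by simpa using hc)).comp μ
  · have h1 := congrArg (fun t => μ ≫ κ ≫ ρ ≫ t) e'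
    simp at h1 hp ⊢
    rw [h1]
    refine mem_baseUnion_intro (i := μ ≫ κ ≫ i) (by simpa using hi.comp (μ ≫ κ))
      (mem_metricBase_intro (by simpa using hc.comp μ) ?_)
    simpa using nearI_self (h.on (μ ≫ κ ≫ ρ ≫ τ ≫ σ)).metric (zero_ltFrac_of_ltFrac hp) (μ ≫ c)

end MetricPresentation

end MetricBase

/-! ### Open balls as unions of rational balls, and sobriety of complete metric spaces -/

section MetricMain

variable {Γ Δ M : E} {d : Γ ⟶ Fn (M ⊗ M) (Cuts E)} {D : Γ ⟶ Pw M} {e : Γ ⟶ Fn (Nn E) (Pw M)}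
  {g : Γ ⟶ Fn (Nn E) (Nn E ⊗ Frac E)}

theorem valid_insideI {q r : Γ ⟶ Frac E} {x y : Γ ⟶ M} : Valid (insideI d q r x y) ↔
    ∃ (Δ : E) (σ : Δ ⟶ Γ) (p : Δ ⟶ Frac E), Epi σ ∧ Valid (nearI (σ ≫ d) p (σ ≫ x) (σ ≫ y)) ∧
      Valid (ltFrac (addFrac p (σ ≫ q)) (σ ≫ r)) := by
  simp [insideI, valid_exC, -exists_and_left]

theorem dec_eq_frac (p q : Γ ⟶ Frac E) : Valid ((p =ᵢ q) ∨ᵢ ¬ᵢ (p =ᵢ q)) := by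
  have h := dec_and (nat_dec_eq (p ≫ fst _ _) (q ≫ fst _ _))
    (nat_dec_eq (p ≫ snd _ _) (q ≫ snd _ _))
  have e : ((p ≫ fst _ _ =ᵢ q ≫ fst _ _) ∧ᵢ p ≫ snd _ _ =ᵢ q ≫ snd _ _) = (p =ᵢ q) := by
    refine omega_ext fun Δ σ => ?_
    simp only [comp_andI, comp_eqI, valid_andI, valid_eqI, ← Category.assoc]
    exact ⟨fun h => frac_ext h.1 h.2, fun h => by rw [h]; exact ⟨rfl, rfl⟩⟩
  rwa [e] at h

namespace MetricPresentation

theorem empty_or_ball (h : MetricPresentation d D e g) (i : Γ ⟶ Nn E) :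
    Valid ((app (metricBase d e g) i =ᵢ emptyI) ∨ᵢ IsBall d (app (metricBase d e g) i)) := by
  refine h.enum.enumerates_cases (app g i ≫ fst _ _) (fun Δ σ h0 => ?_) (fun Δ σ c hc _ => ?_)
  · simp only [comp_orI]
    refine Valid.inl ?_ _
    simp
    refine set_ext fun Θ τ x => ?_
    simp
    refine ⟨fun hx => ?_, fun h => h.ff_elim _⟩
    obtain ⟨Ξ, ρ, c, _, hc, _⟩ := valid_mem_metricBase.1 hx
    have h1 := congrArg (fun t => ρ ≫ τ ≫ t) h0
    simp at hc h1
    simp [centerI, h1] at hc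
    exact Valid.of_epi ρ (by simpa using hc)
  · simp only [comp_orI]
    refine Valid.inr ?_ _
    simp
    have hc' : centerI (σ ≫ e) (σ ≫ g) (σ ≫ i) = singI c := by
      simpa [centerI] using hc
    refine valid_isBall.2 ⟨Δ, 𝟙 Δ, c, fracReal (radiusI (σ ≫ g) (σ ≫ i)), inferInstance,
      isReal_fracReal _, set_ext fun Θ τ x => ?_⟩
    have hc' := congrArg (fun t => τ ≫ t) hc'
    have hm := (h.on (τ ≫ σ)).metric
    simp at hc' hm ⊢
    rw [valid_mem_ballI]
    constructor
    · intro hx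
      have h1 := (h.on (τ ≫ σ)).near_of_mem (c := τ ≫ c) (n := τ ≫ σ ≫ i) (x := x)
        (by simp [hc']) (by simpa using hx)
      obtain ⟨Ξ, ρ, p, _, hp, hpx⟩ := nearI_round (h.on (τ ≫ σ)).metric h1
      exact ⟨Ξ, ρ, p, inferInstance, by simpa using hpx, by simpa using hp⟩
    · rintro ⟨Ξ, ρ, p, _, hp, hpr⟩
      refine Valid.of_epi ρ ?_
      simp at hp hpr ⊢
      refine mem_metricBase_intro (c := ρ ≫ τ ≫ c) ?_ ?_
      · have := congrArg (fun t => ρ ≫ t) hc'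
        simp at this
        simp [this]
      · exact nearI_mono (hm.on ρ) (by simpa using hpr) (by simpa using hp)

/-- The radius is an arbitrary Dedekind real, so the rational balls used are those for which the
distance of the centers plus the rational radius is below some fraction `s` in the lower cut. Lower
cuts and distances are semidecidable, so the index set is countable. -/
theorem ball_mem_genTop (h : MetricPresentation d D e g) (hE : SyntheticComputability E)
    (x : Γ ⟶ M) {r : Γ ⟶ Cuts E} (hr : Valid (IsReal r)) :
    Valid (ballI d x r ∈ᵢ genTop (metricBase d e g)) := by
  let J : Γ ⟶ Pw (Nn E) := compr (Nn E) fun i => ex M fun c => c ∈ᵢ centerI ↟e ↟g ↟i ∧ᵢ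
    ex (Frac E) fun s => s ∈ᵢ lowerI ↟r ∧ᵢ insideI ↟d (radiusI ↟g ↟i) s ↟x ↟c
  have hJ : Valid (IsCountable J) := by
    refine isCountable_of_isSdSet hE (valid_isSdSet.2 fun Δ σ i => ?_)
    have := (h.on σ).isSd_ex_center i (S := compr M fun c => ex (Frac E) fun s =>
      s ∈ᵢ lowerI ↟(σ ≫ r) ∧ᵢ insideI ↟(σ ≫ d) (radiusI ↟(σ ≫ g) ↟i) s ↟(σ ≫ x) ↟c)
      (valid_isSdSet.2 fun Θ τ c => by
        have := (h.on (τ ≫ σ)).isSd_ex_frac hE (S := compr (Frac E) fun s =>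
          s ∈ᵢ lowerI ↟(τ ≫ σ ≫ r) ∧ᵢ
            insideI ↟(τ ≫ σ ≫ d) (radiusI ↟(τ ≫ σ ≫ g) ↟(τ ≫ i)) s ↟(τ ≫ σ ≫ x) ↟c)
          (valid_isSdSet.2 fun Ξ ρ s => by
            simpa using isSd_and hE (isSd_lower hE (hr.on (ρ ≫ τ ≫ σ)) s)
              ((h.on (ρ ≫ τ ≫ σ)).isSd_inside hE (radiusI (ρ ≫ τ ≫ σ ≫ g) (ρ ≫ τ ≫ i)) s
                (ρ ≫ τ ≫ σ ≫ x) (ρ ≫ c)))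
        simpa using this)
    simpa [J] using this
  have hJ' : ∀ ⦃Δ : E⦄ (σ : Δ ⟶ Γ) (i : Δ ⟶ Nn E), Valid (i ∈ᵢ σ ≫ J) ↔
      ∃ (Θ : E) (τ : Θ ⟶ Δ) (c : Θ ⟶ M) (s p : Θ ⟶ Frac E), Epi τ ∧
        Valid (c ∈ᵢ centerI (τ ≫ σ ≫ e) (τ ≫ σ ≫ g) (τ ≫ i)) ∧
        Valid (s ∈ᵢ lowerI (τ ≫ σ ≫ r)) ∧ Valid (nearI (τ ≫ σ ≫ d) p (τ ≫ σ ≫ x) c) ∧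
        Valid (ltFrac (addFrac p (radiusI (τ ≫ σ ≫ g) (τ ≫ i))) s) := by
    intro Δ σ i
    simp [J, -exists_and_left]
    constructor
    · intro hi
      obtain ⟨Θ, τ, c, _, hc⟩ := valid_exC.1 hi
      simp at hc
      obtain ⟨Ξ, ρ, s, _, hs⟩ := valid_exC.1 hc.2
      simp at hs
      obtain ⟨Λ, κ, p, _, hp, hlt⟩ := valid_insideI.1 hs.2
      exact ⟨Λ, κ ≫ ρ ≫ τ, κ ≫ ρ ≫ c, κ ≫ s, p, inferInstance,
        by simpa using hc.1.comp (κ ≫ ρ), by simpa using hs.1.comp κ, by simpa using hp,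
        by simpa using hlt⟩
    · rintro ⟨Θ, τ, c, s, p, _, hc, hs, hp, hlt⟩
      refine valid_exC.2 ⟨Θ, τ, c, inferInstance, ?_⟩
      simp
      refine ⟨hc, Valid.exC_intro s ?_⟩
      simp
      exact ⟨hs, valid_insideI.2 ⟨Θ, 𝟙 Θ, p, inferInstance, by simpa using hp,
        by simpa using hlt⟩⟩
  refine valid_mem_genTop.2 ⟨Γ, 𝟙 Γ, J, inferInstance, hJ, set_ext fun Δ σ y => ?_⟩
  have hm := (h.on σ).metric
  simp
  constructor
  · intro hy
    obtain ⟨Θ, τ, q, _, hq, hqr⟩ := valid_mem_ballI.1 hy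
    obtain ⟨Ξ, ρ, s, _, hqs, hs⟩ := (hr.on (τ ≫ σ)).lower_round (by simpa using hqr)
    -- Between the distance bound `q` and `s` there is room for `2 / (k + 1)`: one part for moving
    -- from `y` to a dense center, one for the radius.
    obtain ⟨k, hk⟩ := exists_recip hqs
    obtain ⟨Λ, κ, c, _, hc, hyc⟩ := h.dense (ρ ≫ τ ≫ σ) (ρ ≫ τ ≫ y) k
    obtain ⟨Ψ, μ, i, _, hi, hri⟩ := (h.on (κ ≫ ρ ≫ τ ≫ σ)).exists_index (by simpa using hc)
      (recipFrac (κ ≫ k))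
    have hm := hm.on (μ ≫ κ ≫ ρ ≫ τ)
    simp at hm hi hri
    refine valid_mem_baseUnion.2 ⟨Ψ, μ ≫ κ ≫ ρ ≫ τ, i, inferInstance, ?_, ?_⟩
    · have := (hJ' (μ ≫ κ ≫ ρ ≫ τ ≫ σ) i).2 ⟨Ψ, 𝟙 Ψ, μ ≫ c, μ ≫ κ ≫ s,
        addFrac (μ ≫ κ ≫ ρ ≫ q) (recipFrac (μ ≫ κ ≫ k)), inferInstance, by simpa using hi,
        by simpa using hs.comp (μ ≫ κ), ?_, ?_⟩
      · simpa using this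
      · have := nearI_trans hm (p := μ ≫ κ ≫ ρ ≫ q) (by simpa using hq.comp (μ ≫ κ ≫ ρ))
          (by simpa using hyc.comp μ)
        simpa using this
      · simp [hri, addFrac_assoc]
        simpa using hk.comp (μ ≫ κ)
    · simp
      refine mem_metricBase_intro hi ?_
      rw [hri]
      exact nearI_symm hm (by simpa using hyc.comp μ)
  · intro hy
    obtain ⟨Θ, τ, i, _, hi, hyi⟩ := valid_mem_baseUnion.1 hy
    obtain ⟨Ξ, ρ, c, s, p, _, hc, hs, hp, hlt⟩ := (hJ' (τ ≫ σ) i).1 (by simpa using hi)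
    refine valid_mem_ballI.2 ⟨Ξ, ρ ≫ τ, addFrac p (radiusI (ρ ≫ τ ≫ σ ≫ g) (ρ ≫ i)),
      inferInstance, ?_, ?_⟩
    · have h1 := (h.on (ρ ≫ τ ≫ σ)).near_of_mem (x := ρ ≫ τ ≫ y) (by simpa using hc)
        (by simpa using hyi.comp ρ)
      have := nearI_trans (h.on (ρ ≫ τ ≫ σ)).metric (by simpa using hp) h1
      simpa using this
    · simp at hlt hs
      have := (hr.on (ρ ≫ τ ≫ σ)).lower_down hlt (by simpa using hs)
      simpa using this

theorem metricTopology_eq_genTop (h : MetricPresentation d D e g)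
    (hE : SyntheticComputability E) : metricTopology d = genTop (metricBase d e g) := by
  refine set_ext fun Δ σ U => ?_
  simp
  have hT := valid_isTopology.1 ((h.formalBase hE).isTopology hE)
  constructor
  · intro hU
    obtain ⟨Θ, τ, V, _, hV, e'⟩ := valid_mem_metricTopology.1 hU
    refine Valid.of_epi τ ?_
    simp only [comp_memI, e']
    suffices h1 : ∀ ⦃Ξ : E⦄ (ρ : Ξ ⟶ Θ) (n : Ξ ⟶ Nn E),
        Valid (app (ρ ≫ V) n ∈ᵢ ρ ≫ (τ ≫ σ) ≫ genTop (metricBase d e g)) by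
      simpa using hT.2.2.2.2 (τ ≫ σ) V h1
    intro Ξ ρ n
    refine (hV ρ n).or_elim (fun Λ κ h0 => ?_) (fun Λ κ h1 => ?_)
    · simp at h0 ⊢
      rw [h0]
      simpa using hT.2.2.2.1.comp (κ ≫ ρ ≫ τ ≫ σ)
    · simp at h1
      obtain ⟨Ψ, μ, x, r, _, hr, e''⟩ := valid_isBall.1 h1
      refine Valid.of_epi μ ?_
      simp at e'' ⊢
      rw [e'']
      simpa using (h.on (μ ≫ κ ≫ ρ ≫ τ ≫ σ)).ball_mem_genTop hE x hr
  · intro hU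
    obtain ⟨Θ, τ, I, _, hI, e'⟩ := valid_mem_genTop.1 hU
    obtain ⟨Ξ, ρ, f, _, hf⟩ := valid_isCountable.1 hI
    -- The enumeration of indices is turned into a sequence of sets that are empty at skips and
    -- otherwise basic, as the definition of the metric topology requires.
    have e1 := iUnionI_baseUnion (B := metricBase (ρ ≫ τ ≫ σ ≫ d) (ρ ≫ τ ≫ σ ≫ e)
      (ρ ≫ τ ≫ σ ≫ g)) hf
    refine valid_mem_metricTopology.2 ⟨Ξ, ρ ≫ τ, _, inferInstance, fun Λ κ n => ?_,
      Eq.trans ?_ e1.symm⟩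
    · simp
      refine (hf.on κ).enumerates_cases n (fun Ψ μ h0 => ?_) (fun Ψ μ i hi _ => ?_)
      · simp at h0 ⊢
        rw [h0, baseUnion_emptyI]
        exact Valid.inl (by simp) _
      · simp at hi ⊢
        rw [hi, baseUnion_singI]
        simpa using (h.on (μ ≫ κ ≫ ρ ≫ τ ≫ σ)).empty_or_ball i
    · have := congrArg (fun t => ρ ≫ t) e'
      simpa using this

theorem exists_center (h : MetricPresentation d D e g) {F : Γ ⟶ Pw (Nn E)}
    (hF : PointFilter (metricBase d e g) (metricRel d e g) F) {i : Γ ⟶ Nn E}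
    (hi : Valid (i ∈ᵢ F)) : ∃ (Δ : E) (σ : Δ ⟶ Γ) (c : Δ ⟶ M), Epi σ ∧
      Valid (c ∈ᵢ centerI (σ ≫ e) (σ ≫ g) (σ ≫ i)) := by
  have : Valid (ex (Γ := Γ) M fun c => c ∈ᵢ centerI ↟e ↟g ↟i) := by
    refine h.enum.enumerates_cases (app g i ≫ fst _ _) (fun Δ σ h0 => ?_) (fun Δ σ c hc _ => ?_)
    · refine Valid.ff_elim (hF.nonempty σ (σ ≫ i) (by simpa using hi.comp σ) ?_) _
      refine set_ext fun Θ τ x => ?_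
      simp
      refine ⟨fun hx => ?_, fun h => h.ff_elim _⟩
      obtain ⟨Ξ, ρ, c, _, hc, _⟩ := valid_mem_metricBase.1 hx
      have h1 := congrArg (fun t => ρ ≫ τ ≫ t) h0
      simp at hc h1
      simp [centerI, h1] at hc
      exact Valid.of_epi ρ (by simpa using hc)
    · simp at hc ⊢
      exact Valid.exC_intro c (by simp [centerI, hc])
  obtain ⟨Δ, σ, c, hσ, hc⟩ := valid_exC.1 this
  exact ⟨Δ, σ, c, hσ, by simpa using hc⟩

/-- Two balls in the filter have a common refinement in it, whose center is within each radius of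
the corresponding center. -/
theorem near_centers (h : MetricPresentation d D e g) {F : Γ ⟶ Pw (Nn E)}
    (hF : PointFilter (metricBase d e g) (metricRel d e g) F) {i j : Γ ⟶ Nn E} {c c' : Γ ⟶ M}
    (hi : Valid (i ∈ᵢ F)) (hj : Valid (j ∈ᵢ F)) (hc : Valid (c ∈ᵢ centerI e g i))
    (hc' : Valid (c' ∈ᵢ centerI e g j)) :
    Valid (nearI d (addFrac (radiusI g i) (radiusI g j)) c c') := by
  obtain ⟨Δ, σ, l, _, _, hli, hlj⟩ := hF.directed (𝟙 Γ) i j (by simpa using hi) (by simpa using hj)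
  simp at hli hlj
  obtain ⟨Θ, τ, b, a, p, _, hb, ha, hp, hlt⟩ := valid_mem_metricRel.1 hli
  have hlj := hlj.on τ
  obtain ⟨Ξ, ρ, b', a', p', _, hb', ha', hp', hlt'⟩ := valid_mem_metricRel.1 hlj
  have hm := (h.on (ρ ≫ τ ≫ σ)).metric
  have e1 := (h.on (τ ≫ σ)).center_unique (c := a) (c' := τ ≫ σ ≫ c) (by simpa using ha)
    (by simpa using hc.comp (τ ≫ σ))
  have e2 := (h.on (ρ ≫ τ ≫ σ)).center_unique (c := a') (c' := ρ ≫ τ ≫ σ ≫ c')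
    (by simpa using ha') (by simpa using hc'.comp (ρ ≫ τ ≫ σ))
  have e3 := (h.on (ρ ≫ τ ≫ σ)).center_unique (c := b') (c' := ρ ≫ b)
    (by simpa using hb') (by simpa using hb.comp ρ)
  subst e1 e2 e3
  have h1 := nearI_mono (h.on (τ ≫ σ)).metric (ltFrac_of_addFrac_lt hlt) (by simpa using hp)
  have h2 := nearI_mono hm (ltFrac_of_addFrac_lt hlt') (by simpa using hp')
  have h1 := h1.comp ρ
  simp at h1 hm h2
  refine Valid.of_epi (ρ ≫ τ ≫ σ) ?_
  simpa using nearI_trans hm h1 (nearI_symm hm h2)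

/-- The rational balls of radius exactly `1 / (k + 1)` cover the space, because their centers are
dense. Primeness then puts one of them in the filter. -/
theorem exists_small_ball (h : MetricPresentation d D e g) (hE : SyntheticComputability E)
    {F : Γ ⟶ Pw (Nn E)} (hF : PointFilter (metricBase d e g) (metricRel d e g) F)
    (k : Γ ⟶ Nn E) : ∃ (Δ : E) (σ : Δ ⟶ Γ) (i : Δ ⟶ Nn E) (c : Δ ⟶ M), Epi σ ∧
      Valid (i ∈ᵢ σ ≫ F) ∧ radiusI (σ ≫ g) i = recipFrac (σ ≫ k) ∧
      Valid (c ∈ᵢ centerI (σ ≫ e) (σ ≫ g) i) := by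
  let I : Γ ⟶ Pw (Nn E) := compr (Nn E) fun i => radiusI ↟g i =ᵢ recipFrac ↟k
  have hI : Valid (IsCountable I) := by
    refine isCountable_of_isSdSet hE (valid_isSdSet.2 fun Δ σ i => isSd_of_dec ?_)
    simpa [I] using dec_eq_frac (radiusI (σ ≫ g) i) (recipFrac (σ ≫ k))
  obtain ⟨Δ, σ, i, _, hi, hiF⟩ := hF.prime (𝟙 Γ) I hI (set_ext fun Δ σ x => by
    obtain ⟨Θ, τ, c, _, hc, hcx⟩ := h.dense σ x (σ ≫ k)
    obtain ⟨Ξ, ρ, i, _, hi, hr⟩ := (h.on (τ ≫ σ)).exists_index (by simpa using hc)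
      (recipFrac (τ ≫ σ ≫ k))
    simp at hi hr ⊢
    refine valid_mem_baseUnion.2 ⟨Ξ, ρ ≫ τ, i, inferInstance, by simpa [I] using hr, ?_⟩
    simp
    refine mem_metricBase_intro hi ?_
    rw [hr]
    have hm := (h.on (ρ ≫ τ ≫ σ)).metric
    simp at hm
    exact nearI_symm hm (by simpa using hcx.comp ρ))
  simp [I] at hi hiF
  have hF' := hF.on σ
  simp at hF'
  obtain ⟨Θ, τ, c, _, hc⟩ := (h.on σ).exists_center (by simpa using hF') hiF
  refine ⟨Θ, τ ≫ σ, τ ≫ i, c, inferInstance, by simpa using hiF.comp τ, ?_, by simpa using hc⟩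
  have := congrArg (fun t => τ ≫ t) hi
  simpa using this

/-- A ball of radius `1 / (k + 1)` around a dense point close to `x` contains `x`, hence also `y`,
so the distance of `x` and `y` is less than `2 / (k + 1)`. -/
theorem eq_of_same_balls (h : MetricPresentation d D e g) {x y : Γ ⟶ M}
    (hxy : ∀ ⦃Δ : E⦄ (σ : Δ ⟶ Γ) (i : Δ ⟶ Nn E),
      Valid (σ ≫ x ∈ᵢ app (metricBase (σ ≫ d) (σ ≫ e) (σ ≫ g)) i) →
      Valid (σ ≫ y ∈ᵢ app (metricBase (σ ≫ d) (σ ≫ e) (σ ≫ g)) i)) : x = y := by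
  refine eq_of_nearI h.metric fun Δ σ q hq => ?_
  obtain ⟨k, hk⟩ := exists_recip hq
  rw [zero_addFrac] at hk
  obtain ⟨Θ, τ, c, _, hc, hcx⟩ := h.dense σ (σ ≫ x) k
  obtain ⟨Ξ, ρ, i, _, hi, hr⟩ := (h.on (τ ≫ σ)).exists_index (by simpa using hc)
    (recipFrac (τ ≫ k))
  have hm := (h.on (ρ ≫ τ ≫ σ)).metric
  have hcx := hcx.comp ρ
  simp at hi hr hm hcx
  have h1 := hxy (ρ ≫ τ ≫ σ) i (by
    simp
    refine mem_metricBase_intro hi ?_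
    rw [hr]
    exact nearI_symm hm (by simpa using hcx))
  have h2 := (h.on (ρ ≫ τ ≫ σ)).near_of_mem (by simpa using hi) h1
  simp [hr] at h2
  refine Valid.of_epi (ρ ≫ τ) ?_
  have h3 := nearI_mono hm (by simpa using hk.comp (ρ ≫ τ)) (nearI_trans hm hcx h2)
  simpa using h3

/-- The sequence of centers of balls in the filter with radius `1 / (n + 1)` is Cauchy by
`near_centers`. The conclusion keeps, for each `k`, a ball of the filter with radius below `1 / (k +
1)` and center within `1 / (k + 1)` of the limit, which is all that sobriety needs. -/
theorem exists_limit (h : MetricPresentation d D e g) (hE : SyntheticComputability E)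
    (hC : Valid (IsCompleteMetric d)) {F : Γ ⟶ Pw (Nn E)}
    (hF : PointFilter (metricBase d e g) (metricRel d e g) F) :
    ∃ (Δ : E) (σ : Δ ⟶ Γ) (x : Δ ⟶ M), Epi σ ∧ ∀ ⦃Θ : E⦄ (τ : Θ ⟶ Δ) (k : Θ ⟶ Nn E),
      ∃ (Ξ : E) (ρ : Ξ ⟶ Θ) (i n : Ξ ⟶ Nn E) (c : Ξ ⟶ M), Epi ρ ∧ Valid (i ∈ᵢ ρ ≫ τ ≫ σ ≫ F) ∧
        Valid (ltI (ρ ≫ k) n) ∧ radiusI (ρ ≫ τ ≫ σ ≫ g) i = recipFrac n ∧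
        Valid (c ∈ᵢ centerI (ρ ≫ τ ≫ σ ≫ e) (ρ ≫ τ ≫ σ ≫ g) i) ∧
        Valid (nearI (ρ ≫ τ ≫ σ ≫ d) (recipFrac (ρ ≫ k)) c (ρ ≫ τ ≫ x)) := by
  let R : Γ ⟶ Pw (Nn E ⊗ M) := compr (Nn E ⊗ M) fun w => ex (Nn E) fun i =>
    i ∈ᵢ ↟F ∧ᵢ (radiusI ↟g i =ᵢ recipFrac ↟(w ≫ fst _ _)) ∧ᵢ ↟(w ≫ snd _ _) ∈ᵢ centerI ↟e ↟g i
  have hR : ∀ ⦃Δ : E⦄ (σ : Δ ⟶ Γ) (n : Δ ⟶ Nn E) (c : Δ ⟶ M), Valid (lift n c ∈ᵢ σ ≫ R) ↔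
      ∃ (Θ : E) (τ : Θ ⟶ Δ) (i : Θ ⟶ Nn E), Epi τ ∧ Valid (i ∈ᵢ τ ≫ σ ≫ F) ∧
        radiusI (τ ≫ σ ≫ g) i = recipFrac (τ ≫ n) ∧
        Valid (τ ≫ c ∈ᵢ centerI (τ ≫ σ ≫ e) (τ ≫ σ ≫ g) i) := by
    intro Δ σ n c
    simp [R, valid_exC, -exists_and_left]
  obtain ⟨Δ, σ, a, _, ha⟩ := countable_choice hE R fun Δ σ n => by
    obtain ⟨Θ, τ, i, c, hτ, hi, hr, hc⟩ := (h.on σ).exists_small_ball hE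
      (by simpa using hF.on σ) n
    refine ⟨Θ, τ, c, hτ, ?_⟩
    have := (hR (τ ≫ σ) (τ ≫ n) c).2 ⟨Θ, 𝟙 Θ, i, inferInstance, by simpa using hi,
      by simpa using hr, by simpa using hc⟩
    simpa using this
  have near : ∀ ⦃Θ : E⦄ (τ : Θ ⟶ Δ) (m n : Θ ⟶ Nn E), Valid (nearI (τ ≫ σ ≫ d)
      (addFrac (recipFrac m) (recipFrac n)) (app (τ ≫ a) m) (app (τ ≫ a) n)) := by
    intro Θ τ m n
    obtain ⟨Ξ, ρ, i, _, hi, hr, hc⟩ := (hR (τ ≫ σ) m _).1 (by simpa using ha τ m)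
    obtain ⟨Λ, κ, j, _, hj, hr', hc'⟩ := (hR (ρ ≫ τ ≫ σ) (ρ ≫ n) (app (ρ ≫ τ ≫ a) (ρ ≫ n))).1
      (by simpa using ha (ρ ≫ τ) (ρ ≫ n))
    refine Valid.of_epi (κ ≫ ρ) ?_
    have hF' := hF.on (κ ≫ ρ ≫ τ ≫ σ)
    have hr := congrArg (fun t => κ ≫ t) hr
    simp at hF' hr hr' hc'
    have := (h.on (κ ≫ ρ ≫ τ ≫ σ)).near_centers (by simpa using hF') (by simpa using hi.comp κ)
      (by simpa using hj) (by simpa using hc.comp κ) (by simpa using hc')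
    simpa [hr, hr'] using this
  obtain ⟨Θ, τ, x, _, hx⟩ := valid_isCompleteMetric.1 hC σ a fun Θ τ k => by
    obtain ⟨t, ht⟩ := exists_recip (zero_ltFrac_recip k)
    rw [zero_addFrac] at ht
    -- The modulus is `t + 1`, not `t`, because `recipFrac_lt` needs strict inequalities between
    -- indices.
    refine ⟨Θ, 𝟙 Θ, t + 1, inferInstance, fun Ξ ρ i j hi hj => ?_⟩
    simp at hi hj ⊢
    have hlt : Valid (ltI (ρ ≫ t) (ρ ≫ t + 1)) := valid_ltI.2 ⟨0, by simp⟩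
    have hm := (h.on (ρ ≫ τ ≫ σ)).metric
    simp at hm
    have h1 := nearI_mono hm (ltFrac_add (recipFrac_lt (ltI_of_ltI_of_leI hlt hi))
      (recipFrac_lt (ltI_of_ltI_of_leI hlt hj))) (by simpa using near (ρ ≫ τ) i j)
    have h2 := nearI_mono hm (by simpa using ht.comp ρ) h1
    simpa using h2
  refine ⟨Θ, τ ≫ σ, x, inferInstance, fun Ξ ρ k => ?_⟩
  obtain ⟨Λ, κ, m, _, hκ⟩ := hx ρ k
  -- The index is past the modulus `m` of convergence and also larger than `k`, so both the center
  -- and the radius are good enough.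
  have h1 := hκ (𝟙 Λ) (m + κ ≫ k + 1) (by
    simp
    exact valid_leI.2 ⟨κ ≫ k + 1, by ring⟩)
  simp at h1
  obtain ⟨Ψ, μ, i, _, hi, hr, hc⟩ := (hR (κ ≫ ρ ≫ τ ≫ σ) (m + κ ≫ k + 1)
    (app (κ ≫ ρ ≫ τ ≫ a) (m + κ ≫ k + 1))).1 (by simpa using ha (κ ≫ ρ ≫ τ) (m + κ ≫ k + 1))
  refine ⟨Ψ, μ ≫ κ, i, μ ≫ m + μ ≫ κ ≫ k + 1, _, inferInstance, by simpa using hi, ?_,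
    by simpa using hr, by simpa using hc, by simpa using h1.comp μ⟩
  simpa using ltI_add_succ_right (μ ≫ m) (μ ≫ κ ≫ k)

theorem isSober (h : MetricPresentation d D e g) (hE : SyntheticComputability E)
    (hC : Valid (IsCompleteMetric d)) : Valid (IsSober (genTop (metricBase d e g))) := by
  refine isSober_genTop hE (h.formalBase hE) (fun Δ σ x y hxy => ?_) (fun Δ σ F hF => ?_)
  · refine (h.on σ).eq_of_same_balls fun Θ τ i hx => ?_
    have := hxy τ i
    simp at this hx
    simpa [← this] using hx
  · simp at hF
    obtain ⟨Θ, τ, x, _, hx⟩ := (h.on σ).exists_limit hE (hC.on σ) (by simpa using hF)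
    refine ⟨Θ, τ, x, inferInstance, fun Ξ ρ i => ⟨fun hi => ?_, fun hi => ?_⟩⟩
    -- A strict refinement `l` of `i` in the filter leaves a margin of `2 / (k + 1)` inside the
    -- `i`-th ball. A small ball of the filter has its center `a` nearly within the radius of `l`,
    -- and the limit is close to `a`; both errors fit into the margin.
    · obtain ⟨Λ, κ, l, _, hl, hli, _⟩ := hF.directed (ρ ≫ τ) i i (by simpa using hi)
        (by simpa using hi)
      simp at hli hl
      obtain ⟨Ψ, μ, b, c, p, _, hb, hc, hp, hlt⟩ := valid_mem_metricRel.1 hli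
      obtain ⟨k, hk⟩ := exists_recip hlt
      obtain ⟨Φ, π, j, n, a, _, hj, hkn, hr, ha, hax⟩ := hx (μ ≫ κ ≫ ρ) k
      have hm := (h.on (π ≫ μ ≫ κ ≫ ρ ≫ τ ≫ σ)).metric
      have hF' := hF.on (π ≫ μ ≫ κ ≫ ρ ≫ τ)
      simp at hm hF' hj hr ha hax hk
      have h1 := (h.on (π ≫ μ ≫ κ ≫ ρ ≫ τ ≫ σ)).near_centers (by simpa using hF')
        (by simpa using hl.comp (π ≫ μ)) hj (by simpa using hb.comp π) (by simpa using ha)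
      have hp := hp.comp π
      have hk := hk.comp π
      simp [hr] at h1 hp hk
      have h2 := nearI_trans hm hp (nearI_trans hm h1 hax)
      have h3 := ltFrac_trans (ltFrac_add_left (ltFrac_add_right (recipFrac_lt hkn)
        (recipFrac (π ≫ k))) _) hk
      simp only [addFrac_assoc] at h2 h3
      have h4 := nearI_mono hm h3 h2
      refine Valid.of_epi (π ≫ μ ≫ κ) ?_
      simp
      exact mem_metricBase_intro (by simpa using hc.comp π) (by simpa using h4)
    · simp at hi ⊢
      obtain ⟨Λ, κ, c, _, hc, hcx⟩ := valid_mem_metricBase.1 hi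
      obtain ⟨Ψ, μ, p, _, hlt, hp⟩ := nearI_round (h.on (κ ≫ ρ ≫ τ ≫ σ)).metric
        (by simpa using hcx)
      obtain ⟨k, hk⟩ := exists_recip hlt
      obtain ⟨Φ, π, j, n, a, _, hj, hkn, hr, ha, hax⟩ := hx (μ ≫ κ ≫ ρ) k
      refine Valid.of_epi (π ≫ μ ≫ κ) ?_
      -- The small ball around `a` is in the filter and is included in the `i`-th ball, since its
      -- radius and the distance from `a` to the limit fit into the margin between `p` and the
      -- radius of that ball.
      have := hF.mono (π ≫ μ ≫ κ ≫ ρ ≫ τ) j (π ≫ μ ≫ κ ≫ i) (by simpa using hj)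
        fun Z ζ y hy => ?_
      · simpa using this
      have hm := (h.on (ζ ≫ π ≫ μ ≫ κ ≫ ρ ≫ τ ≫ σ)).metric
      have ha := ha.comp ζ
      have hr := congrArg (fun t => ζ ≫ t) hr
      have hp := hp.comp (ζ ≫ π)
      have hk := hk.comp (ζ ≫ π)
      have hkn := hkn.comp ζ
      have hax := hax.comp ζ
      simp at hm ha hr hp hk hkn hax hy ⊢
      have h1 := (h.on (ζ ≫ π ≫ μ ≫ κ ≫ ρ ≫ τ ≫ σ)).near_of_mem (x := y) (by simpa using ha)
        (by simpa using hy)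
      simp [hr] at h1
      have h2 := nearI_trans hm hp (nearI_trans hm (nearI_symm hm hax) h1)
      have h3 := nearI_mono hm (ltFrac_trans (ltFrac_add_left (ltFrac_add_left
        (recipFrac_lt hkn) _) _) hk) h2
      exact mem_metricBase_intro (by simpa using hc.comp (ζ ≫ π ≫ μ)) h3

end MetricPresentation

theorem metric_main (hE : SyntheticComputability E) {d : Γ ⟶ Fn (M ⊗ M) (Cuts E)}
    (hd : Valid (IsMetric d)) (hC : Valid (IsCompleteMetric d))
    (hS : Valid (IsSeparableMetric d)) :
    Valid (IsCountablyBased (metricTopology d)) ∧ Valid (IsSober (metricTopology d)) ∧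
      Valid (IsSeparable (metricTopology d)) ∧ Valid (OvertSpace M : Γ ⟶ Om E) := by
  have h : Valid (IsCountablyBased (metricTopology d)) ∧ Valid (IsSober (metricTopology d)) ∧
      Valid (IsSeparable (metricTopology d)) := by
    obtain ⟨Δ, σ, D, _, hD, hdense⟩ := valid_isSeparableMetric.1 hS
    obtain ⟨Θ, τ, e, _, he⟩ := valid_isCountable.1 hD
    obtain ⟨Ξ, ρ, g, _, hg⟩ := exists_pairing hE Θ
    obtain ⟨f, h⟩ : ∃ f, MetricPresentation (ρ ≫ τ ≫ σ ≫ d) (ρ ≫ τ ≫ D) (ρ ≫ e) f := by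
      -- Pairs of a number and a fraction are triples of numbers; applying the surjection `g` once
      -- more to the second component enumerates them.
      refine ⟨lam (Nn E) fun n => lift (app ↟g n ≫ fst _ _) (app ↟g (app ↟g n ≫ snd _ _)),
        by simpa using hd.on (ρ ≫ τ ≫ σ), he.on ρ, fun Λ κ x k => ?_, fun Λ κ z => ?_⟩
      · simpa using hdense (κ ≫ ρ ≫ τ) x k
      · obtain ⟨Ψ, μ, m, _, hm⟩ := valid_mem_rangeI.1 (hg κ (z ≫ snd _ _))
        obtain ⟨Φ, π, n, _, hn⟩ := valid_mem_rangeI.1 (hg (μ ≫ κ) (lift (μ ≫ z ≫ fst _ _) m))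
        refine ⟨Φ, π ≫ μ, n, inferInstance, ?_⟩
        have hm := congrArg (fun t => π ≫ t) hm
        simp at hn hm
        ext <;> simp [← hn, ← hm]
    have e1 := h.metricTopology_eq_genTop hE
    refine ⟨Valid.of_epi (ρ ≫ τ ≫ σ) ?_, Valid.of_epi (ρ ≫ τ ≫ σ) ?_,
      Valid.of_epi (ρ ≫ τ ≫ σ) ?_⟩
    · simp [e1]
      exact valid_isCountablyBased.2 ⟨(h.formalBase hE).isTopology hE, Ξ, 𝟙 Ξ, _,
        inferInstance, by simpa using isBase_genTop _⟩
    · simpa [e1] using h.isSober hE (by simpa using hC.on (ρ ≫ τ ≫ σ))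
    · simpa [e1] using h.isSeparable
  exact ⟨h.1, h.2.1, h.2.2, overtSpace_of_isSeparable hE h.1 h.2.1 h.2.2⟩

end MetricMain

end

end SynthTopos

/-! ### The four statements in the internal language -/

open CategoryTheory CategoryTheory.Limits MonoidalCategory CartesianMonoidalCategory SynthTopos in
theorem mainTheorem9 {E : Type u} [Category.{v} E] [CartesianMonoidalCategory E]
    [HasFiniteLimits E] [MonoidalClosed E] [HasSubobjectClassifier E] [NaturalNumbersObject E]
    (hE : SyntheticComputability E) :
    (∀ X : E, Valid (Γ := 𝟙_ E) (all (Pw (Pw X)) fun T =>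
      IsCountablyBased T →ᵢ IsSober T →ᵢ
      all (Fn (Nn E) X) fun a => IsDenseSeq T a →ᵢ IsDenseSeq (intrinsic X) a)) ∧
    (∀ X : E, Valid (Γ := 𝟙_ E) (all (Pw (Pw X)) fun T =>
      IsCountablyBased T →ᵢ IsSober T →ᵢ IsSeparable T →ᵢ OvertSpace X)) ∧
    (∀ M : E, Valid (Γ := 𝟙_ E) (all (Fn (M ⊗ M) (Cuts E)) fun d =>
      IsMetric d →ᵢ IsCompleteMetric d →ᵢ IsSeparableMetric d →ᵢ
      (IsCountablyBased (metricTopology d) ∧ᵢ IsSober (metricTopology d) ∧ᵢ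
        IsSeparable (metricTopology d) ∧ᵢ OvertSpace M))) ∧
    (∀ P : E, Valid (Γ := 𝟙_ E) (all (Pw (P ⊗ P)) fun le =>
      IsOmegaCpo le →ᵢ IsOmegaAlgebraic le →ᵢ
      (IsCountablyBased (scottTopology le) ∧ᵢ IsSober (scottTopology le) ∧ᵢ
        IsSeparable (scottTopology le) ∧ᵢ OvertSpace P))) := by
  refine ⟨fun X => ?_, fun X => ?_, fun M => ?_, fun P => ?_⟩
  · simp
    refine valid_all_imp_imp.2 fun Δ σ T hT hT' => ?_
    simp at hT hT' ⊢
    refine valid_all_imp.2 fun Θ τ a ha => ?_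
    simp at ha ⊢
    exact isDenseSeq_intrinsic hE (hT.on τ) (hT'.on τ) ha
  · simp
    refine valid_allC.2 fun Δ σ T => ?_
    simp
    refine valid_impI.2 fun Θ τ hT => ?_
    simp
    refine valid_imp_imp.2 fun Ξ ρ hT' hT'' => ?_
    simp at hT hT' hT'' ⊢
    exact overtSpace_of_isSeparable hE (hT.on ρ) hT' hT''
  · simp
    refine valid_allC.2 fun Δ σ d => ?_
    simp
    refine valid_impI.2 fun Θ τ hd => ?_
    simp
    refine valid_imp_imp.2 fun Ξ ρ hC hS => ?_
    simp at hd hC hS ⊢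
    exact metric_main hE (hd.on ρ) hC hS
  · simp
    refine valid_all_imp_imp.2 fun Δ σ le hP hA => ?_
    simp at hP hA ⊢
    exact scott_main hE hP hA
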